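/- Let $p\ge 3$ be odd, let $q\in\mathbb C$ be a primitive $p$-th root of unity, and put $[n]=\frac{q^n-q^{-n}}{q-q^{-1}}$, $[n]!=[1]\cdots[n]$, $(a;r)_k=\prod_{j=1}^k(1-ar^{j-1})$. **The algebra $U_{FS}$** is generated by $P_\pm,H,E_\pm,K$ with $[P_+,P_-]=0$, $[P_\pm,H]=\pm iP_\pm$, $KE_\pm K^{-1}=q^{\pm1}E_\pm$, $[E_+,E_-]=\frac{K^2-K^{-2}}{q-q^{-1}}$, $[K,H]=0$, $[E_\pm,H]=\pm\frac ip E_\pm$, $E_\pm^p=P_\pm$, $K^p=1$. Its Casimir elements are $$C_1=E_-E_++\frac{(q^{1/2}K-q^{-1/2}K^{-1})^2}{(q-q^{-1})^2},\qquad C_2=P_+P_-,\qquad q^{1/2}:=q^{(p+1)/2}.$$ **The algebra $\mathcal A_{FS}$** consists of the polynomials in $\eta_\pm,\delta$ whose coefficients are functions of real variables $z_+,z_-,\lambda$ (which commute with everything), where $\eta_-\eta_+=q^2\eta_+\eta_-$, $\eta_\pm\delta=q^2\delta\eta_\pm$, $\eta_\pm^p=0$, $\delta^p=1$, and all generators are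 self-adjoint for the conjugate-linear anti-involution $*$. **The functions on the generalized superspace** form the subspace $\mathcal A$ of finite sums $\sum_s a_s(\eta_+,\eta_-)f_s(z_+,z_-)$ with $f_s\in C_0^\infty(\mathbb R^2)$ complex-valued and $a_s$ polynomials. **The coaction** $\Delta:\mathcal A\to\mathcal A_{FS}\otimes\mathcal A$ is given by $$\Delta\eta_+=\eta_+\otimes1+e^{\lambda/p}\delta\otimes\eta_++(1+q^2)\,\eta_+\otimes\eta_+\eta_-+q^{-2}e^{-\lambda/p}\delta^{-1}\eta_+^2\otimes(1+q^2\eta_+\eta_-)\eta_-,$$ $$\Delta\eta_-=\eta_-\otimes1+e^{-\lambda/p}\delta^{-1}\otimes\eta_-+\sum_{k=1}^{p-2}(-1)^kq^{-k(k+1)}e^{-(k+1)\lambda/p}\,\delta^{-k-1}\eta_+^k\otimes\eta_-^{k+1},$$ $$\Delta z_+=z_+\otimes1+e^{\lambda}\otimes z_++\sum_{k=1}^{p-1}\frac{q^{k^2}}{[k]![p-k]!}\,e^{k\lambda/p}\eta_+^{p-k}\delta^k\otimes(-q^2\eta_+\eta_-;q^2)_{p-k}\,\eta_+^k,$$ $$\Delta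 z_-=z_-\otimes1+e^{-\lambda}\otimes z_-+\sum_{k=1}^{p-1}\frac{q^{-k^2}}{[k]![p-k]!}\,e^{-k\lambda/p}\eta_-^{p-k}\delta^{-k}(-\eta_+\eta_-;q^{-2})_k\otimes\eta_-^k,$$ and $\Delta\big(f(z_+,z_-)\eta_+^a\eta_-^b\big)=f(\Delta z_+,\Delta z_-)(\Delta\eta_+)^a(\Delta\eta_-)^b$, where $f(\Delta z_+,\Delta z_-)$ is the (finite) Taylor expansion in the nilpotent sums over $k$. **The right representation.** Let $e=i^pq^{(p+1)/2}$ (so $e^2=-q$, $e^p=i$). The generators of $U_{FS}$ pair with $\mathcal A_{FS}$ by $\langle K,f\delta^k\rangle=q^kf(0)$, $\langle E_+,f\eta_+\delta^k\rangle=e\,q^kf(0)$, $\langle E_-,f\eta_-\delta^k\rangle=e^{-1}q^kf(0)$, $\langle P_\pm,f\delta^k\rangle=\pm i\,\partial_{z_\pm}f(0)$, $\langle H,f\delta^k\rangle=-i\,\partial_\lambda f(0)$, and by $0$ on all other monomials $f\eta_+^a\eta_-^b\delta^k$, $0\le a,b,k<p$. For a generator $\phi$ put $\mathcal R(\phi)=(\phi\otimes\mathrm{id})\Delta:\mathcal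 A\to\mathcal A$, and extend $\mathcal R$ linearly to polynomials in the generators by $\mathcal R(\phi\phi')=\mathcal R(\phi')\mathcal R(\phi)$. **The integral** $\mathcal I_E:\mathcal A\to\mathbb C$ is the linear map with $\mathcal I_E(f\,\eta_+^n\eta_-^m)=q^{-1}\delta_{n,p-1}\delta_{m,p-1}\int_{\mathbb R^2}f\,dz_+dz_-$ for $0\le n,m<p$. **Statement.** Let $\mathcal C\in U_{FS}$ be any function of $C_1$, $C_2$ and the identity, that is, any element of the unital subalgebra generated by $C_1$ and $C_2$, expressed in any way as a polynomial in the generators. Then for every $\Phi\in\mathcal A$ the action $$S[\Phi]=\mathcal I_E\big(\Phi^*\,\mathcal R(\mathcal C)\Phi\big)$$ is invariant under the coaction $\Delta$ of $\mathcal A_{FS}$: $$S[\Delta\Phi]:=(\mathrm{id}\otimes\mathcal I_E)\Big((\Delta\Phi)^*\,\big(\mathrm{id}\otimes\mathcal R(\mathcal C)\big)\Delta\Phi\Big)=S[\Phi]\,1_{\mathcal A_{FS}} .$$ -/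

import Mathlib

open scoped TensorProduct ContDiff ComplexConjugate

noncomputable section

namespace FracSusy

/-! ## Finite-dimensional star algebras with a monomial basis

`TwAlg κ` has a basis `e x`, indexed by a finite additive group `M`, with
`e x * e y = κ.c x y • e (x + y)` and `star (e x) = κ.s x • e x`. -/

/-- The structure constants of a monomial star algebra (the constants `c x y` may vanish). -/
structure StarCocycle (M : Type) [AddCommGroup M] where
  c : M → M → ℂ
  s : M → ℂ
  c_zero_left : ∀ x, c 0 x = 1
  c_zero_right : ∀ x, c x 0 = 1
  c_assoc : ∀ x y z, c x y * c (x + y) z = c y z * c x (y + z)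
  s_norm : ∀ x, s x * conj (s x) = 1
  s_mul : ∀ x y, s (x + y) * conj (c x y) = s x * s y * c y x

/-- The monomial algebra with structure constants `κ`: an element is its family of coordinates
in the monomial basis. -/
def TwAlg {M : Type} [AddCommGroup M] (_κ : StarCocycle M) : Type := M → ℂ

namespace TwAlg

variable {M : Type} [AddCommGroup M] [Fintype M] [DecidableEq M] {κ : StarCocycle M}

instance : AddCommGroup (TwAlg κ) := inferInstanceAs (AddCommGroup (M → ℂ))

instance : Module ℂ (TwAlg κ) := inferInstanceAs (Module ℂ (M → ℂ))

/-- The coordinate of `e m`. -/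
def coeff (m : M) : TwAlg κ →ₗ[ℂ] ℂ where
  toFun x := x m
  map_add' _ _ := rfl
  map_smul' _ _ := rfl

/-- The basis monomial with exponents `m`. -/
def e (κ : StarCocycle M) (m : M) : TwAlg κ := fun n => if n = m then 1 else 0

/-- The monomial basis. -/
def basis (κ : StarCocycle M) : Module.Basis M ℂ (TwAlg κ) := Pi.basisFun ℂ M

theorem coeff_e (m n : M) : coeff n (e κ m) = if n = m then 1 else 0 := rfl

theorem basis_apply (m : M) : basis κ m = e κ m := by
  funext n
  change (Pi.basisFun ℂ M m) n = _
  simp [e, Pi.basisFun_apply, Pi.single_apply]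

@[ext]
theorem ext {x y : TwAlg κ} (h : ∀ m, coeff m x = coeff m y) : x = y := funext h

instance : Mul (TwAlg κ) where
  mul x y := fun m => ∑ i : M, κ.c i (m - i) * (coeff i x * coeff (m - i) y)

instance : One (TwAlg κ) := ⟨e κ 0⟩

instance : Star (TwAlg κ) := ⟨fun x m => κ.s m * conj (coeff m x)⟩

theorem coeff_mul (x y : TwAlg κ) (m : M) :
    coeff m (x * y) = ∑ i : M, κ.c i (m - i) * (coeff i x * coeff (m - i) y) := rfl

theorem coeff_one (m : M) : coeff m (1 : TwAlg κ) = if m = 0 then 1 else 0 := rfl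

theorem coeff_star (x : TwAlg κ) (m : M) : coeff m (star x) = κ.s m * conj (coeff m x) := rfl

theorem mul_assoc' (x y z : TwAlg κ) : x * y * z = x * (y * z) := by
  ext m
  simp only [coeff_mul, Finset.sum_mul, Finset.mul_sum]
  rw [Finset.sum_comm]
  refine Finset.sum_congr rfl fun i _ => ?_
  refine Fintype.sum_equiv (Equiv.subRight i) _ _ fun j => ?_
  have h := κ.c_assoc i (j - i) (m - j)
  have h1 : i + (j - i) = j := by abel
  have h2 : j - i + (m - j) = m - i := by abel
  rw [h1, h2] at h
  simp only [Equiv.subRight_apply]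
  have h3 : m - i - (j - i) = m - j := by abel
  rw [h3]
  linear_combination (coeff i x * coeff (j - i) y * coeff (m - j) z) * h

instance : Ring (TwAlg κ) :=
  { (inferInstance : AddCommGroup (TwAlg κ)) with
    mul := (· * ·)
    one := 1
    mul_assoc := mul_assoc'
    one_mul := fun x => by
      ext m
      rw [coeff_mul, Finset.sum_eq_single 0]
      · simp [coeff_one, κ.c_zero_left]
      · intro i _ hi
        simp [coeff_one, hi]
      · simp
    mul_one := fun x => by
      ext m
      rw [coeff_mul, Finset.sum_eq_single m]
      · simp [coeff_one, κ.c_zero_right]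
      · intro i _ hi
        have : m - i ≠ 0 := fun h => hi (sub_eq_zero.mp h).symm
        simp [coeff_one, this]
      · simp
    left_distrib := fun x y z => by
      ext m
      simp only [map_add, coeff_mul, mul_add, Finset.sum_add_distrib]
    right_distrib := fun x y z => by
      ext m
      simp only [map_add, coeff_mul, add_mul, mul_add, Finset.sum_add_distrib]
    zero_mul := fun x => by
      ext m
      simp [coeff_mul]
    mul_zero := fun x => by
      ext m
      simp [coeff_mul] }

instance : Algebra ℂ (TwAlg κ) :=
  Algebra.ofModule
    (fun r x y => by
      ext m
      simp only [map_smul, coeff_mul, smul_eq_mul, Finset.mul_sum]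
      exact Finset.sum_congr rfl fun i _ => by ring)
    (fun r x y => by
      ext m
      simp only [map_smul, coeff_mul, smul_eq_mul, Finset.mul_sum]
      exact Finset.sum_congr rfl fun i _ => by ring)

instance : StarRing (TwAlg κ) where
  star_involutive x := by
    ext m
    simp only [coeff_star, map_mul, Complex.conj_conj]
    rw [← mul_assoc, κ.s_norm, one_mul]
  star_add x y := by
    ext m
    simp only [coeff_star, map_add, mul_add]
  star_mul x y := by
    ext m
    simp only [coeff_star, coeff_mul, map_sum, map_mul, Finset.mul_sum]
    refine Fintype.sum_equiv (Equiv.subLeft m) _ _ fun i => ?_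
    have h := κ.s_mul i (m - i)
    have h1 : i + (m - i) = m := by abel
    rw [h1] at h
    have h2 : m - (m - i) = i := by abel
    simp only [Equiv.subLeft_apply, h2]
    linear_combination (conj (coeff i x) * conj (coeff (m - i) y)) * h

instance : StarModule ℂ (TwAlg κ) where
  star_smul r x := by
    ext m
    simp only [coeff_star, map_smul, smul_eq_mul, map_mul, starRingEnd_apply]
    ring

theorem e_mul_e (x y : M) : e κ x * e κ y = κ.c x y • e κ (x + y) := by
  ext m
  rw [coeff_mul, Finset.sum_eq_single x]
  · simp only [coeff_e, map_smul, smul_eq_mul, if_true, one_mul]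
    by_cases h : m = x + y
    · subst h
      simp
    · have : m - x ≠ y := fun h' => h (by rw [← h']; abel)
      simp [h, this]
  · intro i _ hi
    simp [coeff_e, hi]
  · simp

theorem star_e (x : M) : star (e κ x) = κ.s x • e κ x := by
  ext m
  simp only [coeff_star, coeff_e, map_smul, smul_eq_mul]
  by_cases h : m = x <;> simp [h]

end TwAlg

/-! ## The generalized Grassmann variables -/

section Grassmann

variable {p : ℕ} [NeZero p] {q : ℂ}

/-- `q ^ n` for an exponent `n` modulo `p`. -/
def chi (hq : IsPrimitiveRoot q p) : AddChar (ZMod p) ℂ := AddChar.zmodChar p hq.pow_eq_one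

/-- Indicator of `a + b < p` for two exponents `a, b < p`; it encodes `η ^ p = 0`. -/
def trunc (a b : ZMod p) : ℂ := if a.val + b.val < p then 1 else 0

theorem trunc_assoc (a b c : ZMod p) :
    trunc a b * trunc (a + b) c = trunc b c * trunc a (b + c) := by
  have ha := ZMod.val_lt a
  have hb := ZMod.val_lt b
  have hc := ZMod.val_lt c
  unfold trunc
  by_cases h1 : a.val + b.val < p <;> by_cases h2 : b.val + c.val < p
  · rw [ZMod.val_add_of_lt h1, ZMod.val_add_of_lt h2]
    simp [h1, h2, add_assoc]
  · rw [ZMod.val_add_of_lt h1]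
    have : ¬ a.val + b.val + c.val < p := by omega
    simp [h2, this]
  · rw [ZMod.val_add_of_lt h2]
    have : ¬ a.val + (b.val + c.val) < p := by omega
    simp [h1, this]
  · simp [h1, h2]

theorem trunc_zero_left (a : ZMod p) : trunc 0 a = 1 := by
  simp [trunc, ZMod.val_lt a]

theorem trunc_zero_right (a : ZMod p) : trunc a 0 = 1 := by
  simp [trunc, ZMod.val_lt a]

theorem trunc_comm (a b : ZMod p) : trunc a b = trunc b a := by
  simp [trunc, add_comm]

theorem conj_trunc (a b : ZMod p) : conj (trunc a b) = trunc a b := by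
  unfold trunc
  split_ifs <;> simp

theorem conj_chi (hq : IsPrimitiveRoot q p) (a : ZMod p) : conj (chi hq a) = chi hq (-a) :=
  (AddChar.map_neg_eq_conj (chi hq) a).symm

theorem chi_mul_conj (hq : IsPrimitiveRoot q p) (a : ZMod p) :
    chi hq a * conj (chi hq a) = 1 := by
  rw [conj_chi, ← AddChar.map_add_eq_mul, add_neg_cancel, AddChar.map_zero_eq_one]

/-- Structure constants for the monomials `η₊^a η₋^b`, subject to `η₋ η₊ = q² η₊ η₋`,
`η±^p = 0`, `η±^* = η±`. -/
def etaCocycle (hq : IsPrimitiveRoot q p) : StarCocycle (ZMod p × ZMod p) where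
  c x y := trunc x.1 y.1 * trunc x.2 y.2 * chi hq (2 * x.2 * y.1)
  s x := chi hq (2 * x.1 * x.2)
  c_zero_left x := by simp [trunc_zero_left]
  c_zero_right x := by simp [trunc_zero_right]
  c_assoc x y z := by
    have h : chi hq (2 * x.2 * y.1) * chi hq (2 * (x + y).2 * z.1) =
        chi hq (2 * y.2 * z.1) * chi hq (2 * x.2 * (y + z).1) := by
      rw [← AddChar.map_add_eq_mul, ← AddChar.map_add_eq_mul]
      congr 1
      simp only [Prod.fst_add, Prod.snd_add]
      ring
    have h1 := trunc_assoc x.1 y.1 z.1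
    have h2 := trunc_assoc x.2 y.2 z.2
    simp only [Prod.fst_add, Prod.snd_add] at h ⊢
    calc _ = (trunc x.1 y.1 * trunc (x.1 + y.1) z.1) * (trunc x.2 y.2 * trunc (x.2 + y.2) z.2) *
          (chi hq (2 * x.2 * y.1) * chi hq (2 * (x.2 + y.2) * z.1)) := by ring
      _ = _ := by rw [h1, h2, h]; ring
  s_norm x := chi_mul_conj hq _
  s_mul x y := by
    have h : chi hq (2 * (x + y).1 * (x + y).2) * chi hq (-(2 * x.2 * y.1)) =
        chi hq (2 * x.1 * x.2) * chi hq (2 * y.1 * y.2) * chi hq (2 * y.2 * x.1) := by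
      simp only [← AddChar.map_add_eq_mul]
      congr 1
      simp only [Prod.fst_add, Prod.snd_add]
      ring
    simp only [map_mul, conj_trunc, conj_chi, trunc_comm y.1, trunc_comm y.2]
    linear_combination (trunc x.1 y.1 * trunc x.2 y.2) * h

/-- Structure constants for the monomials `η₊^a η₋^b δ^k`, subject to `η₋ η₊ = q² η₊ η₋`,
`η± δ = q² δ η±`, `η±^p = 0`, `δ^p = 1`, `η±^* = η±`, `δ^* = δ`. -/
def etaDeltaCocycle (hq : IsPrimitiveRoot q p) : StarCocycle (ZMod p × ZMod p × ZMod p) where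
  c x y := trunc x.1 y.1 * trunc x.2.1 y.2.1 *
    chi hq (2 * x.2.1 * y.1 - 2 * x.2.2 * (y.1 + y.2.1))
  s x := chi hq (2 * x.1 * x.2.1 - 2 * x.2.2 * (x.1 + x.2.1))
  c_zero_left x := by simp [trunc_zero_left]
  c_zero_right x := by simp [trunc_zero_right]
  c_assoc x y z := by
    have h : chi hq (2 * x.2.1 * y.1 - 2 * x.2.2 * (y.1 + y.2.1)) *
          chi hq (2 * (x + y).2.1 * z.1 - 2 * (x + y).2.2 * (z.1 + z.2.1)) =
        chi hq (2 * y.2.1 * z.1 - 2 * y.2.2 * (z.1 + z.2.1)) *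
          chi hq (2 * x.2.1 * (y + z).1 - 2 * x.2.2 * ((y + z).1 + (y + z).2.1)) := by
      rw [← AddChar.map_add_eq_mul, ← AddChar.map_add_eq_mul]
      congr 1
      simp only [Prod.fst_add, Prod.snd_add]
      ring
    have h1 := trunc_assoc x.1 y.1 z.1
    have h2 := trunc_assoc x.2.1 y.2.1 z.2.1
    simp only [Prod.fst_add, Prod.snd_add] at h ⊢
    calc _ = (trunc x.1 y.1 * trunc (x.1 + y.1) z.1) *
          (trunc x.2.1 y.2.1 * trunc (x.2.1 + y.2.1) z.2.1) *
          (chi hq (2 * x.2.1 * y.1 - 2 * x.2.2 * (y.1 + y.2.1)) *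
            chi hq (2 * (x.2.1 + y.2.1) * z.1 - 2 * (x.2.2 + y.2.2) * (z.1 + z.2.1))) := by ring
      _ = _ := by rw [h1, h2, h]; ring
  s_norm x := chi_mul_conj hq _
  s_mul x y := by
    have h : chi hq (2 * (x + y).1 * (x + y).2.1 -
            2 * (x + y).2.2 * ((x + y).1 + (x + y).2.1)) *
          chi hq (-(2 * x.2.1 * y.1 - 2 * x.2.2 * (y.1 + y.2.1))) =
        chi hq (2 * x.1 * x.2.1 - 2 * x.2.2 * (x.1 + x.2.1)) *
          chi hq (2 * y.1 * y.2.1 - 2 * y.2.2 * (y.1 + y.2.1)) *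
          chi hq (2 * y.2.1 * x.1 - 2 * y.2.2 * (x.1 + x.2.1)) := by
      simp only [← AddChar.map_add_eq_mul]
      congr 1
      simp only [Prod.fst_add, Prod.snd_add]
      ring
    simp only [map_mul, conj_trunc, conj_chi, trunc_comm y.1, trunc_comm y.2.1]
    linear_combination (trunc x.1 y.1 * trunc x.2.1 y.2.1) * h

theorem etaCocycle_c (hq : IsPrimitiveRoot q p) (x y : ZMod p × ZMod p) :
    (etaCocycle hq).c x y = trunc x.1 y.1 * trunc x.2 y.2 * chi hq (2 * x.2 * y.1) := rfl

theorem etaDeltaCocycle_c (hq : IsPrimitiveRoot q p) (x y : ZMod p × ZMod p × ZMod p) :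
    (etaDeltaCocycle hq).c x y = trunc x.1 y.1 * trunc x.2.1 y.2.1 *
      chi hq (2 * x.2.1 * y.1 - 2 * x.2.2 * (y.1 + y.2.1)) := rfl

theorem etaDeltaCocycle_s (hq : IsPrimitiveRoot q p) (x : ZMod p × ZMod p × ZMod p) :
    (etaDeltaCocycle hq).s x = chi hq (2 * x.1 * x.2.1 - 2 * x.2.2 * (x.1 + x.2.1)) := rfl

/-- The star algebra generated by `η₊, η₋`. -/
abbrev Eta (hq : IsPrimitiveRoot q p) : Type := TwAlg (etaCocycle hq)

/-- The star algebra generated by `η₊, η₋, δ`. -/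
abbrev EtaDelta (hq : IsPrimitiveRoot q p) : Type := TwAlg (etaDeltaCocycle hq)

/-- `η₊` and `η₋` in the algebra generated by `η₊, η₋`. -/
def yp (hq : IsPrimitiveRoot q p) : Eta hq := TwAlg.e _ (1, 0)

/-- See `yp`. -/
def ym (hq : IsPrimitiveRoot q p) : Eta hq := TwAlg.e _ (0, 1)

/-- `η₊`, `η₋`, `δ` and `δ⁻¹` in the algebra generated by `η₊, η₋, δ`. -/
def etap (hq : IsPrimitiveRoot q p) : EtaDelta hq := TwAlg.e _ (1, 0, 0)

/-- See `etap`. -/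
def etam (hq : IsPrimitiveRoot q p) : EtaDelta hq := TwAlg.e _ (0, 1, 0)

/-- See `etap`. -/
def del (hq : IsPrimitiveRoot q p) : EtaDelta hq := TwAlg.e _ (0, 0, 1)

/-- See `etap`. -/
def delInv (hq : IsPrimitiveRoot q p) : EtaDelta hq := TwAlg.e _ (0, 0, -1)

theorem val_one_of_lt (hp : 1 < p) : (1 : ZMod p).val = 1 := by
  haveI : Fact (1 < p) := ⟨hp⟩
  exact ZMod.val_one p

theorem chi_natCast (hq : IsPrimitiveRoot q p) (n : ℕ) : chi hq (n : ZMod p) = q ^ n :=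
  AddChar.zmodChar_apply' _ n

theorem chi_two (hq : IsPrimitiveRoot q p) : chi hq 2 = q ^ 2 := by
  simpa using chi_natCast hq 2

theorem yp_pow (hq : IsPrimitiveRoot q p) (n : ℕ) (hn : n < p) :
    yp hq ^ n = TwAlg.e _ ((n : ZMod p), 0) := by
  induction n with
  | zero => simp; rfl
  | succ n ih =>
    rw [pow_succ, ih (by omega), yp, TwAlg.e_mul_e]
    have h1 : (n : ZMod p).val = n := ZMod.val_cast_of_lt (by omega)
    simp [etaCocycle_c, trunc, h1, val_one_of_lt (show 1 < p by omega), hn, NeZero.pos p]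

theorem ym_pow (hq : IsPrimitiveRoot q p) (n : ℕ) (hn : n < p) :
    ym hq ^ n = TwAlg.e _ (0, (n : ZMod p)) := by
  induction n with
  | zero => simp; rfl
  | succ n ih =>
    rw [pow_succ, ih (by omega), ym, TwAlg.e_mul_e]
    have h1 : (n : ZMod p).val = n := ZMod.val_cast_of_lt (by omega)
    simp [etaCocycle_c, trunc, h1, val_one_of_lt (show 1 < p by omega), hn, NeZero.pos p]

/-- The basis monomials of `Eta hq` are `η₊^a η₋^b`. -/
theorem e_eq_pow (hq : IsPrimitiveRoot q p) (m : ZMod p × ZMod p) :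
    TwAlg.e (etaCocycle hq) m = yp hq ^ m.1.val * ym hq ^ m.2.val := by
  rw [yp_pow hq _ (ZMod.val_lt _), ym_pow hq _ (ZMod.val_lt _), TwAlg.e_mul_e]
  simp [etaCocycle_c, trunc_zero_left, trunc_zero_right]

theorem ym_mul_yp (hq : IsPrimitiveRoot q p) (hp : 2 < p) :
    ym hq * yp hq = q ^ 2 • (yp hq * ym hq) := by
  simp [yp, ym, TwAlg.e_mul_e, etaCocycle_c, trunc_zero_left, trunc_zero_right, chi_two]

theorem yp_pow_p (hq : IsPrimitiveRoot q p) (hp : 1 < p) : yp hq ^ p = 0 := by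
  obtain ⟨n, rfl⟩ : ∃ n, p = n + 1 := ⟨p - 1, by omega⟩
  rw [pow_succ, yp_pow hq _ (by omega), yp, TwAlg.e_mul_e]
  have h1 : ((n : ℕ) : ZMod (n + 1)).val = n := ZMod.val_cast_of_lt (by omega)
  simp only [etaCocycle_c, trunc, h1, val_one_of_lt hp]
  simp

theorem etam_mul_etap (hq : IsPrimitiveRoot q p) :
    etam hq * etap hq = q ^ 2 • (etap hq * etam hq) := by
  simp [etap, etam, TwAlg.e_mul_e, etaDeltaCocycle_c, etaDeltaCocycle_s, trunc_zero_left, trunc_zero_right, chi_two]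

theorem etap_mul_del (hq : IsPrimitiveRoot q p) :
    etap hq * del hq = q ^ 2 • (del hq * etap hq) := by
  have h : chi hq (-2) * q ^ 2 = 1 := by
    rw [← chi_two hq, ← AddChar.map_add_eq_mul]; simp
  have h' : q ^ 2 * chi hq (-2) = 1 := by rw [mul_comm, h]
  simp [etap, del, TwAlg.e_mul_e, etaDeltaCocycle_c, etaDeltaCocycle_s, trunc_zero_left, trunc_zero_right, smul_smul, h']

theorem etam_mul_del (hq : IsPrimitiveRoot q p) :
    etam hq * del hq = q ^ 2 • (del hq * etam hq) := by
  have h : chi hq (-2) * q ^ 2 = 1 := by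
    rw [← chi_two hq, ← AddChar.map_add_eq_mul]; simp
  have h' : q ^ 2 * chi hq (-2) = 1 := by rw [mul_comm, h]
  simp [etam, del, TwAlg.e_mul_e, etaDeltaCocycle_c, etaDeltaCocycle_s, trunc_zero_left, trunc_zero_right, smul_smul, h']

theorem del_mul_delInv (hq : IsPrimitiveRoot q p) : del hq * delInv hq = 1 := by
  simp [delInv, del, TwAlg.e_mul_e, etaDeltaCocycle_c, etaDeltaCocycle_s, trunc_zero_right]
  rfl

theorem del_pow (hq : IsPrimitiveRoot q p) (n : ℕ) :
    del hq ^ n = TwAlg.e _ (0, 0, (n : ZMod p)) := by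
  induction n with
  | zero => simp; rfl
  | succ n ih =>
    rw [pow_succ, ih, del, TwAlg.e_mul_e]
    simp [etaDeltaCocycle_c, etaDeltaCocycle_s, trunc_zero_right]

theorem star_etap (hq : IsPrimitiveRoot q p) : star (etap hq) = etap hq := by
  simp [etap, TwAlg.star_e, etaDeltaCocycle_c, etaDeltaCocycle_s]

theorem star_del (hq : IsPrimitiveRoot q p) : star (del hq) = del hq := by
  simp [del, TwAlg.star_e, etaDeltaCocycle_c, etaDeltaCocycle_s]

end Grassmann

/-! ## The generalized superspace -/

section Functions

/-- The star algebra `C₀^∞(ℝ²)` of smooth compactly supported functions of `(z₊, z₋)`. -/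
def testAlg : NonUnitalStarSubalgebra ℂ (ℝ × ℝ → ℂ) where
  carrier := {f | ContDiff ℝ ∞ f ∧ HasCompactSupport f}
  add_mem' hf hg := ⟨hf.1.add hg.1, hf.2.add hg.2⟩
  zero_mem' := ⟨contDiff_const, HasCompactSupport.zero⟩
  mul_mem' hf hg := ⟨hf.1.mul hg.1, hf.2.mul_right⟩
  smul_mem' r f hf := ⟨contDiff_const.smul hf.1, hf.2.smul_left (f := fun _ => r)⟩
  star_mem' {f} hf := by
    refine ⟨Complex.conjCLE.contDiff.comp hf.1, ?_⟩
    exact hf.2.comp_left (g := fun z : ℂ => star z) (star_zero ℂ)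

/-- `C₀^∞(ℝ²)` as a type. -/
abbrev Test : Type := testAlg

/-- The derivative of a test function in the direction `v`. -/
def dTest (v : ℝ × ℝ) : Test →ₗ[ℂ] Test where
  toFun f := ⟨fun w => fderiv ℝ f.1 w v,
    (f.2.1.fderiv_right (m := ∞) le_rfl).clm_apply contDiff_const, f.2.2.fderiv_apply ℝ v⟩
  map_add' f g := by
    ext w
    change fderiv ℝ (f.1 + g.1) w v = _
    rw [fderiv_add (f.2.1.differentiable (by simp) w) (g.2.1.differentiable (by simp) w)]
    rfl
  map_smul' r f := by
    ext w
    change fderiv ℝ (r • f.1) w v = _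
    rw [fderiv_const_smul (f.2.1.differentiable (by simp) w)]
    rfl

/-- `∂/∂z₊` on test functions. -/
def dzp : Test →ₗ[ℂ] Test := dTest (1, 0)

/-- `∂/∂z₋` on test functions. -/
def dzm : Test →ₗ[ℂ] Test := dTest (0, 1)

/-- The vector field `z₊ ∂/∂z₊ - z₋ ∂/∂z₋` on test functions. -/
def euler : Test →ₗ[ℂ] Test where
  toFun f := ⟨fun w => (w.1 : ℂ) * (dzp f).1 w - (w.2 : ℂ) * (dzm f).1 w, by
    have h1 : ContDiff ℝ ∞ fun w : ℝ × ℝ => (w.1 : ℂ) :=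
      Complex.ofRealCLM.contDiff.comp contDiff_fst
    have h2 : ContDiff ℝ ∞ fun w : ℝ × ℝ => (w.2 : ℂ) :=
      Complex.ofRealCLM.contDiff.comp contDiff_snd
    exact (h1.mul (dzp f).2.1).sub (h2.mul (dzm f).2.1),
    ((dzp f).2.2.mul_left (f := fun w : ℝ × ℝ => (w.1 : ℂ))).sub
      ((dzm f).2.2.mul_left (f := fun w : ℝ × ℝ => (w.2 : ℂ)))⟩
  map_add' f g := by
    ext w
    simp only [map_add]
    change (w.1 : ℂ) * ((dzp f).1 w + (dzp g).1 w) - (w.2 : ℂ) * ((dzm f).1 w + (dzm g).1 w) =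
      ((w.1 : ℂ) * (dzp f).1 w - (w.2 : ℂ) * (dzm f).1 w) +
        ((w.1 : ℂ) * (dzp g).1 w - (w.2 : ℂ) * (dzm g).1 w)
    ring
  map_smul' r f := by
    ext w
    simp only [map_smul]
    change (w.1 : ℂ) * (r * (dzp f).1 w) - (w.2 : ℂ) * (r * (dzm f).1 w) =
      r * ((w.1 : ℂ) * (dzp f).1 w - (w.2 : ℂ) * (dzm f).1 w)
    ring

/-- The affine transformation `(w₊, w₋) ↦ (z₊ + e^l w₊, z₋ + e^(-l) w₋)` of the plane defined by
`g = (z₊, z₋, l)`. -/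
def boost (g : ℝ × ℝ × ℝ) : (ℝ × ℝ) ≃ₜ (ℝ × ℝ) where
  toFun w := (g.1 + Real.exp g.2.2 * w.1, g.2.1 + Real.exp (-g.2.2) * w.2)
  invFun w := (Real.exp (-g.2.2) * (w.1 - g.1), Real.exp g.2.2 * (w.2 - g.2.1))
  left_inv w := by
    ext <;> simp [← mul_assoc, ← Real.exp_add]
  right_inv w := by
    ext <;> simp [← mul_assoc, ← Real.exp_add]
  continuous_toFun := by fun_prop
  continuous_invFun := by fun_prop

/-- The function `w ↦ f (boost g w)`. -/
def pull (g : ℝ × ℝ × ℝ) : Test →ₗ[ℂ] Test where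
  toFun f := ⟨fun w => f.1 (boost g w), by
    refine f.2.1.comp (g := f.1) (f := boost g) ?_
    change ContDiff ℝ ∞ fun w : ℝ × ℝ =>
      (g.1 + Real.exp g.2.2 * w.1, g.2.1 + Real.exp (-g.2.2) * w.2)
    fun_prop, f.2.2.comp_homeomorph (boost g)⟩
  map_add' _ _ := rfl
  map_smul' _ _ := rfl

/-- The integral `∫ dz₊ dz₋ f(z₊, z₋)`. -/
def integralC : Test →ₗ[ℂ] ℂ where
  toFun f := ∫ w, f.1 w
  map_add' f g := MeasureTheory.integral_add
    (f.2.1.continuous.integrable_of_hasCompactSupport f.2.2)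
    (g.2.1.continuous.integrable_of_hasCompactSupport g.2.2)
  map_smul' r f := MeasureTheory.integral_const_mul r f.1

end Functions

section Superspace

variable {p : ℕ} [NeZero p] {q : ℂ} (hq : IsPrimitiveRoot q p)

/-- The algebra of functions on the generalized superspace: finite sums of `f(z₊, z₋) a(η₊, η₋)`
with `f ∈ C₀^∞(ℝ²)`. -/
abbrev Superspace : Type := Test ⊗[ℂ] Eta hq

instance : IsScalarTower ℂ (Superspace hq) (Superspace hq) :=
  Algebra.TensorProduct.isScalarTower_right

instance : SMulCommClass ℂ (Superspace hq) (Superspace hq) :=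
  Algebra.TensorProduct.sMulCommClass_right

instance : NonUnitalRing (EtaDelta hq ⊗[ℂ] Superspace hq) :=
  @Algebra.TensorProduct.instNonUnitalRing ℂ (EtaDelta hq) (Superspace hq) _ _ _ _ _ _ _ _ _

theorem tmul_mul_tmul (a b : EtaDelta hq) (X Y : Superspace hq) :
    (a ⊗ₜ[ℂ] X) * (b ⊗ₜ[ℂ] Y) = (a * b) ⊗ₜ[ℂ] (X * Y) := by
  exact Algebra.TensorProduct.tmul_mul_tmul a b X Y

theorem star_tmul_tmul (a : EtaDelta hq) (f : Test) (b : Eta hq) :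
    star (a ⊗ₜ[ℂ] (f ⊗ₜ[ℂ] b)) = star a ⊗ₜ[ℂ] (star f ⊗ₜ[ℂ] star b) := rfl

/-- The integral over `η₊, η₋`: `η₊^n η₋^m ↦ q⁻¹` if `n = m = p - 1`, and `0` otherwise. -/
def integralEta : Eta hq →ₗ[ℂ] ℂ := q⁻¹ • TwAlg.coeff (-1, -1)

/-- The integral over the generalized superspace. -/
def integralE : Superspace hq →ₗ[ℂ] ℂ :=
  TensorProduct.lid ℂ ℂ ∘ₗ TensorProduct.map integralC (integralEta hq)

/-! ## The coaction

`𝒜_FS` consists of the functions of `g = (z₊, z₋, l) ∈ ℝ³` with values in `EtaDelta hq`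
(`l` stands for the generator `λ`), so that for a vector space `V` an element of `𝒜_FS ⊗ V` is
a function of `g` with values in `EtaDelta hq ⊗[ℂ] V`. -/

/-- The symmetric `q`-number. -/
def qNum (q : ℂ) (n : ℕ) : ℂ := (q ^ n - (q ^ n)⁻¹) / (q - q⁻¹)

/-- The `q`-factorial `[n]! = [1] ⋯ [n]`. -/
def qFact (q : ℂ) (n : ℕ) : ℂ := ∏ j ∈ Finset.Icc 1 n, qNum q j

/-- `(x; r)_k = (1 - x) (1 - r x) ⋯ (1 - r^(k-1) x)`. -/
def qPoch {A : Type} [Ring A] [Algebra ℂ A] (x : A) (r : ℂ) : ℕ → A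
  | 0 => 1
  | k + 1 => qPoch x r k * (1 - r ^ k • x)

/-- `Δ η₊`, as a function of `l`. -/
def coEtap (l : ℝ) : EtaDelta hq ⊗[ℂ] Eta hq :=
  etap hq ⊗ₜ 1 + Complex.exp (l / p) • (del hq ⊗ₜ yp hq)
    + (1 + q ^ 2) • (etap hq ⊗ₜ (yp hq * ym hq))
    + ((q ^ 2)⁻¹ * Complex.exp (-l / p)) •
      ((delInv hq * etap hq ^ 2) ⊗ₜ ((1 + q ^ 2 • (yp hq * ym hq)) * ym hq))

/-- `Δ η₋`, as a function of `l`. -/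
def coEtam (l : ℝ) : EtaDelta hq ⊗[ℂ] Eta hq :=
  etam hq ⊗ₜ 1 + Complex.exp (-l / p) • (delInv hq ⊗ₜ ym hq)
    + ∑ k ∈ Finset.Icc 1 (p - 2),
      ((-1) ^ k * (q ^ (k * (k + 1)))⁻¹ * Complex.exp (-(k + 1) * l / p)) •
        ((delInv hq ^ (k + 1) * etap hq ^ k) ⊗ₜ (ym hq ^ (k + 1)))

/-- The nilpotent part of `Δ z₊ = z₊ ⊗ 1 + e^l ⊗ z₊ + nilp l`. -/
def nilp (l : ℝ) : EtaDelta hq ⊗[ℂ] Eta hq :=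
  ∑ k ∈ Finset.Icc 1 (p - 1),
    (q ^ (k ^ 2) / (qFact q k * qFact q (p - k)) * Complex.exp (k * l / p)) •
      ((etap hq ^ (p - k) * del hq ^ k) ⊗ₜ
        (qPoch (-(q ^ 2 • (yp hq * ym hq))) (q ^ 2) (p - k) * yp hq ^ k))

/-- The nilpotent part of `Δ z₋ = z₋ ⊗ 1 + e^(-l) ⊗ z₋ + nilm l`. -/
def nilm (l : ℝ) : EtaDelta hq ⊗[ℂ] Eta hq :=
  ∑ k ∈ Finset.Icc 1 (p - 1),
    ((q ^ (k ^ 2))⁻¹ / (qFact q k * qFact q (p - k)) * Complex.exp (-k * l / p)) •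
      ((etam hq ^ (p - k) * delInv hq ^ k * qPoch (-(etap hq * etam hq)) (q ^ 2)⁻¹ k) ⊗ₜ
        (ym hq ^ k))

/-- `Δ` on polynomials in `η₊, η₋`: `η₊^a η₋^b ↦ (Δ η₊)^a (Δ η₋)^b`. -/
def coEta (l : ℝ) : Eta hq →ₗ[ℂ] EtaDelta hq ⊗[ℂ] Eta hq :=
  (TwAlg.basis (etaCocycle hq)).constr ℂ fun m => coEtap hq l ^ m.1.val * coEtam hq l ^ m.2.val

/-- The coaction `Δ`, evaluated at `g = (z₊, z₋, l)`. On `f(z₊, z₋) a(η₊, η₋)` it is the product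
of `f(Δ z₊, Δ z₋)` and `Δ a`; here `f(Δ z₊, Δ z₋)` is the Taylor expansion of `f` in the
nilpotent parts of `Δ z₊, Δ z₋`. All products of `p` factors `nilp l` vanish, and the same is
true for `nilm l`, so the expansion stops. -/
def coact (g : ℝ × ℝ × ℝ) : Superspace hq →ₗ[ℂ] EtaDelta hq ⊗[ℂ] Superspace hq :=
  ∑ i ∈ Finset.range p, ∑ j ∈ Finset.range p,
    ((i.factorial : ℂ) * (j.factorial : ℂ))⁻¹ •
      ((TensorProduct.leftComm ℂ Test (EtaDelta hq) (Eta hq)).toLinearMap ∘ₗ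
        TensorProduct.map (pull g ∘ₗ (dzp ^ i) ∘ₗ (dzm ^ j))
          (LinearMap.mulLeft ℂ (nilp hq g.2.2 ^ i * nilm hq g.2.2 ^ j) ∘ₗ coEta hq g.2.2))

end Superspace

/-! ## The algebra `U_FS` and its right representation -/

/-- The generators `P₊, P₋, H, E₊, E₋, K` of `U_FS`. -/
inductive Gen
  | Pp | Pm | H | Ep | Em | K

/-- Words in the generators of `U_FS`. -/
abbrev FreeU : Type := FreeAlgebra ℂ Gen

/-- A generator as an element of the free algebra. -/
def gen (x : Gen) : FreeU := FreeAlgebra.ι ℂ x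

open Gen in
/-- The defining relations of `U_FS`; `K⁻¹` is `K ^ (p - 1)`. -/
inductive URel (p : ℕ) (q : ℂ) : FreeU → FreeU → Prop
  | P_P : URel p q (gen Pp * gen Pm) (gen Pm * gen Pp)
  | Pp_H : URel p q (gen Pp * gen H - gen H * gen Pp) (Complex.I • gen Pp)
  | Pm_H : URel p q (gen Pm * gen H - gen H * gen Pm) (-Complex.I • gen Pm)
  | K_Ep : URel p q (gen K * gen Ep * gen K ^ (p - 1)) (q • gen Ep)
  | K_Em : URel p q (gen K * gen Em * gen K ^ (p - 1)) (q⁻¹ • gen Em)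
  | Ep_Em : URel p q (gen Ep * gen Em - gen Em * gen Ep)
      ((q - q⁻¹)⁻¹ • (gen K ^ 2 - (gen K ^ (p - 1)) ^ 2))
  | K_H : URel p q (gen K * gen H) (gen H * gen K)
  | Ep_H : URel p q (gen Ep * gen H - gen H * gen Ep) ((Complex.I / p) • gen Ep)
  | Em_H : URel p q (gen Em * gen H - gen H * gen Em) (-(Complex.I / p) • gen Em)
  | Ep_pow : URel p q (gen Ep ^ p) (gen Pp)
  | Em_pow : URel p q (gen Em ^ p) (gen Pm)
  | K_pow : URel p q (gen K ^ p) 1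

/-- The fractional supersymmetry algebra `U_FS`. -/
abbrev UFS (p : ℕ) (q : ℂ) : Type := RingQuot (URel p q)

/-- The element of `U_FS` represented by a noncommutative polynomial in the generators. -/
def toU (p : ℕ) (q : ℂ) : FreeU →ₐ[ℂ] UFS p q := RingQuot.mkAlgHom ℂ (URel p q)

/-- The square root `q ^ ((p + 1) / 2)` of `q` (for odd `p`). -/
def sqrtq (p : ℕ) (q : ℂ) : ℂ := q ^ ((p + 1) / 2)

/-- The Casimir element `C₁ = E₋ E₊ + (q^(1/2) K - q^(-1/2) K⁻¹)² / (q - q⁻¹)²`. -/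
def casimir1 (p : ℕ) (q : ℂ) : UFS p q :=
  toU p q (gen .Em * gen .Ep
    + ((q - q⁻¹) ^ 2)⁻¹ • (sqrtq p q • gen .K - (sqrtq p q)⁻¹ • gen .K ^ (p - 1)) ^ 2)

/-- The Casimir element `C₂ = P₊ P₋`. -/
def casimir2 (p : ℕ) (q : ℂ) : UFS p q := toU p q (gen .Pp * gen .Pm)

section RightRep

variable {p : ℕ} [NeZero p] {q : ℂ} (hq : IsPrimitiveRoot q p)

/-- The pairing of `E₊` with `η₊`, namely `i^p q^((p+1)/2)`: the root `i q^(1/2)` of `-q` whose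
`p`-th power is `i`. -/
def pairE (p : ℕ) (q : ℂ) : ℂ := Complex.I ^ p * sqrtq p q

/-- The linear form `∑ k, q^k · (coordinate of η₊^a η₋^b δ^k)`. -/
def deltaSum (a b : ZMod p) : EtaDelta hq →ₗ[ℂ] ℂ :=
  ∑ k : ZMod p, chi hq k • TwAlg.coeff (a, b, k)

/-- The counit on the algebra generated by `η₊, η₋, δ`: `η± ↦ 0`, `δ ↦ 1`. -/
def counit : EtaDelta hq →ₗ[ℂ] ℂ := ∑ k : ZMod p, TwAlg.coeff (0, 0, k)

/-- The duality pairing of the generators of `U_FS` with `𝒜_FS`. It is given by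
`⟨K, f(z₊, z₋, l) δ^k⟩ = q^k f(0)`, `⟨E₊, f η₊ δ^k⟩ = pairE q^k f(0)`,
`⟨E₋, f η₋ δ^k⟩ = pairE⁻¹ q^k f(0)`, `⟨P₊, f δ^k⟩ = i (∂f/∂z₊)(0)`,
`⟨P₋, f δ^k⟩ = -i (∂f/∂z₋)(0)`, `⟨H, f δ^k⟩ = -i (∂f/∂l)(0)`, and vanishes on the other monomials
`f η₊^a η₋^b δ^k`. -/
def pairing (x : Gen) (a : ℝ × ℝ × ℝ → EtaDelta hq) : ℂ :=
  match x with
  | .K => deltaSum hq 0 0 (a 0)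
  | .Ep => pairE p q * deltaSum hq 1 0 (a 0)
  | .Em => (pairE p q)⁻¹ * deltaSum hq 0 1 (a 0)
  | .Pp => Complex.I * deriv (fun t : ℝ => counit hq (a (t, 0, 0))) 0
  | .Pm => -Complex.I * deriv (fun t : ℝ => counit hq (a (0, t, 0))) 0
  | .H => -Complex.I * deriv (fun t : ℝ => counit hq (a (0, 0, t))) 0

/-- The derivation `η₊^a η₋^b ↦ ((a - b) / p) η₊^a η₋^b`. -/
def gradeEta : Eta hq →ₗ[ℂ] Eta hq :=
  (TwAlg.basis (etaCocycle hq)).constr ℂ fun m =>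
    (((m.1.val : ℂ) - (m.2.val : ℂ)) / p) • TwAlg.e _ m

/-- `(φ ⊗ id) Δ` for the linear form on `𝒜_FS` that evaluates at `g = 0` and then applies `φ`. -/
def sliceZero (φ : EtaDelta hq →ₗ[ℂ] ℂ) : Superspace hq →ₗ[ℂ] Superspace hq :=
  (TensorProduct.lid ℂ (Superspace hq)).toLinearMap ∘ₗ
    LinearMap.rTensor (Superspace hq) φ ∘ₗ coact hq 0

/-- The operators `R(x) = (x ⊗ id) Δ` for the generators `x` of `U_FS`, where `x` is read as a
linear form on `𝒜_FS` by `pairing`. For `P±, H`, where the linear form involves a derivative at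
`g = 0`, the derivative is written out; `coord_rightGen` below proves the formula
`R(x) = (x ⊗ id) Δ` in all cases. -/
def rightGen : Gen → Superspace hq →ₗ[ℂ] Superspace hq
  | .K => sliceZero hq (deltaSum hq 0 0)
  | .Ep => sliceZero hq (pairE p q • deltaSum hq 1 0)
  | .Em => sliceZero hq ((pairE p q)⁻¹ • deltaSum hq 0 1)
  | .Pp => Complex.I • LinearMap.rTensor (Eta hq) dzp
  | .Pm => -Complex.I • LinearMap.rTensor (Eta hq) dzm
  | .H => -Complex.I • (LinearMap.rTensor (Eta hq) euler + LinearMap.lTensor Test (gradeEta hq))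

/-- The right representation `R(φ) = (φ ⊗ id) Δ` for `φ` given by a noncommutative polynomial in
the generators of `U_FS`. Products of generators pair with `𝒜_FS` through the coproduct, so that
`R(φ φ') = R(φ') R(φ)`. -/
def rightRep (φ : FreeU) : Superspace hq →ₗ[ℂ] Superspace hq :=
  (FreeAlgebra.lift ℂ
    (fun x => MulOpposite.op (rightGen hq x : Module.End ℂ (Superspace hq))) φ).unop

/-- The value at the point `w` of the coefficient of `η₊^a η₋^b`, `m = (a, b)`. -/
def coord (w : ℝ × ℝ) (m : ZMod p × ZMod p) : Superspace hq →ₗ[ℂ] ℂ :=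
  TensorProduct.lift
    (LinearMap.mk₂ ℂ (fun (f : Test) (a : Eta hq) => f.1 w * TwAlg.coeff m a)
      (fun f f' a => add_mul (f.1 w) (f'.1 w) (TwAlg.coeff m a))
      (fun r f a => mul_assoc r (f.1 w) (TwAlg.coeff m a))
      (fun f a a' => by rw [map_add, mul_add])
      (fun r f a => by rw [map_smul, smul_eq_mul, smul_eq_mul]; ring))

/-- `id ⊗ φ` for a linear form `φ`, on elements of `𝒜_FS ⊗ 𝒜`, `𝒜 = Superspace hq`, evaluated at a point `g`. -/
def idTensor (φ : Superspace hq →ₗ[ℂ] ℂ) : EtaDelta hq ⊗[ℂ] Superspace hq →ₗ[ℂ] EtaDelta hq :=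
  (TensorProduct.rid ℂ (EtaDelta hq)).toLinearMap ∘ₗ LinearMap.lTensor (EtaDelta hq) φ

theorem counit_e (m : ZMod p × ZMod p × ZMod p) :
    counit hq (TwAlg.e _ m) = if m.1 = 0 ∧ m.2.1 = 0 then 1 else 0 := by
  obtain ⟨a, b, k⟩ := m
  simp only [counit, LinearMap.sum_apply, TwAlg.coeff_e, Prod.mk.injEq]
  by_cases h : a = 0 ∧ b = 0
  · obtain ⟨rfl, rfl⟩ := h
    simp
  · rw [if_neg h]
    refine Finset.sum_eq_zero fun j _ => if_neg ?_
    rintro ⟨h1, h2, -⟩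
    exact h ⟨h1.symm, h2.symm⟩

theorem trunc_ne_zero {a b : ZMod p} (h : trunc a b ≠ 0) (hab : a + b = 0) : a = 0 ∧ b = 0 := by
  have h1 : a.val + b.val < p := by
    by_contra h1
    exact h (by simp [trunc, h1])
  have h2 := ZMod.val_add_of_lt h1
  rw [hab, ZMod.val_zero] at h2
  constructor
  · exact (ZMod.val_eq_zero a).mp (by omega)
  · exact (ZMod.val_eq_zero b).mp (by omega)

theorem counit_mul (x y : EtaDelta hq) : counit hq (x * y) = counit hq x * counit hq y := by
  have key : (LinearMap.mul ℂ (EtaDelta hq)).compr₂ (counit hq) =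
      (LinearMap.mul ℂ ℂ).compl₁₂ (counit hq) (counit hq) := by
    refine LinearMap.ext_basis (TwAlg.basis _) (TwAlg.basis _) fun m n => ?_
    simp only [TwAlg.basis_apply, LinearMap.compr₂_apply, LinearMap.mul_apply',
      LinearMap.compl₁₂_apply, TwAlg.e_mul_e, map_smul, counit_e, smul_eq_mul,
      etaDeltaCocycle_c, Prod.fst_add, Prod.snd_add]
    by_cases hm : m.1 = 0 ∧ m.2.1 = 0
    · by_cases hn : n.1 = 0 ∧ n.2.1 = 0
      · simp [hm, hn, trunc_zero_left]
      · simp [hm, hn]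
    · rw [if_neg hm, zero_mul]
      by_cases h : m.1 + n.1 = 0 ∧ m.2.1 + n.2.1 = 0
      · by_cases h1 : trunc m.1 n.1 = 0
        · simp [h1]
        by_cases h2 : trunc m.2.1 n.2.1 = 0
        · simp [h2]
        exact absurd ⟨(trunc_ne_zero h1 h.1).1, (trunc_ne_zero h2 h.2).1⟩ hm
      · rw [if_neg h, mul_zero]
  exact LinearMap.congr_fun (LinearMap.congr_fun key x) y

/-- The counit as an algebra homomorphism. -/
def counitHom : EtaDelta hq →ₐ[ℂ] ℂ :=
  AlgHom.ofLinearMap (counit hq) (by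
    change counit hq (TwAlg.e _ 0) = 1
    simp [counit_e]) (counit_mul hq)

/-- `counit ⊗ id`. -/
def counitTensor : EtaDelta hq ⊗[ℂ] Eta hq →ₐ[ℂ] Eta hq :=
  (Algebra.TensorProduct.lid ℂ (Eta hq)).toAlgHom.comp
    (Algebra.TensorProduct.map (counitHom hq) (AlgHom.id ℂ (Eta hq)))

theorem counitTensor_tmul (x : EtaDelta hq) (y : Eta hq) :
    counitTensor hq (x ⊗ₜ y) = counit hq x • y := by
  simp [counitTensor]
  rfl

theorem counit_etap (hp : 1 < p) : counit hq (etap hq) = 0 := by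
  haveI : Fact (1 < p) := ⟨hp⟩
  simp [etap, counit_e]

theorem counit_etam (hp : 1 < p) : counit hq (etam hq) = 0 := by
  haveI : Fact (1 < p) := ⟨hp⟩
  simp [etam, counit_e]

theorem counit_pow (x : EtaDelta hq) (n : ℕ) : counit hq (x ^ n) = counit hq x ^ n :=
  map_pow (counitHom hq) x n

theorem counitTensor_coEtap (hp : 1 < p) (l : ℝ) :
    counitTensor hq (coEtap hq l) = Complex.exp (l / p) • yp hq := by
  simp [coEtap, counitTensor_tmul, counit_mul, counit_pow, counit_etap hq hp, del, counit_e]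

theorem counitTensor_coEtam (hp : 1 < p) (l : ℝ) :
    counitTensor hq (coEtam hq l) = Complex.exp (-l / p) • ym hq := by
  simp only [coEtam, map_add, map_sum, map_smul, counitTensor_tmul, counit_mul, counit_pow,
    counit_etap hq hp, counit_etam hq hp]
  rw [Finset.sum_eq_zero]
  · simp [delInv, counit_e]
  · intro k hk
    have : k ≠ 0 := by
      have := (Finset.mem_Icc.mp hk).1
      omega
    simp [this]

theorem counitTensor_nilp (hp : 1 < p) (l : ℝ) : counitTensor hq (nilp hq l) = 0 := by
  simp only [nilp, map_sum, map_smul, counitTensor_tmul, counit_mul, counit_pow,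
    counit_etap hq hp]
  refine Finset.sum_eq_zero fun k hk => ?_
  have : p - k ≠ 0 := by
    have := Finset.mem_Icc.mp hk
    omega
  simp [this]

theorem counitTensor_nilm (hp : 1 < p) (l : ℝ) : counitTensor hq (nilm hq l) = 0 := by
  simp only [nilm, map_sum, map_smul, counitTensor_tmul, counit_mul, counit_pow,
    counit_etam hq hp]
  refine Finset.sum_eq_zero fun k hk => ?_
  have : p - k ≠ 0 := by
    have := Finset.mem_Icc.mp hk
    omega
  simp [this]

theorem coord_tmul (w : ℝ × ℝ) (m : ZMod p × ZMod p) (f : Test) (a : Eta hq) :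
    coord hq w m (f ⊗ₜ a) = f.1 w * TwAlg.coeff m a := rfl

theorem counit_idTensor_leftComm (w : ℝ × ℝ) (m : ZMod p × ZMod p) (f : Test)
    (Y : EtaDelta hq ⊗[ℂ] Eta hq) :
    counit hq (idTensor hq (coord hq w m)
      (TensorProduct.leftComm ℂ Test (EtaDelta hq) (Eta hq) (f ⊗ₜ Y))) =
      f.1 w * TwAlg.coeff m (counitTensor hq Y) := by
  have h : counit hq ∘ₗ idTensor hq (coord hq w m) ∘ₗ
      (TensorProduct.leftComm ℂ Test (EtaDelta hq) (Eta hq)).toLinearMap ∘ₗ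
        TensorProduct.mk ℂ Test (EtaDelta hq ⊗[ℂ] Eta hq) f =
      (f.1 w • TwAlg.coeff m) ∘ₗ (counitTensor hq).toLinearMap := by
    refine TensorProduct.ext' fun x y => ?_
    simp only [TensorProduct.leftComm_tmul, idTensor, LinearMap.comp_apply,
      LinearMap.lTensor_tmul, LinearEquiv.coe_coe, TensorProduct.rid_tmul, map_smul,
      coord_tmul, counitTensor_tmul, smul_eq_mul, TensorProduct.mk_apply, LinearMap.smul_apply,
      AlgHom.toLinearMap_apply]
    ring
  exact LinearMap.congr_fun h Y

theorem counit_coact (hp : 1 < p) (w : ℝ × ℝ) (m n : ZMod p × ZMod p) (f : Test)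
    (g : ℝ × ℝ × ℝ) :
    counit hq (idTensor hq (coord hq w m) (coact hq g (f ⊗ₜ TwAlg.e _ n))) =
      f.1 (boost g w) * (Complex.exp (g.2.2 * (((n.1.val : ℂ) - (n.2.val : ℂ)) / p)) *
        TwAlg.coeff m (TwAlg.e (etaCocycle hq) n)) := by
  have hco : counitTensor hq (coEta hq g.2.2 (TwAlg.e _ n)) =
      Complex.exp (g.2.2 * (((n.1.val : ℂ) - (n.2.val : ℂ)) / p)) • TwAlg.e _ n := by
    rw [coEta, ← TwAlg.basis_apply, Module.Basis.constr_basis, TwAlg.basis_apply, map_mul, map_pow,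
      map_pow, counitTensor_coEtap hq hp, counitTensor_coEtam hq hp, smul_pow, smul_pow,
      smul_mul_smul_comm, ← e_eq_pow, ← Complex.exp_nat_mul, ← Complex.exp_nat_mul,
      ← Complex.exp_add]
    congr 2
    ring
  simp only [coact, LinearMap.sum_apply, map_sum, LinearMap.smul_apply, map_smul,
    LinearMap.comp_apply, TensorProduct.map_tmul, LinearEquiv.coe_coe,
    counit_idTensor_leftComm, LinearMap.mulLeft_apply, map_mul, map_pow,
    counitTensor_nilp hq hp, counitTensor_nilm hq hp, hco]
  rw [Finset.sum_eq_single 0, Finset.sum_eq_single 0]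
  · simp
    left
    rfl
  · intro j _ hj
    simp [hj]
  · intro h
    exact absurd (Finset.mem_range.mpr (by omega)) h
  · intro i _ hi
    simp [hi]
  · intro h
    exact absurd (Finset.mem_range.mpr (by omega)) h

theorem hasDerivAt_translate (f : Test) (w v : ℝ × ℝ) :
    HasDerivAt (fun t : ℝ => f.1 (w + t • v)) ((dTest v f).1 w) 0 := by
  have hf : HasFDerivAt f.1 (fderiv ℝ f.1 w) (w + (0 : ℝ) • v) := by
    simpa using (f.2.1.differentiable (by simp) w).hasFDerivAt
  have hc : HasDerivAt (fun t : ℝ => w + t • v) v 0 := by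
    simpa using ((hasDerivAt_id (0 : ℝ)).smul_const v).const_add w
  exact hf.comp_hasDerivAt (0 : ℝ) hc

theorem hasDerivAt_boost (f : Test) (w : ℝ × ℝ) :
    HasDerivAt (fun t : ℝ => f.1 (boost (0, 0, t) w)) ((euler f).1 w) 0 := by
  have hc : HasDerivAt (fun t : ℝ => boost (0, 0, t) w) (w.1, -w.2) 0 := by
    have h1 : HasDerivAt (fun t : ℝ => (0 : ℝ) + Real.exp t * w.1) w.1 0 := by
      simpa using ((Real.hasDerivAt_exp 0).mul_const w.1)
    have h2 : HasDerivAt (fun t : ℝ => (0 : ℝ) + Real.exp (-t) * w.2) (-w.2) 0 := by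
      have := ((hasDerivAt_neg (0 : ℝ)).exp).mul_const w.2
      simpa using this
    exact h1.prodMk h2
  have h0 : boost (0, 0, 0) w = w := by
    simp [boost]
  have hf : HasFDerivAt f.1 (fderiv ℝ f.1 w) (boost (0, 0, 0) w) := by
    rw [h0]
    exact (f.2.1.differentiable (by simp) w).hasFDerivAt
  have h := hf.comp_hasDerivAt (0 : ℝ) hc
  have hv : (w.1, -w.2) = w.1 • ((1, 0) : ℝ × ℝ) - w.2 • ((0, 1) : ℝ × ℝ) := by
    ext <;> simp
  have he : fderiv ℝ f.1 w (w.1, -w.2) = (euler f).1 w := by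
    rw [hv, map_sub, map_smul, map_smul, Complex.real_smul, Complex.real_smul]
    rfl
  rw [he] at h
  exact h

/-- Extends a derivative formula from the elements `f ⊗ e n` by linearity. -/
theorem hasDerivAt_counit (γ : ℝ → ℝ × ℝ × ℝ) (D : Superspace hq →ₗ[ℂ] Superspace hq)
    (w : ℝ × ℝ) (m : ZMod p × ZMod p)
    (h : ∀ f n, HasDerivAt (fun t : ℝ => counit hq (idTensor hq (coord hq w m)
      (coact hq (γ t) (f ⊗ₜ TwAlg.e _ n)))) (coord hq w m (D (f ⊗ₜ TwAlg.e _ n))) 0)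
    (X : Superspace hq) :
    HasDerivAt (fun t : ℝ => counit hq (idTensor hq (coord hq w m) (coact hq (γ t) X)))
      (coord hq w m (D X)) 0 := by
  induction X using TensorProduct.induction_on with
  | zero => simpa using hasDerivAt_const (0 : ℝ) (0 : ℂ)
  | tmul f a =>
    rw [← (TwAlg.basis (etaCocycle hq)).sum_repr a]
    simp only [TensorProduct.tmul_sum, TensorProduct.tmul_smul, map_sum, map_smul,
      TwAlg.basis_apply]
    exact HasDerivAt.fun_sum fun n _ => (h f n).fun_const_smul _
  | add x y hx hy =>
    simp only [map_add]
    exact hx.add hy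

theorem coord_sliceZero (φ : EtaDelta hq →ₗ[ℂ] ℂ) (w : ℝ × ℝ) (m : ZMod p × ZMod p)
    (X : Superspace hq) :
    coord hq w m (sliceZero hq φ X) = φ (idTensor hq (coord hq w m) (coact hq 0 X)) := by
  simp only [sliceZero, LinearMap.comp_apply, idTensor]
  generalize coact hq 0 X = Y
  induction Y using TensorProduct.induction_on with
  | zero => simp
  | tmul x y => simp [mul_comm]
  | add x y hx hy => simp only [map_add, hx, hy]

/-- `R(x) X = (x ⊗ id) Δ(X)` for every generator `x` of `U_FS`: the two sides have the same
coefficients at every point. -/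
theorem coord_rightGen (hp : 1 < p) (x : Gen) (X : Superspace hq) (w : ℝ × ℝ)
    (m : ZMod p × ZMod p) :
    coord hq w m (rightGen hq x X) =
      pairing hq x (fun g => idTensor hq (coord hq w m) (coact hq g X)) := by
  cases x with
  | K => exact coord_sliceZero hq _ w m X
  | Ep => exact coord_sliceZero hq _ w m X
  | Em => exact coord_sliceZero hq _ w m X
  | Pp =>
    have h := hasDerivAt_counit hq (fun t => (t, 0, 0)) (LinearMap.rTensor (Eta hq) dzp) w m
      (fun f n => by
        simp only [counit_coact hq hp, LinearMap.rTensor_tmul, coord_tmul]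
        have h1 := (hasDerivAt_translate f w (1, 0)).mul_const
          (TwAlg.coeff m (TwAlg.e (etaCocycle hq) n))
        have h2 : ∀ t : ℝ, boost (t, 0, 0) w = w + t • ((1, 0) : ℝ × ℝ) := fun t => by
          ext <;> simp [boost, add_comm]
        simp only [h2, Complex.ofReal_zero, zero_mul, Complex.exp_zero, one_mul]
        exact h1) X
    change coord hq w m (Complex.I • _) = Complex.I * deriv _ 0
    rw [map_smul, h.deriv, smul_eq_mul]
  | Pm =>
    have h := hasDerivAt_counit hq (fun t => (0, t, 0)) (LinearMap.rTensor (Eta hq) dzm) w m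
      (fun f n => by
        simp only [counit_coact hq hp, LinearMap.rTensor_tmul, coord_tmul]
        have h1 := (hasDerivAt_translate f w (0, 1)).mul_const
          (TwAlg.coeff m (TwAlg.e (etaCocycle hq) n))
        have h2 : ∀ t : ℝ, boost (0, t, 0) w = w + t • ((0, 1) : ℝ × ℝ) := fun t => by
          ext <;> simp [boost, add_comm]
        simp only [h2, Complex.ofReal_zero, zero_mul, Complex.exp_zero, one_mul]
        exact h1) X
    change coord hq w m (-Complex.I • _) = -Complex.I * deriv _ 0
    rw [map_smul, h.deriv, smul_eq_mul]
  | H =>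
    have h := hasDerivAt_counit hq (fun t => (0, 0, t))
      (LinearMap.rTensor (Eta hq) euler + LinearMap.lTensor Test (gradeEta hq)) w m
      (fun f n => by
        simp only [counit_coact hq hp, LinearMap.add_apply, LinearMap.rTensor_tmul,
          LinearMap.lTensor_tmul, map_add, coord_tmul]
        set r : ℂ := ((n.1.val : ℂ) - (n.2.val : ℂ)) / p with hr
        have hg : gradeEta hq (TwAlg.e _ n) = r • TwAlg.e _ n := by
          rw [gradeEta, ← TwAlg.basis_apply, Module.Basis.constr_basis, TwAlg.basis_apply]
        have h1 := hasDerivAt_boost f w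
        have h2 : HasDerivAt (fun t : ℝ => Complex.exp (t * r)) r 0 := by
          have h3 : HasDerivAt (fun t : ℝ => (t : ℂ) * r) r 0 := by
            simpa using (Complex.ofRealCLM.hasDerivAt (x := (0 : ℝ))).mul_const r
          simpa using h3.cexp
        have h3 := h1.mul (h2.mul_const (TwAlg.coeff m (TwAlg.e (etaCocycle hq) n)))
        have h0 : boost (0, 0, 0) w = w := by simp [boost]
        rw [hg, map_smul, smul_eq_mul]
        simp only [h0, Complex.ofReal_zero, zero_mul, Complex.exp_zero, one_mul] at h3
        exact h3) X
    change coord hq w m (-Complex.I • _) = -Complex.I * deriv _ 0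
    rw [map_smul, h.deriv, smul_eq_mul]

end RightRep

/-! ## The action -/

section Action

variable {p : ℕ} [NeZero p] {q : ℂ} (hq : IsPrimitiveRoot q p)

/-- The action `S[Φ] = I_E(Φ^* R(𝒞) Φ)`. -/
def action (C : FreeU) (Φ : Superspace hq) : ℂ := integralE hq (star Φ * rightRep hq C Φ)

/-- The transformed action `S[Δ Φ] = (id ⊗ I_E)((Δ Φ)^* (id ⊗ R(𝒞)) Δ Φ) ∈ 𝒜_FS`. -/
def actionCoact (C : FreeU) (Φ : Superspace hq) : ℝ × ℝ × ℝ → EtaDelta hq := fun g =>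
  idTensor hq (integralE hq)
    (star (coact hq g Φ) *
      LinearMap.lTensor (EtaDelta hq) (rightRep hq C) (coact hq g Φ))

end Action

end FracSusy

end

/-!
The action is invariant because it is built from three compatible pieces: the coaction is a
homomorphism of star algebras, `R(C)` commutes with the coaction, and the integral is invariant.
Granting these, `(ΔΦ)^* (id ⊗ R(C)) ΔΦ = Δ(Φ^* R(C) Φ)`, and `id ⊗ I_E` maps the right-hand side to
`I_E(Φ^* R(C) Φ) 1`.

**The coaction is a homomorphism.** The formulas for `Δ` come from the Gauss decomposition of
`SL_q(2)`. Write `P = η₊ ⊗ 1`, `M = η₋ ⊗ 1`, `D = e^(l/p) δ ⊗ 1`, `u = 1 ⊗ η₊`, `v = 1 ⊗ η₋` and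
`x = (1 + u v)⁻¹ u`, which exists since `u v` is nilpotent. With `V = P + D x` and
`ψ = D⁻¹ (1 + q² u v) v` one has `Δη₊ = V + V ψ V` and `Δη₋ = M + B`, where
`B = ψ (1 + V ψ)⁻¹ = (D + P v)⁻¹ v`, so that the relations between `Δη₊` and `Δη₋` reduce to `V` and
`M`, `ψ` being `q`-commuting (`GaussRel.xpElem_eq`, `GaussRel.B_mul_a`, `GaussRel.xp_mul_B`). The
nilpotent parts of `Δz₊` and `Δz₋` are the middle terms `middlePow` of `V^p = (P + D x)^p` and
`(Δη₋)^p = (M + B)^p`, formally divided by `[p]! = 0` (`GaussRel.nmElem_eq` for `Δz₋`). The middle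
terms commute with the sum of which they are the power, which leads to the centrality of `Δz±`; as
their squares vanish, the Taylor expansion of `f(Δz₊, Δz₋)` stops after the terms of first order in
each variable and is multiplicative (`coact_mul`). All these elements are self-adjoint, which gives
the compatibility with the star operation (`coact_star`).

**The coaction is generated by `R`.** Expand `Δ` along the monomials `η₊^a η₋^b δ^k` of the
supergroup. The lowering operators in `η₋`, and in `η₊` modulo `η₋`, are twisted derivations; since
a twisted derivation is determined by its values on generators, a check on `Δη±` and on the
nilpotent parts of `Δz±` shows that lowering a component of `Δ` amounts to composing it with
`R(E₋)` or `R(E₊)` (`slice_coact_Em`, `slice_coact_Ep`). The quantum numbers `[1], …, [p-1]` are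
invertible, so all components are generated from those with `a = b = 0` by right multiplication with
`R(E±)`, and those are Fourier components of the automorphisms `evOp` given by the points `η± = 0`,
`δ = q^j` (`coComp_mem`).

**`R(C)` commutes with the coaction.** On `f(z₊, z₋) y(η₊, η₋)` the operator `R(E±)` is a twisted
derivation of the Grassmann variables plus `∂/∂z±` times a multiple of a top power
`η±^(p-1)`; the `p`-th power of the first part vanishes and the mixed terms add up to a multiple of
`∂/∂z±`, which is the relation `E±^p = P±` (`superOp_pow_p`). Together with the other relations this
makes `R` an anti-representation of `U_FS` (`rightRepHom_rel`), so `R(C)` depends only on the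
element of `U_FS`. The Casimir elements commute with `R(E±)`, and with `evOp` as they have degree
zero. Hence `R(C)` commutes with all components of `Δ` (`coact_rightRep`).

**The integral is invariant.** It is preserved by `evOp` and vanishes on the image of `R(E±)`: the
part of `R(E±)` with a derivative in `z±` integrates to zero, and the Grassmann part does not reach
the top monomial. Hence only the component of `Δ` along `1` contributes to the integral
(`integralE_coComp`, `idTensor_integralE_coact`).
-/

open scoped TensorProduct ContDiff ComplexConjugate

open Finset.HasAntidiagonal (antidiagonal mem_antidiagonal)

noncomputable section

namespace FracSusy

/-! ### Symmetric `q`-numbers at a root of unity -/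

section QNumbers

variable {r : ℂ} {p : ℕ}

theorem qFact_zero (r : ℂ) : qFact r 0 = 1 := by simp [qFact]

theorem qFact_succ (r : ℂ) (n : ℕ) : qFact r (n + 1) = qFact r n * qNum r (n + 1) := by
  rw [qFact, qFact, Finset.prod_Icc_succ_top (by omega)]

theorem qNum_zero (r : ℂ) : qNum r 0 = 0 := by simp [qNum]

theorem qNum_inv (r : ℂ) (n : ℕ) : qNum r⁻¹ n = qNum r n := by
  simp only [qNum, inv_pow, inv_inv]
  rw [← neg_sub (r ^ n), ← neg_sub r, neg_div_neg_eq]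

theorem qFact_inv (r : ℂ) (n : ℕ) : qFact r⁻¹ n = qFact r n := by
  simp only [qFact, qNum_inv]

theorem sub_inv_ne_zero (hr : IsPrimitiveRoot r p) (hp : 3 ≤ p) : r - r⁻¹ ≠ 0 := by
  have h0 := hr.ne_zero (by omega)
  intro h
  have h1 : r ^ 2 = 1 := by
    rw [sub_eq_zero] at h
    rw [pow_two]
    nth_rewrite 2 [h]
    exact mul_inv_cancel₀ h0
  exact hr.pow_ne_one_of_pos_of_lt (by omega) (by omega) h1

theorem qNum_one (hr : IsPrimitiveRoot r p) (hp : 3 ≤ p) : qNum r 1 = 1 := by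
  simp [qNum, div_self (sub_inv_ne_zero hr hp)]

theorem qNum_self (hr : IsPrimitiveRoot r p) : qNum r p = 0 := by
  simp [qNum, hr.pow_eq_one]

/-- The symmetric `q`-numbers `[1], …, [p - 1]` do not vanish, as `r ^ 2` is again primitive. -/
theorem qNum_ne_zero (hr : IsPrimitiveRoot r p) (hodd : Odd p) (hp : 3 ≤ p) {n : ℕ} (h0 : 0 < n)
    (hn : n < p) : qNum r n ≠ 0 := by
  have hr0 := hr.ne_zero (by omega)
  refine div_ne_zero ?_ (sub_inv_ne_zero hr hp)
  intro h
  have h1 : (r ^ 2) ^ n = 1 := by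
    rw [sub_eq_zero] at h
    rw [← pow_mul, mul_comm, pow_mul, pow_two]
    nth_rewrite 2 [h]
    exact mul_inv_cancel₀ (pow_ne_zero _ hr0)
  have h2 : IsPrimitiveRoot (r ^ 2) p :=
    hr.pow_of_coprime 2 (Nat.coprime_two_left.mpr hodd)
  exact h2.pow_ne_one_of_pos_of_lt (by omega) hn h1

theorem qFact_ne_zero (hr : IsPrimitiveRoot r p) (hodd : Odd p) (hp : 3 ≤ p) {n : ℕ}
    (hn : n < p) : qFact r n ≠ 0 := by
  refine Finset.prod_ne_zero_iff.mpr fun j hj => ?_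
  have := Finset.mem_Icc.mp hj
  exact qNum_ne_zero hr hodd hp (by omega) (by omega)

theorem qNum_add (hr : r ≠ 0) (i j : ℕ) :
    qNum r i * r ^ j + qNum r j * (r ^ i)⁻¹ = qNum r (i + j) := by
  simp only [qNum]
  rw [div_mul_eq_mul_div, div_mul_eq_mul_div, ← add_div]
  congr 1
  field_simp
  ring

/-- The coefficient `r ^ (-i j) / ([i]! [j]!)` of the divided `q`-binomial formula. -/
def qDiv (r : ℂ) (i j : ℕ) : ℂ := (qFact r i * qFact r j * r ^ (i * j))⁻¹

theorem qDiv_left (hr : r ≠ 0) {i : ℕ} (hi : qNum r (i + 1) ≠ 0) (j : ℕ) :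
    qDiv r i j = qNum r (i + 1) * r ^ j * qDiv r (i + 1) j := by
  rw [qDiv, qDiv, qFact_succ, mul_inv, mul_inv, mul_inv, mul_inv, mul_inv, add_mul, pow_add,
    one_mul, mul_inv]
  have := pow_ne_zero j hr
  field_simp

theorem qDiv_right (hr : r ≠ 0) (i : ℕ) {j : ℕ} (hj : qNum r (j + 1) ≠ 0) :
    qDiv r i j = qNum r (j + 1) * r ^ i * qDiv r i (j + 1) := by
  rw [qDiv, qDiv, qFact_succ, mul_inv, mul_inv, mul_inv, mul_inv, mul_inv, mul_add, pow_add,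
    mul_one, mul_inv]
  have := pow_ne_zero i hr
  field_simp

/-- The `q`-Pascal rule. -/
theorem qDiv_pascal (hr : r ≠ 0) {i j : ℕ} (hi : qNum r (i + 1) ≠ 0) (hj : qNum r (j + 1) ≠ 0) :
    qDiv r i (j + 1) + qDiv r (i + 1) j * (r ^ (2 * (i + 1)))⁻¹ =
      qNum r (i + 1 + (j + 1)) * qDiv r (i + 1) (j + 1) := by
  rw [qDiv_left hr hi (j + 1), qDiv_right hr (i + 1) hj, ← qNum_add hr (i + 1) (j + 1)]
  have := pow_ne_zero (i + 1) hr
  rw [two_mul, pow_add r (i + 1) (i + 1)]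
  generalize r ^ (i + 1) = z at *
  field_simp

end QNumbers

/-! ### The `q`-binomial formula at a root of unity -/

section QBinomial

variable {r : ℂ} {p : ℕ} {A : Type*} [Ring A] [Algebra ℂ A] {X Y : A}

theorem qcomm_pow_left {c : ℂ} (h : Y * X = c • (X * Y)) (n : ℕ) :
    Y * X ^ n = c ^ n • (X ^ n * Y) := by
  induction n with
  | zero => simp
  | succ n ih =>
    rw [pow_succ, ← mul_assoc, ih, smul_mul_assoc, mul_assoc, h, mul_smul_comm, smul_smul,
      mul_assoc, pow_succ]

theorem qcomm_pow_right {c : ℂ} (h : Y * X = c • (X * Y)) (n : ℕ) :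
    Y ^ n * X = c ^ n • (X * Y ^ n) := by
  induction n with
  | zero => simp
  | succ n ih =>
    rw [pow_succ', mul_assoc, ih, mul_smul_comm, ← mul_assoc, h, smul_mul_assoc, smul_smul,
      mul_assoc, pow_succ]

theorem qcomm_pow_pow {c : ℂ} (h : Y * X = c • (X * Y)) (m n : ℕ) :
    Y ^ m * X ^ n = c ^ (m * n) • (X ^ n * Y ^ m) := by
  rw [qcomm_pow_left (qcomm_pow_right h m) n, pow_mul]

theorem qcomm_mul_pow {c : ℂ} (h : Y * X = c • (X * Y)) (n : ℕ) :
    ∃ d : ℂ, (X * Y) ^ n = d • (X ^ n * Y ^ n) := by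
  induction n with
  | zero => exact ⟨1, by simp⟩
  | succ n ih =>
    obtain ⟨d, hd⟩ := ih
    refine ⟨d * c ^ n, ?_⟩
    rw [pow_succ, hd, smul_mul_assoc, mul_assoc, ← mul_assoc (Y ^ n), qcomm_pow_right h,
      smul_mul_assoc, mul_smul_comm, smul_smul]
    simp only [pow_succ, mul_assoc]

theorem qcomm_swap {c : ℂ} (hc : c ≠ 0) (h : X * Y = c • (Y * X)) :
    Y * X = c⁻¹ • (X * Y) := by
  rw [h, smul_smul, inv_mul_cancel₀ hc, one_smul]

/-- The divided `n`-th power `∑ r ^ (-i j) / ([i]! [j]!) X ^ i Y ^ j`, `i + j = n`, of the sum of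
two `q`-commuting elements. -/
def dividedPow (r : ℂ) (X Y : A) (n : ℕ) : A :=
  ∑ x ∈ antidiagonal n, qDiv r x.1 x.2 • (X ^ x.1 * Y ^ x.2)

/-- The part of the divided `p`-th power of `X + Y` between `X ^ p` and `Y ^ p`. It stands for
`(X + Y) ^ p / [p]!`, which is `0 / 0` at a root of unity of order `p`. -/
def middlePow (r : ℂ) (p : ℕ) (X Y : A) : A :=
  ∑ x ∈ antidiagonal (p - 2),
    qDiv r (x.1 + 1) (x.2 + 1) • (X ^ (x.1 + 1) * Y ^ (x.2 + 1))

theorem add_mul_dividedPow (h : Y * X = (r ^ 2)⁻¹ • (X * Y)) (n : ℕ) :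
    (X + Y) * dividedPow r X Y n =
      ∑ x ∈ antidiagonal n, qDiv r x.1 x.2 • (X ^ (x.1 + 1) * Y ^ x.2) +
      ∑ x ∈ antidiagonal n,
        (qDiv r x.1 x.2 * (r ^ (2 * x.1))⁻¹) • (X ^ x.1 * Y ^ (x.2 + 1)) := by
  rw [dividedPow, Finset.mul_sum, ← Finset.sum_add_distrib]
  refine Finset.sum_congr rfl fun x _ => ?_
  rw [mul_smul_comm, add_mul, smul_add, ← mul_assoc X, ← pow_succ', ← mul_assoc Y,
    qcomm_pow_left h, smul_mul_assoc, smul_smul, mul_assoc, ← pow_succ', inv_pow, ← pow_mul]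

/-- The recursion `(X + Y) W_n = [n + 1] W_(n+1)` of the divided powers `W_n`, by the `q`-Pascal
rule. -/
theorem dividedPow_succ (hr : r ≠ 0) (h : Y * X = (r ^ 2)⁻¹ • (X * Y)) (n : ℕ)
    (hn : ∀ k < n + 1, qNum r (k + 1) ≠ 0) :
    (X + Y) * dividedPow r X Y n = qNum r (n + 1) • dividedPow r X Y (n + 1) := by
  have h0 := hn n (by omega)
  cases n with
  | zero =>
    have h1 : qDiv r 0 0 = 1 := by simp [qDiv, qFact_zero]
    have h2 : qDiv r 0 1 = (qNum r 1)⁻¹ := by simp [qDiv, qFact_zero, qFact_succ]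
    have h3 : qDiv r 1 0 = (qNum r 1)⁻¹ := by simp [qDiv, qFact_zero, qFact_succ]
    simp only [zero_add] at h0
    simp [dividedPow, Finset.Nat.antidiagonal_succ, h1, h2, h3, smul_smul, h0, add_comm]
  | succ n =>
    rw [add_mul_dividedPow h, Finset.Nat.sum_antidiagonal_succ',
      Finset.Nat.sum_antidiagonal_succ, dividedPow, Finset.Nat.sum_antidiagonal_succ,
      Finset.Nat.sum_antidiagonal_succ']
    have key : ∑ x ∈ antidiagonal n, qDiv r x.1 (x.2 + 1) • (X ^ (x.1 + 1) * Y ^ (x.2 + 1)) +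
        ∑ x ∈ antidiagonal n,
          (qDiv r (x.1 + 1) x.2 * (r ^ (2 * (x.1 + 1)))⁻¹) • (X ^ (x.1 + 1) * Y ^ (x.2 + 1)) =
        qNum r (n + 1 + 1) • ∑ x ∈ antidiagonal n,
          qDiv r (x.1 + 1) (x.2 + 1) • (X ^ (x.1 + 1) * Y ^ (x.2 + 1)) := by
      rw [← Finset.sum_add_distrib, Finset.smul_sum]
      refine Finset.sum_congr rfl fun x hx => ?_
      have hx' := mem_antidiagonal.mp hx
      rw [← add_smul, smul_smul, qDiv_pascal hr (hn _ (by omega)) (hn _ (by omega))]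
      congr 3
      omega
    have hX : qDiv r (n + 1) 0 = qNum r (n + 1 + 1) * qDiv r (n + 1 + 1) 0 := by
      simpa using qDiv_left hr h0 0
    have hY : qDiv r 0 (n + 1) = qNum r (n + 1 + 1) * qDiv r 0 (n + 1 + 1) := by
      simpa using qDiv_right hr 0 h0
    simp only [smul_add, smul_smul, ← key, hX, hY, pow_zero, mul_zero, inv_one, mul_one]
    abel

/-- The `q`-binomial formula for exponents below the order of `r`. -/
theorem add_pow_eq_dividedPow (hr : IsPrimitiveRoot r p) (hodd : Odd p) (hp : 3 ≤ p)
    (h : Y * X = (r ^ 2)⁻¹ • (X * Y)) {n : ℕ} (hn : n < p) :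
    (X + Y) ^ n = qFact r n • dividedPow r X Y n := by
  induction n with
  | zero => simp [dividedPow, qDiv, qFact_zero]
  | succ n ih =>
    rw [pow_succ', ih (by omega), mul_smul_comm, dividedPow_succ (hr.ne_zero (by omega)) h n
      (fun k hk => qNum_ne_zero hr hodd hp (by omega) (by omega)), smul_smul, qFact_succ]

/-- At a root of unity of order `p`, the `p`-th power of a sum of `q`-commuting elements is the sum
of the `p`-th powers. -/
theorem add_pow_of_qcomm (hr : IsPrimitiveRoot r p) (hodd : Odd p) (hp : 3 ≤ p)
    (h : Y * X = (r ^ 2)⁻¹ • (X * Y)) : (X + Y) ^ p = X ^ p + Y ^ p := by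
  have hr0 := hr.ne_zero (show p ≠ 0 by omega)
  obtain ⟨n, rfl⟩ : ∃ n, p = n + 2 := ⟨p - 2, by omega⟩
  have hq : ∀ k < n + 1, qNum r (k + 1) ≠ 0 :=
    fun k hk => qNum_ne_zero hr hodd hp (by omega) (by omega)
  rw [pow_succ', add_pow_eq_dividedPow hr hodd hp h (by omega), mul_smul_comm,
    add_mul_dividedPow h, Finset.Nat.sum_antidiagonal_succ', Finset.Nat.sum_antidiagonal_succ]
  have key : ∑ x ∈ antidiagonal n, qDiv r x.1 (x.2 + 1) • (X ^ (x.1 + 1) * Y ^ (x.2 + 1)) +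
      ∑ x ∈ antidiagonal n,
        (qDiv r (x.1 + 1) x.2 * (r ^ (2 * (x.1 + 1)))⁻¹) • (X ^ (x.1 + 1) * Y ^ (x.2 + 1)) =
      0 := by
    rw [← Finset.sum_add_distrib]
    refine Finset.sum_eq_zero fun x hx => ?_
    have hx' := mem_antidiagonal.mp hx
    have hx2 : x.1 + 1 + (x.2 + 1) = n + 2 := by omega
    rw [← add_smul, qDiv_pascal hr0 (hq _ (by omega)) (hq _ (by omega)), hx2, qNum_self hr,
      zero_mul, zero_smul]
  have h1 : qFact r (n + 1) * qDiv r (n + 1) 0 = 1 := by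
    simp [qDiv, qFact_zero, qFact_ne_zero hr hodd hp (show n + 1 < n + 2 by omega)]
  have h2 : qFact r (n + 1) * qDiv r 0 (n + 1) = 1 := by
    simp [qDiv, qFact_zero, qFact_ne_zero hr hodd hp (show n + 1 < n + 2 by omega)]
  rw [add_add_add_comm, smul_add, key, smul_zero, add_zero]
  simp only [smul_add, smul_smul, h1, h2, pow_zero, mul_zero, inv_one, mul_one, one_smul, one_mul]

theorem sum_Icc_eq_antidiagonal {B : Type*} [AddCommMonoid B] (hp : 3 ≤ p) (f : ℕ → ℕ → B) :
    ∑ k ∈ Finset.Icc 1 (p - 1), f (p - k) k =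
      ∑ x ∈ antidiagonal (p - 2), f (x.1 + 1) (x.2 + 1) := by
  refine Finset.sum_bij' (fun k _ => (p - k - 1, k - 1)) (fun x _ => x.2 + 1) ?_ ?_ ?_ ?_ ?_
  · intro k hk
    have := Finset.mem_Icc.mp hk
    rw [mem_antidiagonal]
    dsimp only
    omega
  · intro x hx
    have := mem_antidiagonal.mp hx
    rw [Finset.mem_Icc]
    omega
  · intro k hk
    have := Finset.mem_Icc.mp hk
    dsimp only
    omega
  · intro x hx
    have := mem_antidiagonal.mp hx
    ext <;> dsimp only <;> omega
  · intro k hk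
    have := Finset.mem_Icc.mp hk
    congr 1 <;> omega

/-- The element standing for `(X + Y) ^ p / [p]!` commutes with `X + Y`: its commutators with `X`
and `Y` are sums of the same monomials with opposite coefficients. -/
theorem middlePow_commute_add (hr : IsPrimitiveRoot r p) (hodd : Odd p) (hp : 3 ≤ p)
    (h : Y * X = (r ^ 2)⁻¹ • (X * Y)) (hX : X ^ p = 0) (hY : Y ^ p = 0) :
    Commute (middlePow r p X Y) (X + Y) := by
  have hr0 := hr.ne_zero (show p ≠ 0 by omega)
  obtain ⟨n, rfl⟩ : ∃ n, p = n + 3 := ⟨p - 3, by omega⟩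
  have hq : ∀ k < n + 2, qNum r (k + 1) ≠ 0 :=
    fun k hk => qNum_ne_zero hr hodd hp (by omega) (by omega)
  have h1 : middlePow r (n + 3) X Y * X - X * middlePow r (n + 3) X Y =
      ∑ x ∈ antidiagonal (n + 1), (qDiv r (x.1 + 1) (x.2 + 1) * ((r ^ (2 * (x.2 + 1)))⁻¹ - 1)) •
        (X ^ (x.1 + 2) * Y ^ (x.2 + 1)) := by
    simp only [middlePow, Finset.sum_mul, Finset.mul_sum, ← Finset.sum_sub_distrib]
    refine Finset.sum_congr rfl fun x _ => ?_
    rw [smul_mul_assoc, mul_assoc, qcomm_pow_right h, mul_smul_comm, mul_smul_comm, ← mul_assoc,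
      ← mul_assoc, ← pow_succ, ← pow_succ', smul_smul, ← sub_smul, mul_sub, mul_one, inv_pow,
      ← pow_mul]
  have h2 : middlePow r (n + 3) X Y * Y - Y * middlePow r (n + 3) X Y =
      ∑ x ∈ antidiagonal (n + 1), (qDiv r (x.1 + 1) (x.2 + 1) * (1 - (r ^ (2 * (x.1 + 1)))⁻¹)) •
        (X ^ (x.1 + 1) * Y ^ (x.2 + 2)) := by
    simp only [middlePow, Finset.sum_mul, Finset.mul_sum, ← Finset.sum_sub_distrib]
    refine Finset.sum_congr rfl fun x _ => ?_
    rw [smul_mul_assoc, mul_assoc, ← pow_succ, mul_smul_comm, ← mul_assoc, qcomm_pow_left h,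
      smul_mul_assoc, mul_assoc, ← pow_succ', smul_smul, ← sub_smul, mul_sub, mul_one, inv_pow,
      ← pow_mul]
  -- the extreme monomials contain `X ^ p` or `Y ^ p`
  rw [Finset.Nat.sum_antidiagonal_succ', show n + 1 + 2 = n + 3 from rfl, hX] at h1
  rw [Finset.Nat.sum_antidiagonal_succ, show n + 1 + 2 = n + 3 from rfl, hY] at h2
  rw [Commute, SemiconjBy, ← sub_eq_zero]
  have h3 : middlePow r (n + 3) X Y * (X + Y) - (X + Y) * middlePow r (n + 3) X Y =
      (middlePow r (n + 3) X Y * X - X * middlePow r (n + 3) X Y) +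
        (middlePow r (n + 3) X Y * Y - Y * middlePow r (n + 3) X Y) := by
    rw [mul_add, add_mul]
    abel
  rw [h3, h1, h2, zero_mul, smul_zero, mul_zero, smul_zero, zero_add, zero_add,
    ← Finset.sum_add_distrib]
  refine Finset.sum_eq_zero fun x hx => ?_
  have hx' := mem_antidiagonal.mp hx
  rw [← add_smul]
  have hi := hq (x.1 + 1) (by omega)
  have hj := hq (x.2 + 1) (by omega)
  have e1 : qDiv r (x.1 + 1) (x.2 + 1 + 1) =
      qNum r (x.1 + 1 + 1) * r ^ (x.2 + 1 + 1) * qDiv r (x.1 + 1 + 1) (x.2 + 1 + 1) :=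
    qDiv_left hr0 hi _
  have e2 : qDiv r (x.1 + 1 + 1) (x.2 + 1) =
      qNum r (x.2 + 1 + 1) * r ^ (x.1 + 1 + 1) * qDiv r (x.1 + 1 + 1) (x.2 + 1 + 1) :=
    qDiv_right hr0 _ hj
  rw [e1, e2, qNum, qNum, mul_comm 2, mul_comm 2, pow_mul, pow_mul]
  have hz := pow_ne_zero (x.1 + 1 + 1) hr0
  have hw := pow_ne_zero (x.2 + 1 + 1) hr0
  have hs := sub_inv_ne_zero hr hp
  generalize r ^ (x.1 + 1 + 1) = z at *
  generalize r ^ (x.2 + 1 + 1) = w at *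
  generalize r - r⁻¹ = d at *
  convert zero_smul ℂ _
  field_simp
  ring

theorem middlePow_mul_self (hp : 3 ≤ p) {c : ℂ} (h : Y * X = c • (X * Y))
    (hX : X ^ p = 0) (hY : Y ^ p = 0) : middlePow r p X Y * middlePow r p X Y = 0 := by
  simp only [middlePow, Finset.sum_mul, Finset.mul_sum]
  refine Finset.sum_eq_zero fun x hx => Finset.sum_eq_zero fun y hy => ?_
  have hx' := mem_antidiagonal.mp hx
  have hy' := mem_antidiagonal.mp hy
  rw [smul_mul_assoc, mul_smul_comm, mul_assoc, ← mul_assoc (Y ^ _), qcomm_pow_pow h,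
    smul_mul_assoc, mul_smul_comm, mul_assoc, ← pow_add, ← mul_assoc, ← pow_add]
  -- of the two exponents, whose sum is `2 p`, one is at least `p`
  rcases le_or_gt p (x.2 + 1 + (y.2 + 1)) with h1 | h1
  · rw [pow_eq_zero_of_le (m := p) (by omega) hY, mul_zero, smul_zero, smul_zero, smul_zero]
  · rw [pow_eq_zero_of_le (m := p) (by omega) hX, zero_mul, smul_zero, smul_zero, smul_zero]

/-- An element that commutes with `X` and with `Y` up to the same `p`-th root of unity commutes with
all polynomials in `X, Y` that are homogeneous of degree `p`. -/
theorem middlePow_commute_of_qcomm (hp : 3 ≤ p) {c : ℂ} (hc : c ^ p = 1) {Z : A}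
    (hX : X * Z = c • (Z * X)) (hY : Y * Z = c • (Z * Y)) : Commute (middlePow r p X Y) Z := by
  rw [Commute, SemiconjBy, middlePow, Finset.sum_mul, Finset.mul_sum]
  refine Finset.sum_congr rfl fun x hx => ?_
  have hx' := mem_antidiagonal.mp hx
  have hp' : x.2 + 1 + (x.1 + 1) = p := by omega
  rw [smul_mul_assoc, mul_assoc, qcomm_pow_right hY, mul_smul_comm, ← mul_assoc,
    qcomm_pow_right hX, smul_mul_assoc, smul_smul, smul_smul, mul_assoc, mul_assoc, ← pow_add, hp',
    hc, mul_one,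
    mul_smul_comm]

theorem middlePow_commute {Z : A} (hX : Commute X Z) (hY : Commute Y Z) :
    Commute (middlePow r p X Y) Z :=
  Commute.sum_left _ _ _ fun _ _ => ((hX.pow_left _).mul_left (hY.pow_left _)).smul_left _

theorem star_middlePow [StarRing A] [StarModule ℂ A] (hr : r ≠ 0) (hconj : conj r = r⁻¹)
    (h : Y * X = (r ^ 2)⁻¹ • (X * Y)) (hX : star X = X) (hY : star Y = Y) :
    star (middlePow r p X Y) = middlePow r p X Y := by
  have hn : ∀ n, conj (qNum r n) = qNum r n := fun n => by
    nth_rewrite 2 [← qNum_inv]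
    simp only [qNum, map_div₀, map_sub, map_pow, map_inv₀, hconj, inv_inv]
  have hf : ∀ n, conj (qFact r n) = qFact r n := fun n => by simp [qFact, map_prod, hn]
  rw [middlePow, star_sum]
  refine Finset.sum_congr rfl fun x _ => ?_
  rw [star_smul, star_mul, star_pow, star_pow, hX, hY, qcomm_pow_pow h, smul_smul]
  congr 1
  rw [qDiv, ← starRingEnd_apply, map_inv₀, map_mul, map_mul, hf, hf, map_pow, hconj, inv_pow,
    inv_pow, ← pow_mul, mul_comm 2, mul_comm (x.2 + 1), pow_mul r ((x.1 + 1) * (x.2 + 1))]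
  have := pow_ne_zero ((x.1 + 1) * (x.2 + 1)) hr
  generalize r ^ ((x.1 + 1) * (x.2 + 1)) = z at *
  field_simp

/-- A linear map that acts on monomials as a `q`-derivative in `X` sends the element standing for
`(X + Y) ^ p / [p]!` to `(X + Y) ^ (p - 1) / [p - 1]!`, up to the contribution of `X ^ p`. -/
theorem map_middlePow (hr : IsPrimitiveRoot r p) (hodd : Odd p) (hp : 3 ≤ p)
    {B : Type*} [Ring B] [Algebra ℂ B] {X' Y' : B}
    (h : Y' * X' = (r ^ 2)⁻¹ • (X' * Y')) (d : A →ₗ[ℂ] B) (c : ℂ)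
    (hd : ∀ i j : ℕ, d (X ^ (i + 1) * Y ^ j) = (c * qNum r (i + 1) * r ^ j) • (X' ^ i * Y' ^ j)) :
    d (middlePow r p X Y) + (c * (qFact r (p - 1))⁻¹) • X' ^ (p - 1) =
      (c * (qFact r (p - 1))⁻¹) • (X' + Y') ^ (p - 1) := by
  have hr0 := hr.ne_zero (show p ≠ 0 by omega)
  obtain ⟨n, rfl⟩ : ∃ n, p = n + 2 := ⟨p - 2, by omega⟩
  have hf := qFact_ne_zero hr hodd hp (show n + 1 < n + 2 by omega)
  rw [show n + 2 - 1 = n + 1 from rfl, add_pow_eq_dividedPow hr hodd hp h (by omega), dividedPow,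
    Finset.Nat.sum_antidiagonal_succ', smul_smul, smul_add, smul_smul, middlePow, map_sum]
  have e : ∀ x ∈ antidiagonal n,
      d (qDiv r (x.1 + 1) (x.2 + 1) • (X ^ (x.1 + 1) * Y ^ (x.2 + 1))) =
        c • qDiv r x.1 (x.2 + 1) • (X' ^ x.1 * Y' ^ (x.2 + 1)) := fun x hx => by
    have hx' := mem_antidiagonal.mp hx
    rw [map_smul, hd, smul_smul, smul_smul, qDiv_left (i := x.1) hr0
      (qNum_ne_zero hr hodd hp (by omega) (by omega))]
    congr 1
    ring
  rw [show n + 2 - 2 = n from rfl, Finset.sum_congr rfl e, ← Finset.smul_sum,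
    inv_mul_cancel_right₀ hf, add_comm]
  congr 1
  simp [qDiv, qFact_zero]

end QBinomial

/-! ### The `q`-plane `v u = q² u v` with nilpotent generators -/

section QPlane

variable {A : Type} [Ring A] [Algebra ℂ A] {q : ℂ} {p : ℕ} {u v : A}

theorem isUnit_one_add_of_qcomm {X Y : A} {c : ℂ} (h : Y * X = c • (X * Y)) (hX : X ^ p = 0) :
    IsUnit (1 + X * Y) := by
  refine IsNilpotent.isUnit_one_add ⟨p, ?_⟩
  obtain ⟨d, hd⟩ := qcomm_mul_pow h p
  rw [hd, hX, zero_mul, smul_zero]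

/-- Moving `u` through a `q`-shifted factorial in `u v` shifts its factors by one. -/
theorem mul_qPoch (h : v * u = q ^ 2 • (u * v)) (m : ℕ) :
    u * qPoch (-(q ^ 2 • (u * v))) (q ^ 2) (m + 1) =
      (1 + u * v) * qPoch (-(q ^ 2 • (u * v))) (q ^ 2) m * u := by
  induction m with
  | zero => simp [qPoch, mul_add, add_mul, mul_assoc, h]
  | succ m ih =>
    have h1 : u * (1 - (q ^ 2) ^ (m + 1) • -(q ^ 2 • (u * v))) =
        (1 - (q ^ 2) ^ m • -(q ^ 2 • (u * v))) * u := by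
      simp only [smul_neg, sub_neg_eq_add, mul_add, add_mul, mul_one, one_mul, mul_smul_comm,
        smul_mul_assoc, mul_assoc, h, smul_smul]
      congr 2
      ring
    rw [qPoch, ← mul_assoc, ih, mul_assoc _ u, h1, qPoch]
    simp only [mul_assoc]

theorem qPoch_eq_aeval (x : A) (c r : ℂ) (m : ℕ) : qPoch (-(c • x)) r m =
    Polynomial.aeval x (∏ i ∈ Finset.range m, (1 + Polynomial.C (r ^ i * c) * Polynomial.X)) := by
  induction m with
  | zero => simp [qPoch]
  | succ m ih =>
    rw [qPoch, ih, Finset.prod_range_succ, map_mul]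
    congr 1
    simp [Algebra.smul_def, mul_assoc]

/-- `(-q² x; q²)_p = 1` when `x ^ p = 0`, since `∏ (1 + ζ x) = 1 + x ^ p` over the `p`-th roots of
unity `ζ`, for odd `p`. -/
theorem qPoch_full (hq : IsPrimitiveRoot q p) (hodd : Odd p) {x : A} (hx : x ^ p = 0) :
    qPoch (-(q ^ 2 • x)) (q ^ 2) p = 1 := by
  have hq2 : IsPrimitiveRoot (q ^ 2) p :=
    hq.pow_of_coprime 2 (Nat.coprime_two_left.mpr hodd)
  have hp : 0 < p := hodd.pos
  have key : ∏ i ∈ Finset.range p,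
      (1 + Polynomial.C ((q ^ 2) ^ i * q ^ 2) * Polynomial.X : Polynomial ℂ) =
      1 + Polynomial.X ^ p := by
    have h1 := hq2.map_of_injective (Polynomial.C_injective (R := ℂ))
    have h2 := congrArg (Polynomial.eval 1)
      (X_pow_sub_C_eq_prod h1 hp (α := -(Polynomial.C (q ^ 2) * Polynomial.X)) rfl)
    rw [hodd.neg_pow, mul_pow, ← Polynomial.C_pow, hq2.pow_eq_one] at h2
    simp only [map_one, one_mul, map_neg, sub_neg_eq_add, Polynomial.eval_add, Polynomial.eval_pow,
      Polynomial.eval_X, one_pow, Polynomial.eval_C, Polynomial.eval_prod, mul_neg] at h2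
    rw [h2]
    simp only [map_mul, map_pow, mul_assoc]
  rw [qPoch_eq_aeval, key]
  simp [hx]

/-- The element `x = (1 + u v)⁻¹ u` absorbs the `q`-shifted factorials:
`(-q² u v; q²)_(p-k) u^k = x^k`. -/
theorem qPoch_mul_pow (hq : IsPrimitiveRoot q p) (hodd : Odd p) (h : v * u = q ^ 2 • (u * v))
    (hu : u ^ p = 0) {x : A} (hx : (1 + u * v) * x = u) {k : ℕ} (hk : k ≤ p) :
    qPoch (-(q ^ 2 • (u * v))) (q ^ 2) (p - k) * u ^ k = x ^ k := by
  have hs := isUnit_one_add_of_qcomm h hu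
  induction k with
  | zero =>
    obtain ⟨d, hd⟩ := qcomm_mul_pow h p
    rw [hu, zero_mul, smul_zero] at hd
    simp [qPoch_full hq hodd hd]
  | succ k ih =>
    apply hs.mul_left_cancel
    rw [pow_succ' x, ← mul_assoc (1 + u * v) x, hx, ← ih (by omega),
        show p - k = p - (k + 1) + 1 by omega,
      ← mul_assoc u, mul_qPoch h, pow_succ' u]
    simp only [mul_assoc]

theorem x_pow_eq_zero (h : v * u = q ^ 2 • (u * v))
    (hu : u ^ p = 0) (hq : IsPrimitiveRoot q p) (hodd : Odd p)
    {x : A} (hx : (1 + u * v) * x = u) : x ^ p = 0 := by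
  rw [← qPoch_mul_pow hq hodd h hu hx le_rfl, hu, mul_zero]

/-- The powers of `x = (1 + u v)⁻¹ u` and of `u` agree in the top degree, where `u v` acts as zero.
-/
theorem x_pow_pred (h : v * u = q ^ 2 • (u * v))
    (hu : u ^ p = 0) (hq : IsPrimitiveRoot q p) (hodd : Odd p)
    {x : A} (hx : (1 + u * v) * x = u) : x ^ (p - 1) = u ^ (p - 1) := by
  have hp := hodd.pos
  rw [← qPoch_mul_pow hq hodd h hu hx (Nat.sub_le p 1), show p - (p - 1) = 1 by omega]
  have h1 : u * v * u ^ (p - 1) = 0 := by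
    rw [mul_assoc, qcomm_pow_left h, mul_smul_comm, ← mul_assoc, ← pow_succ',
      Nat.sub_add_cancel hp, hu, zero_mul, smul_zero]
  simp [qPoch, add_mul, h1]

end QPlane

/-! ### Commutation relations behind the coaction -/

/-- The relations between `P = η₊ ⊗ 1`, `M = η₋ ⊗ 1`, `D = e^(l/p) δ ⊗ 1`, `Di = D⁻¹`, `u = 1 ⊗ η₊`,
`v = 1 ⊗ η₋`, and `x = (1 + u v)⁻¹ u`. In terms of the matrix elements `a, b, c, d` of `SL_q(2)`
these stand, up to powers of `q`, for `P = a b`, `M = c / a`, `D = a²` in the first factor and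
`u = a b`, `v = c / a`, `x = b / d` in the second one. -/
structure GaussRel {A : Type} [Ring A] [Algebra ℂ A] (q : ℂ) (p : ℕ) (P M D Di u v x : A) :
    Prop where
  P_D : P * D = q ^ 2 • (D * P)
  M_D : M * D = q ^ 2 • (D * M)
  M_P : M * P = q ^ 2 • (P * M)
  D_Di : D * Di = 1
  Di_D : Di * D = 1
  v_u : v * u = q ^ 2 • (u * v)
  P_pow : P ^ p = 0
  M_pow : M ^ p = 0
  u_pow : u ^ p = 0
  v_pow : v ^ p = 0
  x_eq : (1 + u * v) * x = u
  u_P : Commute u P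
  u_M : Commute u M
  u_D : Commute u D
  u_Di : Commute u Di
  v_P : Commute v P
  v_M : Commute v M
  v_D : Commute v D
  v_Di : Commute v Di
  x_P : Commute x P
  x_M : Commute x M
  x_D : Commute x D

theorem smul_comm_assoc {A : Type} [Ring A] [Algebra ℂ A] {a b : A} {c : ℂ}
    (h : a * b = c • (b * a)) (z : A) : a * (b * z) = c • (b * (a * z)) := by
  rw [← mul_assoc, h, smul_mul_assoc, mul_assoc]

theorem commute_assoc {A : Type} [Ring A] {a b : A} (h : Commute a b) (z : A) :
    a * (b * z) = b * (a * z) := by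
  rw [← mul_assoc, h.eq, mul_assoc]

/-- The element `(1 + q² u v) v`, which stands for `c d` in the second factor. -/
def yElem {A : Type} [Ring A] [Algebra ℂ A] (q : ℂ) (u v : A) : A := v + q ^ 2 • (u * v * v)

namespace GaussRel

variable {A : Type} [Ring A] [Algebra ℂ A] {q : ℂ} {p : ℕ} {P M D Di u v x : A}

theorem isUnit (h : GaussRel q p P M D Di u v x) : IsUnit (1 + u * v) :=
  isUnit_one_add_of_qcomm h.v_u h.u_pow

theorem v_mul (h : GaussRel q p P M D Di u v x) : v * (1 + u * v) = yElem q u v := by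
  rw [mul_add, mul_one, ← mul_assoc, h.v_u, yElem, smul_mul_assoc]

theorem y_x (h : GaussRel q p P M D Di u v x) : yElem q u v * x = q ^ 2 • (u * v) := by
  rw [← h.v_mul, mul_assoc, h.x_eq, h.v_u]

theorem x_y (h : GaussRel q p P M D Di u v x) : x * yElem q u v = u * v := by
  apply h.isUnit.mul_left_cancel
  rw [← mul_assoc, h.x_eq, ← h.v_mul]
  simp only [mul_add, add_mul, mul_one, one_mul, mul_assoc]

theorem M_Di (h : GaussRel q p P M D Di u v x) (hq0 : q ≠ 0) : M * Di = (q ^ 2)⁻¹ • (Di * M) := by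
  have h1 : Di * (M * D) * Di = q ^ 2 • (Di * (D * M) * Di) := by
    rw [h.M_D, mul_smul_comm, smul_mul_assoc]
  rw [mul_assoc, mul_assoc M, h.D_Di, mul_one, ← mul_assoc Di D, h.Di_D, one_mul] at h1
  rw [h1, smul_smul, inv_mul_cancel₀ (pow_ne_zero 2 hq0), one_smul]

theorem P_Di (h : GaussRel q p P M D Di u v x) (hq0 : q ≠ 0) : P * Di = (q ^ 2)⁻¹ • (Di * P) := by
  have h1 : Di * (P * D) * Di = q ^ 2 • (Di * (D * P) * Di) := by
    rw [h.P_D, mul_smul_comm, smul_mul_assoc]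
  rw [mul_assoc, mul_assoc P, h.D_Di, mul_one, ← mul_assoc Di D, h.Di_D, one_mul] at h1
  rw [h1, smul_smul, inv_mul_cancel₀ (pow_ne_zero 2 hq0), one_smul]

theorem x_Di (h : GaussRel q p P M D Di u v x) : Commute x Di := by
  have h1 := h.x_D.eq
  calc x * Di = Di * D * x * Di := by rw [h.Di_D, one_mul]
    _ = Di * (x * D) * Di := by rw [h1, mul_assoc Di]
    _ = Di * x := by rw [mul_assoc, mul_assoc, h.D_Di, mul_one]

theorem y_P (h : GaussRel q p P M D Di u v x) : Commute (yElem q u v) P :=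
  h.v_P.add_left (((h.u_P.mul_left h.v_P).mul_left h.v_P).smul_left _)

theorem y_M (h : GaussRel q p P M D Di u v x) : Commute (yElem q u v) M :=
  h.v_M.add_left (((h.u_M.mul_left h.v_M).mul_left h.v_M).smul_left _)

theorem y_D (h : GaussRel q p P M D Di u v x) : Commute (yElem q u v) D :=
  h.v_D.add_left (((h.u_D.mul_left h.v_D).mul_left h.v_D).smul_left _)

theorem y_Di (h : GaussRel q p P M D Di u v x) : Commute (yElem q u v) Di :=
  h.v_Di.add_left (((h.u_Di.mul_left h.v_Di).mul_left h.v_Di).smul_left _)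

end GaussRel

variable {A : Type} [Ring A] [Algebra ℂ A] {q : ℂ} {p : ℕ} {P M D Di u v x : A}

/-- The element `V = P + D x`, the sum of two `q`-commuting elements. -/
def vElem (P D x : A) : A := P + D * x

/-- The element `ψ = D⁻¹ (1 + q² u v) v`, for which `Δ η₊ = V + V ψ V`. -/
def psiElem (q : ℂ) (Di u v : A) : A := Di * yElem q u v

/-- The part of `Δ η₋` without `η₋ ⊗ 1`. -/
def bElem (q : ℂ) (p : ℕ) (P Di v : A) : A :=
  ∑ k ∈ Finset.range (p - 1),
    ((-1) ^ k * (q ^ (k * (k + 1)))⁻¹) • (Di ^ (k + 1) * P ^ k * v ^ (k + 1))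

/-- The right-hand side of the formula for `Δ η₊`. -/
def xpElem (q : ℂ) (P D Di u v : A) : A :=
  P + D * u + (1 + q ^ 2) • (P * (u * v)) +
    (q ^ 2)⁻¹ • (Di * P ^ 2 * ((1 + q ^ 2 • (u * v)) * v))

namespace GaussRel

theorem P_Q (h : GaussRel q p P M D Di u v x) : P * (D * x) = q ^ 2 • (D * x * P) := by
  rw [smul_comm_assoc h.P_D, mul_assoc, h.x_P.eq]

theorem M_Q (h : GaussRel q p P M D Di u v x) : M * (D * x) = q ^ 2 • (D * x * M) := by
  rw [smul_comm_assoc h.M_D, mul_assoc, h.x_M.eq]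

theorem P_psi (h : GaussRel q p P M D Di u v x) (hq0 : q ≠ 0) :
    P * psiElem q Di u v = (q ^ 2)⁻¹ • (psiElem q Di u v * P) := by
  rw [psiElem, smul_comm_assoc (h.P_Di hq0), mul_assoc, h.y_P.eq]

theorem M_psi (h : GaussRel q p P M D Di u v x) (hq0 : q ≠ 0) :
    M * psiElem q Di u v = (q ^ 2)⁻¹ • (psiElem q Di u v * M) := by
  rw [psiElem, smul_comm_assoc (h.M_Di hq0), mul_assoc, h.y_M.eq]

theorem Q_mul_psi (h : GaussRel q p P M D Di u v x) : D * x * psiElem q Di u v = u * v := by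
  rw [psiElem, mul_assoc, commute_assoc h.x_Di, h.x_y, ← mul_assoc, h.D_Di, one_mul]

theorem psi_mul_Q (h : GaussRel q p P M D Di u v x) :
    psiElem q Di u v * (D * x) = q ^ 2 • (u * v) := by
  rw [psiElem, mul_assoc, commute_assoc h.y_D, h.y_x, ← mul_assoc, h.Di_D, one_mul]

theorem Q_psi (h : GaussRel q p P M D Di u v x) (hq0 : q ≠ 0) :
    D * x * psiElem q Di u v = (q ^ 2)⁻¹ • (psiElem q Di u v * (D * x)) := by
  rw [h.Q_mul_psi, h.psi_mul_Q, smul_smul, inv_mul_cancel₀ (pow_ne_zero 2 hq0), one_smul]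

theorem V_psi (h : GaussRel q p P M D Di u v x) (hq0 : q ≠ 0) :
    vElem P D x * psiElem q Di u v = (q ^ 2)⁻¹ • (psiElem q Di u v * vElem P D x) := by
  rw [vElem, add_mul, h.P_psi hq0, h.Q_psi hq0, mul_add, smul_add]

theorem psi_V (h : GaussRel q p P M D Di u v x) (hq0 : q ≠ 0) :
    psiElem q Di u v * vElem P D x = q ^ 2 • (vElem P D x * psiElem q Di u v) := by
  rw [h.V_psi hq0, smul_smul, mul_inv_cancel₀ (pow_ne_zero 2 hq0), one_smul]

theorem M_V (h : GaussRel q p P M D Di u v x) :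
    M * vElem P D x = q ^ 2 • (vElem P D x * M) := by
  rw [vElem, mul_add, h.M_P, h.M_Q, add_mul, smul_add]

theorem Q_pow (h : GaussRel q p P M D Di u v x) (hq : IsPrimitiveRoot q p) (hodd : Odd p) :
    (D * x) ^ p = 0 := by
  rw [(h.x_D.symm).mul_pow, x_pow_eq_zero h.v_u h.u_pow hq hodd h.x_eq, mul_zero]

theorem V_pow (h : GaussRel q p P M D Di u v x) (hq : IsPrimitiveRoot q p) (hodd : Odd p)
    (hp : 3 ≤ p) : vElem P D x ^ p = 0 := by
  have hq0 := hq.ne_zero (show p ≠ 0 by omega)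
  rw [vElem, add_pow_of_qcomm hq hodd hp (qcomm_swap (pow_ne_zero 2 hq0) h.P_Q), h.P_pow,
    h.Q_pow hq hodd, add_zero]

theorem V_mul_psi (h : GaussRel q p P M D Di u v x) (hq0 : q ≠ 0) :
    vElem P D x * psiElem q Di u v =
      u * v + (q ^ 2)⁻¹ • (Di * P * yElem q u v) := by
  rw [vElem, add_mul, h.Q_mul_psi, add_comm, psiElem, ← mul_assoc, h.P_Di hq0, smul_mul_assoc]

/-- The formula for `Δ η₊`, factorized. -/
theorem xpElem_eq (h : GaussRel q p P M D Di u v x) (hq0 : q ≠ 0) :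
    xpElem q P D Di u v =
      (1 + vElem P D x * psiElem q Di u v) * vElem P D x := by
  have hDu : D * u = D * x + u * v * (D * x) := by
    nth_rewrite 1 [← h.x_eq]
    rw [add_mul, one_mul, mul_add]
    congr 1
    rw [← mul_assoc, ← mul_assoc (u * v), (h.u_D.mul_left h.v_D).eq]
  have hy : (1 + q ^ 2 • (u * v)) * v = yElem q u v := by
    rw [yElem, add_mul, one_mul, smul_mul_assoc]
  have hDPQ : Di * P * yElem q u v * (D * x) = (q ^ 2 * q ^ 2) • (P * (u * v)) := by
    calc Di * P * yElem q u v * (D * x) = Di * (P * D) * (yElem q u v * x) := by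
          simp only [mul_assoc, commute_assoc h.y_D]
      _ = _ := by
        rw [h.P_D, h.y_x, mul_smul_comm, mul_smul_comm, smul_mul_assoc, smul_smul, ← mul_assoc Di,
          h.Di_D, one_mul]
  have hDPP : Di * P * yElem q u v * P = Di * P ^ 2 * yElem q u v := by
    rw [mul_assoc, h.y_P.eq, pow_two]
    simp only [mul_assoc]
  have huvP : u * v * P = P * (u * v) := (h.u_P.mul_left h.v_P).eq
  rw [h.V_mul_psi hq0, xpElem, hDu, hy, vElem]
  simp only [add_mul, mul_add, one_mul, smul_mul_assoc, hDPQ, hDPP, huvP, smul_smul]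
  rw [inv_mul_cancel_left₀ (pow_ne_zero 2 hq0)]
  module

theorem xpElem_eq' (h : GaussRel q p P M D Di u v x) (hq0 : q ≠ 0) :
    xpElem q P D Di u v =
      vElem P D x * (1 + psiElem q Di u v * vElem P D x) := by
  rw [h.xpElem_eq hq0, add_mul, mul_add, one_mul, mul_one, mul_assoc]

theorem W_isUnit (h : GaussRel q p P M D Di u v x) (hq : IsPrimitiveRoot q p) (hodd : Odd p)
    (hp : 3 ≤ p) : IsUnit (1 + vElem P D x * psiElem q Di u v) :=
  isUnit_one_add_of_qcomm (h.psi_V (hq.ne_zero (by omega))) (h.V_pow hq hodd hp)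

theorem Di_mul_P_pow (h : GaussRel q p P M D Di u v x) (hq0 : q ≠ 0) (k : ℕ) :
    P * Di ^ k = (q ^ (2 * k))⁻¹ • (Di ^ k * P) := by
  rw [qcomm_pow_left (h.P_Di hq0), inv_pow, pow_mul]

/-- The series `bElem` is `(D + P v)⁻¹ v`. -/
theorem a_mul_B (h : GaussRel q p P M D Di u v x) (hq0 : q ≠ 0) (hp : 3 ≤ p) :
    (D + P * v) * bElem q p P Di v = v := by
  have hvP := h.v_P.eq
  let t : ℕ → A := fun k => ((-1) ^ k * (q ^ (k * (k + 1)))⁻¹) • (Di ^ k * P ^ k * v ^ (k + 1))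
  have h1 : ∀ k, (D + P * v) * (((-1) ^ k * (q ^ (k * (k + 1)))⁻¹) •
      (Di ^ (k + 1) * P ^ k * v ^ (k + 1))) = t k - t (k + 1) := fun k => by
    have e1 : D * (Di ^ (k + 1) * P ^ k * v ^ (k + 1)) = Di ^ k * P ^ k * v ^ (k + 1) := by
      rw [← mul_assoc, ← mul_assoc, pow_succ', ← mul_assoc, h.D_Di, one_mul]
    have e2 : P * v * (Di ^ (k + 1) * P ^ k * v ^ (k + 1)) =
        (q ^ (2 * (k + 1)))⁻¹ • (Di ^ (k + 1) * P ^ (k + 1) * v ^ (k + 1 + 1)) := by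
      rw [mul_assoc P, ← mul_assoc v, ((h.v_Di.pow_right _).mul_right (h.v_P.pow_right _)).eq,
        mul_assoc _ v, ← pow_succ', ← mul_assoc, ← mul_assoc, h.Di_mul_P_pow hq0, smul_mul_assoc,
        smul_mul_assoc, mul_assoc _ P, ← pow_succ']
    rw [mul_smul_comm, add_mul, e1, e2, smul_add, smul_smul]
    simp only [t]
    rw [sub_eq_add_neg, ← neg_smul]
    congr 2
    rw [mul_assoc, ← mul_inv, ← pow_add, pow_succ (-1 : ℂ)]
    rw [show k * (k + 1) + 2 * (k + 1) = (k + 1) * (k + 1 + 1) by ring]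
    ring
  rw [bElem, Finset.mul_sum, Finset.sum_congr rfl fun k _ => h1 k, Finset.sum_range_sub']
  simp only [t]
  rw [show p - 1 + 1 = p by omega, h.v_pow]
  simp

/-- The two units `D + P v` and `1 + V ψ` differ by units whose commutation relations are plain. -/
theorem a_mul_s (h : GaussRel q p P M D Di u v x) (hq0 : q ≠ 0) :
    (D + P * v) * (1 + u * v) = (1 + vElem P D x * psiElem q Di u v) * D := by
  have e1 : P * v * (1 + u * v) = P * yElem q u v := by rw [mul_assoc, h.v_mul]
  have e2 : (q ^ 2)⁻¹ • (Di * P * yElem q u v) * D = P * yElem q u v := by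
    rw [smul_mul_assoc, mul_assoc, h.y_D.eq, ← mul_assoc, mul_assoc Di, h.P_D, mul_smul_comm,
      smul_mul_assoc, smul_smul, inv_mul_cancel₀ (pow_ne_zero 2 hq0), one_smul, ← mul_assoc, h.Di_D,
      one_mul]
  rw [h.V_mul_psi hq0, add_mul D, e1, ← add_assoc, add_mul _ _ D, e2, add_mul, one_mul, mul_add,
    mul_one, (h.u_D.mul_left h.v_D).eq]

theorem a_isUnit (h : GaussRel q p P M D Di u v x) (hq : IsPrimitiveRoot q p) (hodd : Odd p)
    (hp : 3 ≤ p) : IsUnit (D + P * v) := by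
  have hD : IsUnit D := ⟨⟨D, Di, h.D_Di, h.Di_D⟩, rfl⟩
  have h1 := (h.W_isUnit hq hodd hp).mul hD
  rw [← h.a_mul_s (hq.ne_zero (by omega))] at h1
  obtain ⟨s, hs⟩ := h.isUnit
  rw [← hs, Units.isUnit_mul_units] at h1
  exact h1

theorem B_mul_a (h : GaussRel q p P M D Di u v x) (hq : IsPrimitiveRoot q p) (hodd : Odd p)
    (hp : 3 ≤ p) : bElem q p P Di v * (D + P * v) = v := by
  apply (h.a_isUnit hq hodd hp).mul_left_cancel
  rw [← mul_assoc, h.a_mul_B (hq.ne_zero (by omega)) hp]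
  exact (h.v_D.add_right (h.v_P.mul_right (Commute.refl v))).eq

/-- The part `B` of `Δ η₋` is `ψ (1 + V ψ)⁻¹`, so that it inherits its commutation relations from
`V` and `ψ`. -/
theorem B_mul_W (h : GaussRel q p P M D Di u v x) (hq : IsPrimitiveRoot q p) (hodd : Odd p)
    (hp : 3 ≤ p) :
    bElem q p P Di v * (1 + vElem P D x * psiElem q Di u v) = psiElem q Di u v := by
  have h1 : bElem q p P Di v * (1 + vElem P D x * psiElem q Di u v) * D =
      psiElem q Di u v * D := by
    rw [mul_assoc, ← h.a_mul_s (hq.ne_zero (by omega)), ← mul_assoc, h.B_mul_a hq hodd hp, h.v_mul,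
      psiElem, mul_assoc, h.y_D.eq, ← mul_assoc, h.Di_D, one_mul]
  have h2 := congrArg (· * Di) h1
  simpa only [mul_assoc, h.D_Di, mul_one] using h2

theorem xp_mul_B (h : GaussRel q p P M D Di u v x) (hq : IsPrimitiveRoot q p) (hodd : Odd p)
    (hp : 3 ≤ p) :
    xpElem q P D Di u v * bElem q p P Di v = vElem P D x * psiElem q Di u v := by
  apply (h.W_isUnit hq hodd hp).mul_right_cancel
  rw [mul_assoc, h.B_mul_W hq hodd hp, h.xpElem_eq (hq.ne_zero (by omega))]
  simp only [add_mul, mul_add, one_mul, mul_one, mul_assoc]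

theorem B_mul_xp (h : GaussRel q p P M D Di u v x) (hq : IsPrimitiveRoot q p) (hodd : Odd p)
    (hp : 3 ≤ p) :
    bElem q p P Di v * xpElem q P D Di u v =
      q ^ 2 • (xpElem q P D Di u v * bElem q p P Di v) := by
  have hq0 := hq.ne_zero (show p ≠ 0 by omega)
  rw [h.xp_mul_B hq hodd hp, h.xpElem_eq hq0, ← mul_assoc, h.B_mul_W hq hodd hp, h.psi_V hq0]

theorem M_commute_W (h : GaussRel q p P M D Di u v x) (hq0 : q ≠ 0) :
    Commute M (1 + vElem P D x * psiElem q Di u v) := by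
  refine (Commute.one_right M).add_right ?_
  rw [Commute, SemiconjBy, ← mul_assoc, h.M_V, smul_mul_assoc, mul_assoc, h.M_psi hq0,
    mul_smul_comm, smul_smul, mul_inv_cancel₀ (pow_ne_zero 2 hq0), one_smul, mul_assoc]

theorem M_mul_xp (h : GaussRel q p P M D Di u v x) (hq0 : q ≠ 0) :
    M * xpElem q P D Di u v = q ^ 2 • (xpElem q P D Di u v * M) := by
  rw [h.xpElem_eq hq0, ← mul_assoc, (h.M_commute_W hq0).eq, mul_assoc, h.M_V, mul_smul_comm,
    mul_assoc]

theorem M_mul_B (h : GaussRel q p P M D Di u v x) (hq : IsPrimitiveRoot q p) (hodd : Odd p)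
    (hp : 3 ≤ p) : M * bElem q p P Di v = (q ^ 2)⁻¹ • (bElem q p P Di v * M) := by
  have hq0 := hq.ne_zero (show p ≠ 0 by omega)
  apply (h.W_isUnit hq hodd hp).mul_right_cancel
  rw [mul_assoc, h.B_mul_W hq hodd hp, h.M_psi hq0, smul_mul_assoc, mul_assoc,
    (h.M_commute_W hq0).eq, ← mul_assoc, h.B_mul_W hq hodd hp]

theorem B_mul_M (h : GaussRel q p P M D Di u v x) (hq : IsPrimitiveRoot q p) (hodd : Odd p)
    (hp : 3 ≤ p) : bElem q p P Di v * M = (q⁻¹ ^ 2)⁻¹ • (M * bElem q p P Di v) := by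
  have hq0 := hq.ne_zero (show p ≠ 0 by omega)
  rw [h.M_mul_B hq hodd hp, smul_smul, inv_pow, inv_mul_cancel₀ (inv_ne_zero (pow_ne_zero 2 hq0)),
    one_smul]

theorem B_pow (h : GaussRel q p P M D Di u v x) (hq : IsPrimitiveRoot q p) (hodd : Odd p)
    (hp : 3 ≤ p) : bElem q p P Di v ^ p = 0 := by
  have h1 := h.a_mul_B (hq.ne_zero (by omega)) hp
  have hc : Commute (D + P * v) (bElem q p P Di v) := by
    rw [Commute, SemiconjBy, h1, h.B_mul_a hq hodd hp]
  apply ((h.a_isUnit hq hodd hp).pow p).mul_left_cancel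
  rw [← hc.mul_pow, h1, h.v_pow, mul_zero]

/-- The powers of `Δ η₊ = V + V ψ V` are those of `V` up to higher powers of `V`. -/
theorem xp_pow_eq (h : GaussRel q p P M D Di u v x) (hq0 : q ≠ 0) (n : ℕ) :
    ∃ z, xpElem q P D Di u v ^ n = vElem P D x ^ n + vElem P D x ^ (n + 1) * z := by
  induction n with
  | zero => exact ⟨0, by simp⟩
  | succ n ih =>
    obtain ⟨z, hz⟩ := ih
    rw [pow_succ', hz, h.xpElem_eq' hq0]
    set V := vElem P D x
    set ψ := psiElem q Di u v
    have h1 : ψ * V ^ (n + 1) = (q ^ 2) ^ (n + 1) • (V ^ (n + 1) * ψ) :=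
      qcomm_pow_left (h.psi_V hq0) _
    refine ⟨z + (q ^ 2) ^ (n + 1) • (ψ * (1 + V * z)), ?_⟩
    have h2 : ψ * V * (V ^ n + V ^ (n + 1) * z) =
        (q ^ 2) ^ (n + 1) • (V ^ (n + 1) * (ψ * (1 + V * z))) := by
      rw [← mul_assoc _ ψ, ← smul_mul_assoc, ← h1, pow_succ']
      simp only [mul_add, mul_one, mul_assoc, ← pow_succ']
      rw [commute_assoc ((Commute.refl V).pow_right (n + 1)) z]
    rw [mul_assoc, add_mul, h2]
    simp only [mul_add, one_mul, mul_smul_comm, ← mul_assoc, ← pow_succ', add_assoc]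

theorem xp_pow (h : GaussRel q p P M D Di u v x) (hq : IsPrimitiveRoot q p) (hodd : Odd p)
    (hp : 3 ≤ p) : xpElem q P D Di u v ^ p = 0 := by
  obtain ⟨z, hz⟩ := h.xp_pow_eq (hq.ne_zero (by omega)) p
  rw [hz, pow_succ, h.V_pow hq hodd hp, zero_mul, zero_mul, add_zero]

theorem xp_pow_pred (h : GaussRel q p P M D Di u v x) (hq : IsPrimitiveRoot q p) (hodd : Odd p)
    (hp : 3 ≤ p) : xpElem q P D Di u v ^ (p - 1) = vElem P D x ^ (p - 1) := by
  obtain ⟨z, hz⟩ := h.xp_pow_eq (hq.ne_zero (by omega)) (p - 1)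
  rw [hz, Nat.sub_add_cancel (by omega), h.V_pow hq hodd hp, zero_mul, add_zero]

theorem xm_pow (h : GaussRel q p P M D Di u v x) (hq : IsPrimitiveRoot q p) (hodd : Odd p)
    (hp : 3 ≤ p) : (M + bElem q p P Di v) ^ p = 0 := by
  rw [add_pow_of_qcomm hq.inv hodd hp (h.B_mul_M hq hodd hp), h.M_pow, h.B_pow hq hodd hp,
    add_zero]

theorem xm_mul_xp (h : GaussRel q p P M D Di u v x) (hq : IsPrimitiveRoot q p) (hodd : Odd p)
    (hp : 3 ≤ p) : (M + bElem q p P Di v) * xpElem q P D Di u v =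
      q ^ 2 • (xpElem q P D Di u v * (M + bElem q p P Di v)) := by
  rw [add_mul, h.M_mul_xp (hq.ne_zero (by omega)), h.B_mul_xp hq hodd hp, mul_add, smul_add]

/-! The nilpotent parts of `Δ z₊` and `Δ z₋` are central in the image of the coaction. -/

theorem np_commute_M (h : GaussRel q p P M D Di u v x) (hq : IsPrimitiveRoot q p) (hp : 3 ≤ p) :
    Commute (middlePow q p P (D * x)) M := by
  have hq0 := hq.ne_zero (show p ≠ 0 by omega)
  refine middlePow_commute_of_qcomm hp (c := (q ^ 2)⁻¹) ?_
    (qcomm_swap (pow_ne_zero 2 hq0) h.M_P) (qcomm_swap (pow_ne_zero 2 hq0) h.M_Q)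
  rw [inv_pow, ← pow_mul, mul_comm, pow_mul, hq.pow_eq_one, one_pow, inv_one]

theorem np_commute_psi (h : GaussRel q p P M D Di u v x) (hq : IsPrimitiveRoot q p)
    (hp : 3 ≤ p) : Commute (middlePow q p P (D * x)) (psiElem q Di u v) := by
  have hq0 := hq.ne_zero (show p ≠ 0 by omega)
  refine middlePow_commute_of_qcomm hp (c := (q ^ 2)⁻¹) ?_ (h.P_psi hq0) (h.Q_psi hq0)
  rw [inv_pow, ← pow_mul, mul_comm, pow_mul, hq.pow_eq_one, one_pow, inv_one]

theorem np_commute_V (h : GaussRel q p P M D Di u v x) (hq : IsPrimitiveRoot q p)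
    (hodd : Odd p) (hp : 3 ≤ p) : Commute (middlePow q p P (D * x)) (vElem P D x) :=
  middlePow_commute_add hq hodd hp (qcomm_swap (pow_ne_zero 2 (hq.ne_zero (by omega))) h.P_Q)
    h.P_pow (h.Q_pow hq hodd)

theorem np_commute_W (h : GaussRel q p P M D Di u v x) (hq : IsPrimitiveRoot q p)
    (hodd : Odd p) (hp : 3 ≤ p) :
    Commute (middlePow q p P (D * x)) (1 + vElem P D x * psiElem q Di u v) :=
  (Commute.one_right _).add_right ((h.np_commute_V hq hodd hp).mul_right (h.np_commute_psi hq hp))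

theorem np_commute_xp (h : GaussRel q p P M D Di u v x) (hq : IsPrimitiveRoot q p)
    (hodd : Odd p) (hp : 3 ≤ p) : Commute (middlePow q p P (D * x)) (xpElem q P D Di u v) := by
  rw [h.xpElem_eq (hq.ne_zero (by omega))]
  exact (h.np_commute_W hq hodd hp).mul_right (h.np_commute_V hq hodd hp)

theorem np_commute_B (h : GaussRel q p P M D Di u v x) (hq : IsPrimitiveRoot q p)
    (hodd : Odd p) (hp : 3 ≤ p) : Commute (middlePow q p P (D * x)) (bElem q p P Di v) := by
  apply (h.W_isUnit hq hodd hp).mul_right_cancel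
  rw [mul_assoc, h.B_mul_W hq hodd hp, (h.np_commute_psi hq hp).eq, mul_assoc,
    (h.np_commute_W hq hodd hp).eq, ← mul_assoc, h.B_mul_W hq hodd hp]

theorem np_mul_self (h : GaussRel q p P M D Di u v x) (hq : IsPrimitiveRoot q p)
    (hodd : Odd p) (hp : 3 ≤ p) : middlePow q p P (D * x) * middlePow q p P (D * x) = 0 :=
  middlePow_mul_self hp (qcomm_swap (pow_ne_zero 2 (hq.ne_zero (by omega))) h.P_Q) h.P_pow
    (h.Q_pow hq hodd)

theorem nm_mul_self (h : GaussRel q p P M D Di u v x) (hq : IsPrimitiveRoot q p)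
    (hodd : Odd p) (hp : 3 ≤ p) :
    middlePow q⁻¹ p M (bElem q p P Di v) * middlePow q⁻¹ p M (bElem q p P Di v) = 0 :=
  middlePow_mul_self hp (h.B_mul_M hq hodd hp) h.M_pow (h.B_pow hq hodd hp)

theorem nm_commute_xm (h : GaussRel q p P M D Di u v x) (hq : IsPrimitiveRoot q p)
    (hodd : Odd p) (hp : 3 ≤ p) :
    Commute (middlePow q⁻¹ p M (bElem q p P Di v)) (M + bElem q p P Di v) :=
  middlePow_commute_add hq.inv hodd hp (h.B_mul_M hq hodd hp) h.M_pow (h.B_pow hq hodd hp)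

theorem nm_commute_xp (h : GaussRel q p P M D Di u v x) (hq : IsPrimitiveRoot q p)
    (hodd : Odd p) (hp : 3 ≤ p) :
    Commute (middlePow q⁻¹ p M (bElem q p P Di v)) (xpElem q P D Di u v) := by
  refine middlePow_commute_of_qcomm hp (c := q ^ 2) ?_ (h.M_mul_xp (hq.ne_zero (by omega)))
    (h.B_mul_xp hq hodd hp)
  rw [← pow_mul, mul_comm, pow_mul, hq.pow_eq_one, one_pow]

theorem np_commute_nm (h : GaussRel q p P M D Di u v x) (hq : IsPrimitiveRoot q p)
    (hodd : Odd p) (hp : 3 ≤ p) :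
    Commute (middlePow q p P (D * x)) (middlePow q⁻¹ p M (bElem q p P Di v)) :=
  (middlePow_commute (h.np_commute_M hq hp).symm (h.np_commute_B hq hodd hp).symm).symm

theorem np_commute_xm (h : GaussRel q p P M D Di u v x) (hq : IsPrimitiveRoot q p)
    (hodd : Odd p) (hp : 3 ≤ p) :
    Commute (middlePow q p P (D * x)) (M + bElem q p P Di v) :=
  (h.np_commute_M hq hp).add_right (h.np_commute_B hq hodd hp)

end GaussRel

/-! ### The nilpotent part of `Δ z₋` as a divided power -/

section Expansion

variable {A : Type} [Ring A] [Algebra ℂ A] {q : ℂ} {p : ℕ} {P M D Di u v x : A}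

/-- `[n]! [p - 1 - n]! = (-1)^n [p - 1]!`, as `[p - j] = -[j]`. -/
theorem qFact_mul_qFact (hq : IsPrimitiveRoot q p) (n : ℕ) (hn : n + 1 ≤ p) :
    qFact q n * qFact q (p - 1 - n) = (-1) ^ n * qFact q (p - 1) := by
  have hq0 := hq.ne_zero (show p ≠ 0 by omega)
  induction n with
  | zero => simp [qFact_zero]
  | succ n ih =>
    have h1 := ih (by omega)
    have h2 : p - 1 - n = p - 1 - (n + 1) + 1 := by omega
    have h3 : qNum q (p - 1 - (n + 1) + 1) = -qNum q (n + 1) := by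
      have h5 : q ^ (p - 1 - (n + 1) + 1) = (q ^ (n + 1))⁻¹ := by
        refine eq_inv_of_mul_eq_one_left ?_
        rw [← pow_add, ← hq.pow_eq_one]
        congr 1
        omega
      simp only [qNum, h5, inv_inv]
      rw [← neg_div, neg_sub]
    rw [h2, qFact_succ, h3] at h1
    rw [qFact_succ, pow_succ]
    linear_combination -h1

/-- The coefficient of `y ^ i` in `(-y; q⁻²)_n / [n]!`, `i + m = n`. -/
def pochCoeff (q : ℂ) (i m : ℕ) : ℂ := qDiv q i m * q ^ i * (q ^ (i * i))⁻¹

theorem pochCoeff_pascal (hq : q ≠ 0) {i m : ℕ} (hi : qNum q (i + 1) ≠ 0)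
    (hm : qNum q (m + 1) ≠ 0) :
    pochCoeff q (i + 1) m + pochCoeff q i (m + 1) * ((q ^ 2)⁻¹) ^ (i + 1 + m) =
      qNum q (i + 1 + (m + 1)) * pochCoeff q (i + 1) (m + 1) := by
  rw [pochCoeff, pochCoeff, pochCoeff, qDiv_right hq (i + 1) hm, qDiv_left hq hi (m + 1),
    add_comm (i + 1) (m + 1), ← qNum_add hq (m + 1) (i + 1), inv_pow, ← pow_mul,
    show (i + 1) * (i + 1) = i * i + i + (i + 1) by ring,
    show 2 * (i + 1 + m) = (i + 1) + (m + 1) + (i + m) by ring]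
  simp only [pow_add, pow_one]
  have h1 := pow_ne_zero i hq
  have h2 := pow_ne_zero m hq
  have h3 := pow_ne_zero (i * i) hq
  field_simp

/-- The finite `q`-binomial formula for `(-y; q⁻²)_n`. -/
theorem qPoch_expand (hq : IsPrimitiveRoot q p) (hodd : Odd p) (hp : 3 ≤ p) (y : A) {n : ℕ}
    (hn : n < p) : qPoch (-y) (q ^ 2)⁻¹ n =
      qFact q n • ∑ w ∈ antidiagonal n, pochCoeff q w.1 w.2 • y ^ w.1 := by
  have hq0 := hq.ne_zero (show p ≠ 0 by omega)
  have h00 : pochCoeff q 0 0 = 1 := by simp [pochCoeff, qDiv, qFact_zero]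
  induction n with
  | zero => simp [qPoch, qFact_zero, h00]
  | succ n ih =>
    have hqn : ∀ k < n + 1, qNum q (k + 1) ≠ 0 :=
      fun k hk => qNum_ne_zero hq hodd hp (by omega) (by omega)
    have hq1 := hqn n (by omega)
    rw [qPoch, ih (by omega), qFact_succ, mul_smul, smul_mul_assoc]
    congr 1
    have e : (∑ w ∈ antidiagonal n, pochCoeff q w.1 w.2 • y ^ w.1) *
        (1 - (q ^ 2)⁻¹ ^ n • -y) = ∑ w ∈ antidiagonal n, pochCoeff q w.1 w.2 • y ^ w.1 +
          ∑ w ∈ antidiagonal n, (pochCoeff q w.1 w.2 * (q ^ 2)⁻¹ ^ n) • y ^ (w.1 + 1) := by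
      rw [smul_neg, sub_neg_eq_add, mul_add, mul_one, Finset.sum_mul]
      congr 1
      refine Finset.sum_congr rfl fun w _ => ?_
      rw [smul_mul_assoc, mul_smul_comm, ← pow_succ, smul_smul]
    have e0 : ∀ m, pochCoeff q 0 m = qDiv q 0 m := fun m => by simp [pochCoeff]
    have hl : pochCoeff q 0 n = qNum q (n + 1) * pochCoeff q 0 (n + 1) := by
      rw [e0, e0]
      simpa using qDiv_right hq0 0 hq1
    have hr : pochCoeff q n 0 * (q ^ 2)⁻¹ ^ n = qNum q (n + 1) * pochCoeff q (n + 1) 0 := by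
      rw [pochCoeff, pochCoeff, qDiv_left hq0 hq1 0, inv_pow, ← pow_mul,
        show (n + 1) * (n + 1) = n * n + 2 * n + 1 by ring, pow_succ q (n * n + 2 * n), pow_add,
        pow_succ, pow_zero]
      have h1 := pow_ne_zero n hq0
      have h2 := pow_ne_zero (n * n) hq0
      have h3 := pow_ne_zero (2 * n) hq0
      field_simp
      ring
    rw [e]
    cases n with
    | zero =>
      simp only [pow_zero, mul_one, h00, zero_add] at hl hr
      simp [Finset.Nat.antidiagonal_succ, h00, smul_smul, ← hl, ← hr]
    | succ n =>
      rw [Finset.Nat.sum_antidiagonal_succ, Finset.Nat.sum_antidiagonal_succ',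
        Finset.Nat.sum_antidiagonal_succ (n := n + 1), Finset.Nat.sum_antidiagonal_succ']
      have key : ∑ w ∈ antidiagonal n, pochCoeff q (w.1 + 1) w.2 • y ^ (w.1 + 1) +
          ∑ w ∈ antidiagonal n,
            (pochCoeff q w.1 (w.2 + 1) * (q ^ 2)⁻¹ ^ (n + 1)) • y ^ (w.1 + 1) =
          qNum q (n + 1 + 1) • ∑ w ∈ antidiagonal n,
            pochCoeff q (w.1 + 1) (w.2 + 1) • y ^ (w.1 + 1) := by
        rw [← Finset.sum_add_distrib, Finset.smul_sum]
        refine Finset.sum_congr rfl fun w hw => ?_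
        have hw' := mem_antidiagonal.mp hw
        have hw2 : n + 1 = w.1 + 1 + w.2 := by omega
        rw [← add_smul, smul_smul, hw2,
          pochCoeff_pascal hq0 (hqn _ (by omega)) (hqn _ (by omega))]
        rfl
      simp only [smul_add, smul_smul, ← key, ← hl, ← hr]
      abel

namespace GaussRel

/-- The coefficient of `D^(-k-j) P^j v^(k+j)` in `B^k`, for `k = m + 1`. -/
def geomCoeff (q : ℂ) (m j : ℕ) : ℂ :=
  (-1) ^ j * qFact q (m + j) / (qFact q j * qFact q m) * (q ^ (j * (j + m + 1)))⁻¹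

theorem geomCoeff_zero (hm : qFact q m ≠ 0) : geomCoeff q m 0 = 1 := by
  simp [geomCoeff, qFact_zero, hm]

theorem geomCoeff_rec (hq : q ≠ 0) {m j : ℕ} (hm : qFact q (m + 1) ≠ 0) (hj : qFact q (j + 1) ≠ 0) :
    geomCoeff q (m + 1) (j + 1) + geomCoeff q (m + 1) j * (q ^ (2 * (m + 2 + j)))⁻¹ =
      geomCoeff q m (j + 1) := by
  rw [qFact_succ] at hm hj
  have hm1 := left_ne_zero_of_mul hm
  have hm2 := right_ne_zero_of_mul hm
  have hj1 := left_ne_zero_of_mul hj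
  have hj2 := right_ne_zero_of_mul hj
  simp only [geomCoeff]
  rw [show m + 1 + (j + 1) = m + (j + 1) + 1 by ring, show m + 1 + j = m + (j + 1) by ring,
    qFact_succ q (m + (j + 1)), qFact_succ q m, qFact_succ q j,
    show m + (j + 1) + 1 = (m + 1) + (j + 1) by ring, ← qNum_add hq (m + 1) (j + 1),
    show (j + 1) * (j + 1 + (m + 1) + 1) = j * j + j * m + 4 * j + m + 3 by ring,
    show j * (j + (m + 1) + 1) = j * j + j * m + 2 * j by ring,
    show 2 * (m + 2 + j) = 2 * m + 4 + 2 * j by ring,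
    show (j + 1) * (j + 1 + m + 1) = j * j + j * m + 3 * j + m + 2 by ring]
  generalize qNum q (m + 1) = a at *
  generalize qNum q (j + 1) = b at *
  generalize qFact q m = c at *
  generalize qFact q j = d at *
  generalize qFact q (m + (j + 1)) = f at *
  simp only [pow_add, pow_mul', pow_one]
  have h1 := pow_ne_zero j hq
  have h2 := pow_ne_zero m hq
  have h3 : (q ^ j) ^ j ≠ 0 := pow_ne_zero _ h1
  have h4 : (q ^ m) ^ j ≠ 0 := pow_ne_zero _ h2
  field_simp
  ring

/-- The powers of `B = (D + P v)⁻¹ v` as truncated negative `q`-binomial series. Both sides satisfy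
the recursion `(D + P v) X_(k+1) = v X_k`, which determines them as `D + P v` is a unit. -/
theorem B_pow_succ (h : GaussRel q p P M D Di u v x) (hq : IsPrimitiveRoot q p) (hodd : Odd p)
    (hp : 3 ≤ p) {m : ℕ} (hm : m + 1 < p) : bElem q p P Di v ^ (m + 1) =
      ∑ j ∈ Finset.range (p - (m + 1)),
        geomCoeff q m j • (Di ^ (m + 1 + j) * P ^ j * v ^ (m + 1 + j)) := by
  have hq0 := hq.ne_zero (show p ≠ 0 by omega)
  induction m with
  | zero =>
    rw [zero_add, pow_one, bElem]
    refine Finset.sum_congr rfl fun j hj => ?_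
    have hj' := Finset.mem_range.mp hj
    have := qFact_ne_zero hq hodd hp (show j < p by omega)
    rw [add_comm 1 j]
    congr 1
    simp [geomCoeff, qFact_zero, this]
  | succ m ih =>
    apply (h.a_isUnit hq hodd hp).mul_left_cancel
    rw [pow_succ', ← mul_assoc, h.a_mul_B hq0 hp, ih (by omega), Finset.mul_sum, Finset.mul_sum]
    obtain ⟨L, hL⟩ : ∃ L, p = L + (m + 2) := ⟨p - (m + 2), by omega⟩
    have hL1 : p - (m + 1) = L + 1 := by omega
    have hL2 : p - (m + 1 + 1) = L := by omega
    rw [hL1, hL2]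
    let t : ℕ → A := fun j => Di ^ (m + 1 + j) * P ^ j * v ^ (m + 2 + j)
    have ht : t L = 0 := by
      simp only [t]
      rw [show m + 2 + L = p by omega, h.v_pow, mul_zero]
    have e1 : ∀ j, v * (geomCoeff q m j • (Di ^ (m + 1 + j) * P ^ j * v ^ (m + 1 + j))) =
        geomCoeff q m j • t j := fun j => by
      rw [mul_smul_comm, ← mul_assoc,
        ((h.v_Di.pow_right _).mul_right (h.v_P.pow_right _)).eq, mul_assoc, ← pow_succ']
      congr 3
      omega
    have e2 : ∀ j, (D + P * v) * (geomCoeff q (m + 1) j •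
        (Di ^ (m + 1 + 1 + j) * P ^ j * v ^ (m + 1 + 1 + j))) = geomCoeff q (m + 1) j • t j +
          (geomCoeff q (m + 1) j * (q ^ (2 * (m + 2 + j)))⁻¹) • t (j + 1) := fun j => by
      have e3 : D * (Di ^ (m + 1 + 1 + j) * P ^ j * v ^ (m + 1 + 1 + j)) = t j := by
        rw [← mul_assoc, ← mul_assoc, show m + 1 + 1 + j = m + 1 + j + 1 by ring,
          pow_succ' Di, ← mul_assoc, h.D_Di, one_mul]
        simp only [t]
        congr 2
        omega
      have e4 : P * v * (Di ^ (m + 1 + 1 + j) * P ^ j * v ^ (m + 1 + 1 + j)) =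
          (q ^ (2 * (m + 2 + j)))⁻¹ • t (j + 1) := by
        rw [mul_assoc P, ← mul_assoc v, ((h.v_Di.pow_right _).mul_right (h.v_P.pow_right _)).eq,
          mul_assoc _ v, ← pow_succ', ← mul_assoc, ← mul_assoc, h.Di_mul_P_pow hq0, smul_mul_assoc,
          smul_mul_assoc, mul_assoc _ P, ← pow_succ']
        simp only [t]
        congr 3
        congr 1
        omega
      rw [mul_smul_comm, add_mul, e3, e4, smul_add, smul_smul]
    rw [Finset.sum_congr rfl fun j _ => e1 j, Finset.sum_congr rfl fun j _ => e2 j,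
      Finset.sum_range_succ, ht, smul_zero, add_zero, ← sub_eq_zero, ← Finset.sum_sub_distrib]
    -- the difference of the two sides is a telescoping sum
    let s : ℕ → A := fun j => Nat.casesOn j 0 fun i =>
      -((geomCoeff q (m + 1) i * (q ^ (2 * (m + 2 + i)))⁻¹) • t (i + 1))
    have hs : ∀ j ∈ Finset.range L, geomCoeff q m j • t j - (geomCoeff q (m + 1) j • t j +
        (geomCoeff q (m + 1) j * (q ^ (2 * (m + 2 + j)))⁻¹) • t (j + 1)) = s (j + 1) - s j := by
      intro j hj
      have hj' := Finset.mem_range.mp hj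
      cases j with
      | zero =>
        rw [geomCoeff_zero (m := m) (qFact_ne_zero hq hodd hp (by omega)),
          geomCoeff_zero (m := m + 1) (qFact_ne_zero hq hodd hp (by omega))]
        simp [s, geomCoeff_zero (qFact_ne_zero hq hodd hp (show m + 1 < p by omega))]
      | succ j =>
        rw [← geomCoeff_rec hq0 (qFact_ne_zero hq hodd hp (by omega))
          (qFact_ne_zero hq hodd hp (by omega))]
        simp only [s]
        module
    rw [Finset.sum_congr rfl hs, Finset.sum_range_sub]
    cases L with
    | zero => simp
    | succ L => simp [s, ht]

theorem PM_pow (h : GaussRel q p P M D Di u v x) (hq0 : q ≠ 0) (i : ℕ) :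
    (P * M) ^ i = (q ^ (i * i + i))⁻¹ • (M ^ i * P ^ i) := by
  induction i with
  | zero => simp
  | succ i ih =>
    rw [pow_succ, ih, smul_mul_assoc, ← mul_assoc, mul_assoc (M ^ i), ← pow_succ, mul_assoc,
      qcomm_pow_right (qcomm_swap (pow_ne_zero 2 hq0) h.M_P), mul_smul_comm, smul_smul, ← mul_assoc,
      ← pow_succ, inv_pow, ← pow_mul, ← mul_inv, ← pow_add]
    congr 3
    ring

theorem M_pow_mul (h : GaussRel q p P M D Di u v x) (hq0 : q ≠ 0) {n i : ℕ} (hn : n ≤ p)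
    (hi : i ≤ n) : M ^ (p - n) * Di ^ n * (P * M) ^ i =
      (q ^ (2 * (n * i)) * (q ^ (i * i + i))⁻¹) • (M ^ (p - (n - i)) * Di ^ n * P ^ i) := by
  have h1 : Di * M = q ^ 2 • (M * Di) := by
    rw [h.M_Di hq0, smul_smul, mul_inv_cancel₀ (pow_ne_zero 2 hq0), one_smul]
  rw [h.PM_pow hq0, mul_smul_comm, ← mul_assoc, mul_assoc _ (Di ^ n), qcomm_pow_pow h1,
    mul_smul_comm, smul_mul_assoc, smul_smul, ← mul_assoc, ← pow_add,
    show p - n + i = p - (n - i) by omega, ← pow_mul, mul_comm]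

end GaussRel

/-- The right-hand side of the formula for the nilpotent part of `Δ z₋`. -/
def nmElem (q : ℂ) (p : ℕ) (P M Di v : A) : A :=
  ∑ k ∈ Finset.Icc 1 (p - 1), ((q ^ (k ^ 2))⁻¹ / (qFact q k * qFact q (p - k))) •
    (M ^ (p - k) * Di ^ k * qPoch (-(P * M)) (q ^ 2)⁻¹ k * v ^ k)

/-- The coefficients of `M^(p-k) D^(-n) P^i v^n`, where `k = m + 1` and `n = k + i`, in the two
expansions of the nilpotent part of `Δ z₋` agree. -/
theorem nmElem_coeff (hq : IsPrimitiveRoot q p) (hodd : Odd p) (hp : 3 ≤ p) {m i : ℕ}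
    (hm : m + 1 + i < p) :
    ((q ^ ((m + 1 + i) ^ 2))⁻¹ / (qFact q (m + 1 + i) * qFact q (p - (m + 1 + i)))) *
        (qFact q (m + 1 + i) * pochCoeff q i (m + 1)) *
        (q ^ (2 * ((m + 1 + i) * i)) * (q ^ (i * i + i))⁻¹) =
      qDiv q⁻¹ (p - (m + 1)) (m + 1) * GaussRel.geomCoeff q m i := by
  have hq0 := hq.ne_zero (show p ≠ 0 by omega)
  have hp1 : q⁻¹ ^ ((p - (m + 1)) * (m + 1)) = q ^ ((m + 1) * (m + 1)) := by
    rw [inv_pow, inv_eq_iff_eq_inv]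
    refine eq_inv_of_mul_eq_one_left ?_
    rw [← pow_add, ← add_mul, Nat.sub_add_cancel (by omega), pow_mul, hq.pow_eq_one, one_pow]
  have f1 := qFact_mul_qFact hq (m + i) (by omega)
  have f2 := qFact_mul_qFact hq m (by omega)
  rw [show p - 1 - (m + i) = p - (m + 1 + i) by omega] at f1
  rw [show p - 1 - m = p - (m + 1) by omega] at f2
  have n1 := qFact_ne_zero hq hodd hp hm
  have n2 := qFact_ne_zero hq hodd hp (show p - (m + 1 + i) < p by omega)
  have n3 := qFact_ne_zero hq hodd hp (show p - (m + 1) < p by omega)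
  have n4 := qFact_ne_zero hq hodd hp (show m < p by omega)
  have n5 := qFact_ne_zero hq hodd hp (show m + 1 < p by omega)
  have n6 := qFact_ne_zero hq hodd hp (show i < p by omega)
  have f3 : qFact q (m + i) * qFact q (p - (m + 1 + i)) * (-1) ^ i =
      qFact q m * qFact q (p - (m + 1)) := by
    rw [f1, f2, pow_add, mul_right_comm, mul_assoc _ ((-1) ^ i) ((-1) ^ i), ← mul_pow]
    norm_num
  have e : (q ^ ((m + 1 + i) ^ 2))⁻¹ * (q ^ (i * (m + 1)))⁻¹ * q ^ i * (q ^ (i * i))⁻¹ *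
      (q ^ (2 * ((m + 1 + i) * i)) * (q ^ (i * i + i))⁻¹) =
      (q ^ ((m + 1) * (m + 1)))⁻¹ * (q ^ (i * (i + m + 1)))⁻¹ := by
    have e1 : q ^ i * q ^ (2 * ((m + 1 + i) * i)) * (q ^ ((m + 1) * (m + 1)) *
        q ^ (i * (i + m + 1))) = q ^ ((m + 1 + i) ^ 2) * q ^ (i * (m + 1)) * q ^ (i * i) *
          q ^ (i * i + i) := by
      simp only [← pow_add]
      congr 1
      ring
    have := pow_ne_zero ((m + 1) * (m + 1)) hq0
    have := pow_ne_zero (i * (i + m + 1)) hq0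
    have := pow_ne_zero ((m + 1 + i) ^ 2) hq0
    have := pow_ne_zero (i * (m + 1)) hq0
    have := pow_ne_zero (i * i) hq0
    have := pow_ne_zero (i * i + i) hq0
    generalize q ^ ((m + 1) * (m + 1)) = a1 at *
    generalize q ^ (i * (i + m + 1)) = a2 at *
    generalize q ^ ((m + 1 + i) ^ 2) = a3 at *
    generalize q ^ (i * (m + 1)) = a4 at *
    generalize q ^ (i * i + i) = a6 at *
    generalize q ^ (i * i) = a5 at *
    generalize q ^ (2 * ((m + 1 + i) * i)) = a7 at *
    generalize q ^ i = a8 at *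
    field_simp
    linear_combination e1
  rw [pochCoeff, qDiv, qDiv, GaussRel.geomCoeff, qFact_inv, qFact_inv, hp1]
  calc _ = ((q ^ ((m + 1 + i) ^ 2))⁻¹ * (q ^ (i * (m + 1)))⁻¹ * q ^ i * (q ^ (i * i))⁻¹ *
      (q ^ (2 * ((m + 1 + i) * i)) * (q ^ (i * i + i))⁻¹)) *
        (qFact q (p - (m + 1 + i)) * qFact q i * qFact q (m + 1))⁻¹ := by
        rw [div_eq_mul_inv, mul_inv, mul_inv, mul_inv, mul_inv, mul_inv]
        field_simp
    _ = ((q ^ ((m + 1) * (m + 1)))⁻¹ * (q ^ (i * (i + m + 1)))⁻¹) *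
        (qFact q (m + i) * (-1) ^ i *
          (qFact q m * qFact q (p - (m + 1)))⁻¹ * (qFact q i * qFact q (m + 1))⁻¹) := by
        rw [e, ← f3]
        have n7 := left_ne_zero_of_mul (left_ne_zero_of_mul (f3.trans_ne (mul_ne_zero n4 n3)))
        have n8 : ((-1 : ℂ)) ^ i ≠ 0 := pow_ne_zero _ (by norm_num)
        congr 1
        field_simp
    _ = _ := by
        rw [div_eq_mul_inv, mul_inv, mul_inv, mul_inv, mul_inv, mul_inv]
        ring

/-- The nilpotent part of `Δ z₋` stands for `(Δ η₋) ^ p / [p]!`. Both sides are expanded in the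
monomials `M^(p-k) D^(-n) P^(n-k) v^n`, `1 ≤ k ≤ n < p`. -/
theorem GaussRel.nmElem_eq (h : GaussRel q p P M D Di u v x) (hq : IsPrimitiveRoot q p)
    (hodd : Odd p) (hp : 3 ≤ p) :
    nmElem q p P M Di v = middlePow q⁻¹ p M (bElem q p P Di v) := by
  have hq0 := hq.ne_zero (show p ≠ 0 by omega)
  have hI : Finset.Icc 1 (p - 1) = Finset.Ico 1 p := by
    ext
    simp only [Finset.mem_Icc, Finset.mem_Ico]
    omega
  rw [nmElem, middlePow, ← sum_Icc_eq_antidiagonal hp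
    (fun i j => qDiv q⁻¹ i j • (M ^ i * bElem q p P Di v ^ j)), hI]
  let f : ℕ → ℕ → A := fun k n => (qDiv q⁻¹ (p - k) k * geomCoeff q (k - 1) (n - k)) •
    (M ^ (p - k) * Di ^ n * P ^ (n - k) * v ^ n)
  have e1 : ∀ k ∈ Finset.Ico 1 p, qDiv q⁻¹ (p - k) k • (M ^ (p - k) * bElem q p P Di v ^ k) =
      ∑ n ∈ Finset.Ico k p, f k n := fun k hk => by
    have hk' := Finset.mem_Ico.mp hk
    obtain ⟨m, rfl⟩ : ∃ m, k = m + 1 := ⟨k - 1, by omega⟩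
    rw [h.B_pow_succ hq hodd hp hk'.2, Finset.sum_Ico_eq_sum_range, Finset.mul_sum,
      Finset.smul_sum]
    refine Finset.sum_congr rfl fun j _ => ?_
    simp only [f]
    rw [mul_smul_comm, smul_smul, Nat.add_sub_cancel, Nat.add_sub_cancel_left]
    simp only [mul_assoc]
  have e2 : ∀ n ∈ Finset.Ico 1 p, ((q ^ (n ^ 2))⁻¹ / (qFact q n * qFact q (p - n))) •
      (M ^ (p - n) * Di ^ n * qPoch (-(P * M)) (q ^ 2)⁻¹ n * v ^ n) =
      ∑ k ∈ Finset.Ico 1 (n + 1), f k n := fun n hn => by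
    have hn' := Finset.mem_Ico.mp hn
    rw [qPoch_expand hq hodd hp _ hn'.2, ← Finset.Nat.sum_antidiagonal_swap,
      Finset.Nat.sum_antidiagonal_eq_sum_range_succ_mk, Finset.sum_range_succ', mul_smul_comm,
          smul_mul_assoc, smul_smul,
      mul_add, add_mul, smul_add, Finset.sum_Ico_eq_sum_range, Finset.mul_sum, Finset.sum_mul,
      Finset.smul_sum]
    -- the term of highest order in `P M` contains `M ^ p`
    have e3 : M ^ (p - n) * Di ^ n * (P * M) ^ n = 0 := by
      rw [h.M_pow_mul hq0 hn'.2.le le_rfl, Nat.sub_self, Nat.sub_zero, h.M_pow, zero_mul, zero_mul,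
        smul_zero]
    have e4 : M ^ (p - n) * Di ^ n * pochCoeff q n 0 • (P * M) ^ n = 0 := by
      rw [mul_smul_comm, e3, smul_zero]
    simp only [Prod.fst_swap, Prod.snd_swap, Nat.add_sub_cancel, Nat.sub_zero, e4, zero_mul,
        smul_zero, add_zero]
    refine Finset.sum_congr rfl fun m hm => ?_
    have hm' := Finset.mem_range.mp hm
    obtain ⟨i, rfl⟩ : ∃ i, n = m + 1 + i := ⟨n - (m + 1), by omega⟩
    have hi : m + 1 + i - (m + 1) = i := by omega
    have hi2 : m + 1 + i - i = m + 1 := by omega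
    simp only [f]
    rw [add_comm 1 m, hi, Nat.add_sub_cancel, ← nmElem_coeff hq hodd hp hn'.2, mul_smul_comm,
      h.M_pow_mul hq0 hn'.2.le (by omega), smul_smul, smul_mul_assoc, smul_smul, hi2]
    congr 1
    ring
  rw [Finset.sum_congr rfl e1, Finset.sum_congr rfl e2]
  refine Finset.sum_comm' fun k n => ?_
  simp only [Finset.mem_Ico]
  omega

end Expansion

/-! ### Homomorphisms and twisted derivations of monomial algebras -/

section Twisted

variable {S T E : Type*} [Ring S] [Algebra ℂ S] [Ring T] [Algebra ℂ T] [Ring E] [Algebra ℂ E]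

/-- A linear map `d` with `d (x y) = d x · β y + α x · d y`. -/
def IsTwDer (α β : S →ₐ[ℂ] T) (d : S →ₗ[ℂ] T) : Prop :=
  ∀ x y, d (x * y) = d x * β y + α x * d y

namespace IsTwDer

variable {α β : S →ₐ[ℂ] T} {d : S →ₗ[ℂ] T}

theorem smul (h : IsTwDer α β d) (c : ℂ) : IsTwDer α β (c • d) := fun x y => by
  simp only [LinearMap.smul_apply, h x y, smul_add, smul_mul_assoc, mul_smul_comm]

theorem map_one (h : IsTwDer α β d) : d 1 = 0 := by
  have h1 := h 1 1
  rw [mul_one, _root_.map_one β, _root_.map_one α, mul_one, one_mul] at h1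
  simpa using h1

/-- `d ⊗ id` is a twisted derivation. -/
theorem rTensor (h : IsTwDer α β d) :
    IsTwDer (Algebra.TensorProduct.map α (AlgHom.id ℂ E))
      (Algebra.TensorProduct.map β (AlgHom.id ℂ E)) (LinearMap.rTensor E d) := by
  intro x y
  induction x using TensorProduct.induction_on with
  | zero => simp
  | add x x' hx hx' => simp only [add_mul, map_add, hx, hx']; abel
  | tmul a b =>
    induction y using TensorProduct.induction_on with
    | zero => simp
    | add y y' hy hy' => simp only [mul_add, map_add, hy, hy']; abel
    | tmul a' b' =>
      simp only [Algebra.TensorProduct.tmul_mul_tmul, LinearMap.rTensor_tmul, h a a',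
        Algebra.TensorProduct.map_tmul, AlgHom.coe_id, id_eq, TensorProduct.add_tmul]

theorem comp_algHom (h : IsTwDer α β d) {R : Type*} [Ring R] [Algebra ℂ R] (f : R →ₐ[ℂ] S) :
    IsTwDer (α.comp f) (β.comp f) (d ∘ₗ f.toLinearMap) := fun x y => by
  simp [h (f x) (f y)]

theorem algHom_comp (h : IsTwDer α β d) {R : Type*} [Ring R] [Algebra ℂ R] (f : T →ₐ[ℂ] R) :
    IsTwDer (f.comp α) (f.comp β) (f.toLinearMap ∘ₗ d) := fun x y => by
  simp [h x y]

theorem mul_eq_zero (h : IsTwDer α β d) {x y : S} (hx : d x = 0) (hy : d y = 0) :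
    d (x * y) = 0 := by
  rw [h, hx, hy, zero_mul, mul_zero, add_zero]

theorem pow_eq_zero (h : IsTwDer α β d) {x : S} (hx : d x = 0) (n : ℕ) : d (x ^ n) = 0 := by
  induction n with
  | zero => rw [pow_zero, h.map_one]
  | succ n ih => rw [pow_succ, h.mul_eq_zero ih hx]

/-- The `q`-derivative of a power of an element of weight one. -/
theorem map_pow_succ (h : IsTwDer α β d) {q : ℂ} (hq : q ≠ 0) {x : S} {x' : T} {c : ℂ}
    (hα : α x = q⁻¹ • x') (hβ : β x = q • x') (hd : d x = algebraMap ℂ T c)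
    (h1 : qNum q 1 = 1) (n : ℕ) : d (x ^ (n + 1)) = (c * qNum q (n + 1)) • x' ^ n := by
  induction n with
  | zero => simp [hd, h1, Algebra.smul_def]
  | succ n ih =>
    rw [pow_succ, h, ih, hβ, map_pow, hα, hd, smul_pow, Algebra.algebraMap_eq_smul_one,
      smul_mul_smul_comm, smul_mul_smul_comm, mul_one, ← pow_succ, ← add_smul,
      ← qNum_add hq (n + 1) 1, h1, inv_pow, pow_one, one_mul]
    congr 1
    ring

theorem ext_of_generators (h : IsTwDer α β d) {d' : S →ₗ[ℂ] T} (h' : IsTwDer α β d') (s : Set S)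
    (hs : Algebra.adjoin ℂ s = ⊤) (he : ∀ x ∈ s, d x = d' x) : d = d' := by
  ext x
  have hx : x ∈ Algebra.adjoin ℂ s := hs ▸ Algebra.mem_top
  induction hx using Algebra.adjoin_induction with
  | mem x hx => exact he x hx
  | algebraMap r =>
    rw [Algebra.algebraMap_eq_smul_one, map_smul, map_smul, h.map_one, h'.map_one]
  | add x y _ _ hx hy => rw [map_add, map_add, hx, hy]
  | mul x y _ _ hx hy => rw [h, h', hx, hy]

end IsTwDer

end Twisted

section Diagonal

variable {M : Type} [AddCommGroup M] [Fintype M] [DecidableEq M] {κ : StarCocycle M}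

/-- The homomorphism that multiplies the monomial `e m` by `w m`. -/
def diagHom (w : M → ℂ) (h0 : w 0 = 1)
    (hw : ∀ x y, κ.c x y * w (x + y) = κ.c x y * (w x * w y)) : TwAlg κ →ₐ[ℂ] TwAlg κ :=
  AlgHom.ofLinearMap
    { toFun := fun x => fun m => w m * TwAlg.coeff m x
      map_add' := fun x y => by
        ext m
        exact mul_add _ _ _
      map_smul' := fun r x => by
        ext m
        exact mul_left_comm _ _ _ }
    (by
      ext m
      change w m * TwAlg.coeff m 1 = TwAlg.coeff m 1
      rw [TwAlg.coeff_one]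
      split_ifs with h
      · rw [h, h0, one_mul]
      · rw [mul_zero])
    (fun x y => by
      ext m
      change w m * TwAlg.coeff m (x * y) = ∑ i : M, κ.c i (m - i) *
        ((w i * TwAlg.coeff i x) * (w (m - i) * TwAlg.coeff (m - i) y))
      rw [TwAlg.coeff_mul, Finset.mul_sum]
      refine Finset.sum_congr rfl fun i _ => ?_
      have h := hw i (m - i)
      rw [add_sub_cancel] at h
      linear_combination (TwAlg.coeff i x * TwAlg.coeff (m - i) y) * h)

theorem coeff_diagHom {w : M → ℂ} {h0 : w 0 = 1}
    {hw : ∀ x y, κ.c x y * w (x + y) = κ.c x y * (w x * w y)} (m : M) (x : TwAlg κ) :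
    TwAlg.coeff m (diagHom w h0 hw x) = w m * TwAlg.coeff m x := rfl

theorem diagHom_e {w : M → ℂ} {h0 : w 0 = 1}
    {hw : ∀ x y, κ.c x y * w (x + y) = κ.c x y * (w x * w y)} (m : M) :
    diagHom w h0 hw (TwAlg.e κ m) = w m • TwAlg.e κ m := by
  ext n
  rw [coeff_diagHom, map_smul, smul_eq_mul, TwAlg.coeff_e]
  split_ifs with h
  · rw [h]
  · simp

/-- The linear map with prescribed values on the monomials. -/
def ofMonomials {V : Type*} [AddCommGroup V] [Module ℂ V] (f : M → V) : TwAlg κ →ₗ[ℂ] V :=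
  (TwAlg.basis κ).constr ℂ f

theorem ofMonomials_e {V : Type*} [AddCommGroup V] [Module ℂ V] (f : M → V) (m : M) :
    ofMonomials f (TwAlg.e κ m) = f m := by
  rw [ofMonomials, ← TwAlg.basis_apply, Module.Basis.constr_basis]

theorem linearMap_ext_e {V : Type*} [AddCommGroup V] [Module ℂ V] {f g : TwAlg κ →ₗ[ℂ] V}
    (h : ∀ m, f (TwAlg.e κ m) = g (TwAlg.e κ m)) : f = g :=
  (TwAlg.basis κ).ext fun m => by rw [TwAlg.basis_apply, h]

theorem isTwDer_of_monomials {T : Type*} [Ring T] [Algebra ℂ T] {α β : TwAlg κ →ₐ[ℂ] T}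
    {d : TwAlg κ →ₗ[ℂ] T}
    (h : ∀ x y, d (TwAlg.e κ x * TwAlg.e κ y) =
      d (TwAlg.e κ x) * β (TwAlg.e κ y) + α (TwAlg.e κ x) * d (TwAlg.e κ y)) :
    IsTwDer α β d := by
  have key : (LinearMap.mul ℂ (TwAlg κ)).compr₂ d =
      (LinearMap.mul ℂ T).compl₁₂ d β.toLinearMap +
        (LinearMap.mul ℂ T).compl₁₂ α.toLinearMap d := by
    refine LinearMap.ext_basis (TwAlg.basis _) (TwAlg.basis _) fun m n => ?_
    simpa [TwAlg.basis_apply] using h m n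
  intro x y
  simpa using LinearMap.congr_fun (LinearMap.congr_fun key x) y

end Diagonal

/-! ### The lowering operators of the supergroup -/

section Lowering

variable {p : ℕ} [NeZero p] {q : ℂ} (hq : IsPrimitiveRoot q p)

/-- The automorphism `η₊ ↦ q^j η₊`, `η₋ ↦ q^(-j) η₋`, `δ ↦ q^j δ`. -/
def scaleHom (j : ZMod p) : EtaDelta hq →ₐ[ℂ] EtaDelta hq :=
  diagHom (fun m => chi hq (j * (m.1 - m.2.1 + m.2.2))) (by simp) (fun x y => by
    rw [← AddChar.map_add_eq_mul]
    congr 2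
    simp only [Prod.fst_add, Prod.snd_add]
    ring)

theorem scaleHom_e (j : ZMod p) (m : ZMod p × ZMod p × ZMod p) :
    scaleHom hq j (TwAlg.e _ m) = chi hq (j * (m.1 - m.2.1 + m.2.2)) • TwAlg.e _ m :=
  diagHom_e m

/-- The homomorphism `η₋ ↦ 0`. -/
def killM : EtaDelta hq →ₐ[ℂ] EtaDelta hq :=
  diagHom (fun m => if m.2.1 = 0 then 1 else 0) (by simp) (fun x y => by
    by_cases h : (etaDeltaCocycle hq).c x y = 0
    · simp [h]
    congr 1
    rw [etaDeltaCocycle_c] at h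
    have ht : trunc x.2.1 y.2.1 ≠ 0 := right_ne_zero_of_mul (left_ne_zero_of_mul h)
    by_cases hx : x.2.1 = 0
    · simp [hx]
    · have : x.2.1 + y.2.1 ≠ 0 := fun h' => hx (trunc_ne_zero ht h').1
      simp [hx, this])

theorem killM_e (m : ZMod p × ZMod p × ZMod p) :
    killM hq (TwAlg.e _ m) = (if m.2.1 = 0 then (1 : ℂ) else 0) • TwAlg.e _ m :=
  diagHom_e m

/-- The lowering operator in `η₋`: `η₊^a η₋^b δ^k ↦ q^(k-a) [b] η₊^a η₋^(b-1) δ^k`. -/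
def lowM : EtaDelta hq →ₗ[ℂ] EtaDelta hq :=
  ofMonomials fun m => (chi hq (m.2.2 - m.1) * qNum q m.2.1.val) • TwAlg.e _ (m.1, m.2.1 - 1, m.2.2)

/-- The lowering operator in `η₊` modulo `η₋`: `η₊^a δ^k ↦ q^k [a] η₊^(a-1) δ^k`. -/
def lowP : EtaDelta hq →ₗ[ℂ] EtaDelta hq :=
  ofMonomials fun m => ((if m.2.1 = 0 then 1 else 0) * (chi hq m.2.2 * qNum q m.1.val)) •
    TwAlg.e _ (m.1 - 1, m.2.1, m.2.2)

/-- The addition formula for `q`-numbers in the presence of the truncation of exponents at `p`; if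
the exponents add up to `p`, it holds because `[p] = 0`. -/
theorem qNum_val_add (hp : 3 ≤ p) (a b : ZMod p) :
    trunc a b * qNum q (a + b).val =
      qNum q a.val * (trunc (a - 1) b * chi hq b) +
        qNum q b.val * (trunc a (b - 1) * chi hq (-a)) := by
  have hq0 := hq.ne_zero (show p ≠ 0 by omega)
  have hsub : ∀ c : ZMod p, c ≠ 0 → (c - 1).val = c.val - 1 := fun c hc => by
    have h1 : 0 < c.val := Nat.pos_of_ne_zero (by simpa using hc)
    have h2 : c = ((c.val - 1 : ℕ) : ZMod p) + 1 := by
      rw [Nat.cast_sub h1]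
      simp
    nth_rewrite 1 [h2]
    rw [add_sub_cancel_right, ZMod.val_cast_of_lt]
    have := ZMod.val_lt c
    omega
  have hchi : ∀ c : ZMod p, chi hq c = q ^ c.val := fun c => by
    rw [← chi_natCast hq, ZMod.natCast_zmod_val]
  have hadd : qNum q a.val * chi hq b + qNum q b.val * chi hq (-a) = qNum q (a.val + b.val) := by
    rw [AddChar.map_neg_eq_inv, hchi, hchi, ← qNum_add hq0]
  have ha := ZMod.val_lt a
  have hb := ZMod.val_lt b
  by_cases ha0 : a = 0
  · subst ha0
    simp [trunc_zero_left, qNum_zero]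
  by_cases hb0 : b = 0
  · subst hb0
    simp [trunc_zero_right, qNum_zero]
  have ha1 : 0 < a.val := Nat.pos_of_ne_zero (by simpa using ha0)
  have hb1 : 0 < b.val := Nat.pos_of_ne_zero (by simpa using hb0)
  have h1 := hsub a ha0
  have h2 := hsub b hb0
  rcases lt_trichotomy (a.val + b.val) p with h | h | h
  · have e1 : a.val - 1 + b.val < p := by omega
    have e2 : a.val + (b.val - 1) < p := by omega
    simp only [trunc, h1, h2, h, e1, e2, if_true, ZMod.val_add_of_lt h, one_mul, hadd]
  · have e0 : ¬ a.val + b.val < p := by omega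
    have e1 : a.val - 1 + b.val < p := by omega
    have e2 : a.val + (b.val - 1) < p := by omega
    simp only [trunc, h1, h2, e0, e1, e2, if_true, if_false, one_mul, zero_mul, hadd]
    rw [h, qNum_self hq]
  · have e0 : ¬ a.val + b.val < p := by omega
    have e1 : ¬ a.val - 1 + b.val < p := by omega
    have e2 : ¬ a.val + (b.val - 1) < p := by omega
    simp [trunc, h1, h2, e0, e1, e2]

theorem isTwDer_lowM (hp : 3 ≤ p) :
    IsTwDer (scaleHom hq (-1)) (scaleHom hq 1) (lowM hq) := by
  refine isTwDer_of_monomials fun x y => ?_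
  obtain ⟨a, b, k⟩ := x
  obtain ⟨a', b', k'⟩ := y
  rw [TwAlg.e_mul_e, map_smul, lowM, ofMonomials_e, ofMonomials_e, ofMonomials_e, scaleHom_e,
    scaleHom_e, smul_mul_smul_comm, smul_mul_smul_comm, TwAlg.e_mul_e, TwAlg.e_mul_e, smul_smul,
    smul_smul, smul_smul]
  simp only [etaDeltaCocycle_c, Prod.mk_add_mk]
  rw [show b - 1 + b' = b + b' - 1 by ring, show b + (b' - 1) = b + b' - 1 by ring, ← add_smul]
  congr 1
  have h1 : ∀ x y : ZMod p, chi hq x * chi hq y = chi hq (x + y) :=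
    fun x y => (AddChar.map_add_eq_mul _ _ _).symm
  have key := qNum_val_add hq hp b' b
  rw [trunc_comm b' b, add_comm b' b, trunc_comm (b' - 1), trunc_comm b'] at key
  have e1 : chi hq (k - a) * chi hq (1 * (a' - b' + k')) *
      chi hq (2 * (b - 1) * a' - 2 * k * (a' + b')) =
      chi hq (2 * b * a' - 2 * k * (a' + b')) * chi hq (k + k' - (a + a')) * chi hq (-b') := by
    simp only [h1]
    congr 1
    ring
  have e2 : chi hq (-1 * (a - b + k)) * chi hq (k' - a') *
      chi hq (2 * b * a' - 2 * k * (a' + (b' - 1))) =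
      chi hq (2 * b * a' - 2 * k * (a' + b')) * chi hq (k + k' - (a + a')) * chi hq b := by
    simp only [h1]
    congr 1
    ring
  linear_combination (trunc a a' * chi hq (2 * b * a' - 2 * k * (a' + b')) *
    chi hq (k + k' - (a + a'))) * key - (qNum q b.val * trunc a a' * trunc (b - 1) b') * e1 -
    (qNum q b'.val * trunc a a' * trunc b (b' - 1)) * e2

theorem isTwDer_lowP (hp : 3 ≤ p) :
    IsTwDer ((scaleHom hq (-1)).comp (killM hq)) ((scaleHom hq 1).comp (killM hq)) (lowP hq) := by
  refine isTwDer_of_monomials fun x y => ?_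
  obtain ⟨a, b, k⟩ := x
  obtain ⟨a', b', k'⟩ := y
  rw [TwAlg.e_mul_e, map_smul, lowP, ofMonomials_e, ofMonomials_e, ofMonomials_e,
    AlgHom.comp_apply, AlgHom.comp_apply, killM_e, killM_e, map_smul, map_smul, scaleHom_e,
    scaleHom_e]
  simp only [smul_mul_assoc, mul_smul_comm, TwAlg.e_mul_e, smul_smul, etaDeltaCocycle_c,
    Prod.mk_add_mk]
  rw [show a - 1 + a' = a + a' - 1 by ring, show a + (a' - 1) = a + a' - 1 by ring, ← add_smul]
  congr 1
  have h1 : ∀ x y : ZMod p, chi hq x * chi hq y = chi hq (x + y) :=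
    fun x y => (AddChar.map_add_eq_mul _ _ _).symm
  by_cases hb : b = 0
  · by_cases hb' : b' = 0
    · subst hb hb'
      have key := qNum_val_add hq hp a a'
      have e1 : chi hq k * chi hq (1 * (a' - 0 + k')) * chi hq (2 * 0 * a' - 2 * k * (a' + 0)) =
          chi hq (2 * 0 * a' - 2 * k * (a' + 0)) * chi hq (k + k') * chi hq a' := by
        simp only [h1]
        congr 1
        ring
      have e2 : chi hq (-1 * (a - 0 + k)) * chi hq k' *
          chi hq (2 * 0 * (a' - 1) - 2 * k * (a' - 1 + 0)) =
          chi hq (2 * 0 * a' - 2 * k * (a' + 0)) * chi hq (k + k') * chi hq (-a) := by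
        simp only [h1]
        congr 1
        ring
      simp only [trunc_zero_left, add_zero, if_true, one_mul, mul_one] at e1 e2 ⊢
      linear_combination (chi hq (2 * 0 * a' - 2 * k * a') * chi hq (k + k')) * key -
        (qNum q a.val * trunc (a - 1) a') * e1 - (qNum q a'.val * trunc a (a' - 1)) * e2
    · simp [hb, hb']
  · by_cases hc : trunc b b' = 0
    · simp [hb, hc]
    · have : b + b' ≠ 0 := fun h' => hb (trunc_ne_zero hc h').1
      simp [hb, this]

end Lowering

/-! ### The coaction on the Grassmann variables -/

namespace GaussRel

variable {A : Type} [Ring A] [Algebra ℂ A] [StarRing A] [StarModule ℂ A] {q : ℂ} {p : ℕ}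
  {P M D Di u v x : A}

theorem star_x (h : GaussRel q p P M D Di u v x) (hu : star u = u) (hv : star v = v) :
    star x = x := by
  have hs : IsUnit (1 + v * u) := by
    have := h.isUnit.star
    rwa [star_add, star_one, star_mul, hu, hv] at this
  have h1 : x * (1 + v * u) = u := by
    apply h.isUnit.mul_left_cancel
    rw [← mul_assoc, h.x_eq, mul_add, add_mul, mul_one, one_mul, mul_assoc]
  have h2 : star x * (1 + v * u) = u := by
    have := congrArg star h.x_eq
    rwa [star_mul, star_add, star_one, star_mul, hu, hv] at this
  exact hs.mul_right_cancel (h2.trans h1.symm)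

theorem star_B (h : GaussRel q p P M D Di u v x) (hq : IsPrimitiveRoot q p) (hodd : Odd p)
    (hp : 3 ≤ p) (hP : star P = P) (hD : star D = D) (hv : star v = v) :
    star (bElem q p P Di v) = bElem q p P Di v := by
  have h1 := congrArg star (h.a_mul_B (hq.ne_zero (by omega)) hp)
  rw [star_mul, star_add, star_mul, hP, hD, hv, h.v_P.eq] at h1
  exact (h.a_isUnit hq hodd hp).mul_right_cancel (h1.trans (h.B_mul_a hq hodd hp).symm)

theorem star_xp (h : GaussRel q p P M D Di u v x) (hq0 : q ≠ 0)
    (hP : star P = P) (hD : star D = D) (hDi : star Di = Di) (hu : star u = u)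
    (hv : star v = v) : star (xpElem q P D Di u v) = xpElem q P D Di u v := by
  have hx := h.star_x hu hv
  have hV : star (vElem P D x) = vElem P D x := by
    rw [vElem, star_add, star_mul, hP, hD, hx, h.x_D.eq]
  have hψ : star (psiElem q Di u v) = psiElem q Di u v := by
    have h1 := h.v_mul
    have hy : star (yElem q u v) = yElem q u v := by
      rw [← h.v_mul, star_mul, star_add, star_one, star_mul, hu, hv, add_mul, mul_add, mul_one,
        one_mul, mul_assoc]
    rw [psiElem, star_mul, hy, hDi, h.y_Di.eq]
  rw [h.xpElem_eq hq0, star_mul, star_add, star_mul, star_one, hV, hψ, mul_add, add_mul, mul_one,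
    one_mul, mul_assoc]

end GaussRel

section EtaLift

variable {p : ℕ} [NeZero p] {q : ℂ} (hq : IsPrimitiveRoot q p)

theorem pow_val_mul_pow_val {B : Type*} [Ring B] [Algebra ℂ B] {X : B} (hX : X ^ p = 0)
    (a b : ZMod p) : X ^ a.val * X ^ b.val = trunc a b • X ^ (a + b).val := by
  by_cases h : a.val + b.val < p
  · rw [ZMod.val_add_of_lt h, ← pow_add, trunc, if_pos h, one_smul]
  · rw [← pow_add, pow_eq_zero_of_le (not_lt.mp h) hX, trunc, if_neg h, zero_smul]

/-- The homomorphism from the algebra generated by `η₊, η₋` with prescribed values on `η₊, η₋`. -/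
def etaLift {B : Type*} [Ring B] [Algebra ℂ B] (X Y : B) (hYX : Y * X = q ^ 2 • (X * Y))
    (hX : X ^ p = 0) (hY : Y ^ p = 0) : Eta hq →ₐ[ℂ] B :=
  AlgHom.ofLinearMap (ofMonomials fun m => X ^ m.1.val * Y ^ m.2.val)
    (by
      change ofMonomials _ (TwAlg.e _ 0) = 1
      rw [ofMonomials_e]
      simp)
    (by
      have key : (LinearMap.mul ℂ (Eta hq)).compr₂
            (ofMonomials fun m => X ^ m.1.val * Y ^ m.2.val) =
          (LinearMap.mul ℂ B).compl₁₂ (ofMonomials fun m => X ^ m.1.val * Y ^ m.2.val)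
            (ofMonomials fun m => X ^ m.1.val * Y ^ m.2.val) := by
        refine LinearMap.ext_basis (TwAlg.basis _) (TwAlg.basis _) fun m n => ?_
        simp only [TwAlg.basis_apply, LinearMap.compr₂_apply, LinearMap.mul_apply',
          LinearMap.compl₁₂_apply, TwAlg.e_mul_e, map_smul, ofMonomials_e, etaCocycle_c,
          Prod.fst_add, Prod.snd_add]
        have h1 : chi hq (2 * m.2 * n.1) = (q ^ 2) ^ (n.1.val * m.2.val) := by
          rw [← pow_mul, ← chi_natCast hq]
          push_cast
          simp only [ZMod.natCast_zmod_val]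
          congr 1
          ring
        rw [mul_assoc (X ^ m.1.val), ← mul_assoc (Y ^ _), qcomm_pow_pow hYX, h1]
        simp only [smul_mul_assoc, mul_smul_comm]
        rw [mul_assoc (X ^ n.1.val), pow_val_mul_pow_val hY, ← mul_assoc (X ^ m.1.val),
          pow_val_mul_pow_val hX]
        simp only [smul_mul_assoc, mul_smul_comm, smul_smul]
        congr 1
        simp only [mul_comm n.1.val]
        ring
      exact fun x y => LinearMap.congr_fun (LinearMap.congr_fun key x) y)

variable {B : Type*} [Ring B] [Algebra ℂ B] {X Y : B} {hYX : Y * X = q ^ 2 • (X * Y)}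
  {hX : X ^ p = 0} {hY : Y ^ p = 0}

theorem etaLift_e (m : ZMod p × ZMod p) :
    etaLift hq X Y hYX hX hY (TwAlg.e _ m) = X ^ m.1.val * Y ^ m.2.val :=
  ofMonomials_e _ _

theorem conj_q (hq : IsPrimitiveRoot q p) (hp : 3 ≤ p) : conj q = q⁻¹ :=
  (Complex.inv_eq_conj (Complex.norm_eq_one_of_pow_eq_one hq.pow_eq_one (by omega))).symm

theorem etaLift_star [StarRing B] [StarModule ℂ B] (hsX : star X = X) (hsY : star Y = Y)
    (y : Eta hq) : etaLift hq X Y hYX hX hY (star y) = star (etaLift hq X Y hYX hX hY y) := by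
  rw [← (TwAlg.basis (etaCocycle hq)).sum_repr y]
  simp only [star_sum, star_smul, map_sum, map_smul, TwAlg.basis_apply]
  refine Finset.sum_congr rfl fun m _ => ?_
  rw [TwAlg.star_e, map_smul, etaLift_e, star_mul, star_pow, star_pow, hsX, hsY,
    qcomm_pow_pow hYX, ← pow_mul]
  congr 2
  change chi hq (2 * m.1 * m.2) = _
  rw [← chi_natCast hq]
  push_cast
  simp only [ZMod.natCast_zmod_val]
  congr 1
  ring

/-- Two homomorphisms out of the algebra generated by `η₊, η₋` agree if they agree on `η₊, η₋`. -/
theorem eta_algHom_ext {f g : Eta hq →ₐ[ℂ] B} (h1 : f (yp hq) = g (yp hq))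
    (h2 : f (ym hq) = g (ym hq)) : f = g := by
  have : f.toLinearMap = g.toLinearMap := linearMap_ext_e fun m => by
    simp [e_eq_pow, h1, h2]
  exact AlgHom.ext fun y => LinearMap.congr_fun this y

end EtaLift

section Coaction

variable {p : ℕ} [NeZero p] {q : ℂ} (hq : IsPrimitiveRoot q p)

theorem etam_pow (hp : 3 ≤ p) (n : ℕ) (hn : n < p) :
    etam hq ^ n = TwAlg.e _ (0, (n : ZMod p), 0) := by
  induction n with
  | zero => simp; rfl
  | succ n ih =>
    rw [pow_succ, ih (by omega), etam, TwAlg.e_mul_e]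
    have h1 : (n : ZMod p).val = n := ZMod.val_cast_of_lt (by omega)
    simp [etaDeltaCocycle_c, trunc, h1, val_one_of_lt (show 1 < p by omega), hn, NeZero.pos p]

theorem etap_pow (hp : 3 ≤ p) (n : ℕ) (hn : n < p) :
    etap hq ^ n = TwAlg.e _ ((n : ZMod p), 0, 0) := by
  induction n with
  | zero => simp; rfl
  | succ n ih =>
    rw [pow_succ, ih (by omega), etap, TwAlg.e_mul_e]
    have h1 : (n : ZMod p).val = n := ZMod.val_cast_of_lt (by omega)
    simp [etaDeltaCocycle_c, trunc, h1, val_one_of_lt (show 1 < p by omega), hn, NeZero.pos p]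

theorem etap_pow_p (hp : 3 ≤ p) : etap hq ^ p = 0 := by
  obtain ⟨n, rfl⟩ : ∃ n, p = n + 1 := ⟨p - 1, by omega⟩
  rw [pow_succ, etap_pow hq hp _ (by omega), etap, TwAlg.e_mul_e]
  have h1 : ((n : ℕ) : ZMod (n + 1)).val = n := ZMod.val_cast_of_lt (by omega)
  simp only [etaDeltaCocycle_c, trunc, h1, val_one_of_lt (show 1 < n + 1 by omega)]
  simp

theorem etam_pow_p (hp : 3 ≤ p) : etam hq ^ p = 0 := by
  obtain ⟨n, rfl⟩ : ∃ n, p = n + 1 := ⟨p - 1, by omega⟩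
  rw [pow_succ, etam_pow hq hp _ (by omega), etam, TwAlg.e_mul_e]
  have h1 : ((n : ℕ) : ZMod (n + 1)).val = n := ZMod.val_cast_of_lt (by omega)
  simp only [etaDeltaCocycle_c, trunc, h1, val_one_of_lt (show 1 < n + 1 by omega)]
  simp

theorem ym_pow_p (hp : 3 ≤ p) : ym hq ^ p = 0 := by
  obtain ⟨n, rfl⟩ : ∃ n, p = n + 1 := ⟨p - 1, by omega⟩
  rw [pow_succ, ym_pow hq _ (by omega), ym, TwAlg.e_mul_e]
  have h1 : ((n : ℕ) : ZMod (n + 1)).val = n := ZMod.val_cast_of_lt (by omega)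
  simp only [etaCocycle_c, trunc, h1, val_one_of_lt (show 1 < n + 1 by omega)]
  simp

theorem delInv_mul_del : delInv hq * del hq = 1 := by
  simp [delInv, del, TwAlg.e_mul_e, etaDeltaCocycle_c, trunc_zero_right]
  rfl

theorem star_etam : star (etam hq) = etam hq := by
  simp [etam, TwAlg.star_e, etaDeltaCocycle_s]

theorem star_delInv : star (delInv hq) = delInv hq := by
  simp [delInv, TwAlg.star_e, etaDeltaCocycle_s]

theorem etaCocycle_s (m : ZMod p × ZMod p) : (etaCocycle hq).s m = chi hq (2 * m.1 * m.2) := rfl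

theorem star_yp : star (yp hq) = yp hq := by
  rw [yp, TwAlg.star_e, etaCocycle_s]
  simp

theorem star_ym : star (ym hq) = ym hq := by
  rw [ym, TwAlg.star_e, etaCocycle_s]
  simp

/-- The element `(1 + η₊ η₋)⁻¹ η₊`. -/
def xEta : Eta hq := Ring.inverse (1 + yp hq * ym hq) * yp hq

theorem one_add_mul_xEta (hp : 3 ≤ p) : (1 + yp hq * ym hq) * xEta hq = yp hq := by
  have := isUnit_one_add_of_qcomm (ym_mul_yp hq (by omega)) (yp_pow_p hq (by omega))
  rw [xEta, ← mul_assoc, Ring.mul_inverse_cancel _ this, one_mul]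

/-- The value of the character `λ ↦ l` on `e^(λ/p)`. -/
def expl (p : ℕ) (l : ℝ) : ℂ := Complex.exp (l / p)

theorem expl_ne_zero (p : ℕ) (l : ℝ) : expl p l ≠ 0 := Complex.exp_ne_zero _

/-- `η₊ ⊗ 1` -/
def tP : EtaDelta hq ⊗[ℂ] Eta hq := etap hq ⊗ₜ 1

/-- `η₋ ⊗ 1` -/
def tM : EtaDelta hq ⊗[ℂ] Eta hq := etam hq ⊗ₜ 1

/-- `e^(l/p) δ ⊗ 1` -/
def tD (l : ℝ) : EtaDelta hq ⊗[ℂ] Eta hq := expl p l • (del hq ⊗ₜ 1)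

/-- `e^(-l/p) δ⁻¹ ⊗ 1` -/
def tDi (l : ℝ) : EtaDelta hq ⊗[ℂ] Eta hq := (expl p l)⁻¹ • (delInv hq ⊗ₜ 1)

/-- `1 ⊗ η₊` -/
def tu : EtaDelta hq ⊗[ℂ] Eta hq := 1 ⊗ₜ yp hq

/-- `1 ⊗ η₋` -/
def tv : EtaDelta hq ⊗[ℂ] Eta hq := 1 ⊗ₜ ym hq

/-- `1 ⊗ (1 + η₊ η₋)⁻¹ η₊` -/
def tx : EtaDelta hq ⊗[ℂ] Eta hq := 1 ⊗ₜ xEta hq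

theorem commute_tmul_one_one_tmul (a : EtaDelta hq) (b : Eta hq) :
    Commute ((1 : EtaDelta hq) ⊗ₜ[ℂ] b) (a ⊗ₜ[ℂ] (1 : Eta hq)) := by
  simp [Commute, SemiconjBy, Algebra.TensorProduct.tmul_mul_tmul]

theorem gaussRel (hp : 3 ≤ p) (l : ℝ) :
    GaussRel q p (tP hq) (tM hq) (tD hq l) (tDi hq l) (tu hq) (tv hq) (tx hq) where
  P_D := by
    simp only [tP, tD, mul_smul_comm, smul_mul_assoc, Algebra.TensorProduct.tmul_mul_tmul,
      etap_mul_del, mul_one, TensorProduct.smul_tmul', smul_smul]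
    rw [mul_comm]
  M_D := by
    simp only [tM, tD, mul_smul_comm, smul_mul_assoc, Algebra.TensorProduct.tmul_mul_tmul,
      etam_mul_del, mul_one, TensorProduct.smul_tmul', smul_smul]
    rw [mul_comm]
  M_P := by
    simp only [tM, tP, Algebra.TensorProduct.tmul_mul_tmul,
      etam_mul_etap, mul_one, TensorProduct.smul_tmul']
  D_Di := by
    simp only [tD, tDi, smul_mul_smul_comm, mul_inv_cancel₀ (expl_ne_zero p l), one_smul,
      Algebra.TensorProduct.tmul_mul_tmul, del_mul_delInv, mul_one]
    rfl
  Di_D := by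
    simp only [tD, tDi, smul_mul_smul_comm, inv_mul_cancel₀ (expl_ne_zero p l), one_smul,
      Algebra.TensorProduct.tmul_mul_tmul, delInv_mul_del, mul_one]
    rfl
  v_u := by
    simp only [tv, tu, Algebra.TensorProduct.tmul_mul_tmul, ym_mul_yp hq (show 2 < p by omega),
      mul_one, TensorProduct.tmul_smul]
  P_pow := by
    rw [tP, Algebra.TensorProduct.tmul_pow, etap_pow_p hq hp, TensorProduct.zero_tmul]
  M_pow := by
    rw [tM, Algebra.TensorProduct.tmul_pow, etam_pow_p hq hp, TensorProduct.zero_tmul]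
  u_pow := by
    rw [tu, Algebra.TensorProduct.tmul_pow, yp_pow_p hq (by omega), TensorProduct.tmul_zero]
  v_pow := by
    rw [tv, Algebra.TensorProduct.tmul_pow, ym_pow_p hq hp, TensorProduct.tmul_zero]
  x_eq := by
    rw [tu, tv, tx, Algebra.TensorProduct.tmul_mul_tmul, mul_one, Algebra.TensorProduct.one_def,
      ← TensorProduct.tmul_add, Algebra.TensorProduct.tmul_mul_tmul, mul_one,
      one_add_mul_xEta hq hp]
  u_P := commute_tmul_one_one_tmul hq _ _
  u_M := commute_tmul_one_one_tmul hq _ _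
  u_D := (commute_tmul_one_one_tmul hq _ _).smul_right _
  u_Di := (commute_tmul_one_one_tmul hq _ _).smul_right _
  v_P := commute_tmul_one_one_tmul hq _ _
  v_M := commute_tmul_one_one_tmul hq _ _
  v_D := (commute_tmul_one_one_tmul hq _ _).smul_right _
  v_Di := (commute_tmul_one_one_tmul hq _ _).smul_right _
  x_P := commute_tmul_one_one_tmul hq _ _
  x_M := commute_tmul_one_one_tmul hq _ _
  x_D := (commute_tmul_one_one_tmul hq _ _).smul_right _

theorem exp_neg_div (l : ℝ) : Complex.exp (-l / p) = (expl p l)⁻¹ := by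
  rw [expl, ← Complex.exp_neg, neg_div]

theorem coEtap_eq (l : ℝ) :
    coEtap hq l = xpElem q (tP hq) (tD hq l) (tDi hq l) (tu hq) (tv hq) := by
  simp only [coEtap, xpElem, tP, tD, tDi, tu, tv, exp_neg_div, Algebra.TensorProduct.tmul_pow,
    Algebra.TensorProduct.one_def, smul_mul_assoc, Algebra.TensorProduct.tmul_mul_tmul, mul_one,
    one_mul, ← TensorProduct.tmul_smul, ← TensorProduct.tmul_add, one_pow]
  simp only [TensorProduct.tmul_smul, smul_smul, expl]

theorem coEtam_eq (hp : 3 ≤ p) (l : ℝ) :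
    coEtam hq l = tM hq + bElem q p (tP hq) (tDi hq l) (tv hq) := by
  have hI : Finset.Ico (0 + 1) (p - 1) = Finset.Icc 1 (p - 2) := by
    ext
    simp only [Finset.mem_Icc, Finset.mem_Ico]
    omega
  have he : ∀ k : ℕ, Complex.exp (-(k + 1) * l / p) = ((expl p l)⁻¹) ^ (k + 1) := fun k => by
    rw [← exp_neg_div, ← Complex.exp_nat_mul]
    push_cast
    congr 1
    ring
  rw [coEtam, bElem, Finset.range_eq_Ico, Finset.sum_eq_sum_Ico_succ_bot (by omega), hI,
      ← add_assoc]
  congr 1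
  · simp only [tM, tDi, tv, exp_neg_div, pow_zero, mul_one, inv_one, zero_add,
      pow_one, one_smul, smul_mul_assoc, Algebra.TensorProduct.tmul_mul_tmul, one_mul]
  · refine Finset.sum_congr rfl fun k _ => ?_
    rw [he]
    simp only [tDi, tP, tv, smul_pow, Algebra.TensorProduct.tmul_pow, smul_mul_assoc,
      Algebra.TensorProduct.tmul_mul_tmul, one_pow, mul_one, one_mul, smul_smul]

theorem nilp_eq (hodd : Odd p) (hp : 3 ≤ p) (l : ℝ) :
    nilp hq l = middlePow q p (tP hq) (tD hq l * tx hq) := by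
  rw [nilp, middlePow, ← sum_Icc_eq_antidiagonal hp
    (fun i j => qDiv q i j • ((tP hq) ^ i * (tD hq l * tx hq) ^ j))]
  refine Finset.sum_congr rfl fun k hk => ?_
  have hk' := Finset.mem_Icc.mp hk
  have he : Complex.exp (k * l / p) = expl p l ^ k := by
    rw [expl, ← Complex.exp_nat_mul]
    congr 1
    ring
  have hc : q ^ (k ^ 2) / (qFact q k * qFact q (p - k)) = qDiv q (p - k) k := by
    have h1 : q ^ ((p - k) * k) * q ^ (k ^ 2) = 1 := by
      rw [← pow_add, sq, ← add_mul, Nat.sub_add_cancel (by omega), pow_mul, hq.pow_eq_one, one_pow]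
    rw [qDiv, div_eq_mul_inv, eq_inv_of_mul_eq_one_right h1, ← mul_inv]
    congr 1
    ring
  rw [qPoch_mul_pow hq hodd (ym_mul_yp hq (by omega)) (yp_pow_p hq (by omega))
    (one_add_mul_xEta hq hp) (by omega), he, hc]
  simp only [tP, tD, tx, smul_mul_assoc, smul_pow, Algebra.TensorProduct.tmul_mul_tmul,
    Algebra.TensorProduct.tmul_pow, one_pow, mul_one, one_mul, mul_smul_comm, smul_smul]

theorem qPoch_tmul_one (a : EtaDelta hq) (r : ℂ) (k : ℕ) :
    qPoch (-(a ⊗ₜ[ℂ] (1 : Eta hq))) r k = qPoch (-a) r k ⊗ₜ[ℂ] (1 : Eta hq) := by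
  induction k with
  | zero => rfl
  | succ k ih =>
    rw [qPoch, qPoch, ih, Algebra.TensorProduct.one_def, ← TensorProduct.neg_tmul,
      TensorProduct.smul_tmul', ← TensorProduct.sub_tmul, Algebra.TensorProduct.tmul_mul_tmul,
      mul_one]

theorem nilm_eq_nmElem (l : ℝ) :
    nilm hq l = nmElem q p (tP hq) (tM hq) (tDi hq l) (tv hq) := by
  refine Finset.sum_congr rfl fun k hk => ?_
  have he : Complex.exp (-k * l / p) = (expl p l)⁻¹ ^ k := by
    rw [← exp_neg_div, ← Complex.exp_nat_mul]
    congr 1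
    ring
  rw [he]
  simp only [tM, tP, tDi, tv, smul_mul_assoc, smul_pow, Algebra.TensorProduct.tmul_mul_tmul,
    Algebra.TensorProduct.tmul_pow, one_pow, mul_one, one_mul, mul_smul_comm, smul_smul,
    qPoch_tmul_one]

theorem nilm_eq (hodd : Odd p) (hp : 3 ≤ p) (l : ℝ) :
    nilm hq l = middlePow q⁻¹ p (tM hq) (bElem q p (tP hq) (tDi hq l) (tv hq)) := by
  rw [nilm_eq_nmElem, (gaussRel hq hp l).nmElem_eq hq hodd hp]

theorem coEtam_mul_coEtap (hodd : Odd p) (hp : 3 ≤ p) (l : ℝ) :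
    coEtam hq l * coEtap hq l = q ^ 2 • (coEtap hq l * coEtam hq l) := by
  rw [coEtap_eq, coEtam_eq hq hp]
  exact (gaussRel hq hp l).xm_mul_xp hq hodd hp

theorem coEtap_pow_p (hodd : Odd p) (hp : 3 ≤ p) (l : ℝ) : coEtap hq l ^ p = 0 := by
  rw [coEtap_eq]
  exact (gaussRel hq hp l).xp_pow hq hodd hp

theorem coEtam_pow_p (hodd : Odd p) (hp : 3 ≤ p) (l : ℝ) : coEtam hq l ^ p = 0 := by
  rw [coEtam_eq hq hp]
  exact (gaussRel hq hp l).xm_pow hq hodd hp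

/-- The coaction on the Grassmann variables as a homomorphism of algebras. -/
def coEtaHom (hodd : Odd p) (hp : 3 ≤ p) (l : ℝ) : Eta hq →ₐ[ℂ] EtaDelta hq ⊗[ℂ] Eta hq :=
  etaLift hq (coEtap hq l) (coEtam hq l) (coEtam_mul_coEtap hq hodd hp l)
    (coEtap_pow_p hq hodd hp l) (coEtam_pow_p hq hodd hp l)

theorem coEtaHom_apply (hodd : Odd p) (hp : 3 ≤ p) (l : ℝ) (y : Eta hq) :
    coEtaHom hq hodd hp l y = coEta hq l y := rfl

theorem coEta_mul (hodd : Odd p) (hp : 3 ≤ p) (l : ℝ) (y z : Eta hq) :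
    coEta hq l (y * z) = coEta hq l y * coEta hq l z :=
  map_mul (coEtaHom hq hodd hp l) y z

theorem star_tmul' (a : EtaDelta hq) (b : Eta hq) :
    star (a ⊗ₜ[ℂ] b) = star a ⊗ₜ[ℂ] star b := rfl

theorem conj_expl (l : ℝ) : conj (expl p l) = expl p l := by
  rw [expl, ← Complex.exp_conj]
  simp

theorem star_tP : star (tP hq) = tP hq := by
  rw [tP, star_tmul', star_etap, star_one]

theorem star_tM : star (tM hq) = tM hq := by
  rw [tM, star_tmul', star_etam, star_one]

theorem star_tD (l : ℝ) : star (tD hq l) = tD hq l := by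
  rw [tD, star_smul, star_tmul', star_del, star_one, ← starRingEnd_apply, conj_expl]

theorem star_tDi (l : ℝ) : star (tDi hq l) = tDi hq l := by
  rw [tDi, star_smul, star_tmul', star_delInv, star_one, ← starRingEnd_apply, map_inv₀, conj_expl]

theorem star_tu : star (tu hq) = tu hq := by
  rw [tu, star_tmul', star_yp, star_one]

theorem star_tv : star (tv hq) = tv hq := by
  rw [tv, star_tmul', star_ym, star_one]

theorem star_coEta (hodd : Odd p) (hp : 3 ≤ p) (l : ℝ) (y : Eta hq) :
    coEta hq l (star y) = star (coEta hq l y) := by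
  have hg := gaussRel hq hp l
  refine etaLift_star hq (hYX := coEtam_mul_coEtap hq hodd hp l)
    (hX := coEtap_pow_p hq hodd hp l) (hY := coEtam_pow_p hq hodd hp l) ?_ ?_ y
  · rw [coEtap_eq, hg.star_xp (hq.ne_zero (by omega)) (star_tP hq) (star_tD hq l)
      (star_tDi hq l) (star_tu hq) (star_tv hq)]
  · rw [coEtam_eq hq hp, star_add, hg.star_B hq hodd hp (star_tP hq) (star_tD hq l) (star_tv hq),
      star_tM]

theorem star_nilp (hodd : Odd p) (hp : 3 ≤ p) (l : ℝ) : star (nilp hq l) = nilp hq l := by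
  have hg := gaussRel hq hp l
  have hq0 := hq.ne_zero (show p ≠ 0 by omega)
  rw [nilp_eq hq hodd hp, star_middlePow hq0 (conj_q hq hp)
    (qcomm_swap (pow_ne_zero 2 hq0) hg.P_Q) (star_tP hq)]
  rw [star_mul, hg.star_x (star_tu hq) (star_tv hq), star_tD, hg.x_D.eq]

theorem star_nilm (hodd : Odd p) (hp : 3 ≤ p) (l : ℝ) : star (nilm hq l) = nilm hq l := by
  have hg := gaussRel hq hp l
  have hq0 := hq.ne_zero (show p ≠ 0 by omega)
  rw [nilm_eq hq hodd hp, star_middlePow (inv_ne_zero hq0) (by rw [map_inv₀, conj_q hq hp])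
    (hg.B_mul_M hq hodd hp) (star_tM hq)
    (hg.star_B hq hodd hp (star_tP hq) (star_tD hq l) (star_tv hq))]

theorem nilp_mul_self (hodd : Odd p) (hp : 3 ≤ p) (l : ℝ) : nilp hq l * nilp hq l = 0 := by
  rw [nilp_eq hq hodd hp]
  exact (gaussRel hq hp l).np_mul_self hq hodd hp

theorem nilm_mul_self (hodd : Odd p) (hp : 3 ≤ p) (l : ℝ) : nilm hq l * nilm hq l = 0 := by
  rw [nilm_eq hq hodd hp]
  exact (gaussRel hq hp l).nm_mul_self hq hodd hp

theorem nilp_commute_nilm (hodd : Odd p) (hp : 3 ≤ p) (l : ℝ) :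
    Commute (nilp hq l) (nilm hq l) := by
  rw [nilp_eq hq hodd hp, nilm_eq hq hodd hp]
  exact (gaussRel hq hp l).np_commute_nm hq hodd hp

theorem commute_coEta {Z : EtaDelta hq ⊗[ℂ] Eta hq} {l : ℝ} (h1 : Commute Z (coEtap hq l))
    (h2 : Commute Z (coEtam hq l)) (y : Eta hq) : Commute Z (coEta hq l y) := by
  rw [← (TwAlg.basis (etaCocycle hq)).sum_repr y]
  simp only [map_sum, map_smul, coEta, Module.Basis.constr_basis]
  exact Commute.sum_right _ _ _ fun m _ =>
    ((h1.pow_right _).mul_right (h2.pow_right _)).smul_right _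

theorem nilp_commute_coEta (hodd : Odd p) (hp : 3 ≤ p) (l : ℝ) (y : Eta hq) :
    Commute (nilp hq l) (coEta hq l y) := by
  have hg := gaussRel hq hp l
  refine commute_coEta hq ?_ ?_ y
  · rw [nilp_eq hq hodd hp, coEtap_eq]
    exact hg.np_commute_xp hq hodd hp
  · rw [nilp_eq hq hodd hp, coEtam_eq hq hp]
    exact hg.np_commute_xm hq hodd hp

theorem nilm_commute_coEta (hodd : Odd p) (hp : 3 ≤ p) (l : ℝ) (y : Eta hq) :
    Commute (nilm hq l) (coEta hq l y) := by
  have hg := gaussRel hq hp l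
  refine commute_coEta hq ?_ ?_ y
  · rw [nilm_eq hq hodd hp, coEtap_eq]
    exact hg.nm_commute_xp hq hodd hp
  · rw [nilm_eq hq hodd hp, coEtam_eq hq hp]
    exact hg.nm_commute_xm hq hodd hp

end Coaction

/-! ### Calculus of test functions -/

section TestFunctions

theorem test_ext {f g : Test} (h : ∀ w, f.1 w = g.1 w) : f = g := Subtype.ext (funext h)

theorem test_differentiableAt (f : Test) (w : ℝ × ℝ) : DifferentiableAt ℝ f.1 w :=
  f.2.1.differentiable (by simp) w

theorem dTest_mul (v : ℝ × ℝ) (f g : Test) :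
    dTest v (f * g) = dTest v f * g + f * dTest v g := by
  refine test_ext fun w => ?_
  change fderiv ℝ (f.1 * g.1) w v = fderiv ℝ f.1 w v * g.1 w + f.1 w * fderiv ℝ g.1 w v
  rw [fderiv_mul (test_differentiableAt f w) (test_differentiableAt g w)]
  simp
  ring

theorem dTest_star (v : ℝ × ℝ) (f : Test) : dTest v (star f) = star (dTest v f) := by
  refine test_ext fun w => ?_
  change fderiv ℝ (Complex.conjCLE ∘ f.1) w v = conj (fderiv ℝ f.1 w v)
  rw [ContinuousLinearEquiv.comp_fderiv]
  simp

theorem dTest_comm (v v' : ℝ × ℝ) (f : Test) : dTest v (dTest v' f) = dTest v' (dTest v f) := by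
  refine test_ext fun w => ?_
  have hd : DifferentiableAt ℝ (fderiv ℝ f.1) w :=
    (f.2.1.fderiv_right (m := ∞) le_rfl).differentiable (by simp) w
  have h : ∀ a b : ℝ × ℝ, (dTest a (dTest b f)).1 w = fderiv ℝ (fderiv ℝ f.1) w a b := fun a b => by
    change fderiv ℝ (fun w => fderiv ℝ f.1 w b) w a = _
    rw [fderiv_clm_apply hd (differentiableAt_const b)]
    simp
  rw [h, h]
  exact (f.2.1.contDiffAt.isSymmSndFDerivAt (by
    rw [minSmoothness_of_isRCLikeNormedField]
    exact WithTop.coe_le_coe.mpr (le_top (a := (2 : ℕ∞))))) v v'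

theorem hasFDerivAt_boost (g : ℝ × ℝ × ℝ) (w : ℝ × ℝ) :
    HasFDerivAt (boost g)
      ((Real.exp g.2.2 • ContinuousLinearMap.fst ℝ ℝ ℝ).prod
        (Real.exp (-g.2.2) • ContinuousLinearMap.snd ℝ ℝ ℝ)) w :=
  (((hasFDerivAt_fst (p := w)).const_mul (Real.exp g.2.2)).const_add g.1).prodMk
    (((hasFDerivAt_snd (p := w)).const_mul (Real.exp (-g.2.2))).const_add g.2.1)

theorem dTest_pull (g : ℝ × ℝ × ℝ) (v : ℝ × ℝ) (f : Test) :
    dTest v (pull g f) =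
      pull g (dTest (Real.exp g.2.2 * v.1, Real.exp (-g.2.2) * v.2) f) := by
  refine test_ext fun w => ?_
  change fderiv ℝ (f.1 ∘ boost g) w v = fderiv ℝ f.1 (boost g w) _
  rw [((test_differentiableAt f _).hasFDerivAt.comp w (hasFDerivAt_boost g w)).fderiv]
  simp

theorem dTest_smul_dir (r : ℝ) (v : ℝ × ℝ) (f : Test) :
    dTest (r • v) f = (r : ℂ) • dTest v f := by
  refine test_ext fun w => ?_
  change fderiv ℝ f.1 w (r • v) = (r : ℂ) * fderiv ℝ f.1 w v
  rw [map_smul, Complex.real_smul]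

theorem dzp_pull (g : ℝ × ℝ × ℝ) (f : Test) :
    dzp (pull g f) = (Real.exp g.2.2 : ℂ) • pull g (dzp f) := by
  have := dTest_smul_dir (Real.exp g.2.2) (1, 0) f
  rw [dzp, dTest_pull, ← map_smul, ← this]
  simp

theorem dzm_pull (g : ℝ × ℝ × ℝ) (f : Test) :
    dzm (pull g f) = (Real.exp (-g.2.2) : ℂ) • pull g (dzm f) := by
  have := dTest_smul_dir (Real.exp (-g.2.2)) (0, 1) f
  rw [dzm, dTest_pull, ← map_smul, ← this]
  simp

theorem dzp_dzm (f : Test) : dzp (dzm f) = dzm (dzp f) := dTest_comm _ _ f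

theorem pull_mul (g : ℝ × ℝ × ℝ) (f f' : Test) : pull g (f * f') = pull g f * pull g f' := rfl

theorem pull_star (g : ℝ × ℝ × ℝ) (f : Test) : pull g (star f) = star (pull g f) := rfl

theorem integralC_dTest (v : ℝ × ℝ) (f : Test) : integralC (dTest v f) = 0 := by
  have h0 : ∀ f : Test, MeasureTheory.Integrable f.1 := fun f =>
    f.2.1.continuous.integrable_of_hasCompactSupport f.2.2
  have h := integral_mul_fderiv_eq_neg_fderiv_mul_of_integrable (𝕜 := ℂ)
    (μ := MeasureTheory.volume) (f := fun _ : ℝ × ℝ => (1 : ℂ)) (g := f.1) (v := v)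
    (by simp) (by simp only [one_mul]; exact h0 (dTest v f)) (by simpa using h0 f)
    (fun x _ => differentiableAt_const _) (fun x _ => test_differentiableAt f x)
  simp only [one_mul, fderiv_fun_const, Pi.zero_apply, zero_apply, zero_mul,
    MeasureTheory.integral_zero, neg_zero] at h
  exact h

theorem integralC_pull (g : ℝ × ℝ × ℝ) (f : Test) : integralC (pull g f) = integralC f := by
  have hi : ∀ f : Test, MeasureTheory.Integrable f.1 := fun f =>
    f.2.1.continuous.integrable_of_hasCompactSupport f.2.2
  change ∫ w, (pull g f).1 w = ∫ w, f.1 w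
  rw [MeasureTheory.Measure.volume_eq_prod, MeasureTheory.integral_prod _ (hi (pull g f)),
    MeasureTheory.integral_prod _ (hi f)]
  change ∫ x, ∫ y, f.1 (g.1 + Real.exp g.2.2 * x, g.2.1 + Real.exp (-g.2.2) * y) = _
  have h2 : ∀ a : ℝ, ∫ y, f.1 (a, g.2.1 + Real.exp (-g.2.2) * y) =
      Real.exp g.2.2 • ∫ y, f.1 (a, y) := fun a => by
    rw [MeasureTheory.Measure.integral_comp_mul_left (fun y => f.1 (a, g.2.1 + y)),
      MeasureTheory.integral_add_left_eq_self (fun y => f.1 (a, y)), ← Real.exp_neg, neg_neg,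
      abs_of_pos (Real.exp_pos _)]
  simp only [h2]
  rw [MeasureTheory.integral_smul,
    MeasureTheory.Measure.integral_comp_mul_left (fun x => ∫ y, f.1 (g.1 + x, y)),
    MeasureTheory.integral_add_left_eq_self (fun x => ∫ y, f.1 (x, y)), smul_smul,
    ← Real.exp_neg, abs_of_pos (Real.exp_pos _), ← Real.exp_add, add_neg_cancel, Real.exp_zero,
    one_smul]

end TestFunctions

/-! ### The coaction is a homomorphism of star algebras -/

section CoactionHom

set_option synthInstance.maxHeartbeats 200000

variable {p : ℕ} [NeZero p] {q : ℂ} (hq : IsPrimitiveRoot q p)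

instance : RightDistribClass (Superspace hq) :=
  ⟨(inferInstance : NonUnitalRing (Superspace hq)).right_distrib⟩

instance : LeftDistribClass (Superspace hq) :=
  ⟨(inferInstance : NonUnitalRing (Superspace hq)).left_distrib⟩

theorem superspace_zero_mul (F : Superspace hq) : 0 * F = 0 :=
  (inferInstance : NonUnitalRing (Superspace hq)).zero_mul F

theorem superspace_mul_zero (F : Superspace hq) : F * 0 = 0 :=
  (inferInstance : NonUnitalRing (Superspace hq)).mul_zero F

/-- The rearrangement `f ⊗ (a ⊗ b) ↦ a ⊗ (f ⊗ b)`. -/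
def swapL : Test ⊗[ℂ] (EtaDelta hq ⊗[ℂ] Eta hq) ≃ₗ[ℂ] EtaDelta hq ⊗[ℂ] Superspace hq :=
  TensorProduct.leftComm ℂ Test (EtaDelta hq) (Eta hq)

theorem swapL_tmul (f : Test) (a : EtaDelta hq) (b : Eta hq) :
    swapL hq (f ⊗ₜ (a ⊗ₜ b)) = a ⊗ₜ (f ⊗ₜ b) := rfl

theorem superspace_tmul_mul_tmul (f f' : Test) (b b' : Eta hq) :
    (f ⊗ₜ[ℂ] b : Superspace hq) * (f' ⊗ₜ[ℂ] b') = (f * f') ⊗ₜ[ℂ] (b * b') :=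
  Algebra.TensorProduct.tmul_mul_tmul f f' b b'

theorem swapL_mul_swapL (f f' : Test) (Y Y' : EtaDelta hq ⊗[ℂ] Eta hq) :
    swapL hq (f ⊗ₜ Y) * swapL hq (f' ⊗ₜ Y') = swapL hq ((f * f') ⊗ₜ (Y * Y')) := by
  induction Y using TensorProduct.induction_on with
  | zero => simp
  | add Y Z hY hZ => simp only [TensorProduct.tmul_add, map_add, add_mul, hY, hZ]
  | tmul a b =>
    induction Y' using TensorProduct.induction_on with
    | zero => simp
    | add Y Z hY hZ => simp only [TensorProduct.tmul_add, map_add, mul_add, hY, hZ]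
    | tmul a' b' =>
      rw [swapL_tmul, swapL_tmul, tmul_mul_tmul, superspace_tmul_mul_tmul,
        Algebra.TensorProduct.tmul_mul_tmul, swapL_tmul]

theorem star_swapL (f : Test) (Y : EtaDelta hq ⊗[ℂ] Eta hq) :
    star (swapL hq (f ⊗ₜ Y)) = swapL hq (star f ⊗ₜ star Y) := by
  induction Y using TensorProduct.induction_on with
  | zero => simp
  | add Y Z hY hZ => simp only [TensorProduct.tmul_add, map_add, star_add, hY, hZ]
  | tmul a b => rfl

/-- The Taylor expansions in the nilpotent parts of `Δ z₊` and `Δ z₋` stop after the linear term. -/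
theorem coact_tmul (hodd : Odd p) (hp : 3 ≤ p) (g : ℝ × ℝ × ℝ) (f : Test) (y : Eta hq) :
    coact hq g (f ⊗ₜ y) = swapL hq (pull g f ⊗ₜ coEta hq g.2.2 y) +
      swapL hq (pull g (dzm f) ⊗ₜ (nilm hq g.2.2 * coEta hq g.2.2 y)) +
      (swapL hq (pull g (dzp f) ⊗ₜ (nilp hq g.2.2 * coEta hq g.2.2 y)) +
        swapL hq (pull g (dzp (dzm f)) ⊗ₜ
          (nilp hq g.2.2 * (nilm hq g.2.2 * coEta hq g.2.2 y)))) := by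
  have hN : ∀ n, 2 ≤ n → nilp hq g.2.2 ^ n = 0 := fun n hn =>
    pow_eq_zero_of_le hn (by rw [sq, nilp_mul_self hq hodd hp])
  have hN' : ∀ n, 2 ≤ n → nilm hq g.2.2 ^ n = 0 := fun n hn =>
    pow_eq_zero_of_le hn (by rw [sq, nilm_mul_self hq hodd hp])
  have hr : ∀ F : ℕ → EtaDelta hq ⊗[ℂ] Superspace hq, (∀ n, 2 ≤ n → F n = 0) →
      ∑ i ∈ Finset.range p, F i = F 0 + F 1 := fun F hF => by
    obtain ⟨n, rfl⟩ : ∃ n, p = n + 2 := ⟨p - 2, by omega⟩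
    rw [Finset.sum_range_succ', Finset.sum_range_succ', Finset.sum_eq_zero, zero_add]
    · exact add_comm _ _
    · exact fun i _ => hF _ (by omega)
  simp only [coact, LinearMap.sum_apply, LinearMap.smul_apply, LinearMap.comp_apply,
    TensorProduct.map_tmul, LinearMap.mulLeft_apply, LinearEquiv.coe_coe]
  rw [hr]
  · rw [hr, hr]
    · simp [swapL, mul_assoc]
    · intro n hn
      simp [hN' n hn]
    · intro n hn
      simp [hN' n hn]
  · intro n hn
    refine Finset.sum_eq_zero fun j _ => ?_
    simp [hN n hn]

theorem coact_mul (hodd : Odd p) (hp : 3 ≤ p) (g : ℝ × ℝ × ℝ) (F G : Superspace hq) :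
    coact hq g (F * G) = coact hq g F * coact hq g G := by
  induction F using TensorProduct.induction_on with
  | zero => rw [superspace_zero_mul, map_zero, zero_mul]
  | add F F' hF hF' => simp only [add_mul, map_add, hF, hF']
  | tmul f y =>
    induction G using TensorProduct.induction_on with
    | zero => rw [superspace_mul_zero, map_zero, mul_zero]
    | add G G' hG hG' => simp only [mul_add, map_add, hG, hG']
    | tmul f' y' =>
      have c1 : ∀ z, coEta hq g.2.2 y * (nilp hq g.2.2 * z) =
          nilp hq g.2.2 * (coEta hq g.2.2 y * z) :=
        commute_assoc (nilp_commute_coEta hq hodd hp g.2.2 y).symm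
      have c2 : ∀ z, coEta hq g.2.2 y * (nilm hq g.2.2 * z) =
          nilm hq g.2.2 * (coEta hq g.2.2 y * z) :=
        commute_assoc (nilm_commute_coEta hq hodd hp g.2.2 y).symm
      have c3 : ∀ z, nilm hq g.2.2 * (nilp hq g.2.2 * z) =
          nilp hq g.2.2 * (nilm hq g.2.2 * z) :=
        commute_assoc (nilp_commute_nilm hq hodd hp g.2.2).symm
      have c4 : ∀ z, nilp hq g.2.2 * (nilp hq g.2.2 * z) = 0 := fun z => by
        rw [← mul_assoc, nilp_mul_self hq hodd hp, zero_mul]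
      have c5 : ∀ z, nilm hq g.2.2 * (nilm hq g.2.2 * z) = 0 := fun z => by
        rw [← mul_assoc, nilm_mul_self hq hodd hp, zero_mul]
      have hdm : ∀ f f' : Test, dzm (f * f') = dzm f * f' + f * dzm f' := dTest_mul _
      have hdp : ∀ f f' : Test, dzp (f * f') = dzp f * f' + f * dzp f' := dTest_mul _
      rw [superspace_tmul_mul_tmul, coact_tmul hq hodd hp, coact_tmul hq hodd hp,
        coact_tmul hq hodd hp]
      simp only [add_mul, mul_add, swapL_mul_swapL, coEta_mul hq hodd hp, hdm, hdp, map_add,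
        pull_mul, TensorProduct.add_tmul, mul_assoc, c1, c2, c3, c4, c5, mul_zero,
        TensorProduct.tmul_zero, map_zero]
      abel

theorem coact_star (hodd : Odd p) (hp : 3 ≤ p) (g : ℝ × ℝ × ℝ) (F : Superspace hq) :
    coact hq g (star F) = star (coact hq g F) := by
  induction F using TensorProduct.induction_on with
  | zero => simp
  | add F F' hF hF' => simp only [star_add, map_add, hF, hF']
  | tmul f y =>
    have hdm : ∀ f : Test, dzm (star f) = star (dzm f) := dTest_star _
    have hdp : ∀ f : Test, dzp (star f) = star (dzp f) := dTest_star _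
    have hs : star (f ⊗ₜ[ℂ] y : Superspace hq) = star f ⊗ₜ[ℂ] star y := rfl
    have c1 := (nilp_commute_coEta hq hodd hp g.2.2 (star y)).eq
    have c2 := (nilm_commute_coEta hq hodd hp g.2.2 (star y)).eq
    have c3 := (nilp_commute_nilm hq hodd hp g.2.2).eq
    rw [hs, coact_tmul hq hodd hp, coact_tmul hq hodd hp]
    simp only [star_add, star_swapL, star_mul, ← star_coEta hq hodd hp, star_nilp hq hodd hp,
      star_nilm hq hodd hp, hdm, hdp, pull_star]
    rw [c2, mul_assoc (coEta hq _ _), c1, ← c3, ← mul_assoc, c1, mul_assoc]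

end CoactionHom

/-! ### The coaction and the lowering operators -/

section MiddlePow

variable {A : Type*} [Ring A] [Algebra ℂ A] {r : ℂ} {p : ℕ} {X Y : A}

theorem middlePow_mul_add_pow (hr : IsPrimitiveRoot r p) (hodd : Odd p) (hp : 3 ≤ p)
    (h : Y * X = (r ^ 2)⁻¹ • (X * Y)) (hX : X ^ p = 0) (hY : Y ^ p = 0) :
    middlePow r p X Y * (X + Y) ^ (p - 1) = 0 := by
  rw [add_pow_eq_dividedPow hr hodd hp h (by omega)]
  simp only [middlePow, dividedPow, Finset.sum_mul, Finset.mul_sum, mul_smul_comm, smul_mul_assoc,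
    Finset.smul_sum]
  refine Finset.sum_eq_zero fun x hx => Finset.sum_eq_zero fun y hy => ?_
  have hx' := mem_antidiagonal.mp hx
  have hy' := mem_antidiagonal.mp hy
  rw [mul_assoc, ← mul_assoc (Y ^ _), qcomm_pow_pow h, smul_mul_assoc, mul_smul_comm, mul_assoc,
    ← pow_add, ← mul_assoc, ← pow_add]
  -- of the two exponents, whose sum is `2 p - 1`, one is at least `p`
  rcases le_or_gt p (x.2 + 1 + y.2) with h1 | h1
  · rw [pow_eq_zero_of_le (m := p) (by omega) hY, mul_zero, smul_zero, smul_zero, smul_zero,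
      smul_zero]
  · rw [pow_eq_zero_of_le (m := p) (by omega) hX, zero_mul, smul_zero, smul_zero, smul_zero,
      smul_zero]

theorem map_middlePow_of_scale {B : Type*} [Ring B] [Algebra ℂ B] (f : A →ₐ[ℂ] B) {c : ℂ}
    (hp : 3 ≤ p) (hc : c ^ p = 1) {X' Y' : B} (hX : f X = c • X') (hY : f Y = c • Y') :
    f (middlePow r p X Y) = middlePow r p X' Y' := by
  simp only [middlePow, map_sum, map_smul, map_mul, map_pow, hX, hY, smul_pow]
  refine Finset.sum_congr rfl fun x hx => ?_
  have hx' := mem_antidiagonal.mp hx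
  rw [smul_mul_smul_comm, ← pow_add, show x.1 + 1 + (x.2 + 1) = p by omega, hc, one_smul]

end MiddlePow

namespace GaussRel

variable {A : Type} [Ring A] [Algebra ℂ A] {q : ℂ} {p : ℕ} {P M D Di u v x : A}

section Scale

variable {f : A →ₐ[ℂ] A} {c : ℂ}

theorem map_Q (hD : f D = c • D) (hx : f x = x) : f (D * x) = c • (D * x) := by
  rw [map_mul, hD, hx, smul_mul_assoc]

theorem map_V (hP : f P = c • P) (hD : f D = c • D) (hx : f x = x) :
    f (vElem P D x) = c • vElem P D x := by
  rw [vElem, map_add, hP, map_Q hD hx, smul_add]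

theorem map_psi (hDi : f Di = c⁻¹ • Di) (hu : f u = u) (hv : f v = v) :
    f (psiElem q Di u v) = c⁻¹ • psiElem q Di u v := by
  simp only [psiElem, yElem, map_mul, map_add, map_smul, hDi, hu, hv, smul_mul_assoc]

theorem map_W (hc : c ≠ 0) (hP : f P = c • P) (hD : f D = c • D) (hDi : f Di = c⁻¹ • Di)
    (hu : f u = u) (hv : f v = v) (hx : f x = x) :
    f (1 + vElem P D x * psiElem q Di u v) = 1 + vElem P D x * psiElem q Di u v := by
  rw [map_add, map_one, map_mul, map_V hP hD hx, map_psi hDi hu hv, smul_mul_smul_comm,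
    mul_inv_cancel₀ hc, one_smul]

theorem map_xp (h : GaussRel q p P M D Di u v x) (hq0 : q ≠ 0) (hc : c ≠ 0) (hP : f P = c • P)
    (hD : f D = c • D) (hDi : f Di = c⁻¹ • Di) (hu : f u = u) (hv : f v = v) (hx : f x = x) :
    f (xpElem q P D Di u v) = c • xpElem q P D Di u v := by
  rw [h.xpElem_eq hq0, map_mul, map_W hc hP hD hDi hu hv hx, map_V hP hD hx, mul_smul_comm]

theorem map_B (h : GaussRel q p P M D Di u v x) (hq : IsPrimitiveRoot q p) (hodd : Odd p)
    (hp : 3 ≤ p) (hc : c ≠ 0) (hP : f P = c • P)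
    (hD : f D = c • D) (hv : f v = v) :
    f (bElem q p P Di v) = c⁻¹ • bElem q p P Di v := by
  have h1 := h.a_mul_B (hq.ne_zero (by omega)) hp
  have h2 := congrArg f h1
  rw [map_mul, map_add, map_mul, hD, hP, hv, smul_mul_assoc, ← smul_add, smul_mul_assoc] at h2
  apply (h.a_isUnit hq hodd hp).mul_left_cancel
  rw [mul_smul_comm, h1]
  exact ((inv_smul_eq_iff₀ hc).mpr h2.symm).symm

end Scale

section LowerM

variable {α β : A →ₐ[ℂ] A} {d : A →ₗ[ℂ] A}

theorem lowerM_B (hd : IsTwDer α β d) (hP : d P = 0) (hDi : d Di = 0) (hv : d v = 0) :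
    d (bElem q p P Di v) = 0 := by
  rw [bElem, map_sum]
  refine Finset.sum_eq_zero fun k _ => ?_
  rw [map_smul, hd.mul_eq_zero (hd.mul_eq_zero (hd.pow_eq_zero hDi _) (hd.pow_eq_zero hP _))
    (hd.pow_eq_zero hv _), smul_zero]

theorem lowerM_V (hd : IsTwDer α β d) (hP : d P = 0) (hD : d D = 0) (hx : d x = 0) :
    d (vElem P D x) = 0 := by
  rw [vElem, map_add, hP, hd.mul_eq_zero hD hx, add_zero]

theorem lower_psi (hd : IsTwDer α β d) (hDi : d Di = 0) (hu : d u = 0) (hv : d v = 0) :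
    d (psiElem q Di u v) = 0 := by
  rw [psiElem, yElem]
  refine hd.mul_eq_zero hDi ?_
  rw [map_add, map_smul, hv, hd.mul_eq_zero (hd.mul_eq_zero hu hv) hv, smul_zero, add_zero]

theorem lowerM_xp (h : GaussRel q p P M D Di u v x) (hq0 : q ≠ 0) (hd : IsTwDer α β d)
    (hP : d P = 0) (hD : d D = 0) (hDi : d Di = 0) (hu : d u = 0) (hv : d v = 0) (hx : d x = 0) :
    d (xpElem q P D Di u v) = 0 := by
  have hV := lowerM_V hd hP hD hx
  rw [h.xpElem_eq hq0]
  refine hd.mul_eq_zero ?_ hV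
  rw [map_add, hd.map_one, hd.mul_eq_zero hV (lower_psi hd hDi hu hv), add_zero]

theorem lowerM_np (hd : IsTwDer α β d) (hP : d P = 0) (hD : d D = 0) (hx : d x = 0) :
    d (middlePow q p P (D * x)) = 0 := by
  rw [middlePow, map_sum]
  refine Finset.sum_eq_zero fun k _ => ?_
  rw [map_smul, hd.mul_eq_zero (hd.pow_eq_zero hP _) (hd.pow_eq_zero (hd.mul_eq_zero hD hx) _),
    smul_zero]

/-- Lowering in `η₋` sends the nilpotent part of `Δ z₋` to `(Δ η₋) ^ (p - 1) / [p - 1]!`, up to the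
contribution of `η₋ ^ p ⊗ 1`. -/
theorem lowerM_nm (h : GaussRel q p P M D Di u v x) (hq : IsPrimitiveRoot q p) (hodd : Odd p)
    (hp : 3 ≤ p) (hd : IsTwDer α β d) (hM : d M = 1) (hP : d P = 0) (hDi : d Di = 0)
    (hv : d v = 0) (hαM : α M = q • M) (hβM : β M = q⁻¹ • M)
    (hβB : β (bElem q p P Di v) = q⁻¹ • bElem q p P Di v) :
    d (middlePow q⁻¹ p M (bElem q p P Di v)) + (qFact q (p - 1))⁻¹ • M ^ (p - 1) =
      (qFact q (p - 1))⁻¹ • (M + bElem q p P Di v) ^ (p - 1) := by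
  have hq0 := hq.ne_zero (show p ≠ 0 by omega)
  have key := map_middlePow (X := M) (Y := bElem q p P Di v) hq.inv hodd hp
      (h.B_mul_M hq hodd hp) d 1 (fun i j => by
    rw [hd, hd.pow_eq_zero (lowerM_B hd hP hDi hv), mul_zero, add_zero, map_pow β, hβB, smul_pow,
      hd.map_pow_succ (inv_ne_zero hq0) (x' := M) (c := 1) (by rw [inv_inv, hαM]) hβM
        (by rw [hM, map_one]) (qNum_one hq.inv hp), smul_mul_smul_comm])
  rwa [one_mul, qFact_inv] at key

end LowerM

section LowerP

variable {α β : A →ₐ[ℂ] A} {d : A →ₗ[ℂ] A}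

theorem lowerP_V (hd : IsTwDer α β d) (hP : d P = 1) (hD : d D = 0) (hx : d x = 0) :
    d (vElem P D x) = 1 := by
  rw [vElem, map_add, hP, hd.mul_eq_zero hD hx, add_zero]

theorem lowerP_W (hd : IsTwDer α β d) (hP : d P = 1) (hD : d D = 0) (hDi : d Di = 0)
    (hu : d u = 0) (hv : d v = 0) (hx : d x = 0) (hβDi : β Di = q⁻¹ • Di)
    (hβu : β u = u) (hβv : β v = v) :
    d (1 + vElem P D x * psiElem q Di u v) = q⁻¹ • psiElem q Di u v := by
  rw [map_add, hd.map_one, zero_add, hd, lower_psi hd hDi hu hv, mul_zero, add_zero,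
    lowerP_V hd hP hD hx, one_mul, map_psi hβDi hβu hβv]

theorem lowerP_xp (h : GaussRel q p P M D Di u v x) (hq0 : q ≠ 0) (hd : IsTwDer α β d)
    (hP : d P = 1) (hD : d D = 0) (hDi : d Di = 0) (hu : d u = 0) (hv : d v = 0) (hx : d x = 0)
    (hβP : β P = q • P) (hβD : β D = q • D) (hβDi : β Di = q⁻¹ • Di)
    (hβu : β u = u) (hβv : β v = v) (hβx : β x = x)
    (hαW : α (1 + vElem P D x * psiElem q Di u v) = 1 + vElem P D x * psiElem q Di u v) :
    d (xpElem q P D Di u v) = 1 + (1 + q ^ 2) • (vElem P D x * psiElem q Di u v) := by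
  rw [h.xpElem_eq hq0, hd, lowerP_W hd hP hD hDi hu hv hx hβDi hβu hβv, lowerP_V hd hP hD hx,
    hαW, map_V hβP hβD hβx, smul_mul_smul_comm, inv_mul_cancel₀ hq0, one_smul, mul_one,
    h.psi_V hq0, add_smul, one_smul]
  abel

/-- The derivative of `B` is read off from that of `B (1 + V ψ) = ψ`. -/
theorem lowerP_B (h : GaussRel q p P M D Di u v x) (hq : IsPrimitiveRoot q p) (hodd : Odd p)
    (hp : 3 ≤ p) (hd : IsTwDer α β d)
    (hP : d P = 1) (hD : d D = 0) (hDi : d Di = 0) (hu : d u = 0) (hv : d v = 0) (hx : d x = 0)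
    (hβDi : β Di = q⁻¹ • Di) (hβu : β u = u) (hβv : β v = v)
    (hβW : β (1 + vElem P D x * psiElem q Di u v) = 1 + vElem P D x * psiElem q Di u v)
    (hαB : α (bElem q p P Di v) = q • bElem q p P Di v) :
    d (bElem q p P Di v) = -bElem q p P Di v ^ 2 := by
  have hq0 := hq.ne_zero (show p ≠ 0 by omega)
  have h1 := congrArg d (h.B_mul_W hq hodd hp)
  rw [hd, lower_psi hd hDi hu hv, lowerP_W hd hP hD hDi hu hv hx hβDi hβu hβv, hβW, hαB,
    smul_mul_smul_comm, mul_inv_cancel₀ hq0, one_smul] at h1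
  apply (h.W_isUnit hq hodd hp).mul_right_cancel
  rw [neg_mul, sq, mul_assoc, h.B_mul_W hq hodd hp]
  exact eq_neg_of_add_eq_zero_left h1

/-- Lowering in `η₊` sends the nilpotent part of `Δ z₊` to `(Δ η₊) ^ (p - 1) / [p - 1]!`, up to the
contribution of `η₊ ^ p ⊗ 1`. -/
theorem lowerP_np (h : GaussRel q p P M D Di u v x) (hq : IsPrimitiveRoot q p) (hodd : Odd p)
    (hp : 3 ≤ p) (hd : IsTwDer α β d) (hP : d P = 1) (hD : d D = 0) (hx : d x = 0)
    (hαP : α P = q⁻¹ • P) (hβP : β P = q • P) (hβD : β D = q • D) (hβx : β x = x) :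
    d (middlePow q p P (D * x)) + (qFact q (p - 1))⁻¹ • P ^ (p - 1) =
      (qFact q (p - 1))⁻¹ • xpElem q P D Di u v ^ (p - 1) := by
  have hq0 := hq.ne_zero (show p ≠ 0 by omega)
  have key := map_middlePow (X := P) (Y := D * x) hq hodd hp
      (qcomm_swap (pow_ne_zero 2 hq0) h.P_Q) d 1 (fun i j => by
    rw [hd, hd.pow_eq_zero (hd.mul_eq_zero hD hx), mul_zero, add_zero, map_pow β, map_Q hβD hβx,
      smul_pow, hd.map_pow_succ hq0 (x' := P) (c := 1) hαP hβP
        (by rw [hP, map_one]) (qNum_one hq hp), smul_mul_smul_comm])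
  rw [one_mul] at key
  rw [key, h.xp_pow_pred hq hodd hp, vElem]

/-- A twisted derivation `d` that, like its twists, annihilates `M`, annihilates multiples of the
nilpotent part of `Δ z₋`. -/
theorem lowerP_nm_mul (hd : IsTwDer α β d) (hM : d M = 0) (hαM : α M = 0) (B z : A) :
    d (middlePow q⁻¹ p M B * z) = 0 := by
  simp only [middlePow, Finset.sum_mul, map_sum]
  refine Finset.sum_eq_zero fun k _ => ?_
  rw [smul_mul_assoc, map_smul, mul_assoc, hd, hd.pow_eq_zero hM, map_pow, hαM,
    zero_pow (Nat.succ_ne_zero _), zero_mul, zero_mul, add_zero, smul_zero]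

theorem map_nm_eq_zero {f : A →ₐ[ℂ] A} (hM : f M = 0) (B : A) :
    f (middlePow q⁻¹ p M B) = 0 := by
  simp only [middlePow, map_sum, map_smul, map_mul, map_pow, hM]
  simp

end LowerP

end GaussRel

section Concrete

variable {p : ℕ} [NeZero p] {q : ℂ} (hq : IsPrimitiveRoot q p)

/-- `scaleHom j ⊗ id`. -/
def scaleT (j : ZMod p) : EtaDelta hq ⊗[ℂ] Eta hq →ₐ[ℂ] EtaDelta hq ⊗[ℂ] Eta hq :=
  Algebra.TensorProduct.map (scaleHom hq j) (AlgHom.id ℂ (Eta hq))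

/-- `killM ⊗ id`. -/
def killT : EtaDelta hq ⊗[ℂ] Eta hq →ₐ[ℂ] EtaDelta hq ⊗[ℂ] Eta hq :=
  Algebra.TensorProduct.map (killM hq) (AlgHom.id ℂ (Eta hq))

/-- `lowM ⊗ id`. -/
def lowMT : EtaDelta hq ⊗[ℂ] Eta hq →ₗ[ℂ] EtaDelta hq ⊗[ℂ] Eta hq :=
  LinearMap.rTensor (Eta hq) (lowM hq)

/-- `lowP ⊗ id`. -/
def lowPT : EtaDelta hq ⊗[ℂ] Eta hq →ₗ[ℂ] EtaDelta hq ⊗[ℂ] Eta hq :=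
  LinearMap.rTensor (Eta hq) (lowP hq)

theorem isTwDer_lowMT (hp : 3 ≤ p) :
    IsTwDer (scaleT hq (-1)) (scaleT hq 1) (lowMT hq) :=
  (isTwDer_lowM hq hp).rTensor

theorem isTwDer_lowPT (hp : 3 ≤ p) :
    IsTwDer ((scaleT hq (-1)).comp (killT hq)) ((scaleT hq 1).comp (killT hq)) (lowPT hq) := by
  have h := (isTwDer_lowP hq hp).rTensor (E := Eta hq)
  have e : ∀ j, Algebra.TensorProduct.map ((scaleHom hq j).comp (killM hq))
      (AlgHom.id ℂ (Eta hq)) = (scaleT hq j).comp (killT hq) := fun j =>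
    Algebra.TensorProduct.ext' fun a b => rfl
  rwa [e, e] at h

theorem scaleT_tP (j : ZMod p) : scaleT hq j (tP hq) = chi hq j • tP hq := by
  rw [scaleT, tP, Algebra.TensorProduct.map_tmul, etap, scaleHom_e, map_one,
      TensorProduct.smul_tmul']
  simp

theorem scaleT_tM (j : ZMod p) : scaleT hq j (tM hq) = chi hq (-j) • tM hq := by
  rw [scaleT, tM, Algebra.TensorProduct.map_tmul, etam, scaleHom_e, map_one,
      TensorProduct.smul_tmul']
  simp

theorem scaleT_tD (j : ZMod p) (l : ℝ) : scaleT hq j (tD hq l) = chi hq j • tD hq l := by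
  rw [scaleT, tD, map_smul, Algebra.TensorProduct.map_tmul, del, scaleHom_e, map_one,
    ← TensorProduct.smul_tmul', smul_comm]
  simp

theorem scaleT_tDi (j : ZMod p) (l : ℝ) : scaleT hq j (tDi hq l) = (chi hq j)⁻¹ • tDi hq l := by
  rw [scaleT, tDi, map_smul, Algebra.TensorProduct.map_tmul, delInv, scaleHom_e, map_one,
    ← TensorProduct.smul_tmul', smul_comm, ← AddChar.map_neg_eq_inv]
  simp

theorem scaleT_one_tmul (j : ZMod p) (y : Eta hq) : scaleT hq j (1 ⊗ₜ y) = 1 ⊗ₜ y := by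
  rw [scaleT, Algebra.TensorProduct.map_tmul, map_one]
  rfl

theorem killT_tP : killT hq (tP hq) = tP hq := by
  rw [killT, tP, Algebra.TensorProduct.map_tmul, etap, killM_e, map_one]
  simp

theorem killT_tM (hp : 3 ≤ p) : killT hq (tM hq) = 0 := by
  have : Fact (1 < p) := ⟨by omega⟩
  rw [killT, tM, Algebra.TensorProduct.map_tmul, etam, killM_e, map_one]
  simp

theorem killT_tD (l : ℝ) : killT hq (tD hq l) = tD hq l := by
  rw [killT, tD, map_smul, Algebra.TensorProduct.map_tmul, del, killM_e, map_one]
  simp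

theorem killT_tDi (l : ℝ) : killT hq (tDi hq l) = tDi hq l := by
  rw [killT, tDi, map_smul, Algebra.TensorProduct.map_tmul, delInv, killM_e, map_one]
  simp

theorem killT_one_tmul (y : Eta hq) : killT hq (1 ⊗ₜ y) = 1 ⊗ₜ y := by
  rw [killT, Algebra.TensorProduct.map_tmul, map_one]
  rfl

theorem lowMT_one_tmul (hp : 3 ≤ p) (y : Eta hq) : lowMT hq (1 ⊗ₜ y) = 0 := by
  rw [lowMT, LinearMap.rTensor_tmul, (isTwDer_lowM hq hp).map_one, TensorProduct.zero_tmul]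

theorem lowPT_one_tmul (hp : 3 ≤ p) (y : Eta hq) : lowPT hq (1 ⊗ₜ y) = 0 := by
  rw [lowPT, LinearMap.rTensor_tmul, (isTwDer_lowP hq hp).map_one, TensorProduct.zero_tmul]

theorem lowMT_tP : lowMT hq (tP hq) = 0 := by
  rw [lowMT, tP, LinearMap.rTensor_tmul, lowM, etap, ofMonomials_e]
  simp [qNum_zero]

theorem lowMT_tM (hp : 3 ≤ p) : lowMT hq (tM hq) = 1 := by
  rw [lowMT, tM, LinearMap.rTensor_tmul, lowM, etam, ofMonomials_e]
  simp only [val_one_of_lt (show 1 < p by omega), qNum_one hq hp, sub_self]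
  simp
  rfl

theorem lowMT_tD (l : ℝ) : lowMT hq (tD hq l) = 0 := by
  rw [lowMT, tD, map_smul, LinearMap.rTensor_tmul, lowM, del, ofMonomials_e]
  simp [qNum_zero]

theorem lowMT_tDi (l : ℝ) : lowMT hq (tDi hq l) = 0 := by
  rw [lowMT, tDi, map_smul, LinearMap.rTensor_tmul, lowM, delInv, ofMonomials_e]
  simp [qNum_zero]

theorem lowPT_tP (hp : 3 ≤ p) : lowPT hq (tP hq) = 1 := by
  rw [lowPT, tP, LinearMap.rTensor_tmul, lowP, etap, ofMonomials_e]
  simp only [val_one_of_lt (show 1 < p by omega), qNum_one hq hp, sub_self]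
  simp
  rfl

theorem lowPT_tM : lowPT hq (tM hq) = 0 := by
  rw [lowPT, tM, LinearMap.rTensor_tmul, lowP, etam, ofMonomials_e]
  simp [qNum_zero]

theorem lowPT_tD (l : ℝ) : lowPT hq (tD hq l) = 0 := by
  rw [lowPT, tD, map_smul, LinearMap.rTensor_tmul, lowP, del, ofMonomials_e]
  simp [qNum_zero]

theorem lowPT_tDi (l : ℝ) : lowPT hq (tDi hq l) = 0 := by
  rw [lowPT, tDi, map_smul, LinearMap.rTensor_tmul, lowP, delInv, ofMonomials_e]
  simp [qNum_zero]

theorem chi_one : chi hq 1 = q := by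
  simpa using chi_natCast hq 1

theorem chi_neg_one : chi hq (-1) = q⁻¹ := by
  rw [AddChar.map_neg_eq_inv, chi_one]

theorem chi_ne_zero (j : ZMod p) : chi hq j ≠ 0 := fun h => by
  have := chi_mul_conj hq j
  rw [h, zero_mul] at this
  exact zero_ne_one this

theorem chi_pow_p (j : ZMod p) : chi hq j ^ p = 1 := by
  rw [← AddChar.map_nsmul_eq_pow]
  simp

theorem scaleT_coEtap (hp : 3 ≤ p) (j : ZMod p) (l : ℝ) :
    scaleT hq j (coEtap hq l) = chi hq j • coEtap hq l := by
  rw [coEtap_eq]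
  exact (gaussRel hq hp l).map_xp (hq.ne_zero (by omega)) (chi_ne_zero hq j) (scaleT_tP hq j)
    (scaleT_tD hq j l) (scaleT_tDi hq j l) (scaleT_one_tmul hq j _) (scaleT_one_tmul hq j _)
    (scaleT_one_tmul hq j _)

theorem scaleT_B (hodd : Odd p) (hp : 3 ≤ p) (j : ZMod p) (l : ℝ) :
    scaleT hq j (bElem q p (tP hq) (tDi hq l) (tv hq)) =
      (chi hq j)⁻¹ • bElem q p (tP hq) (tDi hq l) (tv hq) :=
  (gaussRel hq hp l).map_B hq hodd hp (chi_ne_zero hq j) (scaleT_tP hq j)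
    (scaleT_tD hq j l) (scaleT_one_tmul hq j _)

theorem scaleT_coEtam (hodd : Odd p) (hp : 3 ≤ p) (j : ZMod p) (l : ℝ) :
    scaleT hq j (coEtam hq l) = (chi hq j)⁻¹ • coEtam hq l := by
  rw [coEtam_eq hq hp, map_add, scaleT_B hq hodd hp, scaleT_tM, AddChar.map_neg_eq_inv, smul_add]

theorem scaleT_nilp (hodd : Odd p) (hp : 3 ≤ p) (j : ZMod p) (l : ℝ) :
    scaleT hq j (nilp hq l) = nilp hq l := by
  rw [nilp_eq hq hodd hp]
  exact map_middlePow_of_scale _ hp (chi_pow_p hq j) (scaleT_tP hq j)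
    (GaussRel.map_Q (scaleT_tD hq j l) (scaleT_one_tmul hq j _))

theorem scaleT_nilm (hodd : Odd p) (hp : 3 ≤ p) (j : ZMod p) (l : ℝ) :
    scaleT hq j (nilm hq l) = nilm hq l := by
  rw [nilm_eq hq hodd hp]
  refine map_middlePow_of_scale _ hp (chi_pow_p hq (-j)) (scaleT_tM hq j) ?_
  rw [scaleT_B hq hodd hp, AddChar.map_neg_eq_inv]

theorem killT_coEtap (hp : 3 ≤ p) (l : ℝ) : killT hq (coEtap hq l) = coEtap hq l := by
  rw [coEtap_eq]
  have h := (gaussRel hq hp l).map_xp (f := killT hq) (c := 1) (hq.ne_zero (by omega)) one_ne_zero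
    (by rw [killT_tP, one_smul]) (by rw [killT_tD, one_smul])
    (by rw [killT_tDi, inv_one, one_smul]) (killT_one_tmul hq _) (killT_one_tmul hq _)
    (killT_one_tmul hq _)
  rwa [one_smul] at h

theorem killT_B (hodd : Odd p) (hp : 3 ≤ p) (l : ℝ) :
    killT hq (bElem q p (tP hq) (tDi hq l) (tv hq)) = bElem q p (tP hq) (tDi hq l) (tv hq) := by
  have h := (gaussRel hq hp l).map_B (f := killT hq) (c := 1) hq hodd hp one_ne_zero
    (by rw [killT_tP, one_smul]) (by rw [killT_tD, one_smul]) (killT_one_tmul hq _)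
  rwa [inv_one, one_smul] at h

theorem killT_coEtam (hodd : Odd p) (hp : 3 ≤ p) (l : ℝ) :
    killT hq (coEtam hq l) = bElem q p (tP hq) (tDi hq l) (tv hq) := by
  rw [coEtam_eq hq hp, map_add, killT_B hq hodd hp, killT_tM hq hp, zero_add]

theorem killT_nilp (hodd : Odd p) (hp : 3 ≤ p) (l : ℝ) :
    killT hq (nilp hq l) = nilp hq l := by
  rw [nilp_eq hq hodd hp]
  exact map_middlePow_of_scale _ hp (one_pow p) (by rw [killT_tP, one_smul])
    (GaussRel.map_Q (by rw [killT_tD, one_smul]) (killT_one_tmul hq _))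

theorem killT_nilm (hodd : Odd p) (hp : 3 ≤ p) (l : ℝ) : killT hq (nilm hq l) = 0 := by
  rw [nilm_eq hq hodd hp]
  exact GaussRel.map_nm_eq_zero (killT_tM hq hp) _

theorem lowMT_coEtap (hp : 3 ≤ p) (l : ℝ) : lowMT hq (coEtap hq l) = 0 := by
  rw [coEtap_eq]
  exact (gaussRel hq hp l).lowerM_xp (hq.ne_zero (by omega)) (isTwDer_lowMT hq hp) (lowMT_tP hq)
    (lowMT_tD hq l) (lowMT_tDi hq l) (lowMT_one_tmul hq hp _) (lowMT_one_tmul hq hp _)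
    (lowMT_one_tmul hq hp _)

theorem lowMT_coEtam (hp : 3 ≤ p) (l : ℝ) : lowMT hq (coEtam hq l) = 1 := by
  rw [coEtam_eq hq hp, map_add, lowMT_tM hq hp, GaussRel.lowerM_B (v := tv hq) (isTwDer_lowMT hq hp)
    (lowMT_tP hq) (lowMT_tDi hq l) (lowMT_one_tmul hq hp _), add_zero]

theorem lowMT_nilp_mul (hodd : Odd p) (hp : 3 ≤ p) (l : ℝ) (z : EtaDelta hq ⊗[ℂ] Eta hq) :
    lowMT hq (nilp hq l * z) = nilp hq l * lowMT hq z := by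
  rw [isTwDer_lowMT hq hp, scaleT_nilp hq hodd hp]
  rw [nilp_eq hq hodd hp, GaussRel.lowerM_np (x := tx hq) (isTwDer_lowMT hq hp) (lowMT_tP hq)
    (lowMT_tD hq l) (lowMT_one_tmul hq hp _), zero_mul, zero_add]

theorem lowMT_nilm (hodd : Odd p) (hp : 3 ≤ p) (l : ℝ) :
    lowMT hq (nilm hq l) = (qFact q (p - 1))⁻¹ • (coEtam hq l ^ (p - 1) - tM hq ^ (p - 1)) := by
  have h := (gaussRel hq hp l).lowerM_nm hq hodd hp (isTwDer_lowMT hq hp) (lowMT_tM hq hp)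
    (lowMT_tP hq) (lowMT_tDi hq l) (lowMT_one_tmul hq hp _)
    (by rw [scaleT_tM, neg_neg, chi_one]) (by rw [scaleT_tM, chi_neg_one])
    (by rw [scaleT_B hq hodd hp, chi_one])
  rw [nilm_eq hq hodd hp, coEtam_eq hq hp, smul_sub, ← h, add_sub_cancel_right]

theorem lowPT_coEtap (hodd : Odd p) (hp : 3 ≤ p) (l : ℝ) :
    lowPT hq (coEtap hq l) =
      1 + (1 + q ^ 2) • (coEtap hq l * bElem q p (tP hq) (tDi hq l) (tv hq)) := by
  have hg := gaussRel hq hp l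
  have hq0 := hq.ne_zero (show p ≠ 0 by omega)
  rw [coEtap_eq, hg.xp_mul_B hq hodd hp]
  refine hg.lowerP_xp hq0 (isTwDer_lowPT hq hp) (lowPT_tP hq hp)
    (lowPT_tD hq l) (lowPT_tDi hq l) (lowPT_one_tmul hq hp _) (lowPT_one_tmul hq hp _)
    (lowPT_one_tmul hq hp _) ?_ ?_ ?_ ?_ ?_ ?_ ?_
  · rw [AlgHom.comp_apply, killT_tP, scaleT_tP, chi_one]
  · rw [AlgHom.comp_apply, killT_tD, scaleT_tD, chi_one]
  · rw [AlgHom.comp_apply, killT_tDi, scaleT_tDi, chi_one]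
  · rw [AlgHom.comp_apply, tu, killT_one_tmul, scaleT_one_tmul]
  · rw [AlgHom.comp_apply, tv, killT_one_tmul, scaleT_one_tmul]
  · rw [AlgHom.comp_apply, tx, killT_one_tmul, scaleT_one_tmul]
  · refine GaussRel.map_W (c := q⁻¹) (inv_ne_zero hq0) ?_ ?_ ?_ ?_ ?_ ?_
    · rw [AlgHom.comp_apply, killT_tP, scaleT_tP, chi_neg_one]
    · rw [AlgHom.comp_apply, killT_tD, scaleT_tD, chi_neg_one]
    · rw [AlgHom.comp_apply, killT_tDi, scaleT_tDi, chi_neg_one]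
    · rw [AlgHom.comp_apply, tu, killT_one_tmul, scaleT_one_tmul]
    · rw [AlgHom.comp_apply, tv, killT_one_tmul, scaleT_one_tmul]
    · rw [AlgHom.comp_apply, tx, killT_one_tmul, scaleT_one_tmul]

theorem lowPT_coEtam (hodd : Odd p) (hp : 3 ≤ p) (l : ℝ) :
    lowPT hq (coEtam hq l) = -bElem q p (tP hq) (tDi hq l) (tv hq) ^ 2 := by
  have hg := gaussRel hq hp l
  have hq0 := hq.ne_zero (show p ≠ 0 by omega)
  rw [coEtam_eq hq hp, map_add, lowPT_tM, zero_add]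
  refine hg.lowerP_B hq hodd hp (isTwDer_lowPT hq hp) (lowPT_tP hq hp)
    (lowPT_tD hq l) (lowPT_tDi hq l) (lowPT_one_tmul hq hp _) (lowPT_one_tmul hq hp _)
    (lowPT_one_tmul hq hp _) ?_ ?_ ?_ ?_ ?_
  · rw [AlgHom.comp_apply, killT_tDi, scaleT_tDi, chi_one]
  · rw [AlgHom.comp_apply, tu, killT_one_tmul, scaleT_one_tmul]
  · rw [AlgHom.comp_apply, tv, killT_one_tmul, scaleT_one_tmul]
  · refine GaussRel.map_W (c := q) hq0 ?_ ?_ ?_ ?_ ?_ ?_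
    · rw [AlgHom.comp_apply, killT_tP, scaleT_tP, chi_one]
    · rw [AlgHom.comp_apply, killT_tD, scaleT_tD, chi_one]
    · rw [AlgHom.comp_apply, killT_tDi, scaleT_tDi, chi_one]
    · rw [AlgHom.comp_apply, tu, killT_one_tmul, scaleT_one_tmul]
    · rw [AlgHom.comp_apply, tv, killT_one_tmul, scaleT_one_tmul]
    · rw [AlgHom.comp_apply, tx, killT_one_tmul, scaleT_one_tmul]
  · rw [AlgHom.comp_apply, killT_B hq hodd hp, scaleT_B hq hodd hp, chi_neg_one, inv_inv]

theorem lowPT_nilm_mul (hodd : Odd p) (hp : 3 ≤ p) (l : ℝ) (z : EtaDelta hq ⊗[ℂ] Eta hq) :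
    lowPT hq (nilm hq l * z) = 0 := by
  rw [nilm_eq hq hodd hp]
  refine GaussRel.lowerP_nm_mul (isTwDer_lowPT hq hp) (lowPT_tM hq) ?_ _ z
  rw [AlgHom.comp_apply, killT_tM hq hp, map_zero]

theorem lowPT_nilp (hodd : Odd p) (hp : 3 ≤ p) (l : ℝ) :
    lowPT hq (nilp hq l) = (qFact q (p - 1))⁻¹ • (coEtap hq l ^ (p - 1) - tP hq ^ (p - 1)) := by
  have h := (gaussRel hq hp l).lowerP_np hq hodd hp (isTwDer_lowPT hq hp) (lowPT_tP hq hp)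
    (lowPT_tD hq l) (lowPT_one_tmul hq hp _)
    (by rw [AlgHom.comp_apply, killT_tP, scaleT_tP, chi_neg_one])
    (by rw [AlgHom.comp_apply, killT_tP, scaleT_tP, chi_one])
    (by rw [AlgHom.comp_apply, killT_tD, scaleT_tD, chi_one])
    (by rw [AlgHom.comp_apply, tx, killT_one_tmul, scaleT_one_tmul])
  rw [nilp_eq hq hodd hp, coEtap_eq, smul_sub, ← h, add_sub_cancel_right]

theorem nilm_mul_coEtam_pow (hodd : Odd p) (hp : 3 ≤ p) (l : ℝ) :
    nilm hq l * coEtam hq l ^ (p - 1) = 0 := by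
  have hg := gaussRel hq hp l
  rw [nilm_eq hq hodd hp, coEtam_eq hq hp]
  exact middlePow_mul_add_pow hq.inv hodd hp (hg.B_mul_M hq hodd hp) hg.M_pow
    (hg.B_pow hq hodd hp)

theorem nilp_mul_coEtap_pow (hodd : Odd p) (hp : 3 ≤ p) (l : ℝ) :
    nilp hq l * coEtap hq l ^ (p - 1) = 0 := by
  have hg := gaussRel hq hp l
  rw [nilp_eq hq hodd hp, coEtap_eq, hg.xp_pow_pred hq hodd hp]
  exact middlePow_mul_add_pow hq hodd hp
    (qcomm_swap (pow_ne_zero 2 (hq.ne_zero (by omega))) hg.P_Q) hg.P_pow (hg.Q_pow hq hodd)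

end Concrete

/-! ### The action of `E₊, E₋, K` on the Grassmann variables -/

section EtaOperators

variable {p : ℕ} [NeZero p] {q : ℂ} (hq : IsPrimitiveRoot q p)

/-- The automorphism `η₊ ↦ w η₊`, `η₋ ↦ w⁻¹ η₋`. -/
def gradeHom (w : ℂˣ) : Eta hq →ₐ[ℂ] Eta hq :=
  diagHom (fun m => (w : ℂ) ^ m.1.val * ((w⁻¹ : ℂˣ) : ℂ) ^ m.2.val) (by simp) (fun x y => by
    rw [etaCocycle_c]
    by_cases h1 : x.1.val + y.1.val < p
    · by_cases h2 : x.2.val + y.2.val < p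
      · rw [Prod.fst_add, Prod.snd_add, ZMod.val_add_of_lt h1, ZMod.val_add_of_lt h2, pow_add,
          pow_add]
        ring
      · simp [trunc, h2]
    · simp [trunc, h1])

theorem gradeHom_e (w : ℂˣ) (m : ZMod p × ZMod p) :
    gradeHom hq w (TwAlg.e _ m) =
      ((w : ℂ) ^ m.1.val * ((w⁻¹ : ℂˣ) : ℂ) ^ m.2.val) • TwAlg.e _ m :=
  diagHom_e m

theorem gradeHom_yp (hp : 3 ≤ p) (w : ℂˣ) : gradeHom hq w (yp hq) = (w : ℂ) • yp hq := by
  rw [yp, gradeHom_e]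
  simp [val_one_of_lt (show 1 < p by omega)]

theorem gradeHom_ym (hp : 3 ≤ p) (w : ℂˣ) :
    gradeHom hq w (ym hq) = ((w⁻¹ : ℂˣ) : ℂ) • ym hq := by
  rw [ym, gradeHom_e]
  simp [val_one_of_lt (show 1 < p by omega)]

theorem gradeHom_gradeHom (w w' : ℂˣ) (y : Eta hq) :
    gradeHom hq w (gradeHom hq w' y) = gradeHom hq (w * w') y := by
  have : (gradeHom hq w).toLinearMap ∘ₗ (gradeHom hq w').toLinearMap =
      (gradeHom hq (w * w')).toLinearMap := linearMap_ext_e fun m => by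
    simp only [LinearMap.comp_apply, AlgHom.toLinearMap_apply, gradeHom_e, map_smul, smul_smul]
    congr 1
    rw [mul_inv, Units.val_mul, Units.val_mul, mul_pow, mul_pow]
    ring
  exact LinearMap.congr_fun this y

theorem gradeHom_one (y : Eta hq) : gradeHom hq 1 y = y := by
  have : (gradeHom hq 1).toLinearMap = LinearMap.id := linearMap_ext_e fun m => by
    simp [gradeHom_e]
  exact LinearMap.congr_fun this y

/-- The root of unity `q` as a unit. -/
def qUnit : ℂˣ := Units.mk0 q (hq.ne_zero (NeZero.ne p))

theorem qUnit_val : (qUnit hq : ℂ) = q := rfl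

theorem qUnit_inv_val : ((qUnit hq)⁻¹ : ℂˣ) = q⁻¹ := by
  rw [Units.val_inv_eq_inv_val, qUnit_val]

theorem qUnit_pow_p : qUnit hq ^ p = 1 := by
  ext
  simp [qUnit_val, hq.pow_eq_one]

theorem adjoin_eta : Algebra.adjoin ℂ {yp hq, ym hq} = ⊤ := by
  rw [eq_top_iff]
  rintro y -
  rw [← (TwAlg.basis (etaCocycle hq)).sum_repr y]
  refine Subalgebra.sum_mem _ fun m _ => Subalgebra.smul_mem _ ?_ _
  rw [TwAlg.basis_apply, e_eq_pow]
  exact mul_mem (pow_mem (Algebra.subset_adjoin (by simp)) _)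
    (pow_mem (Algebra.subset_adjoin (by simp)) _)

/-- A twisted derivation of the algebra generated by `η₊, η₋` is determined by its values on
`η₊, η₋`. -/
theorem IsTwDer.eta_ext {B : Type*} [Ring B] [Algebra ℂ B] {α β : Eta hq →ₐ[ℂ] B}
    {d d' : Eta hq →ₗ[ℂ] B} (h : IsTwDer α β d) (h' : IsTwDer α β d')
    (hP : d (yp hq) = d' (yp hq)) (hM : d (ym hq) = d' (ym hq)) : d = d' := by
  refine h.ext_of_generators h' _ (adjoin_eta hq) ?_
  rintro x (rfl | rfl)
  exacts [hP, hM]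

theorem expl_zero : expl p 0 = 1 := by simp [expl]

/-- The scalar `e^(l/p) q^j`, the value of `e^(λ/p) δ` at a point where `η± = 0`. -/
def evUnit (l : ℝ) (j : ZMod p) : ℂˣ := Units.mk0 (expl p l * chi hq j)
  (mul_ne_zero (expl_ne_zero p l) (chi_ne_zero hq j))

theorem evUnit_zero_one : evUnit hq 0 1 = qUnit hq := by
  ext
  simp [evUnit, qUnit, expl_zero, chi_one]

theorem evUnit_zero_neg_one : evUnit hq 0 (-1) = (qUnit hq)⁻¹ := by
  ext
  rw [qUnit_inv_val]
  simp [evUnit, expl_zero, chi_neg_one]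

theorem evUnit_pow_p (l : ℝ) (j : ZMod p) : (evUnit hq l j : ℂ) ^ p = Complex.exp l := by
  have hp : (p : ℂ) ≠ 0 := Nat.cast_ne_zero.mpr (NeZero.ne p)
  change (expl p l * chi hq j) ^ p = _
  rw [mul_pow, chi_pow_p, mul_one, expl, ← Complex.exp_nat_mul, mul_div_cancel₀ _ hp]

/-- At a point where `η± = 0`, the coaction rescales the Grassmann variables. -/
theorem counitTensor_scaleT_coEta (hodd : Odd p) (hp : 3 ≤ p) (l : ℝ) (j : ZMod p) (y : Eta hq) :
    counitTensor hq (scaleT hq j (coEta hq l y)) = gradeHom hq (evUnit hq l j) y := by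
  have h : ((counitTensor hq).comp (scaleT hq j)).comp (coEtaHom hq hodd hp l) =
      gradeHom hq (evUnit hq l j) := by
    refine eta_algHom_ext hq ?_ ?_
    · have h1 : coEtaHom hq hodd hp l (yp hq) = coEtap hq l := by
        rw [yp, coEtaHom, etaLift_e]
        simp [val_one_of_lt (show 1 < p by omega)]
      rw [AlgHom.comp_apply, AlgHom.comp_apply, h1, scaleT_coEtap hq hp, map_smul,
        counitTensor_coEtap hq (by omega), gradeHom_yp hq hp, smul_smul, mul_comm]
      rfl
    · have h1 : coEtaHom hq hodd hp l (ym hq) = coEtam hq l := by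
        rw [ym, coEtaHom, etaLift_e]
        simp [val_one_of_lt (show 1 < p by omega)]
      rw [AlgHom.comp_apply, AlgHom.comp_apply, h1, scaleT_coEtam hq hodd hp, map_smul,
        counitTensor_coEtam hq (by omega), gradeHom_ym hq hp, smul_smul, exp_neg_div,
        Units.val_inv_eq_inv_val, ← mul_inv, mul_comm]
      rfl
  exact DFunLike.congr_fun h y

theorem coEta_yp (hp : 3 ≤ p) (l : ℝ) : coEta hq l (yp hq) = coEtap hq l := by
  rw [yp, coEta, ← TwAlg.basis_apply, Module.Basis.constr_basis]
  simp [val_one_of_lt (show 1 < p by omega)]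

theorem coEta_ym (hp : 3 ≤ p) (l : ℝ) : coEta hq l (ym hq) = coEtam hq l := by
  rw [ym, coEta, ← TwAlg.basis_apply, Module.Basis.constr_basis]
  simp [val_one_of_lt (show 1 < p by omega)]

theorem scaleT_coEta (hodd : Odd p) (hp : 3 ≤ p) (l : ℝ) (j : ZMod p) (y : Eta hq) :
    scaleT hq j (coEta hq l y) = coEta hq l (gradeHom hq (evUnit hq 0 j) y) := by
  have h : (scaleT hq j).comp (coEtaHom hq hodd hp l) =
      (coEtaHom hq hodd hp l).comp (gradeHom hq (evUnit hq 0 j)) := by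
    refine eta_algHom_ext hq ?_ ?_
    · simp only [AlgHom.comp_apply, coEtaHom_apply, gradeHom_yp hq hp, map_smul, coEta_yp hq hp,
        scaleT_coEtap hq hp]
      simp [evUnit, expl_zero]
    · simp only [AlgHom.comp_apply, coEtaHom_apply, gradeHom_ym hq hp, map_smul, coEta_ym hq hp,
        scaleT_coEtam hq hodd hp]
      simp [evUnit, expl_zero]
  exact DFunLike.congr_fun h y

/-- The operator `(E₋ ⊗ id) Δ` on polynomials in `η₊, η₋`. -/
def etaEm : Eta hq →ₗ[ℂ] Eta hq :=
  (pairE p q)⁻¹ • ((counitTensor hq).toLinearMap ∘ₗ lowMT hq ∘ₗ coEta hq 0)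

/-- The operator `(E₊ ⊗ id) Δ` on polynomials in `η₊, η₋`. -/
def etaEp : Eta hq →ₗ[ℂ] Eta hq :=
  pairE p q • ((counitTensor hq).toLinearMap ∘ₗ lowPT hq ∘ₗ coEta hq 0)

theorem counitTensor_killT (Y : EtaDelta hq ⊗[ℂ] Eta hq) :
    counitTensor hq (killT hq Y) = counitTensor hq Y := by
  have h : (counitHom hq).toLinearMap ∘ₗ (killM hq).toLinearMap = (counitHom hq).toLinearMap :=
    linearMap_ext_e fun m => by
      change counit hq (killM hq _) = counit hq _
      rw [killM_e, map_smul, counit_e]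
      by_cases h : m.2.1 = 0 <;> simp [h]
  have h' : (counitTensor hq).comp (killT hq) = counitTensor hq :=
    Algebra.TensorProduct.ext' fun a b => by
      rw [AlgHom.comp_apply, killT, Algebra.TensorProduct.map_tmul, counitTensor_tmul,
        counitTensor_tmul]
      congr 1
      exact LinearMap.congr_fun h a
  exact DFunLike.congr_fun h' Y

theorem killT_scaleT (j : ZMod p) (Y : EtaDelta hq ⊗[ℂ] Eta hq) :
    killT hq (scaleT hq j Y) = scaleT hq j (killT hq Y) := by
  have h : (killM hq).toLinearMap ∘ₗ (scaleHom hq j).toLinearMap =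
      (scaleHom hq j).toLinearMap ∘ₗ (killM hq).toLinearMap :=
    linearMap_ext_e fun m => by
      simp only [LinearMap.comp_apply, AlgHom.toLinearMap_apply, killM_e, scaleHom_e, map_smul]
      rw [smul_comm]
  have h' : (killT hq).comp (scaleT hq j) = (scaleT hq j).comp (killT hq) :=
    Algebra.TensorProduct.ext' fun a b => by
      simp only [AlgHom.comp_apply, killT, scaleT, Algebra.TensorProduct.map_tmul]
      congr 1
      exact LinearMap.congr_fun h a
  exact DFunLike.congr_fun h' Y

theorem isTwDer_etaEm (hodd : Odd p) (hp : 3 ≤ p) :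
    IsTwDer (gradeHom hq (qUnit hq)⁻¹) (gradeHom hq (qUnit hq)) (etaEm hq) := by
  have h := (((isTwDer_lowMT hq hp).comp_algHom (coEtaHom hq hodd hp 0)).algHom_comp
    (counitTensor hq)).smul (pairE p q)⁻¹
  intro y z
  have h1 := h y z
  simp only [AlgHom.comp_apply, coEtaHom_apply, counitTensor_scaleT_coEta hq hodd hp,
    evUnit_zero_one, evUnit_zero_neg_one] at h1
  exact h1

theorem isTwDer_etaEp (hodd : Odd p) (hp : 3 ≤ p) :
    IsTwDer (gradeHom hq (qUnit hq)⁻¹) (gradeHom hq (qUnit hq)) (etaEp hq) := by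
  have h := (((isTwDer_lowPT hq hp).comp_algHom (coEtaHom hq hodd hp 0)).algHom_comp
    (counitTensor hq)).smul (pairE p q)
  intro y z
  have h1 := h y z
  simp only [AlgHom.comp_apply, ← killT_scaleT, counitTensor_killT, coEtaHom_apply,
    counitTensor_scaleT_coEta hq hodd hp, evUnit_zero_one, evUnit_zero_neg_one] at h1
  exact h1

theorem etaEm_yp (hp : 3 ≤ p) : etaEm hq (yp hq) = 0 := by
  simp [etaEm, coEta_yp hq hp, lowMT_coEtap hq hp]

theorem etaEm_ym (hp : 3 ≤ p) : etaEm hq (ym hq) = algebraMap ℂ _ (pairE p q)⁻¹ := by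
  simp [etaEm, coEta_ym hq hp, lowMT_coEtam hq hp, Algebra.algebraMap_eq_smul_one]

theorem counitTensor_B (hodd : Odd p) (hp : 3 ≤ p) :
    counitTensor hq (bElem q p (tP hq) (tDi hq 0) (tv hq)) = ym hq := by
  rw [← killT_coEtam hq hodd hp, counitTensor_killT, counitTensor_coEtam hq (by omega)]
  simp

theorem etaEp_yp (hodd : Odd p) (hp : 3 ≤ p) :
    etaEp hq (yp hq) = pairE p q • (1 + (1 + q ^ 2) • (yp hq * ym hq)) := by
  simp [etaEp, coEta_yp hq hp, lowPT_coEtap hq hodd hp,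
      counitTensor_coEtap hq (show 1 < p by omega),
    counitTensor_B hq hodd hp]

theorem etaEp_ym (hodd : Odd p) (hp : 3 ≤ p) :
    etaEp hq (ym hq) = -(pairE p q • ym hq ^ 2) := by
  simp [etaEp, coEta_ym hq hp, lowPT_coEtam hq hodd hp, counitTensor_B hq hodd hp]

/-- The operator `E₋` raises the difference `a - b` of the degrees of `η₊^a η₋^b` by one. -/
theorem etaEm_gradeHom (hodd : Odd p) (hp : 3 ≤ p) (w : ℂˣ) (y : Eta hq) :
    etaEm hq (gradeHom hq w y) = ((w⁻¹ : ℂˣ) : ℂ) • gradeHom hq w (etaEm hq y) := by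
  have h1 := (isTwDer_etaEm hq hodd hp).comp_algHom (gradeHom hq w)
  have h2 := ((isTwDer_etaEm hq hodd hp).algHom_comp (gradeHom hq w)).smul ((w⁻¹ : ℂˣ) : ℂ)
  have e : ∀ w', (gradeHom hq w).comp (gradeHom hq w') = (gradeHom hq w').comp (gradeHom hq w) :=
    fun w' => AlgHom.ext fun y => by
      simp only [AlgHom.comp_apply, gradeHom_gradeHom, mul_comm]
  rw [e, e] at h2
  refine LinearMap.congr_fun (IsTwDer.eta_ext hq h1 h2 ?_ ?_) y
  · simp [gradeHom_yp hq hp, etaEm_yp hq hp]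
  · simp [gradeHom_ym hq hp, etaEm_ym hq hp]

/-- The operator `E₊` lowers the difference `a - b` of the degrees of `η₊^a η₋^b` by one. -/
theorem etaEp_gradeHom (hodd : Odd p) (hp : 3 ≤ p) (w : ℂˣ) (y : Eta hq) :
    etaEp hq (gradeHom hq w y) = (w : ℂ) • gradeHom hq w (etaEp hq y) := by
  have h1 := (isTwDer_etaEp hq hodd hp).comp_algHom (gradeHom hq w)
  have h2 := ((isTwDer_etaEp hq hodd hp).algHom_comp (gradeHom hq w)).smul (w : ℂ)
  have e : ∀ w', (gradeHom hq w).comp (gradeHom hq w') = (gradeHom hq w').comp (gradeHom hq w) :=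
    fun w' => AlgHom.ext fun y => by
      simp only [AlgHom.comp_apply, gradeHom_gradeHom, mul_comm]
  rw [e, e] at h2
  refine LinearMap.congr_fun (IsTwDer.eta_ext hq h1 h2 ?_ ?_) y
  · simp [gradeHom_yp hq hp, gradeHom_ym hq hp, etaEp_yp hq hodd hp, smul_smul]
  · simp [gradeHom_ym hq hp, etaEp_ym hq hodd hp, smul_smul, smul_pow]
    congr 1
    field_simp

theorem isTwDer_gradeEta : IsTwDer (AlgHom.id ℂ (Eta hq)) (AlgHom.id ℂ _) (gradeEta hq) := by
  have hg : ∀ m, gradeEta hq (TwAlg.e _ m) =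
      (((m.1.val : ℂ) - (m.2.val : ℂ)) / p) • TwAlg.e _ m := fun m => by
    rw [gradeEta, ← TwAlg.basis_apply, Module.Basis.constr_basis, TwAlg.basis_apply]
  refine isTwDer_of_monomials fun x y => ?_
  rw [TwAlg.e_mul_e, map_smul, hg, hg, hg]
  simp only [AlgHom.coe_id, id_eq, smul_mul_assoc, mul_smul_comm, TwAlg.e_mul_e, smul_smul,
    ← add_smul]
  congr 1
  rw [etaCocycle_c, Prod.fst_add, Prod.snd_add]
  by_cases h1 : x.1.val + y.1.val < p
  · by_cases h2 : x.2.val + y.2.val < p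
    · rw [ZMod.val_add_of_lt h1, ZMod.val_add_of_lt h2]
      push_cast
      ring
    · simp [trunc, h2]
  · simp [trunc, h1]

theorem gradeEta_yp (hp : 3 ≤ p) : gradeEta hq (yp hq) = (p : ℂ)⁻¹ • yp hq := by
  rw [gradeEta, yp, ← TwAlg.basis_apply, Module.Basis.constr_basis, TwAlg.basis_apply]
  simp [val_one_of_lt (show 1 < p by omega)]

theorem gradeEta_ym (hp : 3 ≤ p) : gradeEta hq (ym hq) = -(p : ℂ)⁻¹ • ym hq := by
  rw [gradeEta, ym, ← TwAlg.basis_apply, Module.Basis.constr_basis, TwAlg.basis_apply]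
  simp [val_one_of_lt (show 1 < p by omega), neg_div]

theorem gradeEta_gradeHom (w : ℂˣ) (y : Eta hq) :
    gradeEta hq (gradeHom hq w y) = gradeHom hq w (gradeEta hq y) := by
  have : gradeEta hq ∘ₗ (gradeHom hq w).toLinearMap =
      (gradeHom hq w).toLinearMap ∘ₗ gradeEta hq := linearMap_ext_e fun m => by
    have hg : gradeEta hq (TwAlg.e _ m) =
        (((m.1.val : ℂ) - (m.2.val : ℂ)) / p) • TwAlg.e _ m := by
      rw [gradeEta, ← TwAlg.basis_apply, Module.Basis.constr_basis, TwAlg.basis_apply]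
    simp only [LinearMap.comp_apply, AlgHom.toLinearMap_apply, gradeHom_e, map_smul, hg]
    rw [smul_comm]
  exact LinearMap.congr_fun this y

theorem isTwDer_commutator_gradeEta {w w' : ℂˣ} {E : Eta hq →ₗ[ℂ] Eta hq}
    (hE : IsTwDer (gradeHom hq w) (gradeHom hq w') E) :
    IsTwDer (gradeHom hq w) (gradeHom hq w') (E ∘ₗ gradeEta hq - gradeEta hq ∘ₗ E) := by
  intro y z
  simp only [LinearMap.sub_apply, LinearMap.comp_apply, isTwDer_gradeEta hq y z,
    hE y z, map_add, hE (gradeEta hq y) z, hE y (gradeEta hq z), isTwDer_gradeEta hq (E y),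
        isTwDer_gradeEta hq (gradeHom hq w y),
    AlgHom.coe_id, id_eq, gradeEta_gradeHom, sub_mul, mul_sub]
  abel

theorem gradeEta_mul (y z : Eta hq) :
    gradeEta hq (y * z) = gradeEta hq y * z + y * gradeEta hq z := isTwDer_gradeEta hq y z

theorem etaEm_gradeEta (hodd : Odd p) (hp : 3 ≤ p) (y : Eta hq) :
    etaEm hq (gradeEta hq y) - gradeEta hq (etaEm hq y) = -(p : ℂ)⁻¹ • etaEm hq y := by
  refine LinearMap.congr_fun (IsTwDer.eta_ext hq
    (isTwDer_commutator_gradeEta hq (isTwDer_etaEm hq hodd hp))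
    ((isTwDer_etaEm hq hodd hp).smul (-(p : ℂ)⁻¹)) ?_ ?_) y
  · simp [gradeEta_yp hq hp, etaEm_yp hq hp]
  · simp [gradeEta_ym hq hp, etaEm_ym hq hp, Algebra.algebraMap_eq_smul_one,
      (isTwDer_gradeEta hq).map_one]

theorem etaEp_gradeEta (hodd : Odd p) (hp : 3 ≤ p) (y : Eta hq) :
    etaEp hq (gradeEta hq y) - gradeEta hq (etaEp hq y) = (p : ℂ)⁻¹ • etaEp hq y := by
  refine LinearMap.congr_fun (IsTwDer.eta_ext hq
    (isTwDer_commutator_gradeEta hq (isTwDer_etaEp hq hodd hp))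
    ((isTwDer_etaEp hq hodd hp).smul (p : ℂ)⁻¹) ?_ ?_) y
  · simp [gradeEta_yp hq hp, gradeEta_ym hq hp, etaEp_yp hq hodd hp, gradeEta_mul,
      (isTwDer_gradeEta hq).map_one]
  · simp [gradeEta_ym hq hp, etaEp_ym hq hodd hp, sq, gradeEta_mul]
    module

/-- The commutator of `E₋` and `E₊` on the Grassmann variables. Both sides are twisted derivations
with the same twists, so that it suffices to compare them on `η₊` and `η₋`. -/
theorem etaEm_etaEp (hodd : Odd p) (hp : 3 ≤ p) (y : Eta hq) :
    etaEm hq (etaEp hq y) - etaEp hq (etaEm hq y) =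
      (q - q⁻¹)⁻¹ • (gradeHom hq (qUnit hq ^ 2) y - gradeHom hq ((qUnit hq)⁻¹ ^ 2) y) := by
  have hm := isTwDer_etaEm hq hodd hp
  have hP := isTwDer_etaEp hq hodd hp
  have hq0 := hq.ne_zero (show p ≠ 0 by omega)
  have hs := sub_inv_ne_zero hq hp
  have he : pairE p q ≠ 0 := mul_ne_zero (pow_ne_zero _ Complex.I_ne_zero) (pow_ne_zero _ hq0)
  have hs2 : q ^ 2 - 1 ≠ 0 := fun h => hs (by field_simp; simpa using h)
  have h1 : IsTwDer (gradeHom hq ((qUnit hq)⁻¹ ^ 2)) (gradeHom hq (qUnit hq ^ 2))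
      (etaEm hq ∘ₗ etaEp hq - etaEp hq ∘ₗ etaEm hq) := fun y z => by
    simp only [LinearMap.sub_apply, LinearMap.comp_apply, hP y z, hm y z, map_add,
      hm (etaEp hq y), hP (etaEm hq y), hm (gradeHom hq _ y), hP (gradeHom hq _ y),
      gradeHom_gradeHom, etaEm_gradeHom hq hodd hp, etaEp_gradeHom hq hodd hp, smul_mul_assoc,
      mul_smul_comm, inv_inv, sub_mul, mul_sub, ← sq]
    abel
  have h2 : IsTwDer (gradeHom hq ((qUnit hq)⁻¹ ^ 2)) (gradeHom hq (qUnit hq ^ 2))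
      ((q - q⁻¹)⁻¹ • ((gradeHom hq (qUnit hq ^ 2)).toLinearMap -
        (gradeHom hq ((qUnit hq)⁻¹ ^ 2)).toLinearMap)) := by
    refine IsTwDer.smul (fun y z => ?_) _
    simp only [LinearMap.sub_apply, AlgHom.toLinearMap_apply, map_mul, sub_mul, mul_sub]
    abel
  refine LinearMap.congr_fun (IsTwDer.eta_ext hq h1 h2 ?_ ?_) y
  · have e : etaEm hq (yp hq * ym hq) = (q⁻¹ * (pairE p q)⁻¹) • yp hq := by
      rw [hm, etaEm_yp hq hp, zero_mul, zero_add, gradeHom_yp hq hp, etaEm_ym hq hp, qUnit_inv_val,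
        Algebra.algebraMap_eq_smul_one, smul_mul_smul_comm, mul_one]
    simp only [LinearMap.sub_apply, LinearMap.comp_apply, etaEp_yp hq hodd hp, etaEm_yp hq hp,
      map_zero, sub_zero, map_smul, map_add, hm.map_one, zero_add, e, smul_smul,
      LinearMap.smul_apply, AlgHom.toLinearMap_apply, gradeHom_yp hq hp, ← sub_smul,
      Units.val_pow_eq_pow_val, qUnit_val, qUnit_inv_val]
    congr 1
    field_simp
    ring
  · have e : etaEm hq (ym hq ^ 2) = ((q + q⁻¹) * (pairE p q)⁻¹) • ym hq := by
      rw [sq, hm, etaEm_ym hq hp, gradeHom_ym hq hp, gradeHom_ym hq hp, inv_inv, qUnit_inv_val,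
        Algebra.algebraMap_eq_smul_one, smul_mul_smul_comm, smul_mul_smul_comm, mul_one, one_mul,
        ← add_smul, qUnit_val]
      congr 1
      ring
    simp only [LinearMap.sub_apply, LinearMap.comp_apply, etaEp_ym hq hodd hp, etaEm_ym hq hp,
      Algebra.algebraMap_eq_smul_one, map_smul, hP.map_one, smul_zero, sub_zero, e,
      smul_smul, LinearMap.smul_apply, AlgHom.toLinearMap_apply, gradeHom_ym hq hp, ← sub_smul,
      ← inv_pow, inv_inv, Units.val_pow_eq_pow_val, qUnit_val, qUnit_inv_val, ← neg_smul]
    congr 1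
    field_simp
    ring

/-- The degenerate case of `GaussRel` at the unit of the supergroup. -/
theorem gaussRel_eta (hp : 3 ≤ p) : GaussRel q p 0 0 1 1 (yp hq) (ym hq) (xEta hq) where
  P_D := by simp
  M_D := by simp
  M_P := by simp
  D_Di := by simp
  Di_D := by simp
  v_u := ym_mul_yp hq (by omega)
  P_pow := zero_pow (by omega)
  M_pow := zero_pow (by omega)
  u_pow := yp_pow_p hq (by omega)
  v_pow := ym_pow_p hq hp
  x_eq := one_add_mul_xEta hq hp
  u_P := Commute.zero_right _
  u_M := Commute.zero_right _
  u_D := Commute.one_right _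
  u_Di := Commute.one_right _
  v_P := Commute.zero_right _
  v_M := Commute.zero_right _
  v_D := Commute.one_right _
  v_Di := Commute.one_right _
  x_P := Commute.zero_right _
  x_M := Commute.zero_right _
  x_D := Commute.one_right _

theorem gradeHom_xEta (hp : 3 ≤ p) (w : ℂˣ) : gradeHom hq w (xEta hq) = (w : ℂ) • xEta hq := by
  have hg := gaussRel_eta hq hp
  apply hg.isUnit.mul_left_cancel
  have h := congrArg (gradeHom hq w) hg.x_eq
  rw [map_mul, map_add, map_mul, map_one, gradeHom_yp hq hp, gradeHom_ym hq hp,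
    smul_mul_smul_comm, Units.mul_inv, one_smul] at h
  rw [h, mul_smul_comm, hg.x_eq]

theorem etaEp_yp_mul_ym (hodd : Odd p) (hp : 3 ≤ p) :
    etaEp hq (yp hq * ym hq) = (pairE p q * q⁻¹) • yElem q (yp hq) (ym hq) := by
  rw [isTwDer_etaEp hq hodd hp, etaEp_yp hq hodd hp, etaEp_ym hq hodd hp, gradeHom_yp hq hp,
    gradeHom_ym hq hp, qUnit_inv_val, yElem, smul_mul_smul_comm, mul_neg, smul_mul_smul_comm,
    add_mul, one_mul, smul_mul_assoc, sq (ym hq), ← mul_assoc, mul_comm q⁻¹, ← smul_neg,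
    ← smul_add, add_smul, one_smul]
  congr 1
  abel

theorem etaEp_yElem (hodd : Odd p) (hp : 3 ≤ p) : etaEp hq (yElem q (yp hq) (ym hq)) = 0 := by
  have hq0 := hq.ne_zero (show p ≠ 0 by omega)
  have hg := gaussRel_eta hq hp
  have hE := isTwDer_etaEp hq hodd hp
  have h1 : gradeHom hq (qUnit hq) (1 + yp hq * ym hq) = 1 + yp hq * ym hq := by
    rw [map_add, map_mul, map_one, gradeHom_yp hq hp, gradeHom_ym hq hp,
      smul_mul_smul_comm, Units.mul_inv, one_smul]
  rw [← hg.v_mul, hE, h1, map_add, hE.map_one, zero_add, etaEp_yp_mul_ym hq hodd hp,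
    etaEp_ym hq hodd hp, gradeHom_ym hq hp, inv_inv, qUnit_val, smul_mul_smul_comm, ← hg.v_mul,
    neg_mul, smul_mul_assoc, sq, mul_assoc, mul_comm (pairE p q), mul_inv_cancel_left₀ hq0,
    neg_add_cancel]

/-- In terms of `x = (1 + η₊ η₋)⁻¹ η₊` the operator `E₊` is a `q`-derivative. -/
theorem etaEp_xEta (hodd : Odd p) (hp : 3 ≤ p) :
    etaEp hq (xEta hq) = algebraMap ℂ _ (pairE p q) := by
  have hq0 := hq.ne_zero (show p ≠ 0 by omega)
  have hg := gaussRel_eta hq hp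
  have hE := isTwDer_etaEp hq hodd hp
  have h1 : gradeHom hq (qUnit hq)⁻¹ (1 + yp hq * ym hq) = 1 + yp hq * ym hq := by
    rw [map_add, map_mul, map_one, gradeHom_yp hq hp, gradeHom_ym hq hp,
      smul_mul_smul_comm, Units.mul_inv, one_smul]
  have h := congrArg (etaEp hq) hg.x_eq
  rw [hE, h1, map_add, hE.map_one, zero_add, etaEp_yp_mul_ym hq hodd hp, gradeHom_xEta hq hp,
    qUnit_val, smul_mul_smul_comm, hg.y_x, etaEp_yp hq hodd hp, inv_mul_cancel_right₀ hq0] at h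
  apply hg.isUnit.mul_left_cancel
  rw [Algebra.algebraMap_eq_smul_one, mul_smul_comm, mul_one, eq_sub_of_add_eq' h, ← smul_sub,
    add_smul, one_smul]
  congr 1
  abel

end EtaOperators

/-! ### The right representation of `U_FS` on the superspace -/

section RightOperators

set_option synthInstance.maxHeartbeats 200000

variable {p : ℕ} [NeZero p] {q : ℂ} (hq : IsPrimitiveRoot q p)

/-- The map `φ ⊗ id` for a linear form `φ` on the algebra generated by `η₊, η₋, δ`. -/
def slice {V : Type} [AddCommGroup V] [Module ℂ V] (φ : EtaDelta hq →ₗ[ℂ] ℂ) :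
    EtaDelta hq ⊗[ℂ] V →ₗ[ℂ] V :=
  (TensorProduct.lid ℂ V).toLinearMap ∘ₗ LinearMap.rTensor V φ

theorem slice_tmul {V : Type} [AddCommGroup V] [Module ℂ V] (φ : EtaDelta hq →ₗ[ℂ] ℂ)
    (a : EtaDelta hq) (v : V) : slice hq φ (a ⊗ₜ v) = φ a • v := by simp [slice]

theorem slice_swapL (φ : EtaDelta hq →ₗ[ℂ] ℂ) (f : Test) (Y : EtaDelta hq ⊗[ℂ] Eta hq) :
    slice hq φ (swapL hq (f ⊗ₜ Y)) = f ⊗ₜ slice hq φ Y := by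
  induction Y using TensorProduct.induction_on with
  | zero => simp
  | add Y Z hY hZ => simp only [TensorProduct.tmul_add, map_add, hY, hZ]
  | tmul a b => rw [swapL_tmul, slice_tmul, slice_tmul, TensorProduct.tmul_smul]

theorem slice_smul {V : Type} [AddCommGroup V] [Module ℂ V] (c : ℂ) (φ : EtaDelta hq →ₗ[ℂ] ℂ)
    (X : EtaDelta hq ⊗[ℂ] V) : slice hq (c • φ) X = c • slice hq φ X := by
  simp [slice, LinearMap.rTensor_smul]

theorem slice_comp (φ : EtaDelta hq →ₗ[ℂ] ℂ) (T : EtaDelta hq →ₗ[ℂ] EtaDelta hq)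
    (Y : EtaDelta hq ⊗[ℂ] Eta hq) :
    slice hq (φ ∘ₗ T) Y = slice hq φ (LinearMap.rTensor (Eta hq) T Y) := by
  simp [slice, LinearMap.rTensor_comp]

theorem slice_counit (Y : EtaDelta hq ⊗[ℂ] Eta hq) :
    slice hq (counit hq) Y = counitTensor hq Y := by
  have : slice hq (counit hq) = (counitTensor hq).toLinearMap :=
    TensorProduct.ext' fun a b => by
      rw [slice_tmul, AlgHom.toLinearMap_apply, counitTensor_tmul]
  exact LinearMap.congr_fun this Y

/-- The components of the coaction on `f ⊗ y`. -/
theorem slice_coact_tmul (hodd : Odd p) (hp : 3 ≤ p) (φ : EtaDelta hq →ₗ[ℂ] ℂ)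
    (g : ℝ × ℝ × ℝ) (f : Test) (y : Eta hq) :
    slice hq φ (coact hq g (f ⊗ₜ y)) = pull g f ⊗ₜ slice hq φ (coEta hq g.2.2 y) +
      pull g (dzm f) ⊗ₜ slice hq φ (nilm hq g.2.2 * coEta hq g.2.2 y) +
      (pull g (dzp f) ⊗ₜ slice hq φ (nilp hq g.2.2 * coEta hq g.2.2 y) +
        pull g (dzp (dzm f)) ⊗ₜ
          slice hq φ (nilp hq g.2.2 * (nilm hq g.2.2 * coEta hq g.2.2 y))) := by
  rw [coact_tmul hq hodd hp, map_add, map_add, map_add, slice_swapL, slice_swapL, slice_swapL,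
    slice_swapL]

theorem pull_zero (f : Test) : pull 0 f = f := by
  refine test_ext fun w => ?_
  change f.1 (boost 0 w) = f.1 w
  simp [boost]

theorem deltaSum_e (a b : ZMod p) (m : ZMod p × ZMod p × ZMod p) :
    deltaSum hq a b (TwAlg.e _ m) = if m.1 = a ∧ m.2.1 = b then chi hq m.2.2 else 0 := by
  obtain ⟨a', b', k⟩ := m
  simp only [deltaSum, LinearMap.sum_apply, LinearMap.smul_apply, TwAlg.coeff_e, Prod.mk.injEq]
  by_cases h : a' = a ∧ b' = b
  · obtain ⟨rfl, rfl⟩ := h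
    simp
  · rw [if_neg h]
    refine Finset.sum_eq_zero fun j _ => ?_
    rw [if_neg, smul_zero]
    rintro ⟨h1, h2, -⟩
    exact h ⟨h1.symm, h2.symm⟩

theorem deltaSum_zero_zero : deltaSum hq 0 0 = counit hq ∘ₗ (scaleHom hq 1).toLinearMap := by
  refine linearMap_ext_e fun m => ?_
  rw [deltaSum_e, LinearMap.comp_apply, AlgHom.toLinearMap_apply, scaleHom_e, map_smul, counit_e]
  by_cases h : m.1 = 0 ∧ m.2.1 = 0
  · simp [h]
  · simp [h]

theorem deltaSum_zero_one (hp : 3 ≤ p) : deltaSum hq 0 1 = counit hq ∘ₗ lowM hq := by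
  refine linearMap_ext_e fun m => ?_
  rw [deltaSum_e, LinearMap.comp_apply, lowM, ofMonomials_e, map_smul, counit_e]
  by_cases h : m.1 = 0 ∧ m.2.1 = 1
  · simp [h, val_one_of_lt (show 1 < p by omega), qNum_one hq hp]
  · have : ¬ (m.1 = 0 ∧ m.2.1 - 1 = 0) := fun h' => h ⟨h'.1, sub_eq_zero.mp h'.2⟩
    simp [h, this]

theorem deltaSum_one_zero (hp : 3 ≤ p) : deltaSum hq 1 0 = counit hq ∘ₗ lowP hq := by
  refine linearMap_ext_e fun m => ?_
  rw [deltaSum_e, LinearMap.comp_apply, lowP, ofMonomials_e, map_smul, counit_e]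
  by_cases h : m.1 = 1 ∧ m.2.1 = 0
  · simp [h, val_one_of_lt (show 1 < p by omega), qNum_one hq hp]
  · have : ¬ (m.1 - 1 = 0 ∧ m.2.1 = 0) := fun h' => h ⟨sub_eq_zero.mp h'.1, h'.2⟩
    simp [h, this]

/-- The operator `y ↦ c x (K y)` on the Grassmann variables; for `x = η±^(p-1)` it is the part
of `R(E±)` that comes with a derivative in `z±`. -/
def topMul (c : ℂ) (x : Eta hq) : Eta hq →ₗ[ℂ] Eta hq :=
  c • (LinearMap.mulLeft ℂ x ∘ₗ (gradeHom hq (qUnit hq)).toLinearMap)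

theorem topMul_apply (c : ℂ) (x y : Eta hq) :
    topMul hq c x y = c • (x * gradeHom hq (qUnit hq) y) := rfl

/-- The part `y ↦ (e / [p-1]!) η₊^(p-1) (K y)` of `R(E₊)`, `e = pairE`. -/
def topP : Eta hq →ₗ[ℂ] Eta hq := topMul hq (pairE p q * (qFact q (p - 1))⁻¹) (yp hq ^ (p - 1))

/-- The part `y ↦ (e⁻¹ / [p-1]!) η₋^(p-1) (K y)` of `R(E₋)`, `e = pairE`. -/
def topM : Eta hq →ₗ[ℂ] Eta hq :=
  topMul hq ((pairE p q)⁻¹ * (qFact q (p - 1))⁻¹) (ym hq ^ (p - 1))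

theorem rightGen_K (hodd : Odd p) (hp : 3 ≤ p) :
    rightGen hq .K = LinearMap.lTensor Test (gradeHom hq (qUnit hq)).toLinearMap := by
  refine TensorProduct.ext' fun f y => ?_
  have h0 : ∀ Y : EtaDelta hq ⊗[ℂ] Eta hq, slice hq (deltaSum hq 0 0) Y =
      counitTensor hq (scaleT hq 1 Y) := fun Y => by
    rw [deltaSum_zero_zero, slice_comp, slice_counit]
    rfl
  change slice hq (deltaSum hq 0 0) (coact hq 0 (f ⊗ₜ y)) = f ⊗ₜ gradeHom hq (qUnit hq) y
  rw [slice_coact_tmul hq hodd hp]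
  simp only [h0, map_mul, pull_zero, Prod.snd_zero,
    scaleT_nilp hq hodd hp, scaleT_nilm hq hodd hp, counitTensor_nilp hq (show 1 < p by omega),
    counitTensor_nilm hq (show 1 < p by omega), zero_mul, TensorProduct.tmul_zero, add_zero,
    counitTensor_scaleT_coEta hq hodd hp, evUnit_zero_one]

/-- The form `⟨E₋, ·⟩` applied to the nilpotent part of `Δ z₋`. -/
theorem counitTensor_lowMT_nilm_mul (hodd : Odd p) (hp : 3 ≤ p) (y : Eta hq) :
    (pairE p q)⁻¹ • counitTensor hq (lowMT hq (nilm hq 0 * coEta hq 0 y)) = topM hq y := by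
  have hM : counitTensor hq (tM hq) = 0 := by
    rw [tM, counitTensor_tmul, counit_etam hq (by omega), zero_smul]
  have h1 : counitTensor hq (coEtam hq 0) = ym hq := by
    rw [counitTensor_coEtam hq (by omega)]
    simp
  rw [isTwDer_lowMT hq hp (nilm hq 0), map_add, map_mul, map_mul, scaleT_nilm hq hodd hp,
    counitTensor_nilm hq (by omega), zero_mul, add_zero, counitTensor_scaleT_coEta hq hodd hp,
    evUnit_zero_one, lowMT_nilm hq hodd hp, map_smul, map_sub, map_pow, map_pow, hM, h1,
    zero_pow (by omega), sub_zero, smul_mul_assoc, smul_smul, topM, topMul_apply]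

/-- The form `⟨E₊, ·⟩` applied to the nilpotent part of `Δ z₊`. -/
theorem counitTensor_lowPT_nilp_mul (hodd : Odd p) (hp : 3 ≤ p) (y : Eta hq) :
    pairE p q • counitTensor hq (lowPT hq (nilp hq 0 * coEta hq 0 y)) = topP hq y := by
  have hP : counitTensor hq (tP hq) = 0 := by
    rw [tP, counitTensor_tmul, counit_etap hq (by omega), zero_smul]
  have h1 : counitTensor hq (coEtap hq 0) = yp hq := by
    rw [counitTensor_coEtap hq (by omega)]
    simp
  rw [isTwDer_lowPT hq hp (nilp hq 0), map_add, map_mul, map_mul, AlgHom.comp_apply,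
    AlgHom.comp_apply, ← killT_scaleT, ← killT_scaleT, counitTensor_killT, counitTensor_killT,
    scaleT_nilp hq hodd hp,
    counitTensor_nilp hq (by omega), zero_mul, add_zero, counitTensor_scaleT_coEta hq hodd hp,
    evUnit_zero_one, lowPT_nilp hq hodd hp, map_smul, map_sub, map_pow, map_pow, hP, h1,
    zero_pow (by omega), sub_zero, smul_mul_assoc, smul_smul, topP, topMul_apply]

theorem slice_Em_coact_tmul (hodd : Odd p) (hp : 3 ≤ p) (f : Test) (y : Eta hq) :
    slice hq ((pairE p q)⁻¹ • deltaSum hq 0 1) (coact hq 0 (f ⊗ₜ y)) =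
      f ⊗ₜ etaEm hq y + dzm f ⊗ₜ topM hq y := by
  have h0 : ∀ Y : EtaDelta hq ⊗[ℂ] Eta hq, slice hq ((pairE p q)⁻¹ • deltaSum hq 0 1) Y =
      (pairE p q)⁻¹ • counitTensor hq (lowMT hq Y) := fun Y => by
    rw [slice_smul, deltaSum_zero_one hq hp, slice_comp, slice_counit, lowMT]
  have h1 : ∀ z, counitTensor hq (nilp hq 0 * z) = 0 := fun z => by
    rw [map_mul, counitTensor_nilp hq (by omega), zero_mul]
  have h2 : (pairE p q)⁻¹ • counitTensor hq (lowMT hq (coEta hq 0 y)) = etaEm hq y := rfl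
  rw [slice_coact_tmul hq hodd hp, Prod.snd_zero, Prod.snd_zero, h0, h0, h0, h0,
    lowMT_nilp_mul hq hodd hp, lowMT_nilp_mul hq hodd hp, h1, h1, smul_zero,
    TensorProduct.tmul_zero, TensorProduct.tmul_zero, add_zero, add_zero,
    counitTensor_lowMT_nilm_mul hq hodd hp, h2, pull_zero, pull_zero]

theorem slice_Ep_coact_tmul (hodd : Odd p) (hp : 3 ≤ p) (f : Test) (y : Eta hq) :
    slice hq (pairE p q • deltaSum hq 1 0) (coact hq 0 (f ⊗ₜ y)) =
      f ⊗ₜ etaEp hq y + dzp f ⊗ₜ topP hq y := by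
  have h0 : ∀ Y : EtaDelta hq ⊗[ℂ] Eta hq, slice hq (pairE p q • deltaSum hq 1 0) Y =
      pairE p q • counitTensor hq (lowPT hq Y) := fun Y => by
    rw [slice_smul, deltaSum_one_zero hq hp, slice_comp, slice_counit, lowPT]
  have h1 : ∀ z, lowPT hq (nilp hq 0 * (nilm hq 0 * z)) = 0 := fun z => by
    rw [commute_assoc (nilp_commute_nilm hq hodd hp 0), lowPT_nilm_mul hq hodd hp]
  have h2 : pairE p q • counitTensor hq (lowPT hq (coEta hq 0 y)) = etaEp hq y := rfl
  rw [slice_coact_tmul hq hodd hp, Prod.snd_zero, Prod.snd_zero, h0, h0, h0, h0,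
    lowPT_nilm_mul hq hodd hp, h1, map_zero, smul_zero,
    TensorProduct.tmul_zero, TensorProduct.tmul_zero, add_zero, add_zero,
    counitTensor_lowPT_nilp_mul hq hodd hp, h2, pull_zero, pull_zero]

theorem rightGen_Em (hodd : Odd p) (hp : 3 ≤ p) :
    rightGen hq .Em = LinearMap.lTensor Test (etaEm hq) + TensorProduct.map dzm (topM hq) := by
  refine TensorProduct.ext' fun f y => ?_
  exact slice_Em_coact_tmul hq hodd hp f y

theorem rightGen_Ep (hodd : Odd p) (hp : 3 ≤ p) :
    rightGen hq .Ep = LinearMap.lTensor Test (etaEp hq) + TensorProduct.map dzp (topP hq) := by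
  refine TensorProduct.ext' fun f y => ?_
  exact slice_Ep_coact_tmul hq hodd hp f y

end RightOperators

/-! ### The `p`-th powers of twisted derivations -/

section PowLeibniz

/-- If `R` obeys a twisted Leibniz rule with respect to the pairing `μ`, with `q`-commuting
constituents, then the mixed terms in the Leibniz rule of `R ^ p` cancel. -/
theorem pow_leibniz {p : ℕ} {r : ℂ} (hr : IsPrimitiveRoot r p) (hodd : Odd p) (hp : 3 ≤ p)
    {V W : Type} [AddCommGroup V] [Module ℂ V] [AddCommGroup W] [Module ℂ W]
    (μ : V ⊗[ℂ] W →ₗ[ℂ] V) (R L : Module.End ℂ V) (K E : Module.End ℂ W)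
    (h1 : L * R = r⁻¹ • (R * L)) (h2 : E * K = r⁻¹ • (K * E))
    (hμ : ∀ x, R (μ x) = μ (TensorProduct.map R K x + TensorProduct.map L E x))
    (x : V ⊗[ℂ] W) :
    (R ^ p) (μ x) = μ (TensorProduct.map (R ^ p) (K ^ p) x +
      TensorProduct.map (L ^ p) (E ^ p) x) := by
  have hq : TensorProduct.map L E * TensorProduct.map R K =
      (r ^ 2)⁻¹ • (TensorProduct.map R K * TensorProduct.map L E) := by
    rw [← TensorProduct.map_mul, ← TensorProduct.map_mul, h1, h2, TensorProduct.map_smul_left,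
      TensorProduct.map_smul_right, smul_smul, sq, mul_inv]
  have hs := add_pow_of_qcomm hr hodd hp hq
  have hn : ∀ n x, (R ^ n) (μ x) =
      μ (((TensorProduct.map R K + TensorProduct.map L E) ^ n) x) := fun n => by
    induction n with
    | zero => intro x; rfl
    | succ n ih =>
      intro x
      rw [pow_succ, Module.End.mul_apply, hμ, pow_succ, Module.End.mul_apply,
        ← LinearMap.add_apply, ih]
  rw [hn, hs, ← TensorProduct.map_pow, ← TensorProduct.map_pow, LinearMap.add_apply]

variable {p : ℕ} [NeZero p] {q : ℂ} (hq : IsPrimitiveRoot q p)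

theorem gradeHom_qUnit_inv_apply (y : Eta hq) :
    gradeHom hq (qUnit hq)⁻¹ (gradeHom hq (qUnit hq) y) = y := by
  rw [gradeHom_gradeHom, inv_mul_cancel, gradeHom_one]

theorem gradeHom_qUnit_apply_inv (y : Eta hq) :
    gradeHom hq (qUnit hq) (gradeHom hq (qUnit hq)⁻¹ y) = y := by
  rw [gradeHom_gradeHom, mul_inv_cancel, gradeHom_one]

theorem gradeHom_pow (w : ℂˣ) (n : ℕ) :
    ((gradeHom hq w).toLinearMap : Module.End ℂ (Eta hq)) ^ n =
      (gradeHom hq (w ^ n)).toLinearMap := by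
  induction n with
  | zero => exact LinearMap.ext fun y => by simp [gradeHom_one]
  | succ n ih =>
    refine LinearMap.ext fun y => ?_
    rw [pow_succ, ih, Module.End.mul_apply, AlgHom.toLinearMap_apply, AlgHom.toLinearMap_apply,
      gradeHom_gradeHom, pow_succ, AlgHom.toLinearMap_apply]

theorem gradeHom_pow_p {w : ℂˣ} (hw : w ^ p = 1) :
    ((gradeHom hq w).toLinearMap : Module.End ℂ (Eta hq)) ^ p = 1 := by
  rw [gradeHom_pow, hw]
  exact LinearMap.ext fun y => by simp [gradeHom_one]

variable {r : ℂ} {A : Module.End ℂ (Eta hq)}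

theorem gradeHom_inv_mul_of_comm
    (hK : ∀ y, A (gradeHom hq (qUnit hq) y) = r⁻¹ • gradeHom hq (qUnit hq) (A y)) (y : Eta hq) :
    gradeHom hq (qUnit hq)⁻¹ (A y) = r⁻¹ • A (gradeHom hq (qUnit hq)⁻¹ y) := by
  have h := hK (gradeHom hq (qUnit hq)⁻¹ y)
  rw [gradeHom_qUnit_apply_inv] at h
  rw [h, map_smul, gradeHom_qUnit_inv_apply]

/-- The `p`-th power of a twisted derivation of the Grassmann variables is a derivation, and it is
zero if it kills the generators. -/
theorem twDer_pow_eq_zero (hr : IsPrimitiveRoot r p) (hodd : Odd p) (hp : 3 ≤ p)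
    (hA : IsTwDer (gradeHom hq (qUnit hq)⁻¹) (gradeHom hq (qUnit hq)) A)
    (hK : ∀ y, A (gradeHom hq (qUnit hq) y) = r⁻¹ • gradeHom hq (qUnit hq) (A y))
    (hP : (A ^ p) (yp hq) = 0) (hM : (A ^ p) (ym hq) = 0) : A ^ p = 0 := by
  have hr0 : r ≠ 0 := hr.ne_zero (by omega)
  have h := pow_leibniz hr hodd hp (LinearMap.mul' ℂ (Eta hq)) A
    (gradeHom hq (qUnit hq)⁻¹).toLinearMap (gradeHom hq (qUnit hq)).toLinearMap A
    (LinearMap.ext fun y => gradeHom_inv_mul_of_comm hq hK y) (LinearMap.ext hK)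
    (fun x => by
      induction x using TensorProduct.induction_on with
      | zero => simp
      | add x y hx hy => rw [map_add, map_add, hx, hy]; simp only [map_add]; abel
      | tmul y z => simpa using hA y z)
  rw [gradeHom_pow_p hq (qUnit_pow_p hq), gradeHom_pow_p hq (by rw [inv_pow, qUnit_pow_p, inv_one])]
    at h
  have hD : IsTwDer (AlgHom.id ℂ (Eta hq)) (AlgHom.id ℂ _) (A ^ p) := fun y z => by
    simpa using h (y ⊗ₜ z)
  have h0 : IsTwDer (AlgHom.id ℂ (Eta hq)) (AlgHom.id ℂ _) (0 : Eta hq →ₗ[ℂ] Eta hq) :=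
    fun y z => by simp
  exact IsTwDer.eta_ext hq hD h0 hP hM

theorem etaEm_pow_p (hodd : Odd p) (hp : 3 ≤ p) :
    (etaEm hq : Module.End ℂ (Eta hq)) ^ p = 0 := by
  have hm := isTwDer_etaEm hq hodd hp
  obtain ⟨n, hn⟩ : ∃ n, p = n + 2 := ⟨p - 2, by omega⟩
  refine twDer_pow_eq_zero hq hq hodd hp hm (fun y => ?_) ?_ ?_
  · rw [etaEm_gradeHom hq hodd hp, qUnit_inv_val]
  · rw [show (etaEm hq : Module.End ℂ (Eta hq)) ^ p = etaEm hq ^ (n + 1) * etaEm hq by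
      rw [← pow_succ]
      exact congrArg (fun k => (etaEm hq : Module.End ℂ (Eta hq)) ^ k) hn, Module.End.mul_apply,
          etaEm_yp hq hp, map_zero]
  · rw [show (etaEm hq : Module.End ℂ (Eta hq)) ^ p = etaEm hq ^ n * etaEm hq * etaEm hq by
      rw [← pow_succ, ← pow_succ]
      exact congrArg (fun k => (etaEm hq : Module.End ℂ (Eta hq)) ^ k) hn, Module.End.mul_apply,
          Module.End.mul_apply,
      etaEm_ym hq hp, Algebra.algebraMap_eq_smul_one, map_smul, hm.map_one, smul_zero, map_zero]

theorem etaEp_ym_pow (hodd : Odd p) (hp : 3 ≤ p) (n : ℕ) :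
    etaEp hq (ym hq ^ n) = (-(pairE p q * qNum q n)) • ym hq ^ (n + 1) := by
  have hP := isTwDer_etaEp hq hodd hp
  have hq0 : q ≠ 0 := hq.ne_zero (by omega)
  induction n with
  | zero => rw [pow_zero, hP.map_one, qNum_zero, mul_zero, neg_zero, zero_smul]
  | succ n ih =>
    rw [pow_succ, hP, ih, etaEp_ym hq hodd hp, map_pow, gradeHom_ym hq hp, gradeHom_ym hq hp,
      inv_inv, qUnit_inv_val, qUnit_val, smul_pow, smul_mul_smul_comm, mul_neg,
      smul_mul_smul_comm, ← pow_succ, ← pow_add, ← sub_eq_add_neg, ← sub_smul]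
    congr 1
    have h := qNum_add hq0 1 n
    rw [qNum_one hq hp, pow_one] at h
    rw [add_comm n 1, ← h]
    ring

theorem etaEp_pow_p (hodd : Odd p) (hp : 3 ≤ p) :
    (etaEp hq : Module.End ℂ (Eta hq)) ^ p = 0 := by
  have hP := isTwDer_etaEp hq hodd hp
  obtain ⟨n, hn⟩ : ∃ n, p = n + 3 := ⟨p - 3, by omega⟩
  refine twDer_pow_eq_zero hq hq.inv hodd hp hP (fun y => ?_) ?_ ?_
  · rw [etaEp_gradeHom hq hodd hp, inv_inv, qUnit_val]
  · rw [show (etaEp hq : Module.End ℂ (Eta hq)) ^ p =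
        etaEp hq ^ n * etaEp hq * etaEp hq * etaEp hq by
      rw [← pow_succ, ← pow_succ, ← pow_succ]
      exact congrArg (fun k => (etaEp hq : Module.End ℂ (Eta hq)) ^ k) hn, Module.End.mul_apply,
          Module.End.mul_apply,
      Module.End.mul_apply, etaEp_yp hq hodd hp, map_smul, map_add, hP.map_one,
      zero_add]
    simp only [map_smul]
    rw [etaEp_yp_mul_ym hq hodd hp, map_smul, etaEp_yElem hq hodd hp, smul_zero, map_zero,
      smul_zero, smul_zero]
  · have h : ∀ n, ∃ c : ℂ, ((etaEp hq : Module.End ℂ (Eta hq)) ^ n) (ym hq) =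
        c • ym hq ^ (n + 1) := fun n => by
      induction n with
      | zero => exact ⟨1, by simp⟩
      | succ n ih =>
        obtain ⟨c, hc⟩ := ih
        exact ⟨c * -(pairE p q * qNum q (n + 1)), by
          rw [pow_succ', Module.End.mul_apply, hc, map_smul, etaEp_ym_pow hq hodd hp, smul_smul]⟩
    obtain ⟨c, hc⟩ := h p
    rw [hc, pow_succ, ym_pow_p hq hp, zero_mul, smul_zero]

/-- The `p`-th power of an operator of the form of `R(E₊)` or `R(E₋)`. The variable `x` is one
on which `A` acts as a `q`-derivative. -/
theorem superOp_pow_p (hr : IsPrimitiveRoot r p) (hodd : Odd p) (hp : 3 ≤ p)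
    (hA : IsTwDer (gradeHom hq (qUnit hq)⁻¹) (gradeHom hq (qUnit hq)) A)
    (hK : ∀ y, A (gradeHom hq (qUnit hq) y) = r⁻¹ • gradeHom hq (qUnit hq) (A y))
    (hAp : A ^ p = 0) {x : Eta hq} {c : ℂ} (hx : gradeHom hq (qUnit hq) x = r⁻¹ • x)
    (hxp : x ^ p = 0) (hAx : A x = algebraMap ℂ _ c) (D : Test →ₗ[ℂ] Test) :
    (LinearMap.lTensor Test A +
      TensorProduct.map D (topMul hq (c * (qFact r (p - 1))⁻¹) (x ^ (p - 1))) :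
        Module.End ℂ (Superspace hq)) ^ p = c ^ p • LinearMap.rTensor (Eta hq) D := by
  have hr0 : r ≠ 0 := hr.ne_zero (by omega)
  set N := topMul hq (c * (qFact r (p - 1))⁻¹) (x ^ (p - 1)) with hN
  set R : Module.End ℂ (Superspace hq) := LinearMap.lTensor Test A + TensorProduct.map D N with hR
  have hRt : ∀ f y, R (f ⊗ₜ y) = f ⊗ₜ A y + D f ⊗ₜ N y := fun f y => rfl
  have hx' : gradeHom hq (qUnit hq)⁻¹ x = r • x := by
    have h := congrArg (gradeHom hq (qUnit hq)⁻¹) hx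
    rw [gradeHom_qUnit_inv_apply, map_smul] at h
    conv_rhs => rw [h, smul_smul, mul_inv_cancel₀ hr0, one_smul]
  have hrp : r ^ (p - 1) = r⁻¹ := by
    apply eq_inv_of_mul_eq_one_left
    rw [← pow_succ, Nat.sub_add_cancel (by omega), hr.pow_eq_one]
  have hN1 : ∀ y, gradeHom hq (qUnit hq)⁻¹ (N y) =
      r⁻¹ • N (gradeHom hq (qUnit hq)⁻¹ y) := fun y => by
    rw [hN, topMul_apply, topMul_apply, map_smul, map_mul, map_pow, hx', smul_pow, hrp,
      gradeHom_qUnit_inv_apply, gradeHom_qUnit_apply_inv, smul_mul_assoc, smul_comm]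
  have hN2 : ∀ y z, N (y * z) = N y * gradeHom hq (qUnit hq) z := fun y z => by
    rw [hN, topMul_apply, topMul_apply, map_mul, smul_mul_assoc, mul_assoc]
  set μ : Superspace hq ⊗[ℂ] Eta hq →ₗ[ℂ] Superspace hq :=
    LinearMap.lTensor Test (LinearMap.mul' ℂ (Eta hq)) ∘ₗ
      (TensorProduct.assoc ℂ Test (Eta hq) (Eta hq)).toLinearMap with hμ
  have hμt : ∀ f y z, μ ((f ⊗ₜ y) ⊗ₜ z) = f ⊗ₜ (y * z) := fun f y z => rfl
  have h := pow_leibniz hr hodd hp μ R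
    (LinearMap.lTensor Test (gradeHom hq (qUnit hq)⁻¹).toLinearMap)
    (gradeHom hq (qUnit hq)).toLinearMap A
    (TensorProduct.ext' fun f y => by
      change LinearMap.lTensor Test _ (R (f ⊗ₜ y)) = r⁻¹ • R (f ⊗ₜ gradeHom hq (qUnit hq)⁻¹ y)
      rw [hRt, hRt, map_add, LinearMap.lTensor_tmul, LinearMap.lTensor_tmul,
        AlgHom.toLinearMap_apply, AlgHom.toLinearMap_apply,
        gradeHom_inv_mul_of_comm hq hK, hN1, TensorProduct.tmul_smul,
        TensorProduct.tmul_smul, smul_add])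
    (LinearMap.ext hK)
    (fun X => by
      have : R ∘ₗ μ = μ ∘ₗ (TensorProduct.map R (gradeHom hq (qUnit hq)).toLinearMap +
          TensorProduct.map (LinearMap.lTensor Test (gradeHom hq (qUnit hq)⁻¹).toLinearMap) A) := by
        refine TensorProduct.ext_threefold fun f y z => ?_
        change R (μ ((f ⊗ₜ y) ⊗ₜ z)) = μ (R (f ⊗ₜ y) ⊗ₜ gradeHom hq (qUnit hq) z +
          (f ⊗ₜ gradeHom hq (qUnit hq)⁻¹ y) ⊗ₜ A z)
        rw [hμt, hRt, hRt, hA y z, hN2, TensorProduct.add_tmul, map_add, map_add, hμt, hμt, hμt,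
          TensorProduct.tmul_add]
        abel
      exact LinearMap.congr_fun this X)
  -- `R` lowers the powers of `x` as `A` does, since `N (x ^ (n + 1))` contains `x ^ p`
  have hstep : ∀ (f : Test) (n : ℕ), R (f ⊗ₜ[ℂ] (x ^ (n + 1))) =
      (c * qNum r (n + 1)) • (f ⊗ₜ[ℂ] (x ^ n)) := fun f n => by
    have h1 : A (x ^ (n + 1)) = (c * qNum r (n + 1)) • x ^ n := by
      rw [hA.map_pow_succ (inv_ne_zero hr0) (x' := x) (by rw [hx', inv_inv]) hx hAx
        (by rw [qNum_inv, qNum_one hr hp]), qNum_inv]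
    have h2 : N (x ^ (n + 1)) = 0 := by
      rw [hN, topMul_apply, map_pow, hx, smul_pow, mul_smul_comm, ← pow_add,
        pow_eq_zero_of_le (by omega) hxp, smul_zero, smul_zero]
    rw [hRt, h1, h2, TensorProduct.tmul_zero, add_zero, TensorProduct.tmul_smul]
  have hpow : ∀ (n : ℕ) (f : Test), (R ^ n) (f ⊗ₜ[ℂ] (x ^ n)) = (c ^ n * qFact r n) •
      (f ⊗ₜ[ℂ] 1) := fun n => by
    induction n with
    | zero => intro f; simp [qFact_zero]
    | succ n ih =>
      intro f
      rw [pow_succ, Module.End.mul_apply, hstep, map_smul, ih, smul_smul, qFact_succ, pow_succ]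
      congr 1
      ring
  -- on `f ⊗ 1` the first step leads to `D f ⊗ x ^ (p - 1)` and the others lead back to `D f ⊗ 1`
  have hone : ∀ f : Test, (R ^ p) (f ⊗ₜ[ℂ] 1) = c ^ p • (D f ⊗ₜ[ℂ] 1) := fun f => by
    have hf := qFact_ne_zero hr hodd hp (show p - 1 < p by omega)
    rw [show R ^ p = R ^ (p - 1) * R by rw [← pow_succ, Nat.sub_add_cancel (by omega)],
      Module.End.mul_apply, hRt, hA.map_one, TensorProduct.tmul_zero, zero_add, hN, topMul_apply,
      map_one, mul_one, TensorProduct.tmul_smul, map_smul, hpow, smul_smul]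
    congr 1
    rw [show c ^ p = c ^ (p - 1) * c by rw [← pow_succ, Nat.sub_add_cancel (by omega)]]
    field_simp
  refine TensorProduct.ext' fun f z => ?_
  have hz := h ((f ⊗ₜ[ℂ] 1) ⊗ₜ z)
  rw [hμt, one_mul, TensorProduct.map_tmul, TensorProduct.map_tmul, hAp,
    gradeHom_pow_p hq (qUnit_pow_p hq), hone, LinearMap.zero_apply, TensorProduct.tmul_zero,
    add_zero, Module.End.one_apply, ← TensorProduct.smul_tmul', map_smul, hμt, one_mul] at hz
  rw [hz, LinearMap.smul_apply, LinearMap.rTensor_tmul]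

theorem pairE_pow_p (hq : IsPrimitiveRoot q p) (hodd : Odd p) : pairE p q ^ p = Complex.I := by
  obtain ⟨k, hk⟩ := hodd
  rw [pairE, sqrtq, mul_pow, ← pow_mul, ← pow_mul, mul_comm ((p + 1) / 2), pow_mul q,
    hq.pow_eq_one, one_pow, mul_one, show p * p = 4 * (k ^ 2 + k) + 1 by rw [hk]; ring, pow_succ,
    pow_mul, Complex.I_pow_four, one_pow, one_mul]

theorem pairE_ne_zero (hq : IsPrimitiveRoot q p) : pairE p q ≠ 0 :=
  mul_ne_zero (pow_ne_zero _ Complex.I_ne_zero) (pow_ne_zero _ (hq.ne_zero (NeZero.ne p)))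

theorem rightGen_Em_pow (hodd : Odd p) (hp : 3 ≤ p) :
    (rightGen hq .Em : Module.End ℂ (Superspace hq)) ^ p = rightGen hq .Pm := by
  have h := superOp_pow_p hq hq hodd hp (isTwDer_etaEm hq hodd hp)
    (fun y => by rw [etaEm_gradeHom hq hodd hp, qUnit_inv_val]) (etaEm_pow_p hq hodd hp)
    (x := ym hq) (by rw [gradeHom_ym hq hp, qUnit_inv_val]) (ym_pow_p hq hp) (etaEm_ym hq hp) dzm
  rw [inv_pow, pairE_pow_p hq hodd, Complex.inv_I] at h
  rw [rightGen_Em hq hodd hp]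
  exact h

theorem rightGen_Ep_pow (hodd : Odd p) (hp : 3 ≤ p) :
    (rightGen hq .Ep : Module.End ℂ (Superspace hq)) ^ p = rightGen hq .Pp := by
  have h := superOp_pow_p hq hq.inv hodd hp (isTwDer_etaEp hq hodd hp)
    (fun y => by rw [etaEp_gradeHom hq hodd hp, inv_inv, qUnit_val]) (etaEp_pow_p hq hodd hp)
    (x := xEta hq) (by rw [gradeHom_xEta hq hp, inv_inv, qUnit_val])
    (x_pow_eq_zero (ym_mul_yp hq (by omega)) (yp_pow_p hq (by omega)) hq hodd
      (one_add_mul_xEta hq hp)) (etaEp_xEta hq hodd hp) dzp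
  rw [pairE_pow_p hq hodd, qFact_inv,
      x_pow_pred (ym_mul_yp hq (by omega)) (yp_pow_p hq (by omega)) hq hodd
      (one_add_mul_xEta hq hp)] at h
  rw [rightGen_Ep hq hodd hp]
  exact h

end PowLeibniz

/-! ### The relations of `U_FS` in the right representation -/

section Relations

set_option synthInstance.maxHeartbeats 200000

variable {p : ℕ} [NeZero p] {q : ℂ} (hq : IsPrimitiveRoot q p)

instance : AddCommGroup (Superspace hq) := TensorProduct.addCommGroup

theorem topM_gradeHom (hp : 3 ≤ p) (w : ℂˣ) (y : Eta hq) :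
    topM hq (gradeHom hq w y) = (w : ℂ) ^ (p - 1) • gradeHom hq w (topM hq y) := by
  rw [topM, topMul_apply, topMul_apply, map_smul, map_mul, map_pow, gradeHom_ym hq hp, smul_pow,
    gradeHom_gradeHom, gradeHom_gradeHom, mul_comm w, smul_comm, smul_mul_assoc, smul_smul (_ ^ _),
    ← mul_pow, Units.mul_inv, one_pow, one_smul]

theorem topP_gradeHom (hp : 3 ≤ p) (w : ℂˣ) (y : Eta hq) :
    topP hq (gradeHom hq w y) = ((w⁻¹ : ℂˣ) : ℂ) ^ (p - 1) • gradeHom hq w (topP hq y) := by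
  rw [topP, topMul_apply, topMul_apply, map_smul, map_mul, map_pow, gradeHom_yp hq hp, smul_pow,
    gradeHom_gradeHom, gradeHom_gradeHom, mul_comm w, smul_comm, smul_mul_assoc, smul_smul (_ ^ _),
    ← mul_pow, Units.inv_mul, one_pow, one_smul]

theorem rightGen_Ep_tmul (hodd : Odd p) (hp : 3 ≤ p) (f : Test) (y : Eta hq) :
    rightGen hq .Ep (f ⊗ₜ y) = f ⊗ₜ etaEp hq y + dzp f ⊗ₜ topP hq y := by
  rw [rightGen_Ep hq hodd hp, LinearMap.add_apply, LinearMap.lTensor_tmul, TensorProduct.map_tmul]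

theorem rightGen_Em_tmul (hodd : Odd p) (hp : 3 ≤ p) (f : Test) (y : Eta hq) :
    rightGen hq .Em (f ⊗ₜ y) = f ⊗ₜ etaEm hq y + dzm f ⊗ₜ topM hq y := by
  rw [rightGen_Em hq hodd hp, LinearMap.add_apply, LinearMap.lTensor_tmul, TensorProduct.map_tmul]

/-- The action of the point `η± = 0`, `e^(λ/p) δ = w` of the supergroup on the superspace. -/
def evOp (g : ℝ × ℝ × ℝ) (w : ℂˣ) : Superspace hq →ₗ[ℂ] Superspace hq :=
  TensorProduct.map (pull g) (gradeHom hq w).toLinearMap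

theorem evOp_tmul (g : ℝ × ℝ × ℝ) (w : ℂˣ) (f : Test) (y : Eta hq) :
    evOp hq g w (f ⊗ₜ y) = pull g f ⊗ₜ gradeHom hq w y := rfl

theorem rightGen_Ep_evOp (hodd : Odd p) (hp : 3 ≤ p) (g : ℝ × ℝ × ℝ) {w : ℂˣ}
    (hw : (w : ℂ) ^ p = Complex.exp g.2.2) (F : Superspace hq) :
    rightGen hq .Ep (evOp hq g w F) = (w : ℂ) • evOp hq g w (rightGen hq .Ep F) := by
  have hc : Complex.exp g.2.2 * ((w⁻¹ : ℂˣ) : ℂ) ^ (p - 1) = w := by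
    rw [← hw, show (w : ℂ) ^ p = w * w ^ (p - 1) by
      rw [← pow_succ', Nat.sub_add_cancel (by omega)], mul_assoc, ← mul_pow, Units.mul_inv,
      one_pow, mul_one]
  have : rightGen hq .Ep ∘ₗ evOp hq g w = (w : ℂ) • (evOp hq g w ∘ₗ rightGen hq .Ep) := by
    refine TensorProduct.ext' fun f y => ?_
    rw [LinearMap.comp_apply, LinearMap.smul_apply, LinearMap.comp_apply, evOp_tmul,
      rightGen_Ep_tmul hq hodd hp, rightGen_Ep_tmul hq hodd hp, map_add, evOp_tmul, evOp_tmul,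
      etaEp_gradeHom hq hodd hp, topP_gradeHom hq hp, dzp_pull, TensorProduct.tmul_smul,
      TensorProduct.tmul_smul, ← TensorProduct.smul_tmul', smul_smul, smul_add,
      mul_comm, Complex.ofReal_exp, hc]
  exact LinearMap.congr_fun this F

theorem rightGen_Em_evOp (hodd : Odd p) (hp : 3 ≤ p) (g : ℝ × ℝ × ℝ) {w : ℂˣ}
    (hw : (w : ℂ) ^ p = Complex.exp g.2.2) (F : Superspace hq) :
    rightGen hq .Em (evOp hq g w F) = ((w⁻¹ : ℂˣ) : ℂ) • evOp hq g w (rightGen hq .Em F) := by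
  have hc : Complex.exp (-g.2.2 : ℝ) * (w : ℂ) ^ (p - 1) = ((w⁻¹ : ℂˣ) : ℂ) := by
    rw [Complex.ofReal_neg, Complex.exp_neg, ← hw, show (w : ℂ) ^ p = w * w ^ (p - 1) by
      rw [← pow_succ', Nat.sub_add_cancel (by omega)], mul_inv, mul_assoc,
      inv_mul_cancel₀ (pow_ne_zero _ w.ne_zero), mul_one, Units.val_inv_eq_inv_val]
  have : rightGen hq .Em ∘ₗ evOp hq g w =
      ((w⁻¹ : ℂˣ) : ℂ) • (evOp hq g w ∘ₗ rightGen hq .Em) := by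
    refine TensorProduct.ext' fun f y => ?_
    rw [LinearMap.comp_apply, LinearMap.smul_apply, LinearMap.comp_apply, evOp_tmul,
      rightGen_Em_tmul hq hodd hp, rightGen_Em_tmul hq hodd hp, map_add, evOp_tmul, evOp_tmul,
      etaEm_gradeHom hq hodd hp, topM_gradeHom hq hp, dzm_pull, TensorProduct.tmul_smul,
      TensorProduct.tmul_smul, ← TensorProduct.smul_tmul', smul_smul, smul_add,
      mul_comm, Complex.ofReal_exp, hc]
  exact LinearMap.congr_fun this F

theorem rightGen_K_eq_evOp (hodd : Odd p) (hp : 3 ≤ p) :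
    rightGen hq .K = evOp hq 0 (qUnit hq) := by
  rw [rightGen_K hq hodd hp]
  refine TensorProduct.ext' fun f y => ?_
  rw [evOp_tmul, pull_zero]
  rfl

theorem rightGen_Ep_mul_K (hodd : Odd p) (hp : 3 ≤ p) :
    (rightGen hq .Ep * rightGen hq .K : Module.End ℂ (Superspace hq)) =
      q • (rightGen hq .K * rightGen hq .Ep) := by
  refine LinearMap.ext fun F => ?_
  rw [rightGen_K_eq_evOp hq hodd hp]
  exact rightGen_Ep_evOp hq hodd hp 0 (by simp [qUnit_val, hq.pow_eq_one]) F

theorem rightGen_Em_mul_K (hodd : Odd p) (hp : 3 ≤ p) :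
    (rightGen hq .Em * rightGen hq .K : Module.End ℂ (Superspace hq)) =
      q⁻¹ • (rightGen hq .K * rightGen hq .Em) := by
  refine LinearMap.ext fun F => ?_
  rw [rightGen_K_eq_evOp hq hodd hp, ← qUnit_inv_val hq]
  exact rightGen_Em_evOp hq hodd hp 0 (by simp [qUnit_val, hq.pow_eq_one]) F

theorem rightGen_K_pow (hodd : Odd p) (hp : 3 ≤ p) (n : ℕ) :
    (rightGen hq .K : Module.End ℂ (Superspace hq)) ^ n =
      LinearMap.lTensor Test (gradeHom hq (qUnit hq ^ n)).toLinearMap := by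
  rw [rightGen_K hq hodd hp]
  induction n with
  | zero =>
    refine TensorProduct.ext' fun f y => ?_
    rw [LinearMap.lTensor_tmul, pow_zero, pow_zero, AlgHom.toLinearMap_apply, gradeHom_one]
    rfl
  | succ n ih =>
    rw [pow_succ, ih]
    refine TensorProduct.ext' fun f y => ?_
    rw [Module.End.mul_apply, LinearMap.lTensor_tmul, LinearMap.lTensor_tmul,
      LinearMap.lTensor_tmul, AlgHom.toLinearMap_apply, AlgHom.toLinearMap_apply,
      gradeHom_gradeHom, ← pow_succ, AlgHom.toLinearMap_apply]

theorem rightGen_K_pow_p (hodd : Odd p) (hp : 3 ≤ p) :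
    (rightGen hq .K : Module.End ℂ (Superspace hq)) ^ p = 1 := by
  rw [rightGen_K_pow hq hodd hp, qUnit_pow_p]
  refine TensorProduct.ext' fun f y => ?_
  rw [LinearMap.lTensor_tmul, AlgHom.toLinearMap_apply, gradeHom_one]
  rfl

theorem etaEm_topP (hodd : Odd p) (hp : 3 ≤ p) (y : Eta hq) :
    etaEm hq (topP hq y) = topP hq (etaEm hq y) := by
  have hm := isTwDer_etaEm hq hodd hp
  have hc : ((qUnit hq)⁻¹ : ℂˣ) ^ (p - 1) * (qUnit hq)⁻¹ = 1 := by
    rw [← pow_succ, Nat.sub_add_cancel (by omega), inv_pow, qUnit_pow_p, inv_one]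
  have hc' : (((qUnit hq)⁻¹ : ℂˣ) : ℂ) ^ (p - 1) * (((qUnit hq)⁻¹ : ℂˣ) : ℂ) = 1 := by
    rw [← Units.val_pow_eq_pow_val, ← Units.val_mul, hc, Units.val_one]
  rw [topP, topMul_apply, topMul_apply, map_smul, hm, hm.pow_eq_zero (etaEm_yp hq hp), zero_mul,
    zero_add, map_pow, gradeHom_yp hq hp, smul_pow, etaEm_gradeHom hq hodd hp,
    smul_mul_smul_comm, hc', one_smul]

theorem etaEp_topM (hodd : Odd p) (hp : 3 ≤ p) (y : Eta hq) :
    etaEp hq (topM hq y) = topM hq (etaEp hq y) := by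
  have hP := isTwDer_etaEp hq hodd hp
  have hc' : q ^ (p - 1) * q = 1 := by
    rw [← pow_succ, Nat.sub_add_cancel (by omega), hq.pow_eq_one]
  have h0 := etaEp_ym_pow hq hodd hp (p - 1)
  rw [Nat.sub_add_cancel (by omega), ym_pow_p hq hp, smul_zero] at h0
  rw [topM, topMul_apply, topMul_apply, map_smul, hP, h0, zero_mul,
    zero_add, map_pow, gradeHom_ym hq hp, inv_inv, smul_pow, etaEp_gradeHom hq hodd hp,
    smul_mul_smul_comm, qUnit_val, hc', one_smul]

theorem topM_topP (hp : 3 ≤ p) (y : Eta hq) : topM hq (topP hq y) = topP hq (topM hq y) := by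
  have hq0 : q ≠ 0 := hq.ne_zero (by omega)
  have h1 : q ^ (p - 1) = q⁻¹ := by
    apply eq_inv_of_mul_eq_one_left
    rw [← pow_succ, Nat.sub_add_cancel (by omega), hq.pow_eq_one]
  have h2 := qcomm_pow_pow (ym_mul_yp hq (show 2 < p by omega)) (p - 1) (p - 1)
  rw [topM, topP, topMul_apply, topMul_apply, topMul_apply, topMul_apply, map_smul, map_smul,
    map_mul, map_mul, map_pow, map_pow, gradeHom_yp hq hp, gradeHom_ym hq hp, smul_pow, smul_pow,
    qUnit_val, qUnit_inv_val, inv_pow, h1, inv_inv, smul_mul_assoc, smul_mul_assoc,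
    mul_smul_comm, mul_smul_comm, mul_smul_comm, mul_smul_comm, ← mul_assoc, ← mul_assoc, h2,
    smul_mul_assoc, smul_smul, smul_smul, smul_smul, smul_smul, smul_smul]
  congr 1
  have h3 : (q ^ 2) ^ ((p - 1) * (p - 1)) = q ^ 2 := by
    rw [← pow_mul, show 2 * ((p - 1) * (p - 1)) = (p - 1) * (p - 1) * 2 by ring, pow_mul, pow_mul,
      h1, inv_pow, h1, inv_inv]
  rw [h3]
  field_simp

theorem rightGen_commutator (hodd : Odd p) (hp : 3 ≤ p) :
    (rightGen hq .Em : Module.End ℂ (Superspace hq)) * rightGen hq .Ep -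
        (rightGen hq .Ep : Module.End ℂ (Superspace hq)) * rightGen hq .Em =
      (q - q⁻¹)⁻¹ • ((rightGen hq .K : Module.End ℂ (Superspace hq)) ^ 2 -
        ((rightGen hq .K : Module.End ℂ (Superspace hq)) ^ (p - 1)) ^ 2) := by
  have hu : ((qUnit hq : ℂˣ) ^ (p - 1)) = (qUnit hq)⁻¹ := by
    apply eq_inv_of_mul_eq_one_left
    rw [← pow_succ, Nat.sub_add_cancel (by omega), qUnit_pow_p]
  rw [← pow_mul, rightGen_K_pow hq hodd hp, rightGen_K_pow hq hodd hp, pow_mul, hu]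
  refine TensorProduct.ext' fun f y => ?_
  rw [LinearMap.sub_apply, Module.End.mul_apply, Module.End.mul_apply, LinearMap.smul_apply,
    LinearMap.sub_apply, LinearMap.lTensor_tmul, LinearMap.lTensor_tmul,
    AlgHom.toLinearMap_apply, AlgHom.toLinearMap_apply, ← TensorProduct.tmul_sub,
    ← TensorProduct.tmul_smul, ← etaEm_etaEp hq hodd hp, rightGen_Em_tmul hq hodd hp,
    rightGen_Ep_tmul hq hodd hp, map_add, map_add, rightGen_Em_tmul hq hodd hp,
    rightGen_Em_tmul hq hodd hp, rightGen_Ep_tmul hq hodd hp, rightGen_Ep_tmul hq hodd hp,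
    etaEm_topP hq hodd hp, etaEp_topM hq hodd hp, topM_topP hq hp, dzp_dzm,
    TensorProduct.tmul_sub]
  abel

theorem dTest_euler (v : ℝ × ℝ) (f : Test) :
    dTest v (euler f) = (v.1 : ℂ) • dzp f - (v.2 : ℂ) • dzm f + euler (dTest v f) := by
  refine test_ext fun w => ?_
  have h1 : HasFDerivAt (fun w : ℝ × ℝ => (w.1 : ℂ))
      (Complex.ofRealCLM.comp (ContinuousLinearMap.fst ℝ ℝ ℝ)) w :=
    (Complex.ofRealCLM.comp (ContinuousLinearMap.fst ℝ ℝ ℝ)).hasFDerivAt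
  have h2 : HasFDerivAt (fun w : ℝ × ℝ => (w.2 : ℂ))
      (Complex.ofRealCLM.comp (ContinuousLinearMap.snd ℝ ℝ ℝ)) w :=
    (Complex.ofRealCLM.comp (ContinuousLinearMap.snd ℝ ℝ ℝ)).hasFDerivAt
  have h := ((h1.mul (test_differentiableAt (dzp f) w).hasFDerivAt).sub
    (h2.mul (test_differentiableAt (dzm f) w).hasFDerivAt)).fderiv
  have hc1 : (dTest v (dzp f)).1 w = (dzp (dTest v f)).1 w := by rw [dzp, dTest_comm]
  have hc2 : (dTest v (dzm f)).1 w = (dzm (dTest v f)).1 w := by rw [dzm, dTest_comm]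
  have e : (dTest v (euler f)).1 w = (w.1 : ℂ) * (dTest v (dzp f)).1 w + (v.1 : ℂ) * (dzp f).1 w -
      ((w.2 : ℂ) * (dTest v (dzm f)).1 w + (v.2 : ℂ) * (dzm f).1 w) := by
    refine (DFunLike.congr_fun h v).trans ?_
    simp [mul_comm]
    rfl
  rw [e, hc1, hc2]
  change _ = (v.1 : ℂ) * (dzp f).1 w - (v.2 : ℂ) * (dzm f).1 w +
    ((w.1 : ℂ) * (dzp (dTest v f)).1 w - (w.2 : ℂ) * (dzm (dTest v f)).1 w)
  ring

theorem dzp_euler (f : Test) : dzp (euler f) = dzp f + euler (dzp f) := by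
  have h := dTest_euler (1, 0) f
  rw [← dzp] at h
  simpa using h

theorem dzm_euler (f : Test) : dzm (euler f) = -dzm f + euler (dzm f) := by
  have h := dTest_euler (0, 1) f
  rw [← dzm] at h
  simpa using h

theorem gradeEta_topP (hp : 3 ≤ p) (y : Eta hq) :
    topP hq (gradeEta hq y) = gradeEta hq (topP hq y) + ((p : ℂ)⁻¹ - 1) • topP hq y := by
  have h1 : gradeEta hq (yp hq ^ (p - 1)) = (1 - (p : ℂ)⁻¹) • yp hq ^ (p - 1) := by
    have hp0 : (p : ℂ) ≠ 0 := Nat.cast_ne_zero.mpr (by omega)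
    rw [yp_pow hq _ (by omega), gradeEta, ← TwAlg.basis_apply, Module.Basis.constr_basis,
      TwAlg.basis_apply, ZMod.val_cast_of_lt (by omega), ZMod.val_zero]
    congr 1
    push_cast [Nat.cast_sub (show 1 ≤ p by omega)]
    field_simp
    ring
  rw [topP, topMul_apply, topMul_apply, map_smul, gradeEta_mul, h1, gradeEta_gradeHom,
    smul_mul_assoc]
  module

theorem gradeEta_topM (hp : 3 ≤ p) (y : Eta hq) :
    topM hq (gradeEta hq y) = gradeEta hq (topM hq y) - ((p : ℂ)⁻¹ - 1) • topM hq y := by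
  have h1 : gradeEta hq (ym hq ^ (p - 1)) = ((p : ℂ)⁻¹ - 1) • ym hq ^ (p - 1) := by
    have hp0 : (p : ℂ) ≠ 0 := Nat.cast_ne_zero.mpr (by omega)
    rw [ym_pow hq _ (by omega), gradeEta, ← TwAlg.basis_apply, Module.Basis.constr_basis,
      TwAlg.basis_apply, ZMod.val_cast_of_lt (by omega), ZMod.val_zero]
    congr 1
    push_cast [Nat.cast_sub (show 1 ≤ p by omega)]
    field_simp
    ring
  rw [topM, topMul_apply, topMul_apply, map_smul, gradeEta_mul, h1, gradeEta_gradeHom,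
    smul_mul_assoc]
  module

/-- The operator `i R(H)`. -/
def dilation : Superspace hq →ₗ[ℂ] Superspace hq :=
  LinearMap.rTensor (Eta hq) euler + LinearMap.lTensor Test (gradeEta hq)

theorem dilation_tmul (f : Test) (y : Eta hq) :
    dilation hq (f ⊗ₜ y) = euler f ⊗ₜ y + f ⊗ₜ gradeEta hq y := rfl

theorem rightGen_H : rightGen hq .H = -Complex.I • dilation hq := rfl

theorem rightGen_Ep_dilation (hodd : Odd p) (hp : 3 ≤ p) :
    (rightGen hq .Ep : Module.End ℂ (Superspace hq)) * dilation hq -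
      (dilation hq : Module.End ℂ (Superspace hq)) * rightGen hq .Ep =
        (p : ℂ)⁻¹ • rightGen hq .Ep := by
  refine TensorProduct.ext' fun f y => ?_
  rw [LinearMap.sub_apply, Module.End.mul_apply, Module.End.mul_apply, dilation_tmul, map_add,
    rightGen_Ep_tmul hq hodd hp, rightGen_Ep_tmul hq hodd hp, LinearMap.smul_apply,
    rightGen_Ep_tmul hq hodd hp, map_add, dilation_tmul, dilation_tmul, dzp_euler,
    gradeEta_topP hq hp, eq_add_of_sub_eq (etaEp_gradeEta hq hodd hp y)]
  simp only [TensorProduct.add_tmul, TensorProduct.tmul_add, TensorProduct.tmul_smul]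
  module

theorem rightGen_Em_dilation (hodd : Odd p) (hp : 3 ≤ p) :
    (rightGen hq .Em : Module.End ℂ (Superspace hq)) * dilation hq -
      (dilation hq : Module.End ℂ (Superspace hq)) * rightGen hq .Em =
        -(p : ℂ)⁻¹ • rightGen hq .Em := by
  refine TensorProduct.ext' fun f y => ?_
  rw [LinearMap.sub_apply, Module.End.mul_apply, Module.End.mul_apply, dilation_tmul, map_add,
    rightGen_Em_tmul hq hodd hp, rightGen_Em_tmul hq hodd hp, LinearMap.smul_apply,
    rightGen_Em_tmul hq hodd hp, map_add, dilation_tmul, dilation_tmul, dzm_euler,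
    gradeEta_topM hq hp, eq_add_of_sub_eq (etaEm_gradeEta hq hodd hp y)]
  simp only [TensorProduct.add_tmul, TensorProduct.tmul_add, TensorProduct.tmul_smul,
    TensorProduct.tmul_sub, TensorProduct.neg_tmul]
  module

end Relations

/-! ### The Casimir elements in the right representation -/

/-- The abstract Casimir element `a b + (σ k - σ⁻¹ k')² / (q - q⁻¹)²` commutes with `a` and `b`. -/
theorem commute_casimir {A : Type*} [Ring A] [Algebra ℂ A] {q σ : ℂ} (hq0 : q ≠ 0)
    (hs : q - q⁻¹ ≠ 0) (hσ : σ ^ 2 = q) {a b k k' : A} (hk : k * k' = 1) (hk' : k' * k = 1)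
    (hak : a * k = q • (k * a)) (hbk : b * k = q⁻¹ • (k * b))
    (hab : b * a - a * b = (q - q⁻¹)⁻¹ • (k ^ 2 - k' ^ 2)) :
    Commute a (a * b + ((q - q⁻¹) ^ 2)⁻¹ • (σ • k - σ⁻¹ • k') ^ 2) ∧
      Commute b (a * b + ((q - q⁻¹) ^ 2)⁻¹ • (σ • k - σ⁻¹ • k') ^ 2) := by
  have hσ0 : σ ≠ 0 := fun h => hq0 (by rw [← hσ, h]; simp)
  have inv_comm : ∀ {x : A} {c : ℂ}, c ≠ 0 → x * k = c • (k * x) → x * k' = c⁻¹ • (k' * x) :=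
    fun {x c} hc h => by
      have h1 : k' * (x * k) * k' = c • (k' * (k * x) * k') := by
        rw [h, mul_smul_comm, smul_mul_assoc]
      rw [← mul_assoc k' k, hk', one_mul, mul_assoc, mul_assoc x, hk, mul_one] at h1
      rw [h1, smul_smul, inv_mul_cancel₀ hc, one_smul]
  have hsq : (σ • k - σ⁻¹ • k') ^ 2 = q • k ^ 2 - (2 : ℂ) • (1 : A) + q⁻¹ • k' ^ 2 := by
    rw [sq, sub_mul, mul_sub, mul_sub, smul_mul_smul_comm, smul_mul_smul_comm, smul_mul_smul_comm,
      smul_mul_smul_comm, hk, hk', mul_inv_cancel₀ hσ0, inv_mul_cancel₀ hσ0, ← mul_inv, ← sq σ,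
      ← sq, ← sq, hσ]
    module
  have sq_comm : ∀ {x y : A} {c : ℂ}, x * y = c • (y * x) → x * y ^ 2 = c ^ 2 • (y ^ 2 * x) :=
    fun {x y c} h => by
      rw [sq, ← mul_assoc, h, smul_mul_assoc, mul_assoc, h, mul_smul_comm, smul_smul, ← mul_assoc,
        ← sq]
  have ha1 := sq_comm hak
  have ha2 := sq_comm (inv_comm hq0 hak)
  have hb1 := sq_comm hbk
  have hb2 := sq_comm (inv_comm (inv_ne_zero hq0) hbk)
  have hab' := eq_add_of_sub_eq hab
  have hs2 : q ^ 2 - 1 ≠ 0 := fun h => hs (by field_simp; simpa using h)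
  rw [hsq]
  constructor
  · change a * _ = _ * a
    simp only [mul_add, add_mul, mul_smul_comm, smul_mul_assoc, mul_sub, sub_mul, ha1, ha2, mul_one,
      one_mul]
    rw [mul_assoc a b a, hab', mul_add, mul_smul_comm, mul_sub, ha1, ha2]
    match_scalars <;> field_simp <;> ring
  · change b * _ = _ * b
    simp only [mul_add, add_mul, mul_smul_comm, smul_mul_assoc, mul_sub, sub_mul, hb1, hb2, mul_one,
      one_mul]
    rw [← mul_assoc b a b, hab', add_mul, smul_mul_assoc, sub_mul]
    match_scalars <;> field_simp <;> ring

section Casimir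

set_option synthInstance.maxHeartbeats 200000

variable {p : ℕ} [NeZero p] {q : ℂ} (hq : IsPrimitiveRoot q p)

/-- The right representation as a homomorphism into the opposite algebra. -/
def rightRepHom : FreeU →ₐ[ℂ] (Module.End ℂ (Superspace hq))ᵐᵒᵖ :=
  FreeAlgebra.lift ℂ fun x => MulOpposite.op (rightGen hq x : Module.End ℂ (Superspace hq))

theorem rightRepHom_gen (x : Gen) : rightRepHom hq (gen x) =
    MulOpposite.op (rightGen hq x : Module.End ℂ (Superspace hq)) := by
  rw [rightRepHom, gen, FreeAlgebra.lift_ι_apply]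

theorem dilation_mul_rTensor {D : Test →ₗ[ℂ] Test} {c : ℂ}
    (hD : ∀ f, D (euler f) = c • D f + euler (D f)) :
    (dilation hq : Module.End ℂ (Superspace hq)) * LinearMap.rTensor (Eta hq) D -
      (LinearMap.rTensor (Eta hq) D : Module.End ℂ (Superspace hq)) * dilation hq =
      -c • LinearMap.rTensor (Eta hq) D := by
  refine TensorProduct.ext' fun f y => ?_
  rw [LinearMap.sub_apply, Module.End.mul_apply, Module.End.mul_apply, dilation_tmul, map_add,
    LinearMap.smul_apply, LinearMap.rTensor_tmul, LinearMap.rTensor_tmul, LinearMap.rTensor_tmul,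
    dilation_tmul, hD, TensorProduct.add_tmul, ← TensorProduct.smul_tmul']
  module

theorem end_smul_sub (c : ℂ) (S T : Module.End ℂ (Superspace hq)) :
    c • S - c • T = c • (S - T) :=
  LinearMap.ext fun F => (smul_sub c (S F) (T F)).symm

/-- The operators of the right representation satisfy the relations of `U_FS` in the opposite order.
-/
theorem rightRepHom_rel (hodd : Odd p) (hp : 3 ≤ p) {x y : FreeU} (h : URel p q x y) :
    rightRepHom hq x = rightRepHom hq y := by
  have hk := rightGen_K_pow_p hq hodd hp
  have hI : Complex.I * Complex.I = -1 := Complex.I_mul_I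
  have hpp : ∀ T : Module.End ℂ (Superspace hq),
      (rightGen hq .K : Module.End ℂ (Superspace hq)) ^ (p - 1) * (rightGen hq .K * T) = T :=
    fun T => by
      rw [← mul_assoc, ← pow_succ, Nat.sub_add_cancel (by omega), hk, one_mul]
  apply MulOpposite.unop_injective
  cases h
  -- `[P₊, P₋] = 0`
  · simp only [map_mul, rightRepHom_gen, MulOpposite.unop_mul, MulOpposite.unop_op]
    refine TensorProduct.ext' fun f y => ?_
    change -Complex.I • LinearMap.rTensor (Eta hq) dzm (Complex.I • (dzp f ⊗ₜ y)) =
      Complex.I • LinearMap.rTensor (Eta hq) dzp (-Complex.I • (dzm f ⊗ₜ y))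
    rw [map_smul, map_smul, LinearMap.rTensor_tmul, LinearMap.rTensor_tmul, dzp_dzm, smul_comm]
  -- `[P₊, H] = i P₊`
  · simp only [map_mul, map_sub, map_smul, rightRepHom_gen, MulOpposite.unop_mul,
      MulOpposite.unop_sub, MulOpposite.unop_smul, MulOpposite.unop_op]
    have h1 := dilation_mul_rTensor hq (D := dzp) (c := 1)
      (fun f => by rw [one_smul, dzp_euler])
    change (-Complex.I • dilation hq : Module.End ℂ (Superspace hq)) *
        (Complex.I • LinearMap.rTensor (Eta hq) dzp) -
      (Complex.I • LinearMap.rTensor (Eta hq) dzp : Module.End ℂ (Superspace hq)) *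
        (-Complex.I • dilation hq) = Complex.I • (Complex.I • LinearMap.rTensor (Eta hq) dzp)
    rw [smul_mul_smul_comm, smul_mul_smul_comm, mul_neg, neg_mul, end_smul_sub, h1, smul_smul,
      smul_smul, hI]
    simp
  -- `[P₋, H] = -i P₋`
  · simp only [map_mul, map_sub, map_smul, rightRepHom_gen, MulOpposite.unop_mul,
      MulOpposite.unop_sub, MulOpposite.unop_smul, MulOpposite.unop_op]
    have h1 := dilation_mul_rTensor hq (D := dzm) (c := -1)
      (fun f => by rw [dzm_euler, neg_smul, one_smul])
    change (-Complex.I • dilation hq : Module.End ℂ (Superspace hq)) *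
        (-Complex.I • LinearMap.rTensor (Eta hq) dzm) -
      (-Complex.I • LinearMap.rTensor (Eta hq) dzm : Module.End ℂ (Superspace hq)) *
        (-Complex.I • dilation hq) = -Complex.I • (-Complex.I • LinearMap.rTensor (Eta hq) dzm)
    rw [smul_mul_smul_comm, smul_mul_smul_comm, end_smul_sub, h1, smul_smul, smul_smul]
    simp
  -- `K E₊ K⁻¹ = q E₊`
  · simp only [map_mul, map_pow, map_smul, rightRepHom_gen, MulOpposite.unop_mul,
      MulOpposite.unop_pow, MulOpposite.unop_smul, MulOpposite.unop_op]
    rw [rightGen_Ep_mul_K hq hodd hp, mul_smul_comm, hpp]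
  -- `K E₋ K⁻¹ = q⁻¹ E₋`
  · simp only [map_mul, map_pow, map_smul, rightRepHom_gen, MulOpposite.unop_mul,
      MulOpposite.unop_pow, MulOpposite.unop_smul, MulOpposite.unop_op]
    rw [rightGen_Em_mul_K hq hodd hp, mul_smul_comm, hpp]
  -- `[E₊, E₋] = (K² - K⁻²) / (q - q⁻¹)`
  · simp only [map_mul, map_sub, map_pow, map_smul, rightRepHom_gen, MulOpposite.unop_mul,
      MulOpposite.unop_sub, MulOpposite.unop_pow, MulOpposite.unop_smul, MulOpposite.unop_op]
    exact rightGen_commutator hq hodd hp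
  -- `[K, H] = 0`
  · simp only [map_mul, rightRepHom_gen, MulOpposite.unop_mul, MulOpposite.unop_op]
    rw [rightGen_K hq hodd hp, rightGen_H, smul_mul_assoc, mul_smul_comm]
    congr 1
    refine TensorProduct.ext' fun f y => ?_
    rw [Module.End.mul_apply, Module.End.mul_apply, dilation_tmul, map_add, LinearMap.lTensor_tmul,
      LinearMap.lTensor_tmul, LinearMap.lTensor_tmul, dilation_tmul, AlgHom.toLinearMap_apply,
      AlgHom.toLinearMap_apply, gradeEta_gradeHom]
  -- `[E₊, H] = (i / p) E₊`
  · simp only [map_mul, map_sub, map_smul, rightRepHom_gen, MulOpposite.unop_mul,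
      MulOpposite.unop_sub, MulOpposite.unop_smul, MulOpposite.unop_op]
    have h1 := rightGen_Ep_dilation hq hodd hp
    rw [rightGen_H, smul_mul_assoc, mul_smul_comm, end_smul_sub, ← neg_sub, h1, smul_neg, neg_smul,
      neg_neg, smul_smul, div_eq_mul_inv]
  -- `[E₋, H] = -(i / p) E₋`
  · simp only [map_mul, map_sub, map_smul, rightRepHom_gen, MulOpposite.unop_mul,
      MulOpposite.unop_sub, MulOpposite.unop_smul, MulOpposite.unop_op]
    have h1 := rightGen_Em_dilation hq hodd hp
    rw [rightGen_H, smul_mul_assoc, mul_smul_comm, end_smul_sub, ← neg_sub, h1, smul_neg, neg_smul,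
      neg_neg, smul_smul, mul_neg, div_eq_mul_inv]
  -- `E₊ ^ p = P₊`
  · simp only [map_pow, rightRepHom_gen, MulOpposite.unop_pow, MulOpposite.unop_op]
    exact rightGen_Ep_pow hq hodd hp
  -- `E₋ ^ p = P₋`
  · simp only [map_pow, rightRepHom_gen, MulOpposite.unop_pow, MulOpposite.unop_op]
    exact rightGen_Em_pow hq hodd hp
  -- `K ^ p = 1`
  · simp only [map_pow, map_one, rightRepHom_gen, MulOpposite.unop_pow, MulOpposite.unop_op,
      MulOpposite.unop_one]
    exact hk

/-- The right representation, as a homomorphism on `U_FS`. -/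
def rightRepU (hodd : Odd p) (hp : 3 ≤ p) :
    UFS p q →ₐ[ℂ] (Module.End ℂ (Superspace hq))ᵐᵒᵖ :=
  RingQuot.liftAlgHom ℂ ⟨rightRepHom hq, fun _ _ h => rightRepHom_rel hq hodd hp h⟩

theorem rightRepU_toU (hodd : Odd p) (hp : 3 ≤ p) (c : FreeU) :
    rightRepU hq hodd hp (toU p q c) =
      MulOpposite.op (rightRep hq c : Module.End ℂ (Superspace hq)) := by
  rw [rightRepU, toU, RingQuot.liftAlgHom_mkAlgHom_apply]
  rfl

/-- The operator of `C₁`. -/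
def casimirOp : Module.End ℂ (Superspace hq) :=
  (rightGen hq .Ep : Module.End ℂ (Superspace hq)) * rightGen hq .Em +
    ((q - q⁻¹) ^ 2)⁻¹ • (sqrtq p q • (rightGen hq .K : Module.End ℂ (Superspace hq)) -
      (sqrtq p q)⁻¹ • (rightGen hq .K : Module.End ℂ (Superspace hq)) ^ (p - 1)) ^ 2

/-- The operator of `C₂`. -/
def waveOp : Module.End ℂ (Superspace hq) := LinearMap.rTensor (Eta hq) (dzm ∘ₗ dzp)

theorem rightRepU_casimir1 (hodd : Odd p) (hp : 3 ≤ p) :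
    rightRepU hq hodd hp (casimir1 p q) = MulOpposite.op (casimirOp hq) := by
  rw [casimir1, rightRepU, toU, RingQuot.liftAlgHom_mkAlgHom_apply]
  apply MulOpposite.unop_injective
  simp only [map_add, map_mul, map_sub, map_pow, map_smul, rightRepHom_gen, MulOpposite.unop_mul,
    MulOpposite.unop_add, MulOpposite.unop_sub, MulOpposite.unop_pow, MulOpposite.unop_smul,
    MulOpposite.unop_op, casimirOp]

theorem rightRepU_casimir2 (hodd : Odd p) (hp : 3 ≤ p) :
    rightRepU hq hodd hp (casimir2 p q) = MulOpposite.op (waveOp hq) := by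
  rw [casimir2, rightRepU, toU, RingQuot.liftAlgHom_mkAlgHom_apply]
  apply MulOpposite.unop_injective
  simp only [map_mul, rightRepHom_gen, MulOpposite.unop_mul, MulOpposite.unop_op]
  refine TensorProduct.ext' fun f y => ?_
  change -Complex.I • LinearMap.rTensor (Eta hq) dzm (Complex.I • (dzp f ⊗ₜ y)) =
    dzm (dzp f) ⊗ₜ y
  rw [map_smul, LinearMap.rTensor_tmul, smul_smul, neg_mul, Complex.I_mul_I, neg_neg, one_smul]

/-- An operator that commutes with the operators of `C₁` and `C₂` commutes with those of all
polynomials in `C₁` and `C₂`. -/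
theorem commute_rightRep (hodd : Odd p) (hp : 3 ≤ p) {T : Module.End ℂ (Superspace hq)}
    (h1 : Commute T (casimirOp hq)) (h2 : Commute T (waveOp hq)) {c : FreeU}
    (hc : toU p q c ∈ Algebra.adjoin ℂ {casimir1 p q, casimir2 p q}) :
    Commute T (rightRep hq c) := by
  have hle : Algebra.adjoin ℂ {casimir1 p q, casimir2 p q} ≤
      (Subalgebra.centralizer ℂ {MulOpposite.op T}).comap (rightRepU hq hodd hp) := by
    refine Algebra.adjoin_le ?_
    rintro x (rfl | rfl)
    · rw [SetLike.mem_coe, Subalgebra.mem_comap, Subalgebra.mem_centralizer_iff,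
        rightRepU_casimir1]
      rintro _ rfl
      rw [← MulOpposite.op_mul, ← MulOpposite.op_mul, h1.eq]
    · rw [SetLike.mem_coe, Subalgebra.mem_comap, Subalgebra.mem_centralizer_iff,
        rightRepU_casimir2]
      rintro _ rfl
      rw [← MulOpposite.op_mul, ← MulOpposite.op_mul, h2.eq]
  have h := hle hc
  rw [Subalgebra.mem_comap, Subalgebra.mem_centralizer_iff, rightRepU_toU] at h
  have h' := h _ rfl
  rw [← MulOpposite.op_mul, ← MulOpposite.op_mul] at h'
  exact (MulOpposite.op_injective h').symm

theorem sqrtq_sq (hq : IsPrimitiveRoot q p) (hodd : Odd p) : sqrtq p q ^ 2 = q := by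
  obtain ⟨k, hk⟩ := hodd
  rw [sqrtq, ← pow_mul, show (p + 1) / 2 * 2 = p + 1 by omega, pow_succ, hq.pow_eq_one, one_mul]

theorem commute_casimirOp (hodd : Odd p) (hp : 3 ≤ p) :
    Commute (rightGen hq .Ep : Module.End ℂ (Superspace hq)) (casimirOp hq) ∧
      Commute (rightGen hq .Em : Module.End ℂ (Superspace hq)) (casimirOp hq) := by
  have hk := rightGen_K_pow_p hq hodd hp
  refine commute_casimir (hq.ne_zero (by omega)) (sub_inv_ne_zero hq hp) (sqrtq_sq hq hodd) ?_ ?_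
    (rightGen_Ep_mul_K hq hodd hp) (rightGen_Em_mul_K hq hodd hp) (rightGen_commutator hq hodd hp)
  · rw [← pow_succ', Nat.sub_add_cancel (by omega), hk]
  · rw [← pow_succ, Nat.sub_add_cancel (by omega), hk]

theorem rightGen_K_commute_evOp (hodd : Odd p) (hp : 3 ≤ p) (g : ℝ × ℝ × ℝ) (w : ℂˣ) :
    Commute (evOp hq g w : Module.End ℂ (Superspace hq)) (rightGen hq .K) := by
  refine TensorProduct.ext' fun f y => ?_
  rw [Module.End.mul_apply, Module.End.mul_apply, rightGen_K hq hodd hp, evOp_tmul,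
    LinearMap.lTensor_tmul, LinearMap.lTensor_tmul, evOp_tmul, AlgHom.toLinearMap_apply,
    AlgHom.toLinearMap_apply, gradeHom_gradeHom, gradeHom_gradeHom, mul_comm]

/-- The points `η± = 0` rescale `R(E₊)` and `R(E₋)` by inverse factors. -/
theorem evOp_commute_casimirOp (hodd : Odd p) (hp : 3 ≤ p) (g : ℝ × ℝ × ℝ) {w : ℂˣ}
    (hw : (w : ℂ) ^ p = Complex.exp g.2.2) :
    Commute (evOp hq g w : Module.End ℂ (Superspace hq)) (casimirOp hq) := by
  have hk := rightGen_K_commute_evOp hq hodd hp g w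
  refine Commute.add_right ?_ (((hk.smul_right _).sub_right
    ((hk.pow_right _).smul_right _)).pow_right _ |>.smul_right _)
  refine LinearMap.ext fun F => ?_
  change evOp hq g w (rightGen hq .Ep (rightGen hq .Em F)) =
    rightGen hq .Ep (rightGen hq .Em (evOp hq g w F))
  rw [rightGen_Em_evOp hq hodd hp g hw, map_smul, rightGen_Ep_evOp hq hodd hp g hw, smul_smul,
    Units.inv_mul, one_smul]

/-- The points `η± = 0` rescale the two derivatives by the inverse factors `e^l` and `e^(-l)`. -/
theorem evOp_commute_waveOp (g : ℝ × ℝ × ℝ) (w : ℂˣ) :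
    Commute (evOp hq g w : Module.End ℂ (Superspace hq)) (waveOp hq) := by
  refine TensorProduct.ext' fun f y => ?_
  change pull g (dzm (dzp f)) ⊗ₜ gradeHom hq w y = dzm (dzp (pull g f)) ⊗ₜ gradeHom hq w y
  rw [dzp_pull, map_smul, dzm_pull, smul_smul, ← Complex.ofReal_mul, ← Real.exp_add,
    add_neg_cancel, Real.exp_zero, Complex.ofReal_one, one_smul]

theorem rightGen_Ep_commute_waveOp (hodd : Odd p) (hp : 3 ≤ p) :
    Commute (rightGen hq .Ep : Module.End ℂ (Superspace hq)) (waveOp hq) := by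
  refine TensorProduct.ext' fun f y => ?_
  rw [Module.End.mul_apply, Module.End.mul_apply, waveOp, LinearMap.rTensor_tmul,
    rightGen_Ep_tmul hq hodd hp, rightGen_Ep_tmul hq hodd hp, map_add, LinearMap.rTensor_tmul,
    LinearMap.rTensor_tmul, LinearMap.comp_apply, LinearMap.comp_apply, dzp_dzm]

theorem rightGen_Em_commute_waveOp (hodd : Odd p) (hp : 3 ≤ p) :
    Commute (rightGen hq .Em : Module.End ℂ (Superspace hq)) (waveOp hq) := by
  refine TensorProduct.ext' fun f y => ?_
  rw [Module.End.mul_apply, Module.End.mul_apply, waveOp, LinearMap.rTensor_tmul,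
    rightGen_Em_tmul hq hodd hp, rightGen_Em_tmul hq hodd hp, map_add, LinearMap.rTensor_tmul,
    LinearMap.rTensor_tmul, LinearMap.comp_apply, LinearMap.comp_apply, dzp_dzm]

end Casimir

/-! ### The coaction in terms of the right representation -/

section Intertwining

set_option synthInstance.maxHeartbeats 200000

variable {p : ℕ} [NeZero p] {q : ℂ} (hq : IsPrimitiveRoot q p)

/-- The coaction on the Grassmann variables turns `E₋` into the lowering operator in `η₋` of the
supergroup, as both sides are twisted derivations that agree on `η₊` and `η₋`. -/
theorem lowMT_coEta (hodd : Odd p) (hp : 3 ≤ p) (l : ℝ) (y : Eta hq) :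
    (pairE p q)⁻¹ • lowMT hq (coEta hq l y) = coEta hq l (etaEm hq y) := by
  have h1 := ((isTwDer_lowMT hq hp).comp_algHom (coEtaHom hq hodd hp l)).smul (pairE p q)⁻¹
  have h2 := (isTwDer_etaEm hq hodd hp).algHom_comp (coEtaHom hq hodd hp l)
  have e : ∀ j w, evUnit hq 0 j = w → (coEtaHom hq hodd hp l).comp (gradeHom hq w) =
      (scaleT hq j).comp (coEtaHom hq hodd hp l) := fun j w h => AlgHom.ext fun y => by
    rw [AlgHom.comp_apply, AlgHom.comp_apply, coEtaHom_apply, coEtaHom_apply, ← h,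
      scaleT_coEta hq hodd hp]
  rw [e (-1) _ (evUnit_zero_neg_one hq), e 1 _ (evUnit_zero_one hq)] at h2
  have hone : coEta hq l 1 = 1 := map_one (coEtaHom hq hodd hp l)
  refine LinearMap.congr_fun (IsTwDer.eta_ext hq h1 h2 ?_ ?_) y
  · simp [coEtaHom_apply, coEta_yp hq hp, lowMT_coEtap hq hp, etaEm_yp hq hp]
  · simp [coEtaHom_apply, coEta_ym hq hp, lowMT_coEtam hq hp, etaEm_ym hq hp,
      Algebra.algebraMap_eq_smul_one, hone]

/-- The coaction on the Grassmann variables turns `E₊` into the lowering operator in `η₊` modulo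
`η₋` of the supergroup. -/
theorem lowPT_coEta (hodd : Odd p) (hp : 3 ≤ p) (l : ℝ) (y : Eta hq) :
    pairE p q • lowPT hq (coEta hq l y) = killT hq (coEta hq l (etaEp hq y)) := by
  have h1 := ((isTwDer_lowPT hq hp).comp_algHom (coEtaHom hq hodd hp l)).smul (pairE p q)
  have h2 := ((isTwDer_etaEp hq hodd hp).algHom_comp (coEtaHom hq hodd hp l)).algHom_comp
    (killT hq)
  have e : ∀ j w, evUnit hq 0 j = w →
      (killT hq).comp ((coEtaHom hq hodd hp l).comp (gradeHom hq w)) =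
      (((scaleT hq j).comp (killT hq)).comp (coEtaHom hq hodd hp l)) :=
    fun j w h => AlgHom.ext fun y => by
      rw [AlgHom.comp_apply, AlgHom.comp_apply, AlgHom.comp_apply, AlgHom.comp_apply,
        coEtaHom_apply, coEtaHom_apply, ← h, ← scaleT_coEta hq hodd hp, killT_scaleT]
  rw [e (-1) _ (evUnit_zero_neg_one hq), e 1 _ (evUnit_zero_one hq)] at h2
  have hone : coEta hq l 1 = 1 := map_one (coEtaHom hq hodd hp l)
  refine LinearMap.congr_fun (IsTwDer.eta_ext hq h1 h2 ?_ ?_) y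
  · simp [coEtaHom_apply, coEta_yp hq hp, lowPT_coEtap hq hodd hp, etaEp_yp hq hodd hp,
      coEta_mul hq hodd hp, coEta_ym hq hp, killT_coEtap hq hp, killT_coEtam hq hodd hp, hone]
  · simp [coEtaHom_apply, coEta_ym hq hp, lowPT_coEtam hq hodd hp, etaEp_ym hq hodd hp,
      killT_coEtam hq hodd hp, sq, coEta_mul hq hodd hp]

theorem coEta_topM (hodd : Odd p) (hp : 3 ≤ p) (l : ℝ) (y : Eta hq) :
    coEta hq l (topM hq y) = ((pairE p q)⁻¹ * (qFact q (p - 1))⁻¹) •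
      (coEtam hq l ^ (p - 1) * scaleT hq 1 (coEta hq l y)) := by
  rw [topM, topMul_apply, map_smul, coEta_mul hq hodd hp, ← coEtaHom_apply hq hodd hp, map_pow,
    coEtaHom_apply, coEta_ym hq hp, scaleT_coEta hq hodd hp, evUnit_zero_one]

theorem coEta_topP (hodd : Odd p) (hp : 3 ≤ p) (l : ℝ) (y : Eta hq) :
    coEta hq l (topP hq y) = (pairE p q * (qFact q (p - 1))⁻¹) •
      (coEtap hq l ^ (p - 1) * scaleT hq 1 (coEta hq l y)) := by
  rw [topP, topMul_apply, map_smul, coEta_mul hq hodd hp, ← coEtaHom_apply hq hodd hp, map_pow,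
    coEtaHom_apply, coEta_yp hq hp, scaleT_coEta hq hodd hp, evUnit_zero_one]

theorem slice_mul_eq_zero {φ : EtaDelta hq →ₗ[ℂ] ℂ} {a : EtaDelta hq} {n : ℕ}
    (h : ∀ z, φ (a ^ n * z) = 0) (Z : EtaDelta hq ⊗[ℂ] Eta hq) :
    slice hq φ ((a ⊗ₜ 1) ^ n * Z) = 0 := by
  rw [Algebra.TensorProduct.tmul_pow, one_pow]
  induction Z using TensorProduct.induction_on with
  | zero => simp
  | add Y Z hY hZ => rw [mul_add, map_add, hY, hZ, add_zero]
  | tmul b y => rw [Algebra.TensorProduct.tmul_mul_tmul, slice_tmul, h, zero_smul]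

theorem lowMT_nilm_mul (hodd : Odd p) (hp : 3 ≤ p) (l : ℝ) (y : Eta hq) :
    (pairE p q)⁻¹ • lowMT hq (nilm hq l * coEta hq l y) =
      coEta hq l (topM hq y) + nilm hq l * coEta hq l (etaEm hq y) -
        ((pairE p q)⁻¹ * (qFact q (p - 1))⁻¹) • (tM hq ^ (p - 1) * scaleT hq 1 (coEta hq l y)) := by
  rw [isTwDer_lowMT hq hp, scaleT_nilm hq hodd hp, lowMT_nilm hq hodd hp, coEta_topM hq hodd hp,
    ← lowMT_coEta hq hodd hp, smul_add, smul_mul_assoc, smul_smul, sub_mul, mul_smul_comm, smul_sub]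
  abel

theorem lowPT_nilp_mul (hodd : Odd p) (hp : 3 ≤ p) (l : ℝ) (y : Eta hq) :
    pairE p q • lowPT hq (nilp hq l * coEta hq l y) =
      killT hq (coEta hq l (topP hq y) + nilp hq l * coEta hq l (etaEp hq y)) -
        (pairE p q * (qFact q (p - 1))⁻¹) •
          (tP hq ^ (p - 1) * killT hq (scaleT hq 1 (coEta hq l y))) := by
  rw [isTwDer_lowPT hq hp, AlgHom.comp_apply, AlgHom.comp_apply, killT_nilp hq hodd hp,
    scaleT_nilp hq hodd hp, lowPT_nilp hq hodd hp, map_add, map_mul, killT_nilp hq hodd hp,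
    ← lowPT_coEta hq hodd hp, coEta_topP hq hodd hp, map_smul, map_mul, map_pow,
    killT_coEtap hq hp, ← killT_scaleT, smul_add, smul_mul_assoc, smul_smul, sub_mul,
    mul_smul_comm, smul_sub]
  abel

/-- Lowering a component of the coaction in `η₋` amounts to the action of `R(E₋)`. The hypothesis on
`φ` removes the contribution of `η₋ ^ p ⊗ 1` to the nilpotent part of `Δ z₋`. -/
theorem slice_coact_Em (hodd : Odd p) (hp : 3 ≤ p) {φ : EtaDelta hq →ₗ[ℂ] ℂ}
    (h : ∀ z, φ (etam hq ^ (p - 1) * z) = 0) (g : ℝ × ℝ × ℝ) (F : Superspace hq) :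
    slice hq φ (coact hq g (rightGen hq .Em F)) =
      (pairE p q)⁻¹ • slice hq (φ ∘ₗ lowM hq) (coact hq g F) := by
  induction F using TensorProduct.induction_on with
  | zero => simp
  | add F G hF hG => rw [map_add, map_add, map_add, map_add, map_add, smul_add, hF, hG]
  | tmul f y =>
    set l := g.2.2
    have hs : ∀ Y : EtaDelta hq ⊗[ℂ] Eta hq,
        slice hq (φ ∘ₗ lowM hq) Y = slice hq φ (lowMT hq Y) := fun Y => by
      rw [slice_comp, lowMT]
    have hnn : ∀ z, nilm hq l * coEta hq l (topM hq z) = 0 := fun z => by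
      rw [coEta_topM hq hodd hp, mul_smul_comm, ← mul_assoc, nilm_mul_coEtam_pow hq hodd hp,
        zero_mul, smul_zero]
    have ht : Commute (nilp hq l) (tM hq) := by
      rw [nilp_eq hq hodd hp]
      exact (gaussRel hq hp l).np_commute_M hq hp
    have e1 : (pairE p q)⁻¹ • slice hq φ (lowMT hq (nilm hq l * coEta hq l y)) =
        slice hq φ (coEta hq l (topM hq y)) +
          slice hq φ (nilm hq l * coEta hq l (etaEm hq y)) := by
      rw [← map_smul, lowMT_nilm_mul hq hodd hp, map_sub, map_smul, tM, slice_mul_eq_zero hq h,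
        smul_zero, sub_zero, map_add]
    have e2 : (pairE p q)⁻¹ •
          slice hq φ (nilp hq l * lowMT hq (nilm hq l * coEta hq l y)) =
        slice hq φ (nilp hq l * coEta hq l (topM hq y)) +
          slice hq φ (nilp hq l * (nilm hq l * coEta hq l (etaEm hq y))) := by
      rw [← map_smul, ← mul_smul_comm, lowMT_nilm_mul hq hodd hp, mul_sub, map_sub, mul_smul_comm,
        map_smul, commute_assoc (ht.pow_right _), tM, slice_mul_eq_zero hq h, smul_zero, sub_zero,
        mul_add, map_add]
    have e3 : (pairE p q)⁻¹ • slice hq φ (lowMT hq (coEta hq l y)) =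
        slice hq φ (coEta hq l (etaEm hq y)) := by rw [← map_smul, lowMT_coEta hq hodd hp]
    have e4 : (pairE p q)⁻¹ • slice hq φ (nilp hq l * lowMT hq (coEta hq l y)) =
        slice hq φ (nilp hq l * coEta hq l (etaEm hq y)) := by
      rw [← map_smul, ← mul_smul_comm, lowMT_coEta hq hodd hp]
    rw [rightGen_Em_tmul hq hodd hp, map_add, map_add, slice_coact_tmul hq hodd hp,
      slice_coact_tmul hq hodd hp, slice_coact_tmul hq hodd hp, hnn, mul_zero, map_zero,
      TensorProduct.tmul_zero, TensorProduct.tmul_zero, hs, hs, hs, hs,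
      lowMT_nilp_mul hq hodd hp, lowMT_nilp_mul hq hodd hp, smul_add, smul_add, smul_add,
      ← TensorProduct.tmul_smul, ← TensorProduct.tmul_smul, ← TensorProduct.tmul_smul,
      ← TensorProduct.tmul_smul, e1, e2, e3, e4, TensorProduct.tmul_add, TensorProduct.tmul_add]
    abel

/-- Lowering a component of the coaction in `η₊`, modulo `η₋`, amounts to the action of `R(E₊)`. The
first hypothesis on `φ` removes the contribution of `η₊ ^ p ⊗ 1` to the nilpotent part of `Δ z₊`,
the second one says that `φ` vanishes on multiples of `η₋`. -/
theorem slice_coact_Ep (hodd : Odd p) (hp : 3 ≤ p) {φ : EtaDelta hq →ₗ[ℂ] ℂ}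
    (h : ∀ z, φ (etap hq ^ (p - 1) * z) = 0) (hφ : φ ∘ₗ (killM hq).toLinearMap = φ)
    (g : ℝ × ℝ × ℝ) (F : Superspace hq) :
    slice hq φ (coact hq g (rightGen hq .Ep F)) =
      pairE p q • slice hq (φ ∘ₗ lowP hq) (coact hq g F) := by
  induction F using TensorProduct.induction_on with
  | zero => simp
  | add F G hF hG => rw [map_add, map_add, map_add, map_add, map_add, smul_add, hF, hG]
  | tmul f y =>
    set l := g.2.2
    have hs : ∀ Y : EtaDelta hq ⊗[ℂ] Eta hq,
        slice hq (φ ∘ₗ lowP hq) Y = slice hq φ (lowPT hq Y) := fun Y => by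
      rw [slice_comp, lowPT]
    have hk : ∀ Y : EtaDelta hq ⊗[ℂ] Eta hq, slice hq φ (killT hq Y) = slice hq φ Y := fun Y => by
      conv_rhs => rw [← hφ, slice_comp]
      rfl
    have hnn : ∀ z, nilp hq l * coEta hq l (topP hq z) = 0 := fun z => by
      rw [coEta_topP hq hodd hp, mul_smul_comm, ← mul_assoc, nilp_mul_coEtap_pow hq hodd hp,
        zero_mul, smul_zero]
    have hm : ∀ Z, slice hq φ (nilm hq l * Z) = 0 := fun Z => by
      rw [← hk, map_mul, killT_nilm hq hodd hp, zero_mul, map_zero]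
    have hc : ∀ Z, nilp hq l * (nilm hq l * Z) = nilm hq l * (nilp hq l * Z) :=
      commute_assoc (nilp_commute_nilm hq hodd hp l)
    have e1 : pairE p q • slice hq φ (lowPT hq (nilp hq l * coEta hq l y)) =
        slice hq φ (coEta hq l (topP hq y)) +
          slice hq φ (nilp hq l * coEta hq l (etaEp hq y)) := by
      rw [← map_smul, lowPT_nilp_mul hq hodd hp, map_sub, hk, map_smul, tP,
        slice_mul_eq_zero hq h, smul_zero, sub_zero, map_add]
    have e3 : pairE p q • slice hq φ (lowPT hq (coEta hq l y)) =
        slice hq φ (coEta hq l (etaEp hq y)) := by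
      rw [← map_smul, lowPT_coEta hq hodd hp, hk]
    rw [rightGen_Ep_tmul hq hodd hp, map_add, map_add, slice_coact_tmul hq hodd hp,
      slice_coact_tmul hq hodd hp, slice_coact_tmul hq hodd hp, hc, hc, hc, hnn, hm, hm, hm, hm,
      map_zero, hs, hs, hs, hs, lowPT_nilm_mul hq hodd hp, lowPT_nilm_mul hq hodd hp, map_zero,
      smul_add, smul_add, smul_add,
      ← TensorProduct.tmul_smul, ← TensorProduct.tmul_smul, ← TensorProduct.tmul_smul,
      ← TensorProduct.tmul_smul, e1, e3, TensorProduct.tmul_add]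
    simp only [smul_zero, TensorProduct.tmul_zero]
    abel

/-- The component of the coaction at the point `g` along `η₊^a η₋^b δ^k`, `m = (a, b, k)`. -/
def coComp (g : ℝ × ℝ × ℝ) (m : ZMod p × ZMod p × ZMod p) : Module.End ℂ (Superspace hq) :=
  slice hq (TwAlg.coeff m) ∘ₗ coact hq g

theorem coeff_lowM (a b k : ZMod p) : TwAlg.coeff (a, b, k) ∘ₗ lowM hq =
    (chi hq (k - a) * qNum q (b + 1).val) • TwAlg.coeff (a, b + 1, k) := by
  refine linearMap_ext_e fun m => ?_
  obtain ⟨a', b', k'⟩ := m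
  rw [LinearMap.comp_apply, lowM, ofMonomials_e, map_smul, LinearMap.smul_apply, TwAlg.coeff_e,
    TwAlg.coeff_e]
  by_cases h : a = a' ∧ b + 1 = b' ∧ k = k'
  · obtain ⟨rfl, rfl, rfl⟩ := h
    simp
  · have h1 : ¬ ((a, b + 1, k) = (a', b', k')) := fun h' => h (by simpa using h')
    have h2 : ¬ ((a, b, k) = (a', b' - 1, k')) := fun h' => h (by
      simp only [Prod.mk.injEq] at h'
      exact ⟨h'.1, eq_sub_iff_add_eq.mp h'.2.1, h'.2.2⟩)
    rw [if_neg h1, if_neg h2, smul_zero, smul_zero]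

theorem coeff_lowP (a k : ZMod p) : TwAlg.coeff (a, 0, k) ∘ₗ lowP hq =
    (chi hq k * qNum q (a + 1).val) • TwAlg.coeff (a + 1, 0, k) := by
  refine linearMap_ext_e fun m => ?_
  obtain ⟨a', b', k'⟩ := m
  rw [LinearMap.comp_apply, lowP, ofMonomials_e, map_smul, LinearMap.smul_apply, TwAlg.coeff_e,
    TwAlg.coeff_e]
  by_cases h : a + 1 = a' ∧ 0 = b' ∧ k = k'
  · obtain ⟨rfl, rfl, rfl⟩ := h
    simp
  · have h1 : ¬ ((a + 1, 0, k) = (a', b', k')) := fun h' => h (by simpa using h')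
    have h2 : ¬ ((a, 0, k) = (a' - 1, b', k')) := fun h' => h (by
      simp only [Prod.mk.injEq] at h'
      exact ⟨eq_sub_iff_add_eq.mp h'.1, h'.2.1, h'.2.2⟩)
    rw [if_neg h1, if_neg h2, smul_zero, smul_zero]

theorem coeff_killM (a k : ZMod p) :
    TwAlg.coeff (a, 0, k) ∘ₗ (killM hq).toLinearMap = TwAlg.coeff (a, 0, k) := by
  refine linearMap_ext_e fun m => ?_
  rw [LinearMap.comp_apply, AlgHom.toLinearMap_apply, killM_e, map_smul, TwAlg.coeff_e]
  by_cases h : (a, 0, k) = m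
  · subst h
    simp
  · simp [h]

theorem val_neg_one_zmod : (-1 : ZMod p).val = p - 1 := by
  obtain ⟨n, rfl⟩ : ∃ n, p = n + 1 := ⟨p - 1, (Nat.sub_add_cancel (NeZero.pos p)).symm⟩
  exact ZMod.val_neg_one n

theorem natCast_pred_zmod : ((p - 1 : ℕ) : ZMod p) = -1 := by
  rw [← val_neg_one_zmod, ZMod.natCast_zmod_val]

theorem trunc_neg_one {a : ZMod p} (h : trunc (-1) a ≠ 0) : a = 0 := by
  have h1 : (-1 : ZMod p).val + a.val < p := by
    by_contra h1
    exact h (by simp [trunc, h1])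
  rw [val_neg_one_zmod] at h1
  exact (ZMod.val_eq_zero a).mp (by omega)

theorem coeff_etam_pow_mul (hp : 3 ≤ p) {a b k : ZMod p} (hb : b + 1 ≠ 0) (z : EtaDelta hq) :
    TwAlg.coeff (a, b, k) (etam hq ^ (p - 1) * z) = 0 := by
  have : TwAlg.coeff (a, b, k) ∘ₗ LinearMap.mulLeft ℂ (etam hq ^ (p - 1)) = 0 := by
    refine linearMap_ext_e fun m => ?_
    rw [LinearMap.comp_apply, LinearMap.mulLeft_apply, etam_pow hq hp _ (by omega),
      natCast_pred_zmod, TwAlg.e_mul_e, map_smul, TwAlg.coeff_e, LinearMap.zero_apply,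
      etaDeltaCocycle_c]
    by_cases h : trunc (-1) m.2.1 = 0
    · simp [h]
    · rw [if_neg, smul_zero]
      intro h'
      have h2 := congrArg (fun x => x.2.1) h'
      simp only [Prod.snd_add, Prod.fst_add, trunc_neg_one h, add_zero] at h2
      exact hb (by rw [h2, neg_add_cancel])
  exact LinearMap.congr_fun this z

theorem coeff_etap_pow_mul (hp : 3 ≤ p) {a b k : ZMod p} (ha : a + 1 ≠ 0) (z : EtaDelta hq) :
    TwAlg.coeff (a, b, k) (etap hq ^ (p - 1) * z) = 0 := by
  have : TwAlg.coeff (a, b, k) ∘ₗ LinearMap.mulLeft ℂ (etap hq ^ (p - 1)) = 0 := by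
    refine linearMap_ext_e fun m => ?_
    rw [LinearMap.comp_apply, LinearMap.mulLeft_apply, etap_pow hq hp _ (by omega),
      natCast_pred_zmod, TwAlg.e_mul_e, map_smul, TwAlg.coeff_e, LinearMap.zero_apply,
      etaDeltaCocycle_c]
    by_cases h : trunc (-1) m.1 = 0
    · simp [h]
    · rw [if_neg, smul_zero]
      intro h'
      have h2 := congrArg (fun x => x.1) h'
      simp only [Prod.fst_add, trunc_neg_one h, add_zero] at h2
      exact ha (by rw [h2, neg_add_cancel])
  exact LinearMap.congr_fun this z

theorem qNum_val_ne_zero (hq : IsPrimitiveRoot q p) (hodd : Odd p) (hp : 3 ≤ p) {a : ZMod p}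
    (ha : a ≠ 0) : qNum q a.val ≠ 0 :=
  qNum_ne_zero hq hodd hp (Nat.pos_of_ne_zero fun h => ha ((ZMod.val_eq_zero a).mp h))
    (ZMod.val_lt a)

/-- A component of positive degree in `η₋` comes from one of lower degree through `R(E₋)`. -/
theorem coComp_Em (hodd : Odd p) (hp : 3 ≤ p) (g : ℝ × ℝ × ℝ) (a k : ZMod p) {b : ZMod p}
    (hb : b + 1 ≠ 0) :
    ∃ c : ℂ, coComp hq g (a, b + 1, k) = c • (coComp hq g (a, b, k) * rightGen hq .Em) := by
  have he := pairE_ne_zero hq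
  have hc : chi hq (k - a) * qNum q (b + 1).val ≠ 0 :=
    mul_ne_zero (chi_ne_zero hq _) (qNum_val_ne_zero hq hodd hp hb)
  refine ⟨pairE p q * (chi hq (k - a) * qNum q (b + 1).val)⁻¹, LinearMap.ext fun F => ?_⟩
  have h := slice_coact_Em hq hodd hp (φ := TwAlg.coeff (a, b, k)) (coeff_etam_pow_mul hq hp hb) g F
  rw [coeff_lowM, slice_smul] at h
  change slice hq _ (coact hq g F) = (_ : ℂ) • slice hq _ (coact hq g (rightGen hq .Em F))
  rw [h, smul_smul, smul_smul]
  conv_lhs => rw [← one_smul ℂ (slice hq _ _)]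
  congr 1
  field_simp
  exact (div_self hc).symm

/-- A component of degree zero in `η₋` and of positive degree in `η₊` comes from one of lower degree
through `R(E₊)`. -/
theorem coComp_Ep (hodd : Odd p) (hp : 3 ≤ p) (g : ℝ × ℝ × ℝ) (k : ZMod p) {a : ZMod p}
    (ha : a + 1 ≠ 0) :
    ∃ c : ℂ, coComp hq g (a + 1, 0, k) = c • (coComp hq g (a, 0, k) * rightGen hq .Ep) := by
  have he := pairE_ne_zero hq
  have hc : chi hq k * qNum q (a + 1).val ≠ 0 :=
    mul_ne_zero (chi_ne_zero hq _) (qNum_val_ne_zero hq hodd hp ha)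
  refine ⟨(pairE p q)⁻¹ * (chi hq k * qNum q (a + 1).val)⁻¹, LinearMap.ext fun F => ?_⟩
  have h := slice_coact_Ep hq hodd hp (φ := TwAlg.coeff (a, 0, k)) (coeff_etap_pow_mul hq hp ha)
    (coeff_killM hq a k) g F
  rw [coeff_lowP, slice_smul] at h
  change slice hq _ (coact hq g F) = (_ : ℂ) • slice hq _ (coact hq g (rightGen hq .Ep F))
  rw [h, smul_smul, smul_smul]
  conv_lhs => rw [← one_smul ℂ (slice hq _ _)]
  congr 1
  field_simp
  exact (div_self hc).symm

/-- At the point `η± = 0`, `δ = q^j` the coaction acts by `evOp`; the nilpotent parts of `Δ z±`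
vanish there. -/
theorem slice_counit_scaleHom (hodd : Odd p) (hp : 3 ≤ p) (g : ℝ × ℝ × ℝ) (j : ZMod p)
    (F : Superspace hq) :
    slice hq (counit hq ∘ₗ (scaleHom hq j).toLinearMap) (coact hq g F) =
      evOp hq g (evUnit hq g.2.2 j) F := by
  have h0 : ∀ Y : EtaDelta hq ⊗[ℂ] Eta hq,
      slice hq (counit hq ∘ₗ (scaleHom hq j).toLinearMap) Y =
        counitTensor hq (scaleT hq j Y) := fun Y => by
    rw [slice_comp, slice_counit]
    rfl
  induction F using TensorProduct.induction_on with
  | zero => simp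
  | add F G hF hG => rw [map_add, map_add, map_add, hF, hG]
  | tmul f y =>
    have hP : ∀ z, counitTensor hq (scaleT hq j (nilp hq g.2.2 * z)) = 0 := fun z => by
      rw [map_mul, map_mul, scaleT_nilp hq hodd hp, counitTensor_nilp hq (by omega), zero_mul]
    have hM : ∀ z, counitTensor hq (scaleT hq j (nilm hq g.2.2 * z)) = 0 := fun z => by
      rw [map_mul, map_mul, scaleT_nilm hq hodd hp, counitTensor_nilm hq (by omega), zero_mul]
    rw [slice_coact_tmul hq hodd hp, h0, h0, h0, h0, hP, hP, hM,
      counitTensor_scaleT_coEta hq hodd hp, TensorProduct.tmul_zero, TensorProduct.tmul_zero,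
      TensorProduct.tmul_zero, add_zero, add_zero, add_zero, evOp_tmul]

/-- Fourier inversion: the coordinate of `δ^k` in terms of the points `η± = 0`, `δ = q^j`. -/
theorem coeff_eq_sum_counit (k : ZMod p) :
    (TwAlg.coeff (0, 0, k) : EtaDelta hq →ₗ[ℂ] ℂ) =
      ∑ j : ZMod p, ((p : ℂ)⁻¹ * chi hq (-(j * k))) •
        (counit hq ∘ₗ (scaleHom hq j).toLinearMap) := by
  refine linearMap_ext_e fun m => ?_
  obtain ⟨a, b, n⟩ := m
  rw [TwAlg.coeff_e, LinearMap.sum_apply]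
  simp only [LinearMap.smul_apply, LinearMap.comp_apply, AlgHom.toLinearMap_apply, scaleHom_e,
    map_smul, counit_e, smul_eq_mul]
  by_cases h : a = 0 ∧ b = 0
  · obtain ⟨rfl, rfl⟩ := h
    have hprim : (chi hq).IsPrimitive := AddChar.zmodChar_primitive_of_primitive_root p hq
    have hs := AddChar.sum_mulShift (n - k) hprim
    have hp0 : (p : ℂ) ≠ 0 := Nat.cast_ne_zero.mpr (NeZero.ne p)
    have e : ∀ j : ZMod p, (p : ℂ)⁻¹ * chi hq (-(j * k)) *
        (chi hq (j * (0 - 0 + n)) * if (0 : ZMod p) = 0 ∧ (0 : ZMod p) = 0 then 1 else 0) =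
        (p : ℂ)⁻¹ * chi hq (j * (n - k)) := fun j => by
      rw [if_pos ⟨rfl, rfl⟩, mul_one, mul_assoc, ← AddChar.map_add_eq_mul]
      congr 2
      ring
    rw [Finset.sum_congr rfl fun j _ => e j, ← Finset.mul_sum, hs]
    by_cases hk : k = n
    · subst hk
      simp [hp0, ZMod.card]
    · have : ¬ (n - k = 0) := fun h => hk (sub_eq_zero.mp h).symm
      simp [hk, this]
  · have h1 : ¬ ((0, 0, k) = (a, b, n)) := fun h' => h (by
      simp only [Prod.mk.injEq] at h'
      exact ⟨h'.1.symm, h'.2.1.symm⟩)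
    simp [h, h1]

theorem slice_sum {V ι : Type} [AddCommGroup V] [Module ℂ V] [Fintype ι]
    (φ : ι → EtaDelta hq →ₗ[ℂ] ℂ) (X : EtaDelta hq ⊗[ℂ] V) :
    slice hq (∑ i, φ i) X = ∑ i, slice hq (φ i) X := by
  simp [slice, ← LinearMap.coe_rTensorHom, map_sum]

/-- The components of degree zero in `η±` are the Fourier components of the action of the
points `η± = 0`, `δ = q^j`. -/
theorem coComp_zero_zero (hodd : Odd p) (hp : 3 ≤ p) (g : ℝ × ℝ × ℝ) (k : ZMod p) :
    coComp hq g (0, 0, k) = ∑ j : ZMod p, ((p : ℂ)⁻¹ * chi hq (-(j * k))) •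
      (evOp hq g (evUnit hq g.2.2 j) : Module.End ℂ (Superspace hq)) := by
  refine LinearMap.ext fun F => ?_
  change slice hq (TwAlg.coeff (0, 0, k)) (coact hq g F) = _
  rw [coeff_eq_sum_counit, LinearMap.sum_apply]
  simp only [LinearMap.smul_apply, ← slice_counit_scaleHom hq hodd hp, ← slice_smul]
  exact slice_sum hq _ _

/-- All components of the coaction are generated by the points `η± = 0` of the supergroup and the
operators `R(E±)`. -/
theorem coComp_mem (hodd : Odd p) (hp : 3 ≤ p) (g : ℝ × ℝ × ℝ)
    (S : Submodule ℂ (Module.End ℂ (Superspace hq)))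
    (h0 : ∀ w : ℂˣ, (w : ℂ) ^ p = Complex.exp g.2.2 → evOp hq g w ∈ S)
    (hP : ∀ T ∈ S, T * rightGen hq .Ep ∈ S) (hM : ∀ T ∈ S, T * rightGen hq .Em ∈ S)
    (m : ZMod p × ZMod p × ZMod p) : coComp hq g m ∈ S := by
  obtain ⟨a, b, k⟩ := m
  -- the degree in `η₊` is raised first, as `coComp_Ep` only applies in degree zero in `η₋`
  have h1 : ∀ n : ℕ, n < p → coComp hq g ((n : ZMod p), 0, k) ∈ S := fun n => by
    induction n with
    | zero =>
      intro _
      rw [Nat.cast_zero, coComp_zero_zero hq hodd hp]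
      exact Submodule.sum_mem _ fun j _ =>
        Submodule.smul_mem _ _ (h0 _ (evUnit_pow_p hq g.2.2 j))
    | succ n ih =>
      intro hn
      have hne : (n : ZMod p) + 1 ≠ 0 := fun h => by
        have h' : ((n + 1 : ℕ) : ZMod p) = 0 := by rw [Nat.cast_succ, h]
        have := Nat.le_of_dvd (by omega) ((ZMod.natCast_eq_zero_iff _ _).mp h')
        omega
      obtain ⟨c, hc⟩ := coComp_Ep hq hodd hp g k hne
      rw [Nat.cast_succ, hc]
      exact Submodule.smul_mem _ _ (hP _ (ih (by omega)))
  have h2 : ∀ n : ℕ, n < p → coComp hq g (a, (n : ZMod p), k) ∈ S := fun n => by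
    induction n with
    | zero =>
      intro _
      have := h1 a.val (ZMod.val_lt a)
      rwa [ZMod.natCast_zmod_val, ← Nat.cast_zero] at this
    | succ n ih =>
      intro hn
      have hne : (n : ZMod p) + 1 ≠ 0 := fun h => by
        have h' : ((n + 1 : ℕ) : ZMod p) = 0 := by rw [Nat.cast_succ, h]
        have := Nat.le_of_dvd (by omega) ((ZMod.natCast_eq_zero_iff _ _).mp h')
        omega
      obtain ⟨c, hc⟩ := coComp_Em hq hodd hp g a k hne
      rw [Nat.cast_succ, hc]
      exact Submodule.smul_mem _ _ (hM _ (ih (by omega)))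
  have := h2 b.val (ZMod.val_lt b)
  rwa [ZMod.natCast_zmod_val] at this

end Intertwining

/-! ### Invariance of the integral and of the action -/

section Invariance

set_option synthInstance.maxHeartbeats 200000

variable {p : ℕ} [NeZero p] {q : ℂ} (hq : IsPrimitiveRoot q p)

theorem eq_sum_slice {V : Type} [AddCommGroup V] [Module ℂ V] (X : EtaDelta hq ⊗[ℂ] V) :
    X = ∑ m, TwAlg.e _ m ⊗ₜ slice hq (TwAlg.coeff m) X := by
  induction X using TensorProduct.induction_on with
  | zero => simp
  | add X Y hX hY =>
    conv_lhs => rw [hX, hY]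
    simp only [map_add, TensorProduct.tmul_add, Finset.sum_add_distrib]
  | tmul a v =>
    simp only [slice_tmul, ← TensorProduct.smul_tmul]
    rw [← TensorProduct.sum_tmul]
    congr 1
    conv_lhs => rw [← (TwAlg.basis (etaDeltaCocycle hq)).sum_repr a]
    simp only [TwAlg.basis_apply]
    rfl

theorem slice_lTensor {V W : Type} [AddCommGroup V] [Module ℂ V] [AddCommGroup W] [Module ℂ W]
    (φ : EtaDelta hq →ₗ[ℂ] ℂ) (T : V →ₗ[ℂ] W) (X : EtaDelta hq ⊗[ℂ] V) :
    slice hq φ (LinearMap.lTensor (EtaDelta hq) T X) = T (slice hq φ X) := by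
  induction X using TensorProduct.induction_on with
  | zero => simp
  | add X Y hX hY => simp only [map_add, hX, hY]
  | tmul a v => rw [LinearMap.lTensor_tmul, slice_tmul, slice_tmul, map_smul]

theorem coeff_idTensor (φ : Superspace hq →ₗ[ℂ] ℂ) (m : ZMod p × ZMod p × ZMod p)
    (X : EtaDelta hq ⊗[ℂ] Superspace hq) :
    TwAlg.coeff m (idTensor hq φ X) = φ (slice hq (TwAlg.coeff m) X) := by
  induction X using TensorProduct.induction_on with
  | zero => simp
  | add X Y hX hY => simp only [map_add, hX, hY]
  | tmul a v =>
    rw [slice_tmul, map_smul, idTensor, LinearMap.comp_apply, LinearMap.lTensor_tmul,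
      LinearEquiv.coe_coe, TensorProduct.rid_tmul, map_smul, smul_eq_mul, smul_eq_mul, mul_comm]

/-- The operator of a polynomial in the Casimir elements commutes with the coaction. -/
theorem coact_rightRep (hodd : Odd p) (hp : 3 ≤ p) {c : FreeU}
    (hc : toU p q c ∈ Algebra.adjoin ℂ {casimir1 p q, casimir2 p q}) (g : ℝ × ℝ × ℝ)
    (F : Superspace hq) :
    coact hq g (rightRep hq c F) =
      LinearMap.lTensor (EtaDelta hq) (rightRep hq c) (coact hq g F) := by
  have hcas := commute_casimirOp hq hodd hp
  have hmem := coComp_mem hq hodd hp g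
    (Subalgebra.centralizer ℂ {(rightRep hq c : Module.End ℂ (Superspace hq))}).toSubmodule
    (fun w hw => by
      rw [Subalgebra.mem_toSubmodule, Subalgebra.mem_centralizer_iff]
      rintro _ rfl
      exact (commute_rightRep hq hodd hp (evOp_commute_casimirOp hq hodd hp g hw)
        (evOp_commute_waveOp hq g w) hc).eq.symm)
    (fun T hT => by
      refine mul_mem (S := Subalgebra ℂ (Module.End ℂ (Superspace hq))) hT ?_
      rw [Subalgebra.mem_centralizer_iff]
      rintro _ rfl
      exact (commute_rightRep hq hodd hp hcas.1 (rightGen_Ep_commute_waveOp hq hodd hp) hc).eq.symm)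
    (fun T hT => by
      refine mul_mem (S := Subalgebra ℂ (Module.End ℂ (Superspace hq))) hT ?_
      rw [Subalgebra.mem_centralizer_iff]
      rintro _ rfl
      exact (commute_rightRep hq hodd hp hcas.2 (rightGen_Em_commute_waveOp hq hodd hp) hc).eq.symm)
  rw [eq_sum_slice hq (coact hq g (rightRep hq c F)),
    eq_sum_slice hq (LinearMap.lTensor (EtaDelta hq) (rightRep hq c) (coact hq g F))]
  refine Finset.sum_congr rfl fun m _ => ?_
  rw [slice_lTensor]
  congr 1
  have h := hmem m
  rw [Subalgebra.mem_toSubmodule, Subalgebra.mem_centralizer_iff] at h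
  exact (LinearMap.congr_fun (h _ rfl) F).symm

theorem integralE_tmul (f : Test) (y : Eta hq) :
    integralE hq (f ⊗ₜ y) = integralC f * integralEta hq y := by
  simp [integralE]

theorem integralEta_gradeHom (w : ℂˣ) (y : Eta hq) :
    integralEta hq (gradeHom hq w y) = integralEta hq y := by
  change q⁻¹ * TwAlg.coeff (-1, -1) (gradeHom hq w y) = q⁻¹ * TwAlg.coeff (-1, -1) y
  rw [gradeHom, coeff_diagHom, ← mul_pow, Units.mul_inv, one_pow, one_mul]

theorem integralE_evOp (g : ℝ × ℝ × ℝ) (w : ℂˣ) (F : Superspace hq) :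
    integralE hq (evOp hq g w F) = integralE hq F := by
  induction F using TensorProduct.induction_on with
  | zero => simp
  | add F G hF hG => simp only [map_add, hF, hG]
  | tmul f y =>
    rw [evOp_tmul, integralE_tmul, integralE_tmul, integralC_pull, integralEta_gradeHom]

theorem integralEta_yp_pow_mul_ym_pow (hp : 3 ≤ p) {i j : ℕ} (hi : i < p)
    (hij : ¬ (i = p - 1 ∧ j = p - 1)) : integralEta hq (yp hq ^ i * ym hq ^ j) = 0 := by
  by_cases hj : j < p
  · have : ¬ ((-1 : ZMod p) = (i : ZMod p) ∧ (-1 : ZMod p) = (j : ZMod p)) := fun h => hij (by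
      have h1 := congrArg ZMod.val h.1
      have h2 := congrArg ZMod.val h.2
      rw [val_neg_one_zmod, ZMod.val_cast_of_lt hi] at h1
      rw [val_neg_one_zmod, ZMod.val_cast_of_lt hj] at h2
      exact ⟨h1.symm, h2.symm⟩)
    rw [yp_pow hq _ hi, ym_pow hq _ hj, TwAlg.e_mul_e, map_smul, integralEta, LinearMap.smul_apply,
      TwAlg.coeff_e, if_neg, smul_zero, smul_zero]
    simpa using this
  · rw [pow_eq_zero_of_le (not_lt.mp hj) (ym_pow_p hq hp), mul_zero, map_zero]

theorem qUnit_pow_val (n : ℕ) : (((qUnit hq)⁻¹ : ℂˣ) : ℂ) ^ n = (q ^ n)⁻¹ := by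
  rw [qUnit_inv_val, inv_pow]

theorem etaEm_ym_pow_succ (hodd : Odd p) (hp : 3 ≤ p) (n : ℕ) :
    etaEm hq (ym hq ^ (n + 1)) = ((pairE p q)⁻¹ * qNum q (n + 1)) • ym hq ^ n := by
  have hq0 : q ≠ 0 := hq.ne_zero (by omega)
  rw [(isTwDer_etaEm hq hodd hp).map_pow_succ (inv_ne_zero hq0)
    (by rw [gradeHom_ym hq hp, inv_inv, inv_inv, qUnit_val])
    (by rw [gradeHom_ym hq hp, qUnit_inv_val]) (etaEm_ym hq hp)
    (by rw [qNum_inv, qNum_one hq hp]), qNum_inv]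

/-- The operator `E₋` does not reach the top monomial, as it lowers the degree in `η₋`. -/
theorem integralEta_etaEm (hodd : Odd p) (hp : 3 ≤ p) (y : Eta hq) :
    integralEta hq (etaEm hq y) = 0 := by
  have hm := isTwDer_etaEm hq hodd hp
  have : integralEta hq ∘ₗ etaEm hq = 0 := linearMap_ext_e fun m => by
    rw [LinearMap.comp_apply, LinearMap.zero_apply, e_eq_pow, hm, hm.pow_eq_zero (etaEm_yp hq hp),
      zero_mul, zero_add, map_pow, gradeHom_yp hq hp, smul_pow, smul_mul_assoc, map_smul]
    have h2 := ZMod.val_lt m.2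
    rcases h : m.2.val with _ | n
    · rw [pow_zero, hm.map_one, mul_zero, map_zero, smul_zero]
    · rw [etaEm_ym_pow_succ hq hodd hp, mul_smul_comm, map_smul,
        integralEta_yp_pow_mul_ym_pow hq hp (ZMod.val_lt _) (by omega), smul_zero, smul_zero]
  exact LinearMap.congr_fun this y

theorem etaEp_yp_pow (hodd : Odd p) (hp : 3 ≤ p) (n : ℕ) :
    etaEp hq (yp hq ^ n) = (pairE p q * qNum q n) • yp hq ^ (n - 1) +
      (pairE p q * (q ^ n * qNum q (2 * n))) • (yp hq ^ n * ym hq) := by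
  have hP := isTwDer_etaEp hq hodd hp
  have hq0 : q ≠ 0 := hq.ne_zero (by omega)
  induction n with
  | zero => simp [hP.map_one, qNum_zero]
  | succ n ih =>
    have h1 : (pairE p q * qNum q n) • yp hq ^ (n - 1) * yp hq =
        (pairE p q * qNum q n) • yp hq ^ n := by
      rcases n with _ | n
      · simp [qNum_zero]
      · rw [smul_mul_assoc, Nat.add_sub_cancel, ← pow_succ]
    have h2 : yp hq ^ n * ym hq * yp hq = q ^ 2 • (yp hq ^ (n + 1) * ym hq) := by
      rw [mul_assoc, ym_mul_yp hq (by omega), mul_smul_comm, ← mul_assoc, ← pow_succ]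
    have h3 := qNum_add hq0 n 1
    have h4 := qNum_add hq0 (2 * n) 2
    have h5 := qNum_add hq0 1 1
    rw [qNum_one hq hp] at h3 h5
    rw [pow_succ, hP, ih, gradeHom_yp hq hp, qUnit_val, mul_smul_comm, add_mul, h1, smul_mul_assoc,
      h2, map_pow, gradeHom_yp hq hp, etaEp_yp hq hodd hp, smul_pow, qUnit_pow_val,
      smul_mul_smul_comm, mul_add, mul_one, mul_smul_comm, ← mul_assoc (yp hq ^ n), ← pow_succ,
      Nat.add_sub_cancel, show 2 * (n + 1) = 2 * n + 2 by ring, ← h3, ← h4,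
      show qNum q 2 = _ from h5.symm]
    match_scalars
    · field_simp
    · field_simp
      ring

/-- The operator `E₊` could reach the top monomial only from `η₊^(p-1) η₋^(p-2)`, where the
coefficient vanishes. -/
theorem integralEta_etaEp (hodd : Odd p) (hp : 3 ≤ p) (y : Eta hq) :
    integralEta hq (etaEp hq y) = 0 := by
  have hP := isTwDer_etaEp hq hodd hp
  have hq0 : q ≠ 0 := hq.ne_zero (by omega)
  have : integralEta hq ∘ₗ etaEp hq = 0 := linearMap_ext_e fun m => by
    have h1 := ZMod.val_lt m.1
    have h2 := ZMod.val_lt m.2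
    rw [LinearMap.comp_apply, LinearMap.zero_apply, e_eq_pow]
    generalize m.1.val = a at h1
    generalize m.2.val = b at h2
    have e : etaEp hq (yp hq ^ a * ym hq ^ b) =
        (pairE p q * (qNum q a * (q ^ b)⁻¹)) • (yp hq ^ (a - 1) * ym hq ^ b) +
        (pairE p q * (q ^ a * qNum q (2 * a) * (q ^ b)⁻¹ - (q ^ a)⁻¹ * qNum q b)) •
          (yp hq ^ a * ym hq ^ (b + 1)) := by
      rw [hP, etaEp_yp_pow hq hodd hp, etaEp_ym_pow hq hodd hp, map_pow, map_pow,
        gradeHom_yp hq hp, gradeHom_ym hq hp, smul_pow, smul_pow, qUnit_pow_val, qUnit_pow_val,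
        add_mul,
        smul_mul_smul_comm, smul_mul_smul_comm, smul_mul_smul_comm, mul_assoc (yp hq ^ a),
        ← pow_succ']
      module
    rw [e, map_add, map_smul, map_smul, integralEta_yp_pow_mul_ym_pow hq hp (by omega) (by omega),
      smul_zero, zero_add]
    by_cases hab : a = p - 1 ∧ b = p - 2
    · -- the coefficient vanishes as `q ^ (2 * p - 2) = q ^ (p - 2)`
      obtain ⟨rfl, rfl⟩ := hab
      have hn : qNum q (2 * (p - 1)) = qNum q (p - 2) := by
        rw [show 2 * (p - 1) = p + (p - 2) by omega, ← qNum_add hq0, qNum_self hq, hq.pow_eq_one]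
        simp
      have hq1 : q ^ (p - 1) = q⁻¹ := eq_inv_of_mul_eq_one_left (by
        rw [← pow_succ, Nat.sub_add_cancel (by omega), hq.pow_eq_one])
      have hq2 : q ^ (p - 2) = q⁻¹ * q⁻¹ := by
        rw [← hq1]
        nth_rw 1 [hq1]
        rw [show p - 1 = p - 2 + 1 by omega, pow_succ', inv_mul_cancel_left₀ hq0]
      rw [hn, hq1, hq2]
      have : q⁻¹ * qNum q (p - 2) * (q⁻¹ * q⁻¹)⁻¹ - q⁻¹⁻¹ * qNum q (p - 2) = 0 := by
        field_simp
        ring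
      rw [this, mul_zero, zero_smul]
    · rw [integralEta_yp_pow_mul_ym_pow hq hp h1 (by omega), smul_zero]
  exact LinearMap.congr_fun this y

theorem integralE_Em (hodd : Odd p) (hp : 3 ≤ p) (F : Superspace hq) :
    integralE hq (rightGen hq .Em F) = 0 := by
  induction F using TensorProduct.induction_on with
  | zero => simp
  | add F G hF hG => simp only [map_add, hF, hG, add_zero]
  | tmul f y =>
    rw [rightGen_Em_tmul hq hodd hp, map_add, integralE_tmul, integralE_tmul,
      integralEta_etaEm hq hodd hp, dzm, integralC_dTest, mul_zero, zero_mul, add_zero]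

theorem integralE_Ep (hodd : Odd p) (hp : 3 ≤ p) (F : Superspace hq) :
    integralE hq (rightGen hq .Ep F) = 0 := by
  induction F using TensorProduct.induction_on with
  | zero => simp
  | add F G hF hG => simp only [map_add, hF, hG, add_zero]
  | tmul f y =>
    rw [rightGen_Ep_tmul hq hodd hp, map_add, integralE_tmul, integralE_tmul,
      integralEta_etaEp hq hodd hp, dzp, integralC_dTest, mul_zero, zero_mul, add_zero]

/-- The integral of a component of the coaction vanishes unless it is the component along `1`. -/
theorem integralE_coComp (hodd : Odd p) (hp : 3 ≤ p) (g : ℝ × ℝ × ℝ)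
    (m : ZMod p × ZMod p × ZMod p) (F : Superspace hq) :
    integralE hq (coComp hq g m F) = if m = 0 then integralE hq F else 0 := by
  obtain ⟨a, b, k⟩ := m
  -- every component multiplies the integral by a constant
  let S : Submodule ℂ (Module.End ℂ (Superspace hq)) :=
    { carrier := {T | ∃ c : ℂ, ∀ F, integralE hq (T F) = c * integralE hq F}
      zero_mem' := ⟨0, fun F => by simp⟩
      add_mem' := by
        rintro T T' ⟨c, hc⟩ ⟨c', hc'⟩
        exact ⟨c + c', fun F => by rw [LinearMap.add_apply, map_add, hc, hc', add_mul]⟩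
      smul_mem' := by
        rintro s T ⟨c, hc⟩
        exact ⟨s * c, fun F => by
          rw [LinearMap.smul_apply, map_smul, hc, smul_eq_mul, mul_assoc]⟩ }
  have hS : ∀ m, coComp hq g m ∈ S := coComp_mem hq hodd hp g S
    (fun w _ => ⟨1, fun F => by rw [integralE_evOp, one_mul]⟩)
    (fun T ⟨c, hc⟩ => ⟨0, fun F => by
      rw [Module.End.mul_apply, hc, integralE_Ep hq hodd hp, mul_zero, zero_mul]⟩)
    (fun T ⟨c, hc⟩ => ⟨0, fun F => by
      rw [Module.End.mul_apply, hc, integralE_Em hq hodd hp, mul_zero, zero_mul]⟩)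
  by_cases hb : b = 0
  · subst hb
    by_cases ha : a = 0
    · subst ha
      rw [coComp_zero_zero hq hodd hp, LinearMap.sum_apply, map_sum]
      simp only [LinearMap.smul_apply, map_smul, integralE_evOp, smul_eq_mul]
      rw [← Finset.sum_mul, ← Finset.mul_sum]
      have hprim : (chi hq).IsPrimitive := AddChar.zmodChar_primitive_of_primitive_root p hq
      have hs := AddChar.sum_mulShift (-k) hprim
      have hp0 : (p : ℂ) ≠ 0 := Nat.cast_ne_zero.mpr (NeZero.ne p)
      simp only [mul_neg] at hs
      rw [hs]
      by_cases hk : k = 0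
      · subst hk
        simp [hp0, ZMod.card]
      · simp [hk]
    · obtain ⟨c, hc⟩ := coComp_Ep hq hodd hp g k (a := a - 1) (by rwa [sub_add_cancel])
      obtain ⟨c', hc'⟩ := hS (a - 1, 0, k)
      rw [sub_add_cancel] at hc
      rw [hc, LinearMap.smul_apply, Module.End.mul_apply, map_smul, hc', integralE_Ep hq hodd hp,
        mul_zero, smul_zero, if_neg (by simp [ha])]
  · obtain ⟨c, hc⟩ := coComp_Em hq hodd hp g a k (b := b - 1) (by rwa [sub_add_cancel])
    obtain ⟨c', hc'⟩ := hS (a, b - 1, k)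
    rw [sub_add_cancel] at hc
    rw [hc, LinearMap.smul_apply, Module.End.mul_apply, map_smul, hc', integralE_Em hq hodd hp,
      mul_zero, smul_zero, if_neg (by simp [hb])]

/-- The integral over the superspace is invariant. -/
theorem idTensor_integralE_coact (hodd : Odd p) (hp : 3 ≤ p) (g : ℝ × ℝ × ℝ)
    (F : Superspace hq) :
    idTensor hq (integralE hq) (coact hq g F) = algebraMap ℂ (EtaDelta hq) (integralE hq F) := by
  refine TwAlg.ext fun m => ?_
  rw [coeff_idTensor, Algebra.algebraMap_eq_smul_one, map_smul, TwAlg.coeff_one, smul_eq_mul,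
    mul_ite, mul_one, mul_zero]
  exact integralE_coComp hq hodd hp g m F

end Invariance

end FracSusy

theorem mainTheorem1 (p : ℕ) [NeZero p] (hodd : Odd p) (hp : 3 ≤ p) (q : ℂ)
    (hq : IsPrimitiveRoot q p)
    (C : FracSusy.UFS p q)
    (hC : C ∈ Algebra.adjoin ℂ {FracSusy.casimir1 p q, FracSusy.casimir2 p q})
    (c : FracSusy.FreeU) (hc : FracSusy.toU p q c = C)
    (Φ : FracSusy.Superspace hq) :
    ∀ g : ℝ × ℝ × ℝ, FracSusy.actionCoact hq c Φ g =
      algebraMap ℂ (FracSusy.EtaDelta hq) (FracSusy.action hq c Φ) := by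
  intro g
  rw [FracSusy.actionCoact, FracSusy.action,
    ← FracSusy.coact_rightRep hq hodd hp (by rw [hc]; exact hC), ← FracSusy.coact_star hq hodd hp,
    ← FracSusy.coact_mul hq hodd hp, FracSusy.idTensor_integralE_coact hq hodd hp]

end
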